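/- **Stateless actor programs.** Fix disjoint infinite sets of classes, method names and variables (among them the special variable $\mathit{this}$), and a set of actor names that is partitioned by the classes, with infinitely many names, in a fixed order, in each class. Expressions and processes are given by $$E ::= x \mid \mathtt{new}\ C,\qquad P ::= 0 \mid \mathtt{let}\ x=E\ \mathtt{in}\ P \mid x!m(E_1,\dots,E_n).P \mid [E=E']P;Q \mid P+Q ,$$ where $\mathtt{let}$ binds $x$ in $P$ and processes are taken up to renaming of bound variables; at run time actor names may also stand for free variables. A *value* is a variable or an actor name. A program is a main process together with finitely many method definitions $C.m(\tilde x)=P$, at most one for each pair $(C,m)$, where the formal parameters are distinct variables different from $\mathit{this}$, and $\mathit{this}$ may occur only in method bodies. A configuration is a finite set of terms $A\triangleright(P,q)$, at most one for each actor name $A$, where $P$ is a process and $q$ is a FIFO queue of messages $m(\tilde U)$ with arguments $\tilde U$ that are values. Evaluating a value yields the value; evaluating $\mathtt{new}\ C$ yields the first unused actor name $A$ of class $C$ and adds $A\triangleright(0,\varepsilon)$ to the configuration. In a transition, one actor $A\triangleright(P,q)$ of the configuration does one of the following: - it executes a $\mathtt{let}$, substituting the value of the expression for the variable; - it executes $A'!m(\tilde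 E).P$, where $A'$ is an actor of the configuration (possibly $A$ itself): the message $m(\tilde U)$, with $\tilde U$ the values of $\tilde E$, is appended to the queue of $A'$; - it executes $[E=E']P;Q$, continuing as $P$ if the two values are equal and as $Q$ otherwise; - it executes $P+Q$, continuing as $P$ or as $Q$; - if its process is $0$ and its queue is $m(\tilde U)\cdot q$, its class is $C$, and there is a definition $C.m(\tilde x)=P$ with $|\tilde x|=|\tilde U|$: the message is removed, and the process becomes $P$ with $A$ for $\mathit{this}$, $\tilde U$ for $\tilde x$, and the least unused variables for the other free variables of $P$. Here a variable is unused if it does not occur in the configuration, is not free in the main process, and is not $\mathit{this}$. The initial configuration is $\aleph\triangleright(P,\varepsilon)$, with $P$ the main process and $\aleph$ an actor name of a class without methods that does not belong to the program. The number of actors created in a computation is not bounded. **Ordering.** Let $F$ be the set of free variables of the main process. Two maps $\rho,\rho'$ from variables to values that fix every variable in $F$ are *equivalent* if, for all variables $x,y$: $\rho(x)=\rho(y)$ iff $\rho'(x)=\rho'(y)$; for each class $C$, $\rho(x)$ is an actor name of class $C$ iff $\rho'(x)$ is; and $\rho(x)=\rho'(x)$ whenever $\rho(x)$ or $\rho'(x)$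 is in $F$. Write $P\simeq P'$ if $P=P_0\rho$ and $P'=P_0\rho'$ for some process $P_0$ without actor names and equivalent $\rho,\rho'$; similarly, $m(\tilde U)\simeq m(\tilde U')$ if $\tilde U=\rho(\tilde x)$ and $\tilde U'=\rho'(\tilde x)$ for some tuple $\tilde x$ of variables and equivalent $\rho,\rho'$. Write $T\preceq T'$ if there is an injective map from the actors of $T$ to those of $T'$ that sends each $A\triangleright(P,q)$ to some $A'\triangleright(P',q')$ with $A'$ of the same class as $A$, $P\simeq P'$, and $q$ equal to a subsequence of $q'$ up to $\simeq$ on messages. **Theorem.** The following problems are decidable, uniformly in the stateless actor program given as part of the input: 1. *Termination:* given a program, does it have no infinite computation from its initial configuration? 2. *Control-state reachability:* given a program, a configuration $S$ reachable from its initial configuration (for instance the initial one), and any configuration $T$, is there a configuration $T'\succeq T$ that is reachable from $S$ in finitely many (possibly zero) transitions? 3. *Process reachability:* given a program and a process $P$, is there a configuration reachable from the initial one that contains a term $A\triangleright(P',q)$ with $P'$ equal to $P$ up to injective renaming of variables (to variables) and of actor names (to actor names)? -/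

import Mathlib

/-! Stateless actor programs: expressions are variables or `new C`, processes are built from
termination, `let`, asynchronous invocation, name matching and nondeterministic choice. -/

namespace ActorSL

/-- Actor names, partitioned by class: `(c, i)` is the `i`-th name of class `c`. The classes that
can be defined by a program are `some C`; `none` is the class of the root actor. -/
abbrev ActorName := Option ℕ × ℕ

/-- The root actor, which executes the main process. -/
def root : ActorName := (none, 0)

/-- The special variable `this`. -/
def this : ℕ := 0

/-- Values: variables and actor names. -/
inductive Val
  | var (x : ℕ)
  | act (A : ActorName)
  deriving DecidableEq

/-- Atoms: values, or variables bound by an enclosing `let`. The latter are de Bruijn indices, so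
that alpha-convertible processes are equal and substitution for free variables cannot capture. -/
inductive Atom
  | bvar (k : ℕ)
  | val (U : Val)
  deriving DecidableEq

/-- Expressions: atoms and `new C` (classes have no fields, so there are no arguments). -/
inductive Expr
  | atom (t : Atom)
  | new (C : ℕ)
  deriving DecidableEq

/-- Processes. `letin E P` is `let x = E in P` with `x` bound in `P` (index 0 in `P`),
`send t m Es P` is `t ! m(Es) . P`, and `ite E E' P Q` is `[E = E'] P ; Q`. -/
inductive Proc
  | nil
  | letin (E : Expr) (P : Proc)
  | send (t : Atom) (m : ℕ) (Es : List Expr) (P : Proc)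
  | ite (E E' : Expr) (P Q : Proc)
  | plus (P Q : Proc)
  deriving DecidableEq

/-! ### Operations on the syntax -/

/-- Apply `f` to the value in an atom. -/
def Atom.mapVal (f : Val → Val) : Atom → Atom
  | bvar k => bvar k
  | val U => val (f U)

/-- Apply `f` to the value in an expression. -/
def Expr.mapVal (f : Val → Val) : Expr → Expr
  | atom t => atom (t.mapVal f)
  | new C => new C

/-- Apply `f` to all the values (free variables and actor names) of a process. -/
def Proc.mapVal (f : Val → Val) : Proc → Proc
  | nil => nil
  | letin E P => letin (E.mapVal f) (P.mapVal f)
  | send t m Es P => send (t.mapVal f) m (Es.map (Expr.mapVal f)) (P.mapVal f)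
  | ite E E' P Q => ite (E.mapVal f) (E'.mapVal f) (P.mapVal f) (Q.mapVal f)
  | plus P Q => plus (P.mapVal f) (Q.mapVal f)

/-- Extend a map on variables to values, as the identity on actor names. -/
def Val.bind (ρ : ℕ → Val) : Val → Val
  | var x => ρ x
  | act A => act A

/-- Simultaneous substitution of values for the free variables of a process. -/
def Proc.subst (ρ : ℕ → Val) (P : Proc) : Proc := P.mapVal (Val.bind ρ)

/-- Rename variables by `π` and actor names by `τ`. -/
def Val.rename (π : ℕ → ℕ) (τ : ActorName → ActorName) : Val → Val
  | var x => var (π x)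
  | act A => act (τ A)

/-- Replace the bound variable `k` by `U`. -/
def Atom.inst (U : Val) (k : ℕ) : Atom → Atom
  | bvar j => if j = k then val U else bvar j
  | val V => val V

/-- Replace the bound variable `k` by `U`. -/
def Expr.inst (U : Val) (k : ℕ) : Expr → Expr
  | atom t => atom (t.inst U k)
  | new C => new C

/-- Replace the bound variable `k` by `U`. -/
def Proc.inst (U : Val) : ℕ → Proc → Proc
  | _, nil => nil
  | k, letin E P => letin (E.inst U k) (P.inst U (k + 1))
  | k, send t m Es P => send (t.inst U k) m (Es.map (Expr.inst U k)) (P.inst U k)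
  | k, ite E E' P Q => ite (E.inst U k) (E'.inst U k) (P.inst U k) (Q.inst U k)
  | k, plus P Q => plus (P.inst U k) (Q.inst U k)

/-- The variables of a value. -/
def Val.fv : Val → List ℕ
  | var x => [x]
  | act _ => []

/-- The free variables of an atom. -/
def Atom.fv : Atom → List ℕ
  | bvar _ => []
  | val U => U.fv

/-- The free variables of an expression. -/
def Expr.fv : Expr → List ℕ
  | atom t => t.fv
  | new _ => []

/-- The free variables of a process, in order of occurrence, possibly with repetitions. -/
def Proc.fv : Proc → List ℕ
  | nil => []
  | letin E P => E.fv ++ P.fv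
  | send t _ Es P => t.fv ++ Es.flatMap Expr.fv ++ P.fv
  | ite E E' P Q => E.fv ++ E'.fv ++ P.fv ++ Q.fv
  | plus P Q => P.fv ++ Q.fv

/-- All atoms of an expression satisfy `p`. -/
def Expr.All (p : Atom → Prop) : Expr → Prop
  | atom t => p t
  | new _ => True

/-- All atoms of a process satisfy `p k`, with `k` the number of enclosing binders plus the
initial value. -/
def Proc.All (p : ℕ → Atom → Prop) : ℕ → Proc → Prop
  | _, nil => True
  | k, letin E P => E.All (p k) ∧ P.All p (k + 1)
  | k, send t _ Es P => p k t ∧ (∀ E ∈ Es, E.All (p k)) ∧ P.All p k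
  | k, ite E E' P Q => E.All (p k) ∧ E'.All (p k) ∧ P.All p k ∧ Q.All p k
  | k, plus P Q => P.All p k ∧ Q.All p k

/-- Every bound variable of the process refers to a binder in the process. -/
def Proc.LocallyClosed (P : Proc) : Prop := P.All (fun k t => ∀ j, t = .bvar j → j < k) 0

/-- No actor name occurs in the process. -/
def Proc.NoActors (P : Proc) : Prop := P.All (fun _ t => ∀ A, t ≠ .val (.act A)) 0

/-- A process that may occur in the text of a program. -/
def Proc.IsSource (P : Proc) : Prop := P.LocallyClosed ∧ P.NoActors

/-! ### Programs and configurations -/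

/-- A method definition `C.m(x₁, …, xₙ) = P`. -/
structure MethodDef where
  cls : ℕ
  meth : ℕ
  params : List ℕ
  body : Proc

/-- A program: a main process and a finite set of method definitions. -/
structure Program where
  main : Proc
  defs : List MethodDef

/-- The static conditions on programs: processes are written in the source syntax, `this` occurs
only in method bodies and is not a formal parameter, formal parameters are distinct, and no method
of a class is defined twice. -/
structure Program.WellFormed (𝒢 : Program) : Prop where
  main_source : 𝒢.main.IsSource
  this_notMem_main : this ∉ 𝒢.main.fv
  body_source : ∀ d ∈ 𝒢.defs, d.body.IsSource
  params_nodup : ∀ d ∈ 𝒢.defs, d.params.Nodup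
  this_notMem_params : ∀ d ∈ 𝒢.defs, this ∉ d.params
  unambiguous : (𝒢.defs.map fun d => (d.cls, d.meth)).Nodup

/-- A message `m(U₁, …, Uₙ)`. -/
structure Msg where
  meth : ℕ
  args : List Val

/-- A term `A ▷ (P, ∅, q)` (the state is always empty). -/
structure Actor where
  name : ActorName
  proc : Proc
  queue : List Msg

/-- Configurations: sets of terms, given by an enumeration. The order plays no role. -/
abbrev Config := List Actor

/-- The names of the actors of a configuration. -/
def names (S : Config) : List ActorName := S.map Actor.name

/-- The variables that occur in a configuration. -/
def Config.vars (S : Config) : List ℕ :=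
  S.flatMap fun a => a.proc.fv ++ a.queue.flatMap fun μ => μ.args.flatMap Val.fv

/-- The initial configuration of a program. -/
def Program.init (𝒢 : Program) : Config := [⟨root, 𝒢.main, []⟩]

/-! ### Operational semantics -/

/-- The first name of class `C` that is not in `N`. -/
def freshName (N : List ActorName) (C : ℕ) : ActorName :=
  (some C, ((List.range (N.length + 1)).filter fun i => (some C, i) ∉ N).headD 0)

/-- The least `n` variables that are not in `used`, in increasing order. -/
def freshVars (used : List ℕ) (n : ℕ) : List ℕ :=
  ((List.range (used.length + n)).filter fun x => x ∉ used).take n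

/-- `EvalE N E U M`: when the actor names in `N` are in use, the expression `E` evaluates to `U`
and the actors in `M` are created. -/
inductive EvalE (N : List ActorName) : Expr → Val → List ActorName → Prop
  | val (U : Val) : EvalE N (.atom (.val U)) U []
  | new (C : ℕ) : EvalE N (.new C) (.act (freshName N C)) [freshName N C]

/-- Evaluation of a tuple of expressions. -/
inductive EvalEs : List ActorName → List Expr → List Val → List ActorName → Prop
  | nil (N : List ActorName) : EvalEs N [] [] []
  | cons {N E U M Es Us M'} (h : EvalE N E U M) (h' : EvalEs (N ++ M) Es Us M') :
      EvalEs N (E :: Es) (U :: Us) (M ++ M')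

/-- The newly created actors `A ▷ (0, ∅, ε)`, for `A` in `M`. -/
def newActors (M : List ActorName) : Config := M.map fun A => ⟨A, .nil, []⟩

/-- Enqueue the message `μ` in the queue of `B`. -/
def deliver (B : ActorName) (μ : Msg) (S : Config) : Config :=
  S.map fun a => if a.name = B then { a with queue := a.queue ++ [μ] } else a

/-- The instance of the body of the method `d` executed by `A` with arguments `Us`: `this` becomes
`A`, formal parameters become `Us`, and the remaining free variables become fresh variables. -/
def instBody (used : List ℕ) (A : ActorName) (d : MethodDef) (Us : List Val) : Proc :=
  let ys := d.body.fv.dedup.filter fun y => y ∉ this :: d.params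
  let σ := (this, Val.act A) :: d.params.zip Us ++
    ys.zip ((freshVars used ys.length).map Val.var)
  d.body.subst fun x => (σ.lookup x).getD (.var x)

/-- `Step 𝒢 S S'`: the transition relation of the program `𝒢`. The actor `A` moves in the arbitrary
context `L`, `R`; freshness refers to the whole configuration. The rule `send` covers both
invocations of `A` itself and of another actor. -/
inductive Step (𝒢 : Program) : Config → Config → Prop
  | letin {L R : Config} {A q E P U M}
      (h : EvalE (names (L ++ ⟨A, .letin E P, q⟩ :: R)) E U M) :
      Step 𝒢 (L ++ ⟨A, .letin E P, q⟩ :: R) (L ++ ⟨A, P.inst U 0, q⟩ :: R ++ newActors M)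
  | send {L R : Config} {A q B m Es P Us M}
      (h : EvalEs (names (L ++ ⟨A, .send (.val (.act B)) m Es P, q⟩ :: R)) Es Us M)
      (hB : B ∈ names (L ++ ⟨A, .send (.val (.act B)) m Es P, q⟩ :: R)) :
      Step 𝒢 (L ++ ⟨A, .send (.val (.act B)) m Es P, q⟩ :: R)
        (deliver B ⟨m, Us⟩ (L ++ ⟨A, P, q⟩ :: R) ++ newActors M)
  | inst {L R : Config} {A q d Us} (hd : d ∈ 𝒢.defs) (hA : A.1 = some d.cls)
      (hlen : Us.length = d.params.length) :
      Step 𝒢 (L ++ ⟨A, .nil, ⟨d.meth, Us⟩ :: q⟩ :: R)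
        (L ++ ⟨A, instBody (this :: 𝒢.main.fv ++
          Config.vars (L ++ ⟨A, .nil, ⟨d.meth, Us⟩ :: q⟩ :: R)) A d Us, q⟩ :: R)
  | matched {L R : Config} {A q E E' P Q U M}
      (h : EvalEs (names (L ++ ⟨A, .ite E E' P Q, q⟩ :: R)) [E, E'] [U, U] M) :
      Step 𝒢 (L ++ ⟨A, .ite E E' P Q, q⟩ :: R) (L ++ ⟨A, P, q⟩ :: R ++ newActors M)
  | mismatched {L R : Config} {A q E E' P Q U V M}
      (h : EvalEs (names (L ++ ⟨A, .ite E E' P Q, q⟩ :: R)) [E, E'] [U, V] M) (hne : U ≠ V) :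
      Step 𝒢 (L ++ ⟨A, .ite E E' P Q, q⟩ :: R) (L ++ ⟨A, Q, q⟩ :: R ++ newActors M)
  | plusL {L R : Config} {A q P Q} :
      Step 𝒢 (L ++ ⟨A, .plus P Q, q⟩ :: R) (L ++ ⟨A, P, q⟩ :: R)
  | plusR {L R : Config} {A q P Q} :
      Step 𝒢 (L ++ ⟨A, .plus P Q, q⟩ :: R) (L ++ ⟨A, Q, q⟩ :: R)

/-- `S'` is reachable from `S` in finitely many (possibly zero) transitions. -/
def Reach (𝒢 : Program) : Config → Config → Prop := Relation.ReflTransGen (Step 𝒢)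

/-! ### The decision problems -/

/-- Termination: the program has no infinite computation. -/
def Program.Terminates (𝒢 : Program) : Prop :=
  ¬ ∃ s : ℕ → Config, s 0 = 𝒢.init ∧ ∀ n, Step 𝒢 (s n) (s (n + 1))

/-- Process reachability: some computation of the program traverses a configuration in which an
actor executes `P`, up to renaming of variables and actor names. -/
def Program.ProcessReachable (𝒢 : Program) (P : Proc) : Prop :=
  ∃ S, Reach 𝒢 𝒢.init S ∧ ∃ a ∈ S, ∃ (π : Equiv.Perm ℕ) (τ : Equiv.Perm ActorName),
    a.proc = P.mapVal (Val.rename π τ)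

/-- The equivalence of renamings, which are maps from variables to values that fix the variables
in `F` (the free variables of the main process). -/
structure RenEq (F : List ℕ) (ρ ρ' : ℕ → Val) : Prop where
  fix_left : ∀ x ∈ F, ρ x = .var x
  fix_right : ∀ x ∈ F, ρ' x = .var x
  partition : ∀ x y, ρ x = ρ y ↔ ρ' x = ρ' y
  cls : ∀ x c, (∃ i, ρ x = .act (c, i)) ↔ ∃ i, ρ' x = .act (c, i)
  free : ∀ x, ∀ z ∈ F, (ρ x = .var z ∨ ρ' x = .var z) → ρ x = ρ' x

/-- Similarity of processes: instances of a process without actor names under equivalent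
renamings. -/
def ProcSim (F : List ℕ) (P P' : Proc) : Prop :=
  ∃ (P₀ : Proc) (ρ ρ' : ℕ → Val), P₀.NoActors ∧ RenEq F ρ ρ' ∧ P = P₀.subst ρ ∧ P' = P₀.subst ρ'

/-- Similarity of messages. -/
def MsgSim (F : List ℕ) (μ μ' : Msg) : Prop :=
  μ.meth = μ'.meth ∧
    ∃ (xs : List ℕ) (ρ ρ' : ℕ → Val), RenEq F ρ ρ' ∧ μ.args = xs.map ρ ∧ μ'.args = xs.map ρ'

/-- The ordering on configurations: the actors of `T` are mapped injectively to actors of `T'` of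
the same class, with a similar process, and a queue in which the queue of the former embeds. -/
def ConfigLE (F : List ℕ) (T T' : Config) : Prop :=
  ∃ f : Fin T.length → Fin T'.length, Function.Injective f ∧ ∀ i,
    (T.get i).name.1 = (T'.get (f i)).name.1 ∧
    ProcSim F (T.get i).proc (T'.get (f i)).proc ∧
    List.SublistForall₂ (MsgSim F) (T.get i).queue (T'.get (f i)).queue

/-- Control-state reachability: from `S` some configuration that is at least `T` is reachable. -/
def Program.ControlStateReachable (𝒢 : Program) (S T : Config) : Prop :=
  ∃ T', ConfigLE 𝒢.main.fv T T' ∧ Reach 𝒢 S T'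

/-! ### Codings of the inputs, and decidability -/

/-- Values as a sum type. -/
def Val.equiv : Val ≃ ℕ ⊕ ActorName where
  toFun | var x => .inl x | act A => .inr A
  invFun | .inl x => var x | .inr A => act A
  left_inv U := by cases U <;> rfl
  right_inv s := by cases s <;> rfl

instance : Denumerable Val := Denumerable.ofEquiv _ Val.equiv

/-- Atoms as a sum type. -/
def Atom.equiv : Atom ≃ ℕ ⊕ Val where
  toFun | bvar k => .inl k | val U => .inr U
  invFun | .inl k => bvar k | .inr U => val U
  left_inv t := by cases t <;> rfl
  right_inv s := by cases s <;> rfl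

instance : Denumerable Atom := Denumerable.ofEquiv _ Atom.equiv

/-- Expressions as a sum type. -/
def Expr.equiv : Expr ≃ Atom ⊕ ℕ where
  toFun | atom t => .inl t | new C => .inr C
  invFun | .inl t => atom t | .inr C => new C
  left_inv E := by cases E <;> rfl
  right_inv s := by cases s <;> rfl

instance : Denumerable Expr := Denumerable.ofEquiv _ Expr.equiv

/-- The Gödel number of a process. -/
def Proc.code : Proc → ℕ
  | nil => 0
  | letin E P => 4 * Nat.pair (Encodable.encode E) P.code + 1
  | send t m Es P => 4 * Nat.pair (Encodable.encode (t, m, Es)) P.code + 2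
  | ite E E' P Q => 4 * Nat.pair (Encodable.encode (E, E')) (Nat.pair P.code Q.code) + 3
  | plus P Q => 4 * Nat.pair P.code Q.code + 4

/-- The process with a given Gödel number. -/
def Proc.decode : ℕ → Proc
  | 0 => nil
  | n + 1 =>
    have hk : n / 4 < n + 1 := Nat.lt_succ_of_le (Nat.div_le_self _ _)
    have _h1 : (n / 4).unpair.1 < n + 1 := lt_of_le_of_lt (Nat.unpair_left_le _) hk
    have h2 : (n / 4).unpair.2 < n + 1 := lt_of_le_of_lt (Nat.unpair_right_le _) hk
    have _h3 : (n / 4).unpair.2.unpair.1 < n + 1 := lt_of_le_of_lt (Nat.unpair_left_le _) h2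
    have _h4 : (n / 4).unpair.2.unpair.2 < n + 1 := lt_of_le_of_lt (Nat.unpair_right_le _) h2
    match n % 4 with
    | 0 => letin (Denumerable.ofNat Expr (n / 4).unpair.1) (decode (n / 4).unpair.2)
    | 1 =>
      let x := Denumerable.ofNat (Atom × ℕ × List Expr) (n / 4).unpair.1
      send x.1 x.2.1 x.2.2 (decode (n / 4).unpair.2)
    | 2 =>
      let x := Denumerable.ofNat (Expr × Expr) (n / 4).unpair.1
      ite x.1 x.2 (decode (n / 4).unpair.2.unpair.1) (decode (n / 4).unpair.2.unpair.2)
    | _ => plus (decode (n / 4).unpair.1) (decode (n / 4).unpair.2)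
termination_by n => n

theorem Proc.decode_code (P : Proc) : decode P.code = P := by
  induction P with
  | nil => simp [code, decode]
  | letin E P ih =>
    rw [code, decode]
    have h1 : ∀ a, (4 * a) / 4 = a := fun a => by omega
    have h2 : ∀ a, (4 * a) % 4 = 0 := fun a => by omega
    simp only [h1, h2, Nat.unpair_pair, Denumerable.ofNat_encode, ih]
  | send t m Es P ih =>
    rw [code, decode]
    have h1 : ∀ a, (4 * a + 1) / 4 = a := fun a => by omega
    have h2 : ∀ a, (4 * a + 1) % 4 = 1 := fun a => by omega
    simp only [h1, h2, Nat.unpair_pair, Denumerable.ofNat_encode, ih]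
  | ite E E' P Q ih ih' =>
    rw [code, decode]
    have h1 : ∀ a, (4 * a + 2) / 4 = a := fun a => by omega
    have h2 : ∀ a, (4 * a + 2) % 4 = 2 := fun a => by omega
    simp only [h1, h2, Nat.unpair_pair, Denumerable.ofNat_encode, ih, ih']
  | plus P Q ih ih' =>
    rw [code, decode]
    have h1 : ∀ a, (4 * a + 3) / 4 = a := fun a => by omega
    have h2 : ∀ a, (4 * a + 3) % 4 = 3 := fun a => by omega
    simp only [h1, h2, Nat.unpair_pair, ih, ih']

theorem Proc.code_decode (n : ℕ) : (decode n).code = n := by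
  induction n using Nat.strong_induction_on with
  | _ n ih =>
    cases n with
    | zero => simp [code, decode]
    | succ n =>
      have hk : n / 4 < n + 1 := Nat.lt_succ_of_le (Nat.div_le_self _ _)
      have h1 := ih _ (lt_of_le_of_lt (Nat.unpair_left_le _) hk)
      have h2' := lt_of_le_of_lt (Nat.unpair_right_le (n / 4)) hk
      have h2 := ih _ h2'
      have h3 := ih _ (lt_of_le_of_lt (Nat.unpair_left_le _) h2')
      have h4 := ih _ (lt_of_le_of_lt (Nat.unpair_right_le _) h2')
      have hr : n % 4 = 0 ∨ n % 4 = 1 ∨ n % 4 = 2 ∨ n % 4 = 3 := by omega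
      rw [decode]
      rcases hr with hr | hr | hr | hr <;> simp only [hr, code] <;>
        simp only [Prod.mk.eta, Denumerable.encode_ofNat, h1, h2, h3, h4, Nat.pair_unpair] <;>
        omega

instance : Denumerable Proc :=
  Denumerable.mk' ⟨Proc.code, Proc.decode, Proc.decode_code, Proc.code_decode⟩

/-- Method definitions as tuples. -/
def MethodDef.equiv : MethodDef ≃ ℕ × ℕ × List ℕ × Proc where
  toFun d := (d.cls, d.meth, d.params, d.body)
  invFun x := ⟨x.1, x.2.1, x.2.2.1, x.2.2.2⟩
  left_inv _ := rfl
  right_inv _ := rfl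

instance : Denumerable MethodDef := Denumerable.ofEquiv _ MethodDef.equiv

/-- Programs as pairs. -/
def Program.equiv : Program ≃ Proc × List MethodDef where
  toFun 𝒢 := (𝒢.main, 𝒢.defs)
  invFun x := ⟨x.1, x.2⟩
  left_inv _ := rfl
  right_inv _ := rfl

instance : Denumerable Program := Denumerable.ofEquiv _ Program.equiv

/-- Messages as pairs. -/
def Msg.equiv : Msg ≃ ℕ × List Val where
  toFun μ := (μ.meth, μ.args)
  invFun x := ⟨x.1, x.2⟩
  left_inv _ := rfl
  right_inv _ := rfl

instance : Denumerable Msg := Denumerable.ofEquiv _ Msg.equiv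

/-- Terms as triples. -/
def Actor.equiv : Actor ≃ ActorName × Proc × List Msg where
  toFun a := (a.name, a.proc, a.queue)
  invFun x := ⟨x.1, x.2.1, x.2.2⟩
  left_inv _ := rfl
  right_inv _ := rfl

instance : Denumerable Actor := Denumerable.ofEquiv _ Actor.equiv

/-- The problem `p`, with instances the `x` that satisfy `dom`, is decidable: there is an algorithm
that halts on every input and answers correctly on every instance. -/
def DecidableOn {α : Type} [Primcodable α] (dom p : α → Prop) : Prop :=
  ∃ f : α → Bool, Computable f ∧ ∀ x, dom x → (f x = true ↔ p x)

end ActorSL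

namespace ActorSL

/-! ### Values occurring in processes -/

/-! A method body has access to no state. Up to the choice of new values, what an item of an actor
(its running process or a queued message) can do therefore depends on the item and its owner alone.
The rest of the configuration matters only through the FIFO discipline, which lets an owner work on
its first item only. A configuration is thus viewed as a list of entries (flag, owner, item), where
the order counts between entries of the same owner (`Rep`, `step_iff`).

From runs to finite data: fix a run and at most `N` items of its last configuration that are to be
observed. Marks are carried backwards: an item is tracked if the item it becomes, or one that it
emits, is tracked. The number of tracked items does not grow in this direction, so it is at most `N`
throughout (`exec_lift`). An untracked item matters only because it may precede a tracked one in a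
queue and get stuck there. Nothing flows from untracked items to tracked ones, so a value that
exists but is not known (neither free in the main process nor in a tracked entry) never becomes
known (`known_exec`). Hence untracked items of unknown owners can be forgotten, unknown values can
be renamed separately in each untracked entry, and of equal untracked entries between two
consecutive tracked ones a single one suffices. The sizes of items are bounded by the program and
the starting configuration, so these normal forms (`norm`) leave finitely many abstract states
(`finite_apath`). Every marked run projects to an abstract run (`Run.apath`).

Back to runs (`APath.concretize`): in the concrete run all untracked work is postponed. The
invariant `Lag` says that every concrete untracked item of a known actor can be executed until it is
finished or is a copy of an untracked abstract item that is preceded by no more tracked entries.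
When the abstract run moves a tracked item, no untracked abstract item of the same owner precedes
it. So the concrete items that block it can be run to the end one after the other (`Junk.flush`),
and what they send goes to the end of the queues. Items that were merged in the abstract state are
executed separately, by renamed copies of the same steps.

Process reachability is then reachability in a finite graph with `N = 1`, and control-state
reachability with `N` the number of items of the target. For termination, a transition replaces an
item by at most two unfinished ones, so an infinite computation contains arbitrarily long causal
chains. Tracking one item along such a chain and using the pigeonhole principle gives an abstract
cycle with a tracked step; conversely, such a cycle can be concretized again and again
(`terminates_iff`). The graphs are given by primitive recursive functions and explored by an
unbounded search for a closed layer (`exists_computable_reach`). -/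

def Atom.vals : Atom → List Val
  | .bvar _ => []
  | .val U => [U]

def Expr.vals : Expr → List Val
  | .atom t => t.vals
  | .new _ => []

/-- The values that occur in a process. -/
def Proc.vals : Proc → List Val
  | .nil => []
  | .letin E P => E.vals ++ P.vals
  | .send t _ Es P => t.vals ++ Es.flatMap Expr.vals ++ P.vals
  | .ite E E' P Q => E.vals ++ E'.vals ++ P.vals ++ Q.vals
  | .plus P Q => P.vals ++ Q.vals

theorem Atom.fv_eq (t : Atom) : t.fv = t.vals.flatMap Val.fv := by
  cases t <;> simp [Atom.fv, Atom.vals]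

theorem Expr.fv_eq (E : Expr) : E.fv = E.vals.flatMap Val.fv := by
  cases E <;> simp [Expr.fv, Expr.vals, Atom.fv_eq]

theorem Proc.fv_eq (P : Proc) : P.fv = P.vals.flatMap Val.fv := by
  induction P <;> simp_all [Proc.fv, Proc.vals, Atom.fv_eq, List.flatMap_assoc,
    funext Expr.fv_eq]

theorem Val.mem_fv {x : ℕ} {v : Val} : x ∈ v.fv ↔ v = .var x := by
  cases v <;> simp [Val.fv, eq_comm]

theorem Proc.mem_fv {x : ℕ} {P : Proc} : x ∈ P.fv ↔ .var x ∈ P.vals := by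
  rw [P.fv_eq, List.mem_flatMap]
  constructor
  · rintro ⟨v, hv, hx⟩
    rwa [← Val.mem_fv.1 hx]
  · intro h
    exact ⟨_, h, Val.mem_fv.2 rfl⟩

/-! ### The action of maps of values on the syntax. -/

theorem Atom.mapVal_congr {f g : Val → Val} {t : Atom} (h : ∀ v ∈ t.vals, f v = g v) :
    t.mapVal f = t.mapVal g := by
  cases t <;> simp_all [Atom.mapVal, Atom.vals]

theorem Expr.mapVal_congr {f g : Val → Val} {E : Expr} (h : ∀ v ∈ E.vals, f v = g v) :
    E.mapVal f = E.mapVal g := by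
  cases E with
  | atom t => simp only [Expr.mapVal]; rw [Atom.mapVal_congr h]
  | new C => rfl

theorem Proc.mapVal_congr {f g : Val → Val} {P : Proc} (h : ∀ v ∈ P.vals, f v = g v) :
    P.mapVal f = P.mapVal g := by
  induction P with
  | nil => rfl
  | letin E P ih =>
    simp only [Proc.vals, List.mem_append] at h
    simp only [Proc.mapVal]
    rw [Expr.mapVal_congr fun v hv => h v (.inl hv), ih fun v hv => h v (.inr hv)]
  | send t m Es P ih =>
    simp only [Proc.vals, List.mem_append, List.mem_flatMap] at h
    simp only [Proc.mapVal]
    rw [Atom.mapVal_congr fun v hv => h v (.inl (.inl hv)), ih fun v hv => h v (.inr hv),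
      List.map_congr_left fun E hE => Expr.mapVal_congr fun v hv => h v (.inl (.inr ⟨E, hE, hv⟩))]
  | ite E E' P Q ih ih' =>
    simp only [Proc.vals, List.mem_append] at h
    simp only [Proc.mapVal]
    rw [Expr.mapVal_congr fun v hv => h v (.inl (.inl (.inl hv))),
      Expr.mapVal_congr fun v hv => h v (.inl (.inl (.inr hv))),
      ih fun v hv => h v (.inl (.inr hv)), ih' fun v hv => h v (.inr hv)]
  | plus P Q ih ih' =>
    simp only [Proc.vals, List.mem_append] at h
    simp only [Proc.mapVal]
    rw [ih fun v hv => h v (.inl hv), ih' fun v hv => h v (.inr hv)]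

theorem Atom.mapVal_mapVal (f g : Val → Val) (t : Atom) :
    (t.mapVal f).mapVal g = t.mapVal (g ∘ f) := by
  cases t <;> simp [Atom.mapVal]

theorem Expr.mapVal_mapVal (f g : Val → Val) (E : Expr) :
    (E.mapVal f).mapVal g = E.mapVal (g ∘ f) := by
  cases E <;> simp [Expr.mapVal, Atom.mapVal_mapVal]

theorem Proc.mapVal_mapVal (f g : Val → Val) (P : Proc) :
    (P.mapVal f).mapVal g = P.mapVal (g ∘ f) := by
  induction P <;> simp_all [Proc.mapVal, Atom.mapVal_mapVal, Expr.mapVal_mapVal]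

theorem Atom.mapVal_id (t : Atom) : t.mapVal id = t := by
  cases t <;> simp [Atom.mapVal]

theorem Expr.mapVal_id (E : Expr) : E.mapVal id = E := by
  cases E <;> simp [Expr.mapVal, Atom.mapVal_id]

theorem Proc.mapVal_id (P : Proc) : P.mapVal id = P := by
  induction P <;> simp_all [Proc.mapVal, Atom.mapVal_id, funext Expr.mapVal_id]

theorem Atom.vals_mapVal (f : Val → Val) (t : Atom) : (t.mapVal f).vals = t.vals.map f := by
  cases t <;> simp [Atom.mapVal, Atom.vals]

theorem Expr.vals_mapVal (f : Val → Val) (E : Expr) : (E.mapVal f).vals = E.vals.map f := by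
  cases E <;> simp [Expr.mapVal, Expr.vals, Atom.vals_mapVal]

theorem Proc.vals_mapVal (f : Val → Val) (P : Proc) : (P.mapVal f).vals = P.vals.map f := by
  induction P <;> simp_all [Proc.mapVal, Proc.vals, Atom.vals_mapVal, Expr.vals_mapVal,
    List.flatMap_map, List.map_flatMap]

theorem Atom.mapVal_inst (f : Val → Val) (U : Val) (k : ℕ) (t : Atom) :
    (t.inst U k).mapVal f = (t.mapVal f).inst (f U) k := by
  cases t with
  | bvar j => by_cases h : j = k <;> simp [Atom.mapVal, Atom.inst, h]
  | val V => simp [Atom.mapVal, Atom.inst]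

theorem Expr.mapVal_inst (f : Val → Val) (U : Val) (k : ℕ) (E : Expr) :
    (E.inst U k).mapVal f = (E.mapVal f).inst (f U) k := by
  cases E <;> simp [Expr.mapVal, Expr.inst, Atom.mapVal_inst]

theorem Proc.mapVal_inst (f : Val → Val) (U : Val) (P : Proc) (k : ℕ) :
    (P.inst U k).mapVal f = (P.mapVal f).inst (f U) k := by
  induction P generalizing k <;>
    simp_all [Proc.mapVal, Proc.inst, Atom.mapVal_inst, Expr.mapVal_inst]

theorem Atom.mem_vals_inst {v U : Val} {k : ℕ} {t : Atom} (h : v ∈ (t.inst U k).vals) :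
    v = U ∨ v ∈ t.vals := by
  cases t with
  | bvar j => by_cases hj : j = k <;> simp_all [Atom.vals, Atom.inst]
  | val V => simp_all [Atom.vals, Atom.inst]

theorem Expr.mem_vals_inst {v U : Val} {k : ℕ} {E : Expr} (h : v ∈ (E.inst U k).vals) :
    v = U ∨ v ∈ E.vals := by
  cases E with
  | atom t => exact Atom.mem_vals_inst h
  | new C => simp_all [Expr.vals, Expr.inst]

theorem Proc.mem_vals_inst {v U : Val} {P : Proc} {k : ℕ} (h : v ∈ (P.inst U k).vals) :
    v = U ∨ v ∈ P.vals := by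
  induction P generalizing k with
  | nil => simp_all [Proc.vals, Proc.inst]
  | letin E P ih =>
    simp only [Proc.vals, Proc.inst, List.mem_append] at h ⊢
    rcases h with h | h
    · rcases Expr.mem_vals_inst h with h | h <;> simp [h]
    · rcases ih h with h | h <;> simp [h]
  | send t m Es P ih =>
    simp only [Proc.vals, Proc.inst, List.mem_append, List.mem_flatMap, List.mem_map] at h ⊢
    rcases h with (h | ⟨_, ⟨E, hE, rfl⟩, h⟩) | h
    · rcases Atom.mem_vals_inst h with h | h <;> simp [h]
    · rcases Expr.mem_vals_inst h with h | h
      · simp [h]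
      · exact .inr (.inl (.inr ⟨E, hE, h⟩))
    · rcases ih h with h | h <;> simp [h]
  | ite E E' P Q ih ih' =>
    simp only [Proc.vals, Proc.inst, List.mem_append] at h ⊢
    rcases h with ((h | h) | h) | h
    · rcases Expr.mem_vals_inst h with h | h <;> simp [h]
    · rcases Expr.mem_vals_inst h with h | h <;> simp [h]
    · rcases ih h with h | h <;> simp [h]
    · rcases ih' h with h | h <;> simp [h]
  | plus P Q ih ih' =>
    simp only [Proc.vals, Proc.inst, List.mem_append] at h ⊢
    rcases h with h | h
    · rcases ih h with h | h <;> simp [h]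
    · rcases ih' h with h | h <;> simp [h]

theorem Expr.All_iff {p : Atom → Prop} {q : Val → Prop} (h : ∀ U, p (.val U) → q U) {E : Expr}
    (hE : E.All p) : ∀ v ∈ E.vals, q v := by
  cases E with
  | atom t => cases t <;> simp_all [Expr.vals, Atom.vals, Expr.All]
  | new C => simp [Expr.vals]

theorem Proc.All.vals {p : ℕ → Atom → Prop} {q : Val → Prop} (h : ∀ k U, p k (.val U) → q U)
    {P : Proc} {k : ℕ} (hP : P.All p k) : ∀ v ∈ P.vals, q v := by
  induction P generalizing k with
  | nil => simp [Proc.vals]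
  | letin E P ih =>
    simp only [Proc.vals, List.mem_append]
    rintro v (hv | hv)
    · exact Expr.All_iff (h k) hP.1 v hv
    · exact ih hP.2 v hv
  | send t m Es P ih =>
    simp only [Proc.vals, List.mem_append, List.mem_flatMap]
    rintro v ((hv | ⟨E, hE, hv⟩) | hv)
    · exact Expr.All_iff (E := .atom t) (h k) hP.1 v hv
    · exact Expr.All_iff (h k) (hP.2.1 E hE) v hv
    · exact ih hP.2.2 v hv
  | ite E E' P Q ih ih' =>
    simp only [Proc.vals, List.mem_append]
    rintro v (((hv | hv) | hv) | hv)
    · exact Expr.All_iff (h k) hP.1 v hv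
    · exact Expr.All_iff (h k) hP.2.1 v hv
    · exact ih hP.2.2.1 v hv
    · exact ih' hP.2.2.2 v hv
  | plus P Q ih ih' =>
    simp only [Proc.vals, List.mem_append]
    rintro v (hv | hv)
    · exact ih hP.1 v hv
    · exact ih' hP.2 v hv

theorem Proc.NoActors.vals {P : Proc} (h : P.NoActors) {v : Val} (hv : v ∈ P.vals) :
    ∃ x, v = .var x :=
  Proc.All.vals (q := fun v => ∃ x, v = .var x) (fun k U hU => by
    cases U with
    | var x => exact ⟨x, rfl⟩
    | act A => exact absurd rfl (hU A)) h v hv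

/-! ### Permutations of values -/

/-- The kind of a value: `none` for variables, the class for actor names. -/
def kind : Val → Option (Option ℕ)
  | .var _ => none
  | .act A => some A.1

/-- The permutation `g` preserves kinds and fixes the values in `K`. -/
structure Fixes (K : List Val) (g : Equiv.Perm Val) : Prop where
  kind_eq : ∀ v, kind (g v) = kind v
  fix : ∀ v ∈ K, g v = v

theorem Fixes.one (K : List Val) : Fixes K 1 := ⟨fun _ => rfl, fun _ _ => rfl⟩

theorem Fixes.mul {K : List Val} {g h : Equiv.Perm Val} (hg : Fixes K g) (hh : Fixes K h) :
    Fixes K (g * h) :=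
  ⟨fun v => by simp [hg.kind_eq, hh.kind_eq], fun v hv => by simp [hh.fix v hv, hg.fix v hv]⟩

theorem Fixes.inv {K : List Val} {g : Equiv.Perm Val} (hg : Fixes K g) : Fixes K g⁻¹ :=
  ⟨fun v => by rw [← hg.kind_eq]; simp,
    fun v hv => by rw [Equiv.Perm.inv_eq_iff_eq, hg.fix v hv]⟩

theorem Fixes.mono {K K' : List Val} {g : Equiv.Perm Val} (hg : Fixes K g) (h : K' ⊆ K) :
    Fixes K' g :=
  ⟨hg.kind_eq, fun v hv => hg.fix v (h hv)⟩

/-- The transposition of `g u` and `v` corrects the image of `u`. Neither of the two lies in the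
image of `X`, and they have the same colour. The colouring is left open because process reachability
only distinguishes variables from actor names, while everything else also respects classes. -/
theorem exists_perm_single {γ : Type*} {c : Val → γ} {g : Equiv.Perm Val}
    (hg : ∀ v, c (g v) = c v) (X : Set Val) {u v : Val} (hu : u ∉ X) (hv : ∀ x ∈ X, g x ≠ v)
    (huv : c u = c v) :
    ∃ g' : Equiv.Perm Val, (∀ v, c (g' v) = c v) ∧ (∀ x ∈ X, g' x = g x) ∧ g' u = v := by
  refine ⟨Equiv.swap (g u) v * g, fun w => ?_, fun x hx => ?_, by simp⟩
  · rw [Equiv.Perm.mul_apply, Equiv.swap_apply_def]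
    split_ifs with h1 h2
    · rw [← huv, ← hg u, ← h1, hg]
    · rw [hg, huv, ← h2, hg]
    · exact hg w
  · rw [Equiv.Perm.mul_apply, Equiv.swap_apply_of_ne_of_ne _ (hv x hx)]
    intro h
    exact hu (g.injective h ▸ hx)

theorem exists_perm_list {γ : Type*} {c : Val → γ} {g : Equiv.Perm Val}
    (hg : ∀ v, c (g v) = c v) (X : Set Val) {us vs : List Val} (hus : us.Nodup) (hvs : vs.Nodup)
    (hu : ∀ u ∈ us, u ∉ X) (hv : ∀ v ∈ vs, ∀ x ∈ X, g x ≠ v)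
    (huv : us.map c = vs.map c) :
    ∃ g' : Equiv.Perm Val, (∀ v, c (g' v) = c v) ∧ (∀ x ∈ X, g' x = g x) ∧ us.map g' = vs := by
  induction us generalizing vs with
  | nil => exact ⟨g, hg, fun _ _ => rfl, by cases vs <;> simp_all⟩
  | cons u us ih =>
    cases vs with
    | nil => simp at huv
    | cons v vs =>
      simp only [List.map_cons, List.cons.injEq] at huv
      simp only [List.nodup_cons] at hus hvs
      obtain ⟨g', h1, h2, h3⟩ := ih hus.2 hvs.2 (fun w hw => hu w (by simp [hw]))
        (fun w hw => hv w (by simp [hw])) huv.2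
      -- The head is adjusted after the tail, which joins the set of protected values.
      obtain ⟨g'', k1, k2, k3⟩ := exists_perm_single h1 (X ∪ {w | w ∈ us}) (u := u) (v := v)
        (by simpa using ⟨hu u (by simp), hus.1⟩)
        (by
          rintro x (hx | hx)
          · rw [h2 x hx]
            exact hv v (by simp) x hx
          · rintro rfl
            apply hvs.1
            rw [← h3]
            exact List.mem_map_of_mem hx) huv.1
      refine ⟨g'', k1, fun x hx => (k2 x (.inl hx)).trans (h2 x hx), ?_⟩
      rw [List.map_cons, k3, ← h3, List.map_congr_left fun x hx => k2 x (.inr hx)]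

/-- Two lists of values that have the same equalities are related by a permutation. -/
theorem exists_perm_of_zip {γ : Type*} {c : Val → γ} (l : List (Val × Val))
    (hc : ∀ p ∈ l, c p.1 = c p.2) (hl : ∀ p ∈ l, ∀ q ∈ l, p.1 = q.1 ↔ p.2 = q.2) :
    ∃ g : Equiv.Perm Val, (∀ v, c (g v) = c v) ∧ ∀ p ∈ l, g p.1 = p.2 := by
  induction l with
  | nil => exact ⟨1, fun _ => rfl, by simp⟩
  | cons p l ih =>
    obtain ⟨g, h1, h2⟩ := ih (fun q hq => hc q (by simp [hq]))
      (fun q hq r hr => hl q (by simp [hq]) r (by simp [hr]))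
    -- A repeated first component imposes nothing new, because by `hl` its second component is
    -- repeated as well.
    by_cases hp : ∃ q ∈ l, q.1 = p.1
    · obtain ⟨q, hq, hqp⟩ := hp
      refine ⟨g, h1, ?_⟩
      rintro r hr
      rcases List.mem_cons.1 hr with rfl | hr
      · rw [← hqp, h2 q hq]
        exact (hl q (by simp [hq]) r (by simp)).1 hqp
      · exact h2 r hr
    · push Not at hp
      obtain ⟨g', k1, k2, k3⟩ := exists_perm_single h1 {v | ∃ q ∈ l, q.1 = v} (u := p.1) (v := p.2)
        (by rintro ⟨q, hq, h⟩; exact hp q hq h)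
        (by
          rintro _ ⟨q, hq, rfl⟩ h
          rw [h2 q hq] at h
          exact hp q hq ((hl q (by simp [hq]) p (by simp)).2 h)) (hc p (by simp))
      refine ⟨g', k1, ?_⟩
      rintro r hr
      rcases List.mem_cons.1 hr with rfl | hr
      · exact k3
      · rw [k2 _ ⟨r, hr, rfl⟩, h2 r hr]

/-- The tool for freshness: a correspondence `g` between the old values of two runs extends to the
new values `us` and `vs` that a step introduces on either side. -/
theorem Fixes.exists_list {K : List Val} {g : Equiv.Perm Val} (hg : Fixes K g) (X : Set Val)
    {us vs : List Val} (hus : us.Nodup) (hvs : vs.Nodup) (hu : ∀ u ∈ us, u ∉ X)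
    (hv : ∀ v ∈ vs, ∀ x ∈ X, g x ≠ v) (huK : ∀ u ∈ us, u ∉ K) (hvK : ∀ v ∈ vs, v ∉ K)
    (huv : us.map kind = vs.map kind) :
    ∃ g' : Equiv.Perm Val, Fixes K g' ∧ (∀ x ∈ X, g' x = g x) ∧ us.map g' = vs := by
  obtain ⟨g', h1, h2, h3⟩ := exists_perm_list hg.kind_eq (X ∪ {v | v ∈ K}) hus hvs
    (fun u hu' => by simpa using ⟨hu u hu', huK u hu'⟩)
    (by
      rintro v hv' x (hx | hx)
      · exact hv v hv' x hx
      · rw [hg.fix x hx]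
        rintro rfl
        exact hvK _ hv' hx) huv
  exact ⟨g', ⟨h1, fun v hv => (h2 v (.inr hv)).trans (hg.fix v hv)⟩, fun x hx => h2 x (.inl hx), h3⟩

/-- No actor names occur in the text of the program. -/
structure Program.Pure (𝒢 : Program) : Prop where
  main : 𝒢.main.NoActors
  body : ∀ d ∈ 𝒢.defs, d.body.NoActors

/-! ### Local steps -/

/-- What an actor can hold: a message in its queue or a running process. -/
abbrev Item := (ℕ × List Val) ⊕ Proc

def Item.mapVal (f : Val → Val) : Item → Item
  | .inl μ => .inl (μ.1, μ.2.map f)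
  | .inr P => .inr (P.mapVal f)

def Item.vals : Item → List Val
  | .inl μ => μ.2
  | .inr P => P.vals

theorem Item.mapVal_congr {f g : Val → Val} {z : Item} (h : ∀ v ∈ z.vals, f v = g v) :
    z.mapVal f = z.mapVal g := by
  cases z with
  | inl μ => simp only [Item.mapVal]; rw [List.map_congr_left (l := μ.2) h]
  | inr P => simp only [Item.mapVal]; rw [Proc.mapVal_congr h]

theorem Item.mapVal_mapVal (f g : Val → Val) (z : Item) :
    (z.mapVal f).mapVal g = z.mapVal (g ∘ f) := by
  cases z <;> simp [Item.mapVal, Proc.mapVal_mapVal]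

theorem Item.mapVal_id (z : Item) : z.mapVal id = z := by
  cases z <;> simp [Item.mapVal, Proc.mapVal_id]

theorem Item.vals_mapVal (f : Val → Val) (z : Item) : (z.mapVal f).vals = z.vals.map f := by
  cases z <;> simp [Item.mapVal, Item.vals, Proc.vals_mapVal]

theorem Item.mapVal_eq_self {f : Val → Val} {z : Item} (h : ∀ v ∈ z.vals, f v = v) :
    z.mapVal f = z := by
  rw [Item.mapVal_congr (g := id) h, Item.mapVal_id]

theorem Item.mapVal_nil {f : Val → Val} {z : Item} : z.mapVal f = .inr .nil ↔ z = .inr .nil := by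
  rcases z with μ | P
  · simp [Item.mapVal]
  · cases P <;> simp [Item.mapVal, Proc.mapVal]

/-- Evaluation of expressions, with the list of the new actors. -/
inductive EvalF : List Expr → List Val → List Val → Prop
  | nil : EvalF [] [] []
  | val {Es Us ν} (U : Val) (h : EvalF Es Us ν) : EvalF (.atom (.val U) :: Es) (U :: Us) ν
  | new {Es Us ν C} (v : Val) (hv : kind v = some (some C)) (h : EvalF Es Us ν) :
      EvalF (.new C :: Es) (v :: Us) (v :: ν)

/-- The free variables of a body that are neither `this` nor parameters. -/
def MethodDef.locals (d : MethodDef) : List ℕ := d.body.fv.dedup.filter fun y => y ∉ this :: d.params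

/-- The instance of a body, with `ν` for the free variables. -/
def MethodDef.instWith (d : MethodDef) (A : Val) (Us ν : List Val) : Proc :=
  d.body.subst fun x =>
    (((this, A) :: d.params.zip Us ++ d.locals.zip ν).lookup x).getD (.var x)

theorem instBody_eq (used : List ℕ) (A : ActorName) (d : MethodDef) (Us : List Val) :
    instBody used A d Us =
      d.instWith (.act A) Us ((freshVars used d.locals.length).map .var) := rfl

/-- `LStep 𝒢 A z ν o z'`: the item `z` of the actor `A` is turned into `z'`, creating the values
`ν` and sending the message `o`. -/
inductive LStep (𝒢 : Program) (A : Val) :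
    Item → List Val → Option (Val × Item) → Item → Prop
  | letin {E P U ν} (h : EvalF [E] [U] ν) :
      LStep 𝒢 A (.inr (.letin E P)) ν none (.inr (P.inst U 0))
  | send {B m Es P Us ν} (h : EvalF Es Us ν) (hB : kind B ≠ none) :
      LStep 𝒢 A (.inr (.send (.val B) m Es P)) ν (some (B, .inl (m, Us))) (.inr P)
  | ite {E E' P Q U V ν} (h : EvalF [E, E'] [U, V] ν) :
      LStep 𝒢 A (.inr (.ite E E' P Q)) ν none (.inr (if U = V then P else Q))
  | plusL {P Q} : LStep 𝒢 A (.inr (.plus P Q)) [] none (.inr P)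
  | plusR {P Q} : LStep 𝒢 A (.inr (.plus P Q)) [] none (.inr Q)
  | start {d Us ν} (hd : d ∈ 𝒢.defs) (hA : kind A = some (some d.cls))
      (hlen : Us.length = d.params.length) (hν : ν.length = d.locals.length)
      (hk : ∀ v ∈ ν, kind v = none) :
      LStep 𝒢 A (.inl (d.meth, Us)) ν none (.inr (d.instWith A Us ν))

/-! ### Invariance of evaluation and of local steps under renaming. -/

theorem EvalF.mapVal {g : Val → Val} (hg : ∀ v, kind (g v) = kind v) {Es Us ν}
    (h : EvalF Es Us ν) : EvalF (Es.map (Expr.mapVal g)) (Us.map g) (ν.map g) := by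
  induction h with
  | nil => exact .nil
  | val U h ih => exact .val _ ih
  | new v hv h ih => exact .new _ ((hg v).trans hv) ih

theorem EvalF.mem_vals {Es Us ν} (h : EvalF Es Us ν) : ∀ v ∈ Us, v ∈ Es.flatMap Expr.vals ∨ v ∈ ν := by
  induction h with
  | nil => simp
  | val U h ih =>
    intro w hw
    simp only [List.flatMap_cons, Expr.vals, Atom.vals, List.mem_append, List.mem_singleton]
    rcases List.mem_cons.1 hw with rfl | hw
    · simp
    · rcases ih w hw with h | h <;> simp [h]
  | new v hv h ih =>
    intro w hw
    simp only [List.flatMap_cons, Expr.vals, List.mem_append, List.mem_cons]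
    rcases List.mem_cons.1 hw with rfl | hw
    · simp
    · rcases ih w hw with h | h <;> simp [h]

/-- The list `ν` prescribes the result of every `new`, which leaves no choice. -/
theorem EvalF.unique {Es Us Us' ν} (h : EvalF Es Us ν) (h' : EvalF Es Us' ν) : Us = Us' := by
  induction h generalizing Us' with
  | nil => cases h'; rfl
  | val U h ih => cases h' with | val _ h' => rw [ih h']
  | new v hv h ih => cases h' with | new _ _ h' => rw [ih h']

theorem lookup_isSome_of_mem {α β : Type*} [BEq α] [LawfulBEq α] {l : List (α × β)} {x : α}
    (h : x ∈ l.map Prod.fst) : ∃ y, l.lookup x = some y := by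
  induction l with
  | nil => simp at h
  | cons p l ih =>
    rw [List.lookup_cons]
    by_cases hx : x = p.1
    · simp [hx]
    · simp only [List.map_cons, List.mem_cons, hx, false_or] at h
      simpa [beq_false_of_ne hx] using ih h

theorem mem_of_lookup_eq {α β : Type*} [BEq α] [LawfulBEq α] {l : List (α × β)} {x : α} {y : β}
    (h : l.lookup x = some y) : (x, y) ∈ l := by
  induction l with
  | nil => simp at h
  | cons p l ih =>
    rw [List.lookup_cons] at h
    by_cases hx : x = p.1
    · subst hx
      simp only [beq_self_eq_true, Option.some.injEq] at h
      subst h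
      simp
    · rw [beq_false_of_ne hx] at h
      exact List.mem_cons_of_mem _ (ih h)

theorem lookup_map_snd {α β γ : Type*} [BEq α] (l : List (α × β)) (f : β → γ) (x : α) :
    (l.map fun p => (p.1, f p.2)).lookup x = (l.lookup x).map f := by
  induction l with
  | nil => simp
  | cons p l ih =>
    obtain ⟨a, b⟩ := p
    cases h : x == a <;> simp [List.lookup_cons, h, ih]

/-- A free variable of a body is `this`, a parameter or a local. The default `.var x` of the lookup,
which would not commute with renamings, is therefore never used. -/
theorem MethodDef.exists_lookup {d : MethodDef} {A : Val} {Us ν : List Val}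
    (hlen : Us.length = d.params.length) (hν : ν.length = d.locals.length) {x : ℕ}
    (hx : x ∈ d.body.fv) :
    ∃ v, (((this, A) :: d.params.zip Us ++ d.locals.zip ν).lookup x) = some v := by
  apply lookup_isSome_of_mem
  rw [List.cons_append, List.map_cons, List.map_append, List.map_fst_zip (by omega),
    List.map_fst_zip (by omega)]
  by_cases h : x ∈ this :: d.params
  · rcases List.mem_cons.1 h with h | h <;> simp [h]
  · have : x ∈ d.locals := by
      rw [MethodDef.locals, List.mem_filter, List.mem_dedup]
      exact ⟨hx, by simpa using h⟩
    simp [this]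

theorem MethodDef.mapVal_instWith {d : MethodDef} (hd : d.body.NoActors) {A : Val}
    {Us ν : List Val} (hlen : Us.length = d.params.length) (hν : ν.length = d.locals.length)
    (g : Val → Val) :
    (d.instWith A Us ν).mapVal g = d.instWith (g A) (Us.map g) (ν.map g) := by
  rw [MethodDef.instWith, MethodDef.instWith, Proc.subst, Proc.subst, Proc.mapVal_mapVal]
  refine Proc.mapVal_congr fun v hv => ?_
  obtain ⟨x, rfl⟩ := hd.vals hv
  obtain ⟨w, hw⟩ := MethodDef.exists_lookup (A := A) hlen hν (Proc.mem_fv.2 hv)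
  simp only [Function.comp, Val.bind]
  have : ((this, g A) :: d.params.zip (Us.map g) ++ d.locals.zip (ν.map g)) =
      ((this, A) :: d.params.zip Us ++ d.locals.zip ν).map fun p => (p.1, g p.2) := by
    simp [List.zip_map_right]; rfl
  rw [this, lookup_map_snd, hw]
  rfl

theorem MethodDef.mem_vals_instWith {d : MethodDef} (hd : d.body.NoActors) {A : Val}
    {Us ν : List Val} (hlen : Us.length = d.params.length) (hν : ν.length = d.locals.length)
    {v : Val} (hv : v ∈ (d.instWith A Us ν).vals) : v = A ∨ v ∈ Us ∨ v ∈ ν := by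
  rw [MethodDef.instWith, Proc.subst, Proc.vals_mapVal, List.mem_map] at hv
  obtain ⟨u, hu, rfl⟩ := hv
  obtain ⟨x, rfl⟩ := hd.vals hu
  obtain ⟨w, hw⟩ := MethodDef.exists_lookup (A := A) hlen hν (Proc.mem_fv.2 hu)
  simp only [Val.bind, hw, Option.getD_some]
  have := mem_of_lookup_eq hw
  rw [List.cons_append, List.mem_cons, List.mem_append] at this
  rcases this with h | h | h
  · simp only [Prod.mk.injEq] at h
    exact .inl h.2
  · exact .inr (.inl (List.of_mem_zip h).2)
  · exact .inr (.inr (List.of_mem_zip h).2)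

/-- Local steps are preserved by permutations of the values. -/
theorem LStep.perm {𝒢 : Program} (h𝒢 : 𝒢.Pure) {g : Equiv.Perm Val}
    (hg : ∀ v, kind (g v) = kind v) {A z ν o z'} (h : LStep 𝒢 A z ν o z') :
    LStep 𝒢 (g A) (z.mapVal g) (ν.map g) (o.map fun p => (g p.1, p.2.mapVal g))
      (z'.mapVal g) := by
  cases h with
  | letin h =>
    simp only [Item.mapVal, Proc.mapVal, Proc.mapVal_inst]
    exact .letin (h.mapVal hg)
  | send h hB => exact .send (h.mapVal hg) (by rwa [hg])
  | @ite E E' P Q U V ν h =>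
    have := LStep.ite (𝒢 := 𝒢) (A := g A) (P := P.mapVal g) (Q := Q.mapVal g) (h.mapVal hg)
    -- Matching observes equalities between values, so a renaming has to be injective here.
    simp only [g.injective.eq_iff] at this
    simp only [Item.mapVal, Proc.mapVal]
    rw [apply_ite (Proc.mapVal g)]
    exact this
  | plusL => exact .plusL
  | plusR => exact .plusR
  | start hd hA hlen hν hk =>
    simp only [Item.mapVal]
    rw [MethodDef.mapVal_instWith (h𝒢.body _ hd) hlen hν]
    exact .start hd (by rw [hg, hA]) (by simpa using hlen) (by simpa using hν)
      (by simpa [hg] using hk)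

/-- The values that occur after a local step. -/
theorem LStep.mem_vals {𝒢 : Program} (h𝒢 : 𝒢.Pure) {A z ν o z'} (h : LStep 𝒢 A z ν o z') :
    (∀ v ∈ z'.vals, v = A ∨ v ∈ z.vals ∨ v ∈ ν) ∧
    ∀ p, o = some p → kind p.1 ≠ none ∧ p.1 ∈ z.vals ∧ ∀ v ∈ p.2.vals, v ∈ z.vals ∨ v ∈ ν := by
  cases h with
  | letin h =>
    refine ⟨fun v hv => ?_, by simp⟩
    simp only [Item.vals, Proc.vals, List.mem_append] at hv ⊢
    rcases Proc.mem_vals_inst hv with rfl | hv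
    · have := h.mem_vals v (by simp)
      simp only [List.flatMap_cons, List.flatMap_nil, List.append_nil] at this
      tauto
    · tauto
  | send h hB =>
    refine ⟨fun v hv => ?_, ?_⟩
    · simp only [Item.vals, Proc.vals, List.mem_append] at hv ⊢
      tauto
    · rintro p hp
      cases hp
      refine ⟨hB, by simp [Item.vals, Proc.vals, Atom.vals], fun v hv => ?_⟩
      have := h.mem_vals v hv
      simp only [Item.vals, Proc.vals, List.mem_append]
      tauto
  | ite h =>
    refine ⟨fun v hv => ?_, by simp⟩
    simp only [Item.vals, Proc.vals, List.mem_append] at hv ⊢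
    split_ifs at hv <;> tauto
  | plusL => exact ⟨fun v hv => by simp_all [Item.vals, Proc.vals], by simp⟩
  | plusR => exact ⟨fun v hv => by simp_all [Item.vals, Proc.vals], by simp⟩
  | start hd hA hlen hν hk =>
    exact ⟨fun v hv => MethodDef.mem_vals_instWith (h𝒢.body _ hd) hlen hν hv, by simp⟩

theorem LStep.ne_nil {𝒢 : Program} {A z ν o z'} (h : LStep 𝒢 A z ν o z') : z ≠ .inr .nil := by
  cases h <;> simp

/-! ### Fresh names and variables -/

/-- Pigeonhole: `N.length + 1` distinct candidates cannot all lie in `N`. This justifies the range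
in `freshName` and shows that its default index is not reached for lack of candidates. -/
theorem exists_lt_notMem_map {α : Type*} [DecidableEq α] (N : List α) (f : ℕ → α)
    (hf : f.Injective) : ∃ i < N.length + 1, f i ∉ N := by
  by_contra! h
  have h1 : (Finset.range (N.length + 1)).image f ⊆ N.toFinset := by
    intro x hx
    obtain ⟨i, hi, rfl⟩ := Finset.mem_image.1 hx
    simpa using h i (Finset.mem_range.1 hi)
  have h2 := Finset.card_le_card h1
  rw [Finset.card_image_of_injective _ hf, Finset.card_range] at h2
  have := N.toFinset_card_le
  omega

theorem headD_filter_range {n : ℕ} {p : ℕ → Bool} (h : ∃ i < n, p i = true) :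
    p (((List.range n).filter p).headD 0) = true ∧ ((List.range n).filter p).headD 0 < n := by
  obtain ⟨i, hi, hp⟩ := h
  have hmem : i ∈ (List.range n).filter p := by simp [hi, hp]
  cases hl : (List.range n).filter p with
  | nil => simp [hl] at hmem
  | cons a l =>
    have : a ∈ (List.range n).filter p := by simp [hl]
    simp only [List.mem_filter, List.mem_range] at this
    exact ⟨this.2, this.1⟩

theorem freshName_notMem (N : List ActorName) (C : ℕ) : freshName N C ∉ N := by
  have := headD_filter_range (n := N.length + 1) (p := fun i => decide ((some C, i) ∉ N)) (by
    simpa using exists_lt_notMem_map N (fun i => ((some C, i) : ActorName))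
      (fun i j h => (Prod.mk.inj h).2))
  exact of_decide_eq_true this.1

theorem freshVars_spec (used : List ℕ) (n : ℕ) :
    (freshVars used n).length = n ∧ (freshVars used n).Nodup ∧ ∀ x ∈ freshVars used n, x ∉ used := by
  refine ⟨?_, ?_, ?_⟩
  · rw [freshVars, List.length_take, min_eq_left]
    -- At most `used.length` of the `used.length + n` candidates are in use, so at least `n` remain.
    have h1 := List.length_eq_length_filter_add (l := List.range (used.length + n)) (fun x => decide (x ∈ used))
    have h2 : ((List.range (used.length + n)).filter fun x => decide (x ∈ used)).length ≤ used.length := by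
      refine (List.subperm_of_subset (List.nodup_range.filter _) ?_).length_le
      intro x hx
      simpa using (List.mem_filter.1 hx).2
    simp only [List.length_range] at h1
    have h3 : ((List.range (used.length + n)).filter fun x => !decide (x ∈ used)) =
        (List.range (used.length + n)).filter fun x => x ∉ used := by
      congr 1; ext x; simp
    rw [h3] at h1
    omega
  · exact (List.nodup_range.filter _).sublist (List.take_sublist _ _)
  · intro x hx
    have := List.mem_of_mem_take hx
    simpa using (List.mem_filter.1 this).2

theorem EvalEs.evalF {N Es Us M} (h : EvalEs N Es Us M) :
    EvalF Es Us (M.map .act) ∧ M.Nodup ∧ ∀ B ∈ M, B ∉ N := by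
  induction h with
  | nil N => exact ⟨.nil, by simp, by simp⟩
  | cons h h' ih =>
    cases h with
    | val => exact ⟨.val _ ih.1, by simpa using ih.2.1, by simpa using ih.2.2⟩
    | new C =>
      refine ⟨.new _ rfl ih.1, ?_, ?_⟩
      · rw [List.singleton_append, List.nodup_cons]
        exact ⟨fun hm => ih.2.2 _ hm (by simp), ih.2.1⟩
      · intro B hB
        rcases List.mem_cons.1 hB with rfl | hB
        · exact freshName_notMem _ _
        · exact fun hN => ih.2.2 B hB (by simp [hN])

/-- Whether an evaluation succeeds does not depend on the names in use; only the names of the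
created actors change, and they keep their classes. -/
theorem EvalF.exists_evalEs {Es Us ν} (h : EvalF Es Us ν) (N : List ActorName) :
    ∃ Us' M, EvalEs N Es Us' M ∧ ν.map kind = (M.map Val.act).map kind := by
  induction h generalizing N with
  | nil => exact ⟨_, _, .nil N, rfl⟩
  | val U h ih =>
    obtain ⟨Us', M, h1, h2⟩ := ih (N ++ [])
    exact ⟨_, _, .cons (.val U) h1, h2⟩
  | @new Es Us ν C v hv h ih =>
    obtain ⟨Us', M, h1, h2⟩ := ih (N ++ [freshName N C])
    exact ⟨_, _, .cons (.new C) h1, by simp [hv, h2]; rfl⟩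

theorem evalEs_singleton {N E U M} (h : EvalEs N [E] [U] M) : EvalE N E U M := by
  cases h with
  | cons h h' =>
    cases h'
    rwa [List.append_nil]

theorem EvalE.evalEs {N E U M} (h : EvalE N E U M) : EvalEs N [E] [U] M := by
  have := EvalEs.cons h (.nil _)
  rwa [List.append_nil] at this

/-! ### Configurations as lists of entries -/

/-- An item with a flag and its owner. -/
abbrev Entry (φ : Type) := φ × Val × Item

def Entry.vals {φ : Type} (e : Entry φ) : List Val := e.2.1 :: e.2.2.vals

/-- The values that occur in a list of entries. -/
def stateVals {φ : Type} (w : List (Entry φ)) : List Val := w.flatMap Entry.vals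

theorem mem_stateVals {φ : Type} {w : List (Entry φ)} {v : Val} :
    v ∈ stateVals w ↔ ∃ e ∈ w, v = e.2.1 ∨ v ∈ e.2.2.vals := by
  simp [stateVals, Entry.vals]

/-- The items sent and created by a local step. -/
def outItems (o : Option (Val × Item)) (ν : List Val) : List (Val × Item) :=
  o.toList ++ (ν.filter fun v => kind v ≠ none).map fun v => (v, .inr .nil)

/-- The expressions that are evaluated in the first step of a process. -/
def Proc.heads : Proc → List Expr
  | .letin E _ => [E]
  | .send _ _ Es _ => Es
  | .ite E E' _ _ => [E, E']
  | _ => []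

/-- `ν` is the list of new values that is determined by the names `N` and variables `X` in use. -/
def Supply (N : List ActorName) (X : List ℕ) (z : Item) (ν : List Val) : Prop :=
  match z with
  | .inl _ => ν = (freshVars X ν.length).map .var
  | .inr P => ∃ Us M, EvalEs N P.heads Us M ∧ ν = M.map .act

/-- For the correspondence with abstract runs, this is all that matters about the order in which
names and variables are supplied: the new values are distinct and not in use. -/
theorem Supply.spec {N X z ν} (h : Supply N X z ν) :
    ν.Nodup ∧ (∀ A, .act A ∈ ν → A ∉ N) ∧ ∀ x, .var x ∈ ν → x ∉ X := by
  cases z with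
  | inl μ =>
    obtain ⟨h1, h2, h3⟩ := freshVars_spec X ν.length
    simp only [Supply] at h
    generalize freshVars X ν.length = l at *
    subst h
    exact ⟨h2.map fun a b => by simp, by simp, by simpa using h3⟩
  | inr P =>
    obtain ⟨Us, M, h1, rfl⟩ := h
    obtain ⟨h2, h3, h4⟩ := h1.evalF
    exact ⟨h3.map fun a b => by simp, by simpa using h4, by simp⟩

theorem LStep.evalF {𝒢 : Program} {A P ν o z'} (h : LStep 𝒢 A (.inr P) ν o z') :
    ∃ Us, EvalF P.heads Us ν := by
  cases h with
  | letin h => exact ⟨_, h⟩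
  | send h hB => exact ⟨_, h⟩
  | ite h => exact ⟨_, h⟩
  | plusL => exact ⟨_, .nil⟩
  | plusR => exact ⟨_, .nil⟩

/-- The item determines how many new values are needed and of which kinds, so the values of the step
can be exchanged for the ones that the semantics imposes. -/
theorem LStep.exists_supply {𝒢 : Program} {A z ν o z'} (h : LStep 𝒢 A z ν o z')
    (N : List ActorName) (X : List ℕ) :
    ∃ ν', Supply N X z ν' ∧ ν.map kind = ν'.map kind := by
  cases z with
  | inl μ =>
    cases h with
    | start hd hA hlen hν hk =>
      refine ⟨(freshVars X ν.length).map .var, ?_, ?_⟩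
      · simp [Supply, (freshVars_spec X ν.length).1]
      · rw [List.eq_replicate_of_mem (l := ν.map kind) (a := none) (by simpa using hk), List.map_map]
        symm
        rw [List.eq_replicate_iff]
        refine ⟨by simp [(freshVars_spec X ν.length).1], ?_⟩
        intro b hb
        obtain ⟨x, hx, rfl⟩ := List.mem_map.1 hb
        rfl
  | inr P =>
    obtain ⟨Us, h⟩ := h.evalF
    obtain ⟨Us', M, h1, h2⟩ := h.exists_evalEs N
    exact ⟨_, ⟨Us', M, h1, rfl⟩, h2⟩

/-- The actor name in a value. -/
def Val.toName : Val → Option ActorName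
  | .act A => some A
  | .var _ => none

/-- The effect of an output and of the creation of actors on a configuration. -/
def post (o : Option (Val × Item)) (ν : List Val) (S : Config) : Config :=
  (match o with
    | some (.act B, .inl μ) => deliver B ⟨μ.1, μ.2⟩ S
    | _ => S) ++ newActors (ν.filterMap Val.toName)

theorem post_none_map_act (M : List ActorName) (S : Config) :
    post none (M.map .act) S = S ++ newActors M := by
  simp [post, List.filterMap_map, Function.comp_def, Val.toName]

theorem post_some_map_act (B : ActorName) (m : ℕ) (Us : List Val) (M : List ActorName)
    (S : Config) :
    post (some (.act B, .inl (m, Us))) (M.map .act) S = deliver B ⟨m, Us⟩ S ++ newActors M := by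
  simp [post, List.filterMap_map, Function.comp_def, Val.toName]

theorem post_none_map_var (l : List ℕ) (S : Config) : post none (l.map .var) S = S := by
  simp [post, List.filterMap_map, Function.comp_def, Val.toName, newActors]

/-- The variables that are in use in a configuration. -/
def usedVars (𝒢 : Program) (S : Config) : List ℕ := this :: 𝒢.main.fv ++ Config.vars S

/-- The item of a term that is concerned by its next step, and what remains of the queue. -/
inductive Front : Proc → List Msg → Item → List Msg → Prop
  | proc (P q) : Front P q (.inr P) q
  | msg (m Us q) : Front .nil (⟨m, Us⟩ :: q) (.inl (m, Us)) q

/-- The factorization on which everything rests. The local step sees only the front item, its owner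
and the new values; the context enters through `Supply` and through the existence of the receiver.
-/
theorem step_iff {𝒢 : Program} {T T₁ : Config} :
    Step 𝒢 T T₁ ↔ ∃ L R A P q z q' ν o P', T = L ++ ⟨A, P, q⟩ :: R ∧ Front P q z q' ∧
      Supply (names T) (usedVars 𝒢 T) z ν ∧ LStep 𝒢 (.act A) z ν o (.inr P') ∧
      (∀ B i, o = some (.act B, i) → B ∈ names T) ∧ T₁ = post o ν (L ++ ⟨A, P', q'⟩ :: R) := by
  constructor
  · intro h
    cases h with
    | letin h =>
      refine ⟨_, _, _, _, _, _, _, _, _, _, rfl, .proc _ _, ⟨_, _, h.evalEs, rfl⟩,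
        .letin h.evalEs.evalF.1, by simp, ?_⟩
      rw [post_none_map_act]
    | send h hB =>
      refine ⟨_, _, _, _, _, _, _, _, _, _, rfl, .proc _ _, ⟨_, _, h, rfl⟩,
        .send h.evalF.1 (by simp [kind]), ?_, ?_⟩
      · rintro B i hi
        cases hi
        exact hB
      · rw [post_some_map_act]
    | @inst L R A q d Us hd hA hlen =>
      refine ⟨_, _, _, _, _, _, _, _, _, _, rfl, .msg _ _ _, ?_,
        .start hd (by simp [kind, hA]) hlen (ν := (freshVars (usedVars 𝒢 (L ++ ⟨A, .nil, ⟨d.meth, Us⟩ :: q⟩ :: R)) d.locals.length).map .var) ?_ ?_, by simp, ?_⟩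
      · simp [Supply, (freshVars_spec _ d.locals.length).1]
      · simp [(freshVars_spec _ d.locals.length).1]
      · simp [kind]
      · rw [post_none_map_var, instBody_eq]
        rfl
    | @matched L R A q E E' P Q U M h =>
      refine ⟨_, _, _, _, _, _, _, _, none, P, rfl, .proc _ _, ⟨_, _, h, rfl⟩, ?_, by simp, ?_⟩
      · simpa using LStep.ite (𝒢 := 𝒢) (A := .act A) (P := P) (Q := Q) h.evalF.1
      · rw [post_none_map_act]
    | @mismatched L R A q E E' P Q U V M h hne =>
      refine ⟨_, _, _, _, _, _, _, _, none, Q, rfl, .proc _ _, ⟨_, _, h, rfl⟩, ?_, by simp, ?_⟩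
      · simpa [hne] using LStep.ite (𝒢 := 𝒢) (A := .act A) (P := P) (Q := Q) h.evalF.1
      · rw [post_none_map_act]
    | plusL =>
      exact ⟨_, _, _, _, _, _, _, _, _, _, rfl, .proc _ _, ⟨_, _, .nil _, rfl⟩, .plusL, by simp,
        by simp [post, newActors]⟩
    | plusR =>
      exact ⟨_, _, _, _, _, _, _, _, _, _, rfl, .proc _ _, ⟨_, _, .nil _, rfl⟩, .plusR, by simp,
        by simp [post, newActors]⟩
  · rintro ⟨L, R, A, P, q, z, q', ν, o, P', rfl, hF, hS, h, ho, rfl⟩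
    cases hF with
    | proc =>
      obtain ⟨Us, M, hM, hν⟩ := hS
      cases h with
      | letin h =>
        subst hν
        cases hM.evalF.1.unique h
        rw [post_none_map_act]
        exact .letin (evalEs_singleton hM)
      | @send B _ _ _ _ _ h hB =>
        subst hν
        cases hM.evalF.1.unique h
        cases B with
        | var x => simp [kind] at hB
        | act B =>
          rw [post_some_map_act]
          exact .send hM (ho B _ rfl)
      | @ite E E' P Q U V ν h =>
        subst hν
        cases hM.evalF.1.unique h
        rw [post_none_map_act]
        split_ifs with hUV
        · subst hUV
          exact .matched hM
        · exact .mismatched hM hUV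
      | plusL =>
        simp only [post, List.filterMap_nil, newActors, List.map_nil, List.append_nil]
        exact .plusL
      | plusR =>
        simp only [post, List.filterMap_nil, newActors, List.map_nil, List.append_nil]
        exact .plusR
    | msg m Us q =>
      cases h with
      | @start d _ _ hd hA hlen hν hk =>
        simp only [Supply] at hS
        rw [hS, post_none_map_var, hν]
        simp only [kind, Option.some.injEq] at hA
        exact .inst hd hA hlen

/-! ### Representation of configurations -/

/-- The items of the owner `v`. -/
def cont {φ : Type} (v : Val) (w : List (Entry φ)) : List Item :=
  w.filterMap fun e => if e.2.1 = v then some e.2.2 else none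

theorem cont_append {φ : Type} (v : Val) (w w' : List (Entry φ)) :
    cont v (w ++ w') = cont v w ++ cont v w' := List.filterMap_append

theorem cont_cons {φ : Type} (v : Val) (e : Entry φ) (w : List (Entry φ)) :
    cont v (e :: w) = if e.2.1 = v then e.2.2 :: cont v w else cont v w := by
  rw [cont, List.filterMap_cons]
  by_cases h : e.2.1 = v <;> simp [h, cont]

theorem cont_eq_nil {φ : Type} {v : Val} {w : List (Entry φ)} (h : ∀ e ∈ w, e.2.1 ≠ v) :
    cont v w = [] := by
  rw [cont, List.filterMap_eq_nil_iff]
  intro e he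
  simp [h e he]

theorem mem_cont {φ : Type} {v : Val} {w : List (Entry φ)} {z : Item} :
    z ∈ cont v w ↔ ∃ f, (f, v, z) ∈ w := by
  rw [cont, List.mem_filterMap]
  constructor
  · rintro ⟨⟨f, u, z⟩, he, h⟩
    by_cases hu : u = v
    · simp only [hu, ↓reduceIte, Option.some.injEq] at h
      subst hu h
      exact ⟨f, he⟩
    · simp [hu] at h
  · rintro ⟨f, h⟩
    exact ⟨_, h, by simp⟩

def msgItems (q : List Msg) : List Item := q.map fun μ => .inl (μ.meth, μ.args)

/-- The list of entries `w` represents the configuration `T`. The process of an actor may be missing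
from `w` if it is `0`. -/
structure Rep {φ : Type} (T : Config) (w : List (Entry φ)) : Prop where
  nodup : (names T).Nodup
  owner : ∀ e ∈ w, ∃ A ∈ names T, e.2.1 = .act A
  content : ∀ a ∈ T, cont (.act a.name) w = .inr a.proc :: msgItems a.queue ∨
    a.proc = .nil ∧ cont (.act a.name) w = msgItems a.queue
  closed : ∀ e ∈ w, ∀ A, .act A ∈ e.2.2.vals → A ∈ names T

theorem mem_names {T : Config} {A : ActorName} : A ∈ names T ↔ ∃ a ∈ T, a.name = A := by
  simp [names]

/-- The values of a representation occur in the configuration. -/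
theorem Rep.mem_used {φ : Type} {𝒢 : Program} {T : Config} {w : List (Entry φ)} (h : Rep T w)
    {v : Val} (hv : v ∈ stateVals w) :
    (∃ A ∈ names T, v = .act A) ∨ ∃ x ∈ usedVars 𝒢 T, v = .var x := by
  obtain ⟨e, he, hv⟩ := mem_stateVals.1 hv
  rcases hv with rfl | hv
  · exact .inl (h.owner e he)
  · cases v with
    | act A => exact .inl ⟨A, h.closed e he A hv, rfl⟩
    | var x =>
      refine .inr ⟨x, ?_, rfl⟩
      obtain ⟨A, hA, hA'⟩ := h.owner e he
      obtain ⟨a, ha, rfl⟩ := mem_names.1 hA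
      have hc : e.2.2 ∈ cont (.act a.name) w := mem_cont.2 ⟨e.1, by rw [← hA']; exact he⟩
      have hc' : e.2.2 = .inr a.proc ∨ e.2.2 ∈ msgItems a.queue := by
        rcases h.content a ha with h | ⟨-, h⟩ <;> rw [h] at hc <;> simp_all
      have : x ∈ Config.vars T := by
        rw [Config.vars, List.mem_flatMap]
        refine ⟨a, ha, ?_⟩
        rw [List.mem_append]
        rcases hc' with h' | h'
        · rw [h'] at hv
          exact .inl (Proc.mem_fv.2 hv)
        · obtain ⟨μ, hμ, h''⟩ := List.mem_map.1 h'
          rw [← h''] at hv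
          refine .inr (List.mem_flatMap.2 ⟨μ, hμ, List.mem_flatMap.2 ⟨_, hv, by simp [Val.fv]⟩⟩)
      simp [usedVars, this]

/-- The names of the actors after a step. -/
theorem names_post (o : Option (Val × Item)) (ν : List Val) (S : Config) :
    names (post o ν S) =
      names S ++ ν.filterMap Val.toName := by
  have h1 : ∀ M, names (newActors M) = M := fun M => by
    simp [names, newActors, Function.comp_def]
  have h2 : ∀ B μ, names (deliver B μ S) = names S := fun B μ => by
    simp only [names, deliver, List.map_map]
    refine List.map_congr_left fun a _ => ?_
    simp only [Function.comp]
    split_ifs <;> rfl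
  have h3 : ∀ S S' : Config, names (S ++ S') = names S ++ names S' := fun S S' => List.map_append
  unfold post
  rw [h3, h1]
  split
  · rw [h2]
  · rfl

/-- The messages that the output `o` puts into the queue of `A`. -/
def newMsgs (o : Option (Val × Item)) (A : ActorName) : List Msg :=
  match o with
  | some (.act B, .inl μ) => if A = B then [⟨μ.1, μ.2⟩] else []
  | _ => []

theorem post_eq (o : Option (Val × Item)) (ν : List Val) (S : Config) :
    post o ν S = (S.map fun b => { b with queue := b.queue ++ newMsgs o b.name }) ++
      newActors (ν.filterMap Val.toName) := by
  unfold post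
  congr 1
  split
  · rename_i B μ
    refine List.map_congr_left fun a _ => ?_
    simp only [newMsgs]
    split_ifs <;> simp
  · rename_i h
    have : ∀ A, newMsgs o A = [] := by
      intro A
      unfold newMsgs
      split
      · exact absurd rfl (h _ _)
      · rfl
    simp [this]

theorem LStep.out_cases {𝒢 : Program} {A z ν o z'} (h : LStep 𝒢 A z ν o z') :
    o = none ∨ ∃ B μ, o = some (.act B, .inl μ) := by
  cases h with
  | @send B _ _ _ _ _ h hB =>
    cases B with
    | var x => simp [kind] at hB
    | act B => exact .inr ⟨_, _, rfl⟩
  | _ => exact .inl rfl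

theorem LStep.exists_proc {𝒢 : Program} {A z ν o z'} (h : LStep 𝒢 A z ν o z') :
    ∃ P, z' = .inr P := by
  cases h <;> exact ⟨_, rfl⟩

theorem mem_outItems {o : Option (Val × Item)} {ν : List Val} {p : Val × Item} :
    p ∈ outItems o ν ↔ o = some p ∨ kind p.1 ≠ none ∧ p.1 ∈ ν ∧ p.2 = .inr .nil := by
  obtain ⟨v, z⟩ := p
  simp only [outItems, List.mem_append, Option.mem_toList, List.mem_map,
    List.mem_filter, decide_eq_true_eq, Prod.mk.injEq]
  constructor
  · rintro (h | ⟨u, ⟨h1, h2⟩, rfl, rfl⟩)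
    · exact .inl h
    · exact .inr ⟨h2, h1, rfl⟩
  · rintro (h | ⟨h1, h2, rfl⟩)
    · exact .inl h
    · exact .inr ⟨v, ⟨h2, h1⟩, rfl, rfl⟩

theorem cont_eq {φ : Type} (v : Val) (w : List (Entry φ)) :
    cont v w = (w.map Prod.snd).filterMap fun e => if e.1 = v then some e.2 else none := by
  rw [List.filterMap_map]
  rfl

theorem filterMap_eq_singleton {ν : List Val} (hν : ν.Nodup) {v : Val} (hv : v ∈ ν)
    (hk : kind v ≠ none) (z : Item) :
    ((ν.filter fun v => kind v ≠ none).map fun v => (v, z)).filterMap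
      (fun e => if e.1 = v then some e.2 else none) = [z] := by
  induction ν with
  | nil => simp at hv
  | cons u ν ih =>
    rw [List.nodup_cons] at hν
    rcases List.mem_cons.1 hv with rfl | hv
    · rw [List.filter_cons_of_pos (by simpa using hk), List.map_cons, List.filterMap_cons]
      simp only [↓reduceIte, List.cons.injEq, true_and, List.filterMap_eq_nil_iff]
      rintro ⟨a, b⟩ ha
      have : a ≠ v := by
        rintro rfl
        obtain ⟨c, hc, hc'⟩ := List.mem_map.1 ha
        simp only [Prod.mk.injEq] at hc'
        rw [hc'.1] at hc
        exact hν.1 (List.mem_of_mem_filter hc)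
      simp [this]
    · have huv : u ≠ v := fun h => hν.1 (h ▸ hv)
      by_cases hu : kind u = none
      · rw [List.filter_cons_of_neg (by simpa using hu)]
        exact ih hν.2 hv
      · rw [List.filter_cons_of_pos (by simpa using hu), List.map_cons, List.filterMap_cons]
        simpa [huv] using ih hν.2 hv

/-- An old actor gains at most the message sent to it. A new actor owns exactly its initial process
`0`, as long as the message of the same step is not addressed to it. -/
theorem cont_outs {φ : Type} {𝒢 : Program} {A z ν o z'} (h : LStep 𝒢 A z ν o z') (hν : ν.Nodup)
    {outs : List (Entry φ)} (houts : outs.map Prod.snd = outItems o ν) (N : ActorName) :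
    (.act N ∉ ν → cont (.act N) outs = msgItems (newMsgs o N)) ∧
    (.act N ∈ ν → (∀ B i, o = some (.act B, i) → B ≠ N) → cont (.act N) outs = [.inr .nil]) := by
  rw [cont_eq, houts, outItems, List.filterMap_append]
  have h1 : o.toList.filterMap (fun e => if e.1 = .act N then some e.2 else none) =
      msgItems (newMsgs o N) := by
    rcases h.out_cases with rfl | ⟨B, μ, rfl⟩
    · simp [newMsgs, msgItems]
    · by_cases hB : N = B
      · simp [newMsgs, msgItems, hB]
      · have : B ≠ N := fun h => hB h.symm
        simp [newMsgs, msgItems, hB, this]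
  rw [h1]
  constructor
  · intro hN
    rw [List.filterMap_eq_nil_iff.2, List.append_nil]
    rintro ⟨v, i⟩ hv
    obtain ⟨u, hu, hu'⟩ := List.mem_map.1 hv
    simp only [Prod.mk.injEq] at hu'
    have : v ≠ .act N := by
      rintro rfl
      rw [hu'.1] at hu
      exact hN (List.mem_of_mem_filter hu)
    simp [this]
  · intro hN ho
    rw [filterMap_eq_singleton hν hN (by simp [kind])]
    rcases h.out_cases with rfl | ⟨B, μ, rfl⟩
    · simp [newMsgs, msgItems]
    · have : N ≠ B := fun h => ho B _ rfl h.symm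
      simp [newMsgs, msgItems, this]

/-- Appending all outputs at the end of the list is faithful to the FIFO queues, since a
representation only fixes the order of the items of each single owner. -/
theorem Rep.post {φ : Type} {𝒢 : Program} (h𝒢 : 𝒢.Pure) {L R : Config} {A P q z q' ν o P'}
    {Lw Rw outs : List (Entry φ)} {f f' : φ}
    (h : Rep (L ++ ⟨A, P, q⟩ :: R) (Lw ++ (f, .act A, z) :: Rw)) (hL : ∀ e ∈ Lw, e.2.1 ≠ .act A)
    (hF : Front P q z q')
    (hS : Supply (names (L ++ ⟨A, P, q⟩ :: R)) (usedVars 𝒢 (L ++ ⟨A, P, q⟩ :: R)) z ν)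
    (hs : LStep 𝒢 (.act A) z ν o (.inr P')) (houts : outs.map Prod.snd = outItems o ν) :
    Rep (post o ν (L ++ ⟨A, P', q'⟩ :: R)) (Lw ++ (f', .act A, .inr P') :: Rw ++ outs) := by
  obtain ⟨hν, hνN, hνX⟩ := hS.spec
  have hnames : names (L ++ ⟨A, P', q'⟩ :: R) = names (L ++ ⟨A, P, q⟩ :: R) := by simp [names]
  have hact : ∀ B, B ∈ ν.filterMap Val.toName ↔
      .act B ∈ ν := by
    intro B
    rw [List.mem_filterMap]
    constructor
    · rintro ⟨v, hv, hv'⟩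
      cases v with
      | var x => simp [Val.toName] at hv'
      | act C =>
        simp only [Val.toName, Option.some.injEq] at hv'
        rwa [← hv']
    · exact fun h => ⟨_, h, rfl⟩
  have hmem : ∀ B, B ∈ names (ActorSL.post o ν (L ++ ⟨A, P', q'⟩ :: R)) ↔
      B ∈ names (L ++ ⟨A, P, q⟩ :: R) ∨ .act B ∈ ν := by
    intro B
    rw [names_post, hnames, List.mem_append, hact]
  have hA : A ∈ names (L ++ ⟨A, P, q⟩ :: R) := by simp [names]
  have hzc : ∀ B, .act B ∈ z.vals → B ∈ names (L ++ ⟨A, P, q⟩ :: R) :=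
    fun B hB => h.closed (f, .act A, z) (by simp) B hB
  have ho : ∀ B i, o = some (.act B, i) → B ∈ names (L ++ ⟨A, P, q⟩ :: R) := by
    intro B i hi
    exact hzc B ((hs.mem_vals h𝒢).2 _ hi).2.1
  have hcont : ∀ B, cont (.act B) (Lw ++ (f', .act A, .inr P') :: Rw ++ outs) =
      (if B = A then .inr P' :: cont (.act A) Rw else cont (.act B) (Lw ++ (f, .act A, z) :: Rw)) ++
        cont (.act B) outs := by
    intro B
    rw [cont_append]
    congr 1
    by_cases hBA : B = A
    · subst hBA
      rw [cont_append, cont_eq_nil hL, cont_cons]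
      simp
    · have : A ≠ B := fun h => hBA h.symm
      simp [cont_append, cont_cons, hBA, this]
  have hcA : cont (.act A) (Lw ++ (f, .act A, z) :: Rw) = z :: cont (.act A) Rw := by
    rw [cont_append, cont_eq_nil hL, cont_cons]
    simp
  constructor
  · rw [names_post, hnames, List.nodup_append']
    refine ⟨h.nodup, ?_, ?_⟩
    · refine List.Nodup.filterMap ?_ hν
      intro a a' b hb hb'
      cases a <;> cases a' <;> simp_all [Val.toName]
    · intro B hB hB'
      exact hνN B ((hact B).1 hB') hB
  · intro e he
    simp only [List.mem_append, List.mem_cons] at he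
    have hold : ∀ e ∈ Lw ++ (f, .act A, z) :: Rw,
        ∃ B ∈ names (ActorSL.post o ν (L ++ ⟨A, P', q'⟩ :: R)), e.2.1 = .act B := by
      intro e he
      obtain ⟨B, hB, hB'⟩ := h.owner e he
      exact ⟨B, (hmem B).2 (.inl hB), hB'⟩
    rcases he with (he | rfl | he) | he
    · exact hold e (by simp [he])
    · exact ⟨A, (hmem A).2 (.inl hA), rfl⟩
    · exact hold e (by simp [he])
    · have : e.2 ∈ outItems o ν := houts ▸ List.mem_map_of_mem he
      rcases mem_outItems.1 this with h1 | ⟨h1, h2, -⟩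
      · rcases hs.out_cases with rfl | ⟨B, μ, rfl⟩
        · simp at h1
        · simp only [Option.some.injEq] at h1
          rw [← h1]
          exact ⟨B, (hmem B).2 (.inl (ho B _ rfl)), rfl⟩
      · cases hv : e.2.1 with
        | var x => simp [hv, kind] at h1
        | act B => exact ⟨B, (hmem B).2 (.inr (hv ▸ h2)), rfl⟩
  · intro a ha
    rw [post_eq, List.mem_append] at ha
    rcases ha with ha | ha
    · obtain ⟨b, hb, rfl⟩ := List.mem_map.1 ha
      have hbn : b.name ∈ names (L ++ ⟨A, P, q⟩ :: R) := hnames ▸ mem_names.2 ⟨b, hb, rfl⟩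
      have hbν : .act b.name ∉ ν := fun h => hνN _ h hbn
      simp only
      rw [hcont, (cont_outs hs hν houts b.name).1 hbν]
      have hmi : ∀ q r, msgItems (q ++ r) = msgItems q ++ msgItems r := fun q r => List.map_append
      rw [hmi]
      by_cases hbA : b.name = A
      · have hbe : b = ⟨A, P', q'⟩ := by
          have hnd := h.nodup
          rw [← hnames] at hnd
          exact List.inj_on_of_nodup_map hnd hb (by simp) hbA
        subst hbe
        left
        have hc := h.content ⟨A, P, q⟩ (by simp)
        simp only at hc
        rw [hcA] at hc
        simp only [if_pos, List.cons_append, List.cons.injEq, true_and]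
        -- The kind of the front item decides which alternative of `content` held. A process that
        -- makes a step is not `0`, so it was present. A message can be first only if the process
        -- `0` was missing.
        cases hF with
        | proc =>
          rcases hc with hc | ⟨hc, -⟩
          · rw [List.cons.injEq] at hc
            rw [hc.2]
          · exact absurd (by rw [hc]) hs.ne_nil
        | msg m Us q =>
          rcases hc with hc | ⟨-, hc⟩
          · simp at hc
          · simp only [msgItems, List.map_cons, List.cons.injEq] at hc
            rw [hc.2]
            rfl
      · rw [if_neg hbA]
        have hb' : b ∈ L ++ ⟨A, P, q⟩ :: R := by
          simp only [List.mem_append, List.mem_cons] at hb ⊢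
          rcases hb with hb | rfl | hb
          · exact .inl hb
          · exact absurd rfl hbA
          · exact .inr (.inr hb)
        rcases h.content b hb' with hc | ⟨hc, hc'⟩
        · left
          rw [hc]
          simp
        · right
          exact ⟨hc, by rw [hc']⟩
    · obtain ⟨N, hN, rfl⟩ := List.mem_map.1 ha
      rw [hact] at hN
      left
      have hNn := hνN N hN
      have hNA : N ≠ A := fun h => hNn (h ▸ hA)
      simp only
      rw [hcont, if_neg hNA, (cont_outs hs hν houts N).2 hN
        (fun B i hi h => hNn (h ▸ ho B i hi)), cont_eq_nil]
      · rfl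
      · intro e he h'
        obtain ⟨B, hB, hB'⟩ := h.owner e he
        rw [hB'] at h'
        exact hNn (by cases h'; exact hB)
  · intro e he B hB
    rw [hmem]
    simp only [List.mem_append, List.mem_cons] at he
    rcases he with (he | rfl | he) | he
    · exact .inl (h.closed e (by simp [he]) B hB)
    · rcases (hs.mem_vals h𝒢).1 _ hB with h' | h' | h'
      · cases h'
        exact .inl hA
      · exact .inl (hzc B h')
      · exact .inr h'
    · exact .inl (h.closed e (by simp [he]) B hB)
    · have : e.2 ∈ outItems o ν := houts ▸ List.mem_map_of_mem he
      rcases mem_outItems.1 this with h1 | ⟨-, -, h2⟩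
      · rcases ((hs.mem_vals h𝒢).2 _ h1).2.2 _ hB with h' | h'
        · exact .inl (hzc B h')
        · exact .inr h'
      · simp [h2, Item.vals, Proc.vals] at hB

/-! ### Steps of lists of entries -/

/-- The free variables of the main process. -/
def Program.free (𝒢 : Program) : List Val := 𝒢.main.fv.map .var

/-- A step of the first item of some owner; the flags of the new items are related by `child` to the
flag of the item that makes the step. -/
inductive Exec {φ : Type} (𝒢 : Program) (child : φ → φ → Prop) :
    φ → List (Entry φ) → List (Entry φ) → Prop
  | mk {L R outs : List (Entry φ)} {f f' : φ} {A z ν o z'} (hL : ∀ e ∈ L, e.2.1 ≠ A)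
      (h : LStep 𝒢 A z ν o z') (hν : ν.Nodup)
      (hfresh : ∀ v ∈ ν, v ∉ 𝒢.free ∧ v ∉ stateVals (L ++ (f, A, z) :: R))
      (houts : outs.map Prod.snd = outItems o ν) (hf : child f f')
      (hc : ∀ e ∈ outs, child f e.1) :
      Exec 𝒢 child f (L ++ (f, A, z) :: R) (L ++ (f', A, z') :: R ++ outs)

theorem cont_split {φ : Type} {v : Val} {w : List (Entry φ)} {z : Item} {l : List Item}
    (h : cont v w = z :: l) :
    ∃ L f R, w = L ++ (f, v, z) :: R ∧ (∀ e ∈ L, e.2.1 ≠ v) ∧ cont v R = l := by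
  induction w with
  | nil => simp [cont] at h
  | cons e w ih =>
    rw [cont_cons] at h
    by_cases he : e.2.1 = v
    · rw [if_pos he] at h
      obtain ⟨f, u, y⟩ := e
      simp only [List.cons.injEq] at h he
      obtain ⟨rfl, rfl⟩ := h
      subst he
      exact ⟨[], f, w, rfl, by simp, rfl⟩
    · rw [if_neg he] at h
      obtain ⟨L, f, R, rfl, h2, h3⟩ := ih h
      refine ⟨e :: L, f, R, rfl, ?_, h3⟩
      intro e' he'
      rcases List.mem_cons.1 he' with rfl | he'
      · exact he
      · exact h2 e' he'

/-- A finished process can be removed from a representation. -/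
theorem Rep.drop {φ : Type} {T : Config} {L R : List (Entry φ)} {f : φ} {v : Val}
    (h : Rep T (L ++ (f, v, .inr .nil) :: R)) (hL : ∀ e ∈ L, e.2.1 ≠ v) : Rep T (L ++ R) := by
  have hsub : ∀ e ∈ L ++ R, e ∈ L ++ (f, v, .inr .nil) :: R := by
    intro e he
    simp only [List.mem_append, List.mem_cons] at he ⊢
    tauto
  refine ⟨h.nodup, fun e he => h.owner e (hsub e he), fun a ha => ?_,
    fun e he => h.closed e (hsub e he)⟩
  have hc := h.content a ha
  by_cases hv : v = .act a.name
  · subst hv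
    rw [cont_append, cont_eq_nil hL, cont_cons, if_pos rfl, List.nil_append] at hc
    rw [cont_append, cont_eq_nil hL, List.nil_append]
    rcases hc with hc | ⟨-, hc⟩
    · simp only [List.cons.injEq, Sum.inr.injEq] at hc
      exact .inr ⟨hc.1.symm, hc.2⟩
    · cases hq : a.queue <;> simp [hq, msgItems] at hc
  · rw [cont_append, cont_cons, if_neg hv] at hc
    rw [cont_append]
    exact hc

theorem Supply.fresh {φ : Type} {𝒢 : Program} {T : Config} {w : List (Entry φ)} {z ν}
    (hS : Supply (names T) (usedVars 𝒢 T) z ν) (h : Rep T w) :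
    ∀ v ∈ ν, v ∉ 𝒢.free ∧ v ∉ stateVals w := by
  obtain ⟨-, h1, h2⟩ := hS.spec
  intro v hv
  constructor
  · intro hF
    obtain ⟨x, hx, rfl⟩ := List.mem_map.1 hF
    exact h2 x hv (by simp [usedVars, hx])
  · intro hw
    rcases h.mem_used (𝒢 := 𝒢) hw with ⟨A, hA, rfl⟩ | ⟨x, hx, rfl⟩
    · exact h1 A hv hA
    · exact h2 x hv hx

/-- The first item of an owner can make a step in the configuration. -/
theorem Rep.step {φ : Type} {𝒢 : Program} (h𝒢 : 𝒢.Pure) {T : Config}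
    {L R : List (Entry φ)} {f : φ} {A z ν o z'} (h : Rep T (L ++ (f, A, z) :: R))
    (hL : ∀ e ∈ L, e.2.1 ≠ A) (hs : LStep 𝒢 A z ν o z') :
    ∃ ν', ν.map kind = ν'.map kind ∧ ν'.Nodup ∧
      (∀ v ∈ ν', v ∉ 𝒢.free ∧ v ∉ stateVals (L ++ (f, A, z) :: R)) ∧
      ∀ o' z'', LStep 𝒢 A z ν' o' z'' → ∃ T₁, Step 𝒢 T T₁ ∧
        ∀ f' outs, outs.map Prod.snd = outItems o' ν' →
          Rep T₁ (L ++ (f', A, z'') :: R ++ outs) := by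
  obtain ⟨ν', h1, h2⟩ := hs.exists_supply (names T) (usedVars 𝒢 T)
  -- The configuration dictates the new values `ν'`. The local step itself is left open, so that it
  -- can be transported to `ν'` by a permutation that also suits the other data of the application.
  refine ⟨ν', h2, h1.spec.1, h1.fresh h, fun o' z'' hs' => ?_⟩
  obtain ⟨A, hA, rfl⟩ := h.owner (f, A, z) (by simp)
  obtain ⟨⟨A, P, q⟩, ha, rfl⟩ := mem_names.1 hA
  obtain ⟨LT, RT, rfl⟩ := List.append_of_mem ha
  obtain ⟨P', rfl⟩ := hs'.exists_proc
  have hc := h.content _ ha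
  simp only at hc h hs' hL h1 ⊢
  rw [cont_append, cont_eq_nil hL, cont_cons, if_pos rfl, List.nil_append] at hc
  have hF : ∃ q', Front P q z q' := by
    rcases hc with hc | ⟨rfl, hc⟩
    · simp only [List.cons.injEq] at hc
      rw [hc.1]
      exact ⟨_, .proc _ _⟩
    · cases q with
      | nil => simp [msgItems] at hc
      | cons μ q =>
        simp only [msgItems, List.map_cons, List.cons.injEq] at hc
        rw [hc.1]
        exact ⟨_, .msg _ _ _⟩
  obtain ⟨q', hF⟩ := hF
  refine ⟨_, step_iff.2 ⟨LT, RT, A, P, q, z, q', ν', o', P', rfl, hF, h1, hs', ?_, rfl⟩,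
    fun f' outs houts => h.post h𝒢 hL hF h1 hs' houts⟩
  rintro B i rfl
  exact h.closed (f, .act A, z) (by simp) B ((hs'.mem_vals h𝒢).2 _ rfl).2.1

/-- All processes occur in the representation. -/
def Exact {φ : Type} (T : Config) (w : List (Entry φ)) : Prop :=
  ∀ a ∈ T, .inr a.proc ∈ cont (.act a.name) w

theorem Rep.exact_content {φ : Type} {T : Config} {w : List (Entry φ)} (h : Rep T w)
    (hx : Exact T w) {a : Actor} (ha : a ∈ T) :
    cont (.act a.name) w = .inr a.proc :: msgItems a.queue := by
  rcases h.content a ha with h' | ⟨-, h'⟩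
  · exact h'
  · have := hx a ha
    rw [h'] at this
    simp [msgItems] at this

/-- Exactness refers to a list `w` from before the removal of a finished process of the acting
owner. Only the other owners have to agree, because the acting one gets its new process from the
step. -/
theorem Exact.post {φ : Type} {L R : Config} {A P q z q' ν o P'}
    {Lw Rw outs : List (Entry φ)} {f f' : φ} {w : List (Entry φ)}
    (hnd : (names (L ++ ⟨A, P, q⟩ :: R)).Nodup)
    (hx : Exact (L ++ ⟨A, P, q⟩ :: R) w)
    (hw : ∀ v ≠ .act A, cont v w = cont v (Lw ++ (f, .act A, z) :: Rw)) (houts : outs.map Prod.snd = outItems o ν) :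
    Exact (post o ν (L ++ ⟨A, P', q'⟩ :: R)) (Lw ++ (f', .act A, .inr P') :: Rw ++ outs) := by
  intro a ha
  rw [post_eq, List.mem_append] at ha
  rw [cont_append, List.mem_append]
  rcases ha with ha | ha
  · left
    obtain ⟨b, hb, rfl⟩ := List.mem_map.1 ha
    simp only
    have hnames : names (L ++ ⟨A, P', q'⟩ :: R) = names (L ++ ⟨A, P, q⟩ :: R) := by simp [names]
    by_cases hbA : b.name = A
    · have hbe : b = ⟨A, P', q'⟩ := by
        rw [← hnames] at hnd
        exact List.inj_on_of_nodup_map hnd hb (by simp) hbA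
      subst hbe
      simp [cont_append, cont_cons]
    · have hb' : b ∈ L ++ ⟨A, P, q⟩ :: R := by
        simp only [List.mem_append, List.mem_cons] at hb ⊢
        rcases hb with hb | rfl | hb
        · exact .inl hb
        · exact absurd rfl hbA
        · exact .inr (.inr hb)
      have := hx b hb'
      rw [hw _ (by simpa using hbA)] at this
      have hne : Val.act A ≠ .act b.name := by simpa using fun h => hbA h.symm
      rw [cont_append, cont_cons, if_neg hne] at this ⊢
      exact this
  · right
    obtain ⟨N, hN, rfl⟩ := List.mem_map.1 ha
    rw [List.mem_filterMap] at hN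
    obtain ⟨v, hv, hv'⟩ := hN
    cases v with
    | var x => simp [Val.toName] at hv'
    | act C =>
      simp only [Val.toName, Option.some.injEq] at hv'
      subst hv'
      simp only
      rw [cont_eq, houts, List.mem_filterMap]
      exact ⟨(.act C, .inr .nil), mem_outItems.2 (.inr ⟨by simp [kind], hv, rfl⟩), by simp⟩

/-- Removal of a finished process with a flag that satisfies `junk`. -/
inductive Drop {φ : Type} (junk : φ → Prop) : List (Entry φ) → List (Entry φ) → Prop
  | refl (w) : Drop junk w w
  | drop {L R f A} (hL : ∀ e ∈ L, e.2.1 ≠ A) (hf : junk f) :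
      Drop junk (L ++ (f, A, .inr .nil) :: R) (L ++ R)

/-- A step of the configuration is a step of its representation. -/
theorem Rep.exec {φ : Type} {𝒢 : Program} (h𝒢 : 𝒢.Pure) {T T₁ : Config}
    {w : List (Entry φ)} (h : Rep T w) (hx : Exact T w) (hT : Step 𝒢 T T₁) (g : φ → φ) :
    ∃ w₀ f w₁, Drop (fun _ => True) w w₀ ∧ Exec 𝒢 (fun f f' => f' = g f) f w₀ w₁ ∧ Rep T₁ w₁ ∧
      Exact T₁ w₁ := by
  obtain ⟨L, R, A, P, q, z, q', ν, o, P', rfl, hF, hS, hs, -, rfl⟩ := step_iff.1 hT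
  -- A message starts only when the process is `0`. In an exact representation the item of this `0`
  -- still stands before the message, and it is removed first.
  have key : ∃ w₀, Drop (fun _ => True) w w₀ ∧ Rep (L ++ ⟨A, P, q⟩ :: R) w₀ ∧
      (∀ v ≠ .act A, cont v w = cont v w₀) ∧ ∃ l, cont (.act A) w₀ = z :: l := by
    have hc := h.exact_content hx (a := ⟨A, P, q⟩) (by simp)
    cases hF with
    | proc => exact ⟨w, .refl w, h, fun _ _ => rfl, _, hc⟩
    | msg m Us q =>
      obtain ⟨Lw, f, Rw, rfl, h2, h3⟩ := cont_split hc
      refine ⟨_, .drop h2 trivial, h.drop h2, fun v hv => ?_, msgItems q', ?_⟩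
      · rw [cont_append, cont_append, cont_cons, if_neg hv.symm]
      · rw [cont_append, cont_eq_nil h2, h3]
        rfl
  obtain ⟨w₀, h1, h2, h3, l, h4⟩ := key
  obtain ⟨Lw, f, Rw, rfl, h5, -⟩ := cont_split h4
  let outs : List (Entry φ) := (outItems o ν).map fun p => (g f, p)
  have houts : outs.map Prod.snd = outItems o ν := by simp [outs, Function.comp_def]
  refine ⟨_, f, Lw ++ (g f, .act A, .inr P') :: Rw ++ outs, h1,
    .mk h5 hs hS.spec.1 (hS.fresh h2) houts rfl ?_, h2.post h𝒢 h5 hF hS hs houts,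
    Exact.post h.nodup hx h3 houts⟩
  intro e he
  obtain ⟨p, -, rfl⟩ := List.mem_map.1 he
  rfl

/-! ### Initial representations -/

/-- The items of a configuration. -/
def Config.items (S : Config) : List (Val × Item) :=
  S.flatMap fun a => (.inr a.proc :: msgItems a.queue).map fun z => (.act a.name, z)

theorem Config.cont_items {φ : Type} {S : Config} (hS : (names S).Nodup) {w : List (Entry φ)}
    (hw : w.map Prod.snd = S.items) {a : Actor} (ha : a ∈ S) :
    cont (.act a.name) w = .inr a.proc :: msgItems a.queue := by
  rw [cont_eq, hw]
  clear hw
  induction S with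
  | nil => simp at ha
  | cons b S ih =>
    have hrest : ∀ c : Actor, ((Sum.inr c.proc :: msgItems c.queue).map fun z => (Val.act c.name, z)).filterMap
        (fun e : Val × Item => if e.1 = .act a.name then some e.2 else none) =
        if c.name = a.name then .inr c.proc :: msgItems c.queue else [] := by
      intro c
      rw [List.filterMap_map]
      by_cases hc : c.name = a.name
      · simp [hc]
      · simp [hc]
    rw [Config.items, List.flatMap_cons, List.filterMap_append, hrest]
    rw [names, List.map_cons, List.nodup_cons] at hS
    rcases List.mem_cons.1 ha with rfl | ha
    · rw [if_pos rfl, List.filterMap_eq_nil_iff.2, List.append_nil]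
      intro e he
      obtain ⟨c, hc, he⟩ := List.mem_flatMap.1 he
      obtain ⟨z, hz, rfl⟩ := List.mem_map.1 he
      have : c.name ≠ a.name := fun h => hS.1 (h ▸ List.mem_map_of_mem hc)
      simp [this]
    · have : b.name ≠ a.name := fun h => hS.1 (h ▸ List.mem_map_of_mem ha)
      rw [if_neg this, List.nil_append]
      exact ih hS.2 ha

theorem Config.mem_items {S : Config} {p : Val × Item} :
    p ∈ S.items ↔ ∃ a ∈ S, p.1 = .act a.name ∧ p.2 ∈ .inr a.proc :: msgItems a.queue := by
  simp only [Config.items, List.mem_flatMap, List.mem_map]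
  constructor
  · rintro ⟨a, ha, z, hz, rfl⟩
    exact ⟨a, ha, rfl, hz⟩
  · rintro ⟨a, ha, h1, h2⟩
    exact ⟨a, ha, p.2, h2, by rw [← h1]⟩

theorem rep_items {φ : Type} {S : Config} (hS : (names S).Nodup) {w : List (Entry φ)}
    (hw : w.map Prod.snd = S.items)
    (hc : ∀ p ∈ S.items, ∀ A, .act A ∈ p.2.vals → A ∈ names S) : Rep S w ∧ Exact S w := by
  refine ⟨⟨hS, ?_, fun a ha => .inl (Config.cont_items hS hw ha), ?_⟩, fun a ha => ?_⟩
  · intro e he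
    have : e.2 ∈ S.items := hw ▸ List.mem_map_of_mem he
    obtain ⟨a, ha, h1, -⟩ := Config.mem_items.1 this
    exact ⟨a.name, mem_names.2 ⟨a, ha, rfl⟩, h1⟩
  · intro e he
    exact hc e.2 (hw ▸ List.mem_map_of_mem he)
  · rw [Config.cont_items hS hw ha]
    simp

theorem rep_init {φ : Type} {𝒢 : Program} (h𝒢 : 𝒢.Pure) {w : List (Entry φ)}
    (hw : w.map Prod.snd = 𝒢.init.items) : Rep 𝒢.init w ∧ Exact 𝒢.init w := by
  refine rep_items (by simp [names, Program.init]) hw ?_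
  intro p hp A hA
  obtain ⟨a, ha, h1, h2⟩ := Config.mem_items.1 hp
  simp only [Program.init, List.mem_singleton] at ha
  subst ha
  simp only [msgItems, List.map_nil, List.mem_singleton] at h2
  rw [h2] at hA
  obtain ⟨x, hx⟩ := h𝒢.main.vals hA
  cases hx

theorem Reach.rep {𝒢 : Program} (h𝒢 : 𝒢.Pure) {S T : Config} (h : Reach 𝒢 S T)
    {w : List (Entry Unit)} (hw : Rep S w) (hx : Exact S w) :
    ∃ w' : List (Entry Unit), Rep T w' ∧ Exact T w' := by
  induction h with
  | refl => exact ⟨w, hw, hx⟩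
  | tail _ h ih =>
    obtain ⟨w', h1, h2⟩ := ih
    obtain ⟨_, _, w₁, -, -, h3, h4⟩ := h1.exec h𝒢 h2 h id
    exact ⟨w₁, h3, h4⟩

/-- Any flagging of the items of a reachable configuration represents it. -/
theorem Reach.rep_items {φ : Type} {𝒢 : Program} (h𝒢 : 𝒢.Pure) {S : Config}
    (h : Reach 𝒢 𝒢.init S) {w : List (Entry φ)} (hw : w.map Prod.snd = S.items) :
    Rep S w ∧ Exact S w := by
  obtain ⟨h1, h2⟩ := rep_init (φ := Unit) h𝒢 (w := 𝒢.init.items.map fun p => ((), p))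
    (by simp [Function.comp_def])
  obtain ⟨w', h3, h4⟩ := h.rep h𝒢 h1 h2
  refine ActorSL.rep_items h3.nodup hw ?_
  intro p hp A hA
  obtain ⟨a, ha, -, hp2⟩ := Config.mem_items.1 hp
  rw [← h3.exact_content h4 ha, mem_cont] at hp2
  obtain ⟨f, hf⟩ := hp2
  exact h3.closed _ hf A hA

/-! ### Marked runs -/

/-- Items that are not tracked have no tracked children. -/
def bchild (f f' : Bool) : Prop := f' = true → f = true

/-- The number of tracked items. -/
def cnt (w : List (Entry Bool)) : ℕ := w.countP (·.1)

/-- `Run 𝒢 N n w w'`: there is a run from `w` to `w'`, with `n` steps of tracked items and at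
most `N` tracked items at any time. -/
inductive Run (𝒢 : Program) (N : ℕ) : ℕ → List (Entry Bool) → List (Entry Bool) → Prop
  | refl (w) : Run 𝒢 N 0 w w
  | drop {n w w' w''} (h : Run 𝒢 N n w w') (h' : Drop (· = false) w' w'') : Run 𝒢 N n w w''
  | exec {n w w' w'' b} (h : Run 𝒢 N n w w') (h' : Exec 𝒢 bchild b w' w'') (hN : cnt w'' ≤ N) :
      Run 𝒢 N (n + b.toNat) w w''

def boolOf (W : List (Entry (ℕ × Bool))) : List (Entry Bool) := W.map fun e => (e.1.2, e.2)

def depthOf (W : List (Entry (ℕ × Bool))) : List (Entry ℕ) := W.map fun e => (e.1.1, e.2)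

theorem stateVals_congr {φ ψ : Type} {w : List (Entry φ)} {w' : List (Entry ψ)}
    (h : w.map Prod.snd = w'.map Prod.snd) : stateVals w = stateVals w' := by
  have : ∀ {χ : Type} (w : List (Entry χ)), stateVals w =
      (w.map Prod.snd).flatMap fun e => e.1 :: e.2.vals := by
    intro χ w
    rw [List.flatMap_map]
    rfl
  rw [this, this, h]

/-- Marks go backwards: the acting item is marked if its continuation or one of its outputs is. The
flags in `ℕ` are causal depths, which grow by one in each step, so going back over a step lowers the
depth of a marked item by at most one, and only if the step is one of a marked item. -/
theorem exec_lift {𝒢 : Program} {d : ℕ} {w w' : List (Entry ℕ)}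
    (h : Exec 𝒢 (fun f f' => f' = f + 1) d w w') {W' : List (Entry (ℕ × Bool))}
    (hW : depthOf W' = w') :
    ∃ b W, depthOf W = w ∧ Exec 𝒢 bchild b (boolOf W) (boolOf W') ∧
      cnt (boolOf W) ≤ cnt (boolOf W') ∧ ((∃ e ∈ W', e.1.2 = true) → ∃ e ∈ W, e.1.2 = true) ∧
      ∀ m, (∀ e ∈ W', e.1.2 = true → m ≤ e.1.1) →
        ∀ e ∈ W, e.1.2 = true → m ≤ b.toNat + e.1.1 := by
  cases h with
  | @mk L R outs f f' A z ν o z' hL h hν hfresh houts hf hc =>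
    subst hf
    obtain ⟨LR', outs', rfl, h1, h2⟩ := List.map_eq_append_iff.1 hW
    obtain ⟨L', R₀, rfl, h3, h4⟩ := List.map_eq_append_iff.1 h1
    obtain ⟨⟨⟨d', b'⟩, A', z₁⟩, R', rfl, h5, h6⟩ := List.map_eq_cons_iff.1 h4
    simp only [Prod.mk.injEq] at h5
    obtain ⟨rfl, rfl, rfl⟩ := h5
    have hmap : ∀ (X : List (Entry (ℕ × Bool))) (Y : List (Entry ℕ)),
        X.map (fun e => (e.1.1, e.2)) = Y → (boolOf X).map Prod.snd = Y.map Prod.snd := by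
      rintro X Y rfl
      simp [boolOf, Function.comp_def]
    refine ⟨b' || outs'.any fun e => e.1.2, L' ++ ((d, b' || outs'.any fun e => e.1.2), A', z) :: R',
      ?_, ?_, ?_, ?_, ?_⟩
    · simp [depthOf, h3, h6]
    · have := Exec.mk (𝒢 := 𝒢) (child := bchild) (L := boolOf L') (R := boolOf R')
        (outs := boolOf outs') (f := b' || outs'.any fun e => e.1.2) (f' := b') (A := A')
        (z := z) (ν := ν) (o := o) (z' := z₁) ?_ h hν ?_ ?_ ?_ ?_
      · simpa [boolOf] using this
      · intro e he
        obtain ⟨e', he', rfl⟩ := List.mem_map.1 he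
        exact hL (e'.1.1, e'.2) (h3 ▸ List.mem_map_of_mem he')
      · rw [stateVals_congr (w' := L ++ (d, A', z) :: R)]
        · exact hfresh
        · simp only [List.map_append, List.map_cons]
          rw [hmap _ _ h3, hmap _ _ h6]
      · rw [hmap _ _ h2, houts]
      · intro h
        simp [h]
      · intro e he h
        obtain ⟨e', he', rfl⟩ := List.mem_map.1 he
        rw [Bool.or_eq_true, List.any_eq_true]
        exact .inr ⟨e', he', h⟩
    -- If the acting item is marked, then so is at least one of its results. This keeps the number
    -- of marks from growing backwards.
    · have : (b' || outs'.any fun e => e.1.2).toNat ≤ b'.toNat + cnt (boolOf outs') := by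
        cases b' with
        | true => simp
        | false =>
          by_cases h : outs'.any fun e => e.1.2
          · have hpos : 0 < cnt (boolOf outs') := by
              obtain ⟨e, he, he'⟩ := List.any_eq_true.1 h
              exact List.countP_pos_iff.2 ⟨_, List.mem_map_of_mem he, he'⟩
            rw [h, Bool.false_or, Bool.toNat_true]
            omega
          · rw [Bool.not_eq_true] at h
            simp [h]
      have h1 : ∀ b : Bool, (if b = true then 1 else 0) = b.toNat := by decide
      simp only [cnt, boolOf, List.map_append, List.map_cons, List.countP_append,
        List.countP_cons, h1] at this ⊢
      omega
    · rintro ⟨e, he, hb⟩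
      simp only [List.mem_append, List.mem_cons] at he
      rcases he with (he | rfl | he) | he
      · exact ⟨e, by simp [he], hb⟩
      · refine ⟨_, List.mem_append_right _ List.mem_cons_self, ?_⟩
        simp only at hb
        simp [hb]
      · exact ⟨e, by simp [he], hb⟩
      · refine ⟨_, List.mem_append_right _ List.mem_cons_self, ?_⟩
        rw [Bool.or_eq_true, List.any_eq_true]
        exact .inr ⟨e, he, hb⟩
    · intro m hm e he hb
      simp only [List.mem_append, List.mem_cons] at he
      rcases he with he | rfl | he
      · have := hm e (by simp [he]) hb
        omega
      · simp only at hb ⊢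
        rw [hb, Bool.toNat_true]
        rw [Bool.or_eq_true, List.any_eq_true] at hb
        rcases hb with hb | ⟨e, he, hb⟩
        · have := hm ((d + 1, b'), A', z₁) (by simp) hb
          simp only at this
          omega
        · have := hm e (by simp [he]) hb
          have h7 := hc (e.1.1, e.2) (h2 ▸ List.mem_map_of_mem he)
          simp only at h7
          omega
      · have := hm e (by simp [he]) hb
        omega

/-- The removed process is absent later, so nothing asks for its mark and it gets the flag `false`.
-/
theorem drop_lift {w w' : List (Entry ℕ)} (h : Drop (fun _ => True) w w')
    {W' : List (Entry (ℕ × Bool))} (hW : depthOf W' = w') :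
    ∃ W, depthOf W = w ∧ Drop (· = false) (boolOf W) (boolOf W') ∧
      cnt (boolOf W) = cnt (boolOf W') ∧
      ∀ e : Entry (ℕ × Bool), e.1.2 = true → (e ∈ W ↔ e ∈ W') := by
  cases h with
  | refl => exact ⟨W', hW, .refl _, rfl, fun _ _ => Iff.rfl⟩
  | @drop L R f A hL hf =>
    obtain ⟨L', R', rfl, h1, h2⟩ := List.map_eq_append_iff.1 hW
    refine ⟨L' ++ ((f, false), A, .inr .nil) :: R', by simp [depthOf, h1, h2], ?_, ?_, ?_⟩
    · simp only [boolOf, List.map_append, List.map_cons]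
      refine .drop ?_ rfl
      intro e he
      obtain ⟨e', he', rfl⟩ := List.mem_map.1 he
      exact hL (e'.1.1, e'.2) (h1 ▸ List.mem_map_of_mem he')
    · simp [cnt, boolOf]
    · intro e he
      simp only [List.mem_append, List.mem_cons]
      constructor
      · rintro (h | rfl | h)
        · exact .inl h
        · simp at he
        · exact .inr h
      · tauto

/-- Marks can be carried back from `w'` to `w`. -/
def Lift (𝒢 : Program) (w w' : List (Entry ℕ)) : Prop :=
  ∀ N W', depthOf W' = w' → cnt (boolOf W') ≤ N → ∃ W n, depthOf W = w ∧ cnt (boolOf W) ≤ N ∧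
    Run 𝒢 N n (boolOf W) (boolOf W') ∧ ((∃ e ∈ W', e.1.2 = true) → ∃ e ∈ W, e.1.2 = true) ∧
    ∀ m, (∀ e ∈ W', e.1.2 = true → m ≤ e.1.1) → ∀ e ∈ W, e.1.2 = true → m ≤ n + e.1.1

theorem Lift.refl (𝒢 : Program) (w : List (Entry ℕ)) : Lift 𝒢 w w := by
  intro N W hW hN
  exact ⟨W, 0, hW, hN, .refl _, id, fun m h e he hb => by simpa using h e he hb⟩

/-- The last clause of `Lift` trades depth for tracked steps: if the items of `w` have depth `0` and
some item is tracked in the end, a lower bound for the depths of the tracked items there is a lower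
bound for the number of tracked steps. -/
theorem Lift.step {𝒢 : Program} {d : ℕ} {w w' w₀ w₁ : List (Entry ℕ)} (h : Lift 𝒢 w w')
    (hd : Drop (fun _ => True) w' w₀) (he : Exec 𝒢 (fun f f' => f' = f + 1) d w₀ w₁) :
    Lift 𝒢 w w₁ := by
  intro N W₁ hW₁ hN
  obtain ⟨b, W₀, h1, h2, h3, h4, h5⟩ := exec_lift he hW₁
  obtain ⟨W', k1, k2, k3, k4⟩ := drop_lift hd h1
  obtain ⟨W, n, l1, l2, l3, l4, l5⟩ := h N W' k1 (by omega)
  refine ⟨W, n + b.toNat, l1, l2, .exec (.drop l3 k2) h2 hN, fun h => ?_, fun m hm e he hb => ?_⟩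
  · obtain ⟨e, he, hb⟩ := h4 h
    exact l4 ⟨e, (k4 e hb).2 he, hb⟩
  · have := l5 (m - b.toNat) (fun e he hb => by
      have := h5 m hm e ((k4 e hb).1 he) hb
      omega) e he hb
    omega

/-- Runs of configurations give marked runs. -/
theorem Reach.exists_lift {𝒢 : Program} (h𝒢 : 𝒢.Pure) {S T : Config} (h : Reach 𝒢 S T)
    {w : List (Entry ℕ)} (hw : Rep S w) (hx : Exact S w) :
    ∃ w', Rep T w' ∧ Exact T w' ∧ Lift 𝒢 w w' := by
  induction h with
  | refl => exact ⟨w, hw, hx, .refl _ _⟩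
  | tail _ h ih =>
    obtain ⟨w', h1, h2, h3⟩ := ih
    obtain ⟨w₀, f, w₁, k1, k2, k3, k4⟩ := h1.exec h𝒢 h2 h (· + 1)
    exact ⟨w₁, k3, k4, h3.step k1 k2⟩

/-! ### Infinite computations -/

/-- The weight of an item that is not finished, for depths up to `D`. -/
def weight (D : ℕ) (e : Entry ℕ) : ℕ := if e.2.2 = .inr .nil then 0 else 3 ^ (D - e.1)

def totalWeight (D : ℕ) (w : List (Entry ℕ)) : ℕ := (w.map (weight D)).sum

theorem Drop.totalWeight {w w' : List (Entry ℕ)} (h : Drop (fun _ => True) w w') (D : ℕ) :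
    totalWeight D w' = totalWeight D w := by
  cases h with
  | refl => rfl
  | drop hL hf => simp [ActorSL.totalWeight, weight]

/-- An item of weight `3 * 3 ^ k` is replaced by its continuation and at most one message, each of
weight at most `3 ^ k`. The processes `0` of new actors weigh nothing. -/
theorem Exec.totalWeight {𝒢 : Program} {d : ℕ} {w w' : List (Entry ℕ)}
    (h : Exec 𝒢 (fun f f' => f' = f + 1) d w w') {D : ℕ} (hD : ∀ e ∈ w', e.1 ≤ D) :
    totalWeight D w' < totalWeight D w := by
  cases h with
  | @mk L R outs f f' A z ν o z' hL h hν hfresh houts hf hc =>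
    subst hf
    have h1 : d + 1 ≤ D := hD (d + 1, A, z') (by simp)
    obtain ⟨k, rfl⟩ := Nat.exists_eq_add_of_le h1
    have houts' : outs = (outItems o ν).map fun p => (d + 1, p) := by
      rw [← houts, List.map_map]
      refine (List.map_id _).symm.trans (List.map_congr_left fun e he => ?_)
      exact Prod.ext (hc e he) rfl
    have h2 : (outs.map (weight (d + 1 + k))).sum ≤ 3 ^ k := by
      rw [houts', outItems, List.map_append, List.map_append, List.sum_append]
      have : (((((ν.filter fun v => kind v ≠ none).map fun v => (v, (.inr .nil : Item))).map
          fun p => ((d + 1, p) : Entry ℕ)).map (weight (d + 1 + k))).sum) = 0 := by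
        rw [List.sum_eq_zero]
        intro x hx
        simp only [List.map_map, List.mem_map, Function.comp] at hx
        obtain ⟨v, -, rfl⟩ := hx
        simp [weight]
      rw [this]
      cases o with
      | none => simp
      | some p =>
        simp only [Option.toList_some, List.map_cons, List.map_nil, List.sum_cons, List.sum_nil,
          weight]
        split_ifs <;> simp
    have h3 : weight (d + 1 + k) (d + 1, A, z') ≤ 3 ^ k := by
      simp only [weight]
      split_ifs <;> simp
    have h4 : weight (d + 1 + k) (d, A, z) = 3 * 3 ^ k := by
      simp only [weight]
      rw [if_neg h.ne_nil, show d + 1 + k - d = k + 1 by omega, pow_succ]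
      ring
    have h5 : 0 < 3 ^ k := by positivity
    simp only [ActorSL.totalWeight, List.map_append, List.map_cons, List.sum_append,
      List.sum_cons, h4]
    omega

/-- An infinite computation contains marked runs with any number of steps of tracked items. -/
theorem exists_run_of_infinite {𝒢 : Program} (h𝒢 : 𝒢.Pure) {s : ℕ → Config}
    (hs : ∀ n, Step 𝒢 (s n) (s (n + 1))) {w : List (Entry ℕ)} (hw : Rep (s 0) w)
    (hx : Exact (s 0) w) (h0 : ∀ e ∈ w, e.1 = 0) (D : ℕ) :
    ∃ W W' n, W.map Prod.snd = w.map Prod.snd ∧ cnt W ≤ 1 ∧ D ≤ n ∧ Run 𝒢 1 n W W' := by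
  by_contra hcon
  -- If there is no such run, then no depth ever exceeds `D`, and the weight of the initial list
  -- bounds the length of the computation.
  have key : ∀ m, ∃ w', Rep (s m) w' ∧ Exact (s m) w' ∧ Lift 𝒢 w w' ∧
      totalWeight D w' + m ≤ totalWeight D w := by
    intro m
    induction m with
    | zero => exact ⟨w, hw, hx, .refl _ _, le_rfl⟩
    | succ m ih =>
      obtain ⟨w', h1, h2, h3, h4⟩ := ih
      obtain ⟨w₀, f, w₁, k1, k2, k3, k4⟩ := h1.exec h𝒢 h2 (hs m) (· + 1)
      have hl := h3.step k1 k2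
      have hD : ∀ e ∈ w₁, e.1 ≤ D := by
        intro e he
        by_contra hlt
        apply hcon
        obtain ⟨L, R, rfl⟩ := List.append_of_mem he
        -- Only the entry `e`, whose depth exceeds `D`, is marked; its causal ancestors then form a
        -- single tracked chain.
        obtain ⟨W, n, l1, l2, l3, l4, l5⟩ := hl 1 ((L.map fun e => ((e.1, false), e.2)) ++
          ((e.1, true), e.2) :: R.map fun e => ((e.1, false), e.2))
          (by simp [depthOf, Function.comp_def]) (by simp [cnt, boolOf, Function.comp_def])
        refine ⟨_, _, n, ?_, l2, ?_, l3⟩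
        · rw [← l1]
          simp [boolOf, depthOf, Function.comp_def]
        · obtain ⟨e', he', hb⟩ := l4 ⟨_, List.mem_append_right _ List.mem_cons_self, rfl⟩
          have := l5 e.1 (by
            intro e'' he'' hb''
            simp only [List.mem_append, List.mem_map, List.mem_cons] at he''
            rcases he'' with ⟨a, -, rfl⟩ | rfl | ⟨a, -, rfl⟩
            · simp at hb''
            · exact le_rfl
            · simp at hb'') e' he' hb
          have h7 := h0 (e'.1.1, e'.2) (l1 ▸ List.mem_map_of_mem he')
          simp only at h7
          omega
      have h5 := k2.totalWeight hD
      rw [k1.totalWeight] at h5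
      exact ⟨w₁, k3, k4, hl, by omega⟩
  obtain ⟨w', -, -, -, h⟩ := key (totalWeight D w + 1)
  omega

/-! ### Enumeration of the local steps -/

/-- Evaluation of one expression after the evaluation of others. -/
def evalStep (N : List ActorName) (s : Option (List Val × List ActorName)) (E : Expr) :
    Option (List Val × List ActorName) :=
  s.bind fun r =>
    match E with
    | .atom t => t.vals.head?.map fun U => (r.1 ++ [U], r.2)
    | .new C => some (r.1 ++ [.act (freshName (N ++ r.2) C)], r.2 ++ [freshName (N ++ r.2) C])

def evals (N : List ActorName) (Es : List Expr) : Option (List Val × List ActorName) :=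
  Es.foldl (evalStep N) (some ([], []))

theorem foldl_evalStep_none (N : List ActorName) (Es : List Expr) :
    Es.foldl (evalStep N) none = none := by
  induction Es with
  | nil => rfl
  | cons E Es ih => simpa [evalStep] using ih

/-- The accumulator holds the names created so far, which `EvalEs` adds to the names in use from
left to right. -/
theorem foldl_evalStep {N : List ActorName} {Es : List Expr} {Us₀ : List Val}
    {M₀ : List ActorName} {r : List Val × List ActorName} :
    Es.foldl (evalStep N) (some (Us₀, M₀)) = some r ↔
      ∃ Us M, EvalEs (N ++ M₀) Es Us M ∧ r = (Us₀ ++ Us, M₀ ++ M) := by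
  induction Es generalizing Us₀ M₀ with
  | nil =>
    constructor
    · intro h
      cases h
      exact ⟨[], [], .nil _, by simp⟩
    · rintro ⟨Us, M, h, rfl⟩
      cases h
      simp
  | cons E Es ih =>
    rw [List.foldl_cons]
    constructor
    · intro h
      cases E with
      | atom t =>
        cases t with
        | bvar k =>
          simp [evalStep, Atom.vals, foldl_evalStep_none] at h
        | val U =>
          simp only [evalStep, Atom.vals, List.head?_cons, Option.map_some, Option.bind_some] at h
          obtain ⟨Us, M, h1, rfl⟩ := ih.1 h
          exact ⟨U :: Us, _, .cons (.val U) (by rwa [List.append_nil]), by simp⟩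
      | new C =>
        simp only [evalStep, Option.bind_some] at h
        obtain ⟨Us, M, h1, rfl⟩ := ih.1 h
        exact ⟨_, _, .cons (.new C) (by rwa [List.append_assoc]), by simp⟩
    · rintro ⟨Us, M, h, rfl⟩
      cases h with
      | cons h h' =>
        cases h with
        | val U =>
          simp only [evalStep, Atom.vals, List.head?_cons, Option.map_some, Option.bind_some]
          rw [List.append_nil] at h'
          exact ih.2 ⟨_, _, h', by simp⟩
        | new C =>
          simp only [evalStep, Option.bind_some]
          rw [List.append_assoc] at h'
          exact ih.2 ⟨_, _, h', by simp⟩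

theorem evals_eq_some {N Es Us M} : evals N Es = some (Us, M) ↔ EvalEs N Es Us M := by
  rw [evals, foldl_evalStep]
  simp

/-- The local steps of an item, when the names `N` and the variables `X` are in use. -/
def lsteps (𝒢 : Program) (N : List ActorName) (X : List ℕ) (A : Val) :
    Item → List (List Val × Option (Val × Item) × Item)
  | .inl μ => (𝒢.defs.filter fun d =>
      kind A = some (some d.cls) ∧ d.meth = μ.1 ∧ μ.2.length = d.params.length).map fun d =>
        ((freshVars X d.locals.length).map .var, none,
          .inr (d.instWith A μ.2 ((freshVars X d.locals.length).map .var)))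
  | .inr .nil => []
  | .inr (.letin E P) => (evals N [E]).toList.map fun r =>
      (r.2.map .act, none, .inr (P.inst (r.1.headD (.var 0)) 0))
  | .inr (.send t m Es P) => (t.vals.filter fun B => kind B ≠ none).flatMap fun B =>
      (evals N Es).toList.map fun r => (r.2.map .act, some (B, .inl (m, r.1)), .inr P)
  | .inr (.ite E E' P Q) => (evals N [E, E']).toList.map fun r =>
      (r.2.map .act, none, .inr (if r.1.head? = r.1.tail.head? then P else Q))
  | .inr (.plus P Q) => [([], none, .inr P), ([], none, .inr Q)]

/-- Once the supply is fixed, an item has finitely many local steps. The default in `lsteps` and the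
comparison of optional heads are harmless, because a successful evaluation returns as many values as
there are expressions. -/
theorem mem_lsteps {𝒢 : Program} {N X A z ν o z'} :
    (ν, o, z') ∈ lsteps 𝒢 N X A z ↔ LStep 𝒢 A z ν o z' ∧ Supply N X z ν := by
  constructor
  · intro h
    match z with
    | .inl μ =>
      obtain ⟨d, hd, he⟩ := List.mem_map.1 h
      simp only [List.mem_filter, decide_eq_true_eq] at hd
      obtain ⟨hd, h1, h2, h3⟩ := hd
      obtain ⟨m, Us⟩ := μ
      simp only [Prod.mk.injEq] at h2 h3 he
      obtain ⟨rfl, rfl, rfl⟩ := he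
      subst h2
      refine ⟨.start hd h1 h3 ?_ ?_, ?_⟩
      · simp [(freshVars_spec X d.locals.length).1]
      · simp [kind]
      · simp [Supply, (freshVars_spec X d.locals.length).1]
    | .inr .nil => simp [lsteps] at h
    | .inr (.letin E P) =>
      obtain ⟨⟨Us, M⟩, hr, h⟩ := List.mem_map.1 h
      rw [Option.mem_toList, evals_eq_some] at hr
      cases h
      refine ⟨?_, ⟨Us, M, hr, rfl⟩⟩
      cases hr with
      | cons h1 h2 =>
        cases h2
        simpa using LStep.letin (𝒢 := 𝒢) (A := A) (P := P) (EvalE.evalEs h1).evalF.1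
    | .inr (.send t m Es P) =>
      obtain ⟨B, hB, h⟩ := List.mem_flatMap.1 h
      obtain ⟨⟨Us, M⟩, hr, h⟩ := List.mem_map.1 h
      rw [Option.mem_toList, evals_eq_some] at hr
      cases h
      cases t with
      | bvar k => simp [Atom.vals] at hB
      | val U =>
        simp only [Atom.vals, List.mem_filter, List.mem_singleton, decide_eq_true_eq] at hB
        obtain ⟨rfl, hB⟩ := hB
        exact ⟨.send hr.evalF.1 hB, ⟨Us, M, hr, rfl⟩⟩
    | .inr (.ite E E' P Q) =>
      obtain ⟨⟨Us, M⟩, hr, h⟩ := List.mem_map.1 h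
      rw [Option.mem_toList, evals_eq_some] at hr
      cases h
      refine ⟨?_, ⟨Us, M, hr, rfl⟩⟩
      have he := hr.evalF.1
      cases hr with
      | cons h h' =>
        cases h' with
        | cons h' h'' =>
          cases h''
          have := LStep.ite (𝒢 := 𝒢) (A := A) (P := P) (Q := Q) he
          simpa using this
    | .inr (.plus P Q) =>
      simp only [lsteps, List.mem_cons, Prod.mk.injEq, List.not_mem_nil, or_false] at h
      rcases h with ⟨rfl, rfl, rfl⟩ | ⟨rfl, rfl, rfl⟩
      · exact ⟨.plusL, ⟨[], [], .nil _, rfl⟩⟩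
      · exact ⟨.plusR, ⟨[], [], .nil _, rfl⟩⟩
  · rintro ⟨h, hS⟩
    cases h with
    | @letin E P U ν h =>
      obtain ⟨Us, M, hr, rfl⟩ := hS
      cases hr.evalF.1.unique h
      refine List.mem_map.2 ⟨([U], M), ?_, rfl⟩
      rwa [Option.mem_toList, evals_eq_some]
    | @send B m Es P Us ν h hB =>
      obtain ⟨Us', M, hr, rfl⟩ := hS
      cases hr.evalF.1.unique h
      refine List.mem_flatMap.2 ⟨B, by simp [Atom.vals, hB], List.mem_map.2 ⟨(Us, M), ?_, rfl⟩⟩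
      rwa [Option.mem_toList, evals_eq_some]
    | @ite E E' P Q U V ν h =>
      obtain ⟨Us', M, hr, rfl⟩ := hS
      cases hr.evalF.1.unique h
      refine List.mem_map.2 ⟨([U, V], M), ?_, by simp⟩
      rwa [Option.mem_toList, evals_eq_some]
    | plusL => simp [lsteps]
    | plusR => simp [lsteps]
    | @start d Us ν hd hA hlen hν hk =>
      simp only [Supply] at hS
      rw [hν] at hS
      subst hS
      refine List.mem_map.2 ⟨d, ?_, rfl⟩
      simp [hd, hA, hlen]

/-! ### Enumeration of the steps -/

/-- The lists of length `n` with elements in `l`. -/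
def tuples {α : Type} (l : List α) : ℕ → List (List α)
  | 0 => [[]]
  | n + 1 => l.flatMap fun x => (tuples l n).map (x :: ·)

theorem mem_tuples {α : Type} {l : List α} {n : ℕ} {xs : List α} :
    xs ∈ tuples l n ↔ xs.length = n ∧ ∀ x ∈ xs, x ∈ l := by
  induction n generalizing xs with
  | zero => cases xs <;> simp [tuples]
  | succ n ih =>
    cases xs with
    | nil => simp [tuples]
    | cons x xs =>
      simp only [tuples, List.mem_flatMap, List.mem_map, List.cons.injEq, List.length_cons,
        Nat.add_right_cancel_iff, List.mem_cons, forall_eq_or_imp]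
      constructor
      · rintro ⟨y, hy, ys, hys, rfl, rfl⟩
        exact ⟨(ih.1 hys).1, hy, (ih.1 hys).2⟩
      · rintro ⟨h1, h2, h3⟩
        exact ⟨x, h2, xs, ih.2 ⟨h1, h3⟩, rfl, rfl⟩

/-- The flags of the children of an item. -/
def childFlags (b : Bool) : List Bool := if b then [true, false] else [false]

theorem mem_childFlags {b b' : Bool} : b' ∈ childFlags b ↔ bchild b b' := by
  cases b <;> cases b' <;> simp [childFlags, bchild]

/-- The names and variables in use in an abstract state. -/
def usedVals (𝒢 : Program) (α : List (Entry Bool)) : List Val := 𝒢.free ++ stateVals α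

/-- The steps of the item `e` that occurs between `L` and `R`. -/
def stepsAt (𝒢 : Program) (U : List Val) (L : List (Entry Bool)) (e : Entry Bool)
    (R : List (Entry Bool)) : List (Bool × List (Entry Bool)) :=
  if ∃ e' ∈ L, e'.2.1 = e.2.1 then [] else
    (lsteps 𝒢 (U.filterMap Val.toName) (U.flatMap Val.fv) e.2.1 e.2.2).flatMap fun s =>
      (tuples (childFlags e.1) (1 + (outItems s.2.1 s.1).length)).map fun fl =>
        (e.1, L ++ (fl.headD false, e.2.1, s.2.2) :: R ++ fl.tail.zip (outItems s.2.1 s.1))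

/-- The steps of an abstract state. -/
def steps (𝒢 : Program) (α : List (Entry Bool)) : List (Bool × List (Entry Bool)) :=
  (List.range α.length).flatMap fun i =>
    (α.drop i).head?.toList.flatMap fun e =>
      stepsAt 𝒢 (usedVals 𝒢 α) (α.take i) e (α.drop (i + 1))

theorem mem_steps {𝒢 : Program} {α : List (Entry Bool)} {r : Bool × List (Entry Bool)} :
    r ∈ steps 𝒢 α ↔ ∃ L e R, α = L ++ e :: R ∧ r ∈ stepsAt 𝒢 (usedVals 𝒢 α) L e R := by
  simp only [steps, List.mem_flatMap, List.mem_range, Option.mem_toList]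
  constructor
  · rintro ⟨i, hi, e, he, hr⟩
    refine ⟨_, e, _, ?_, hr⟩
    rw [List.drop_eq_getElem_cons hi] at he
    simp only [List.head?_cons, Option.some.injEq] at he
    rw [← he, ← List.drop_eq_getElem_cons hi, List.take_append_drop]
  · rintro ⟨L, e, R, rfl, hr⟩
    exact ⟨L.length, by simp, e, by simp, by simpa using hr⟩

theorem mem_stepsAt {𝒢 : Program} {U : List Val} {L R : List (Entry Bool)} {e : Entry Bool}
    {r : Bool × List (Entry Bool)} :
    r ∈ stepsAt 𝒢 U L e R ↔ (∀ e' ∈ L, e'.2.1 ≠ e.2.1) ∧ ∃ ν o z' f' outs,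
      LStep 𝒢 e.2.1 e.2.2 ν o z' ∧
      Supply (U.filterMap Val.toName) (U.flatMap Val.fv) e.2.2 ν ∧
      outs.map Prod.snd = outItems o ν ∧ bchild e.1 f' ∧ (∀ e' ∈ outs, bchild e.1 e'.1) ∧
      r = (e.1, L ++ (f', e.2.1, z') :: R ++ outs) := by
  rw [stepsAt]
  by_cases hL : ∃ e' ∈ L, e'.2.1 = e.2.1
  · rw [if_pos hL]
    obtain ⟨e', he', h⟩ := hL
    simp only [List.not_mem_nil, false_iff]
    rintro ⟨h', -⟩
    exact h' e' he' h
  · rw [if_neg hL]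
    push Not at hL
    simp only [List.mem_flatMap, List.mem_map]
    constructor
    · rintro ⟨⟨ν, o, z'⟩, hs, fl, hfl, rfl⟩
      obtain ⟨h1, h2⟩ := mem_lsteps.1 hs
      obtain ⟨h3, h4⟩ := mem_tuples.1 hfl
      cases fl with
      | nil => simp only [List.length_nil] at h3; omega
      | cons f fl =>
        simp only [List.length_cons] at h3
        refine ⟨hL, ν, o, z', f, _, h1, h2, ?_, mem_childFlags.1 (h4 f (by simp)), ?_, rfl⟩
        · exact List.map_snd_zip (by simp; omega)
        · rintro ⟨b, p⟩ he
          exact mem_childFlags.1 (h4 b (List.mem_cons_of_mem _ (List.of_mem_zip he).1))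
    · rintro ⟨-, ν, o, z', f', outs, h1, h2, h3, h4, h5, rfl⟩
      refine ⟨(ν, o, z'), mem_lsteps.2 ⟨h1, h2⟩, f' :: outs.map Prod.fst, mem_tuples.2 ⟨?_, ?_⟩, ?_⟩
      · simp [← h3, add_comm]
      · intro b hb
        rcases List.mem_cons.1 hb with rfl | hb
        · exact mem_childFlags.2 h4
        · obtain ⟨e', he', rfl⟩ := List.mem_map.1 hb
          exact mem_childFlags.2 (h5 e' he')
      · simp only [List.headD_cons, List.tail_cons, ← h3]
        have hz : (outs.map Prod.fst).zip (outs.map Prod.snd) = outs :=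
          (List.zip_of_prod rfl rfl).symm
        rw [hz]

theorem supply_used {U : List Val} {z ν}
    (h : Supply (U.filterMap Val.toName) (U.flatMap Val.fv) z ν) : ∀ v ∈ ν, v ∉ U := by
  obtain ⟨-, h1, h2⟩ := h.spec
  intro v hv hU
  cases v with
  | act A => exact h1 A hv (List.mem_filterMap.2 ⟨_, hU, rfl⟩)
  | var x => exact h2 x hv (List.mem_flatMap.2 ⟨_, hU, by simp [Val.fv]⟩)

/-! ### Simulation of lists of entries -/

/-- Apply `g` to the values of an entry. -/
def Entry.mapVal {φ : Type} (g : Val → Val) (e : Entry φ) : Entry φ :=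
  (e.1, g e.2.1, e.2.2.mapVal g)

theorem Entry.mapVal_congr {φ : Type} {f g : Val → Val} {e : Entry φ}
    (h : ∀ v ∈ e.vals, f v = g v) : e.mapVal f = e.mapVal g := by
  simp only [Entry.vals, List.mem_cons, forall_eq_or_imp] at h
  rw [Entry.mapVal, Entry.mapVal, h.1, Item.mapVal_congr h.2]

theorem Entry.mapVal_mapVal {φ : Type} (f g : Val → Val) (e : Entry φ) :
    (e.mapVal f).mapVal g = e.mapVal (g ∘ f) := by
  simp [Entry.mapVal, Item.mapVal_mapVal]

theorem Entry.mapVal_id {φ : Type} (e : Entry φ) : e.mapVal id = e := by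
  simp [Entry.mapVal, Item.mapVal_id]

theorem Entry.vals_mapVal {φ : Type} (f : Val → Val) (e : Entry φ) :
    (e.mapVal f).vals = e.vals.map f := by
  simp [Entry.mapVal, Entry.vals, Item.vals_mapVal]

/-- The tracked entries. -/
def tracked (w : List (Entry Bool)) : List (Entry Bool) := w.filter (·.1)

/-- The values in `F` or in tracked entries. -/
def known (F : List Val) (w : List (Entry Bool)) : List Val := F ++ stateVals (tracked w)

theorem mem_known {F : List Val} {w : List (Entry Bool)} {v : Val} :
    v ∈ known F w ↔ v ∈ F ∨ ∃ e ∈ w, e.1 = true ∧ v ∈ e.vals := by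
  simp [known, stateVals, tracked, and_assoc]

theorem mem_stateVals' {φ : Type} {w : List (Entry φ)} {v : Val} :
    v ∈ stateVals w ↔ ∃ e ∈ w, v ∈ e.vals := by
  simp [stateVals]

theorem known_subset {F : List Val} {w : List (Entry Bool)} {v : Val} (h : v ∈ known F w) :
    v ∈ F ∨ v ∈ stateVals w := by
  rcases mem_known.1 h with h | ⟨e, he, -, hv⟩
  · exact .inl h
  · exact .inr (mem_stateVals'.2 ⟨e, he, hv⟩)

/-- The list `α` is obtained from a sublist of `w` that contains the tracked entries by
permutations of the values that agree on `K`. -/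
inductive Sub (F K : List Val) (h : Equiv.Perm Val) :
    List (Entry Bool) → List (Entry Bool) → Prop
  | nil : Sub F K h [] []
  | skip {e α w} (he : e.1 = false) (hs : Sub F K h α w) : Sub F K h α (e :: w)
  | cons {e α w} {g : Equiv.Perm Val} (hg : Fixes F g) (hK : ∀ v ∈ K, g v = h v)
      (hs : Sub F K h α w) : Sub F K h (e :: α) (e.mapVal g :: w)

/-- Known values are renamed by one `h` for the whole list; any other value is renamed entry by
entry. So the abstraction forgets which unknown values are shared by different untracked entries. -/
def Sim (F : List Val) (α w : List (Entry Bool)) : Prop :=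
  ∃ h, Fixes F h ∧ Sub F (known F α) h α w

section

variable {F K : List Val} {h : Equiv.Perm Val} {α w : List (Entry Bool)}

theorem Sub.append {α' w' : List (Entry Bool)} (hs : Sub F K h α w) (hs' : Sub F K h α' w') :
    Sub F K h (α ++ α') (w ++ w') := by
  induction hs with
  | nil => exact hs'
  | skip he _ ih => exact .skip he ih
  | cons hg hK _ ih => exact .cons hg hK ih

theorem Sub.skips (hw : ∀ e ∈ w, e.1 = false) : Sub F K h [] w := by
  induction w with
  | nil => exact .nil
  | cons e w ih => exact .skip (hw e (by simp)) (ih fun e he => hw e (by simp [he]))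

theorem Sub.map {g : Equiv.Perm Val} (hg : Fixes F g) (hK : ∀ v ∈ K, g v = h v)
    (α : List (Entry Bool)) : Sub F K h α (α.map (Entry.mapVal g)) := by
  induction α with
  | nil => exact .nil
  | cons e α ih => exact .cons hg hK ih

theorem Sub.split {L R : List (Entry Bool)} {e : Entry Bool} (hs : Sub F K h α (L ++ e :: R)) :
    (e.1 = false ∧ ∃ α₁ α₂, α = α₁ ++ α₂ ∧ Sub F K h α₁ L ∧ Sub F K h α₂ R) ∨
    ∃ α₁ x α₂ g, α = α₁ ++ x :: α₂ ∧ Sub F K h α₁ L ∧ Sub F K h α₂ R ∧ Fixes F g ∧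
      (∀ v ∈ K, g v = h v) ∧ e = x.mapVal g := by
  induction L generalizing α with
  | nil =>
    cases hs with
    | skip he hs => exact .inl ⟨he, [], α, rfl, .nil, hs⟩
    | cons hg hK hs => exact .inr ⟨[], _, _, _, rfl, .nil, hs, hg, hK, rfl⟩
  | cons e' L ih =>
    cases hs with
    | skip he hs =>
      rcases ih hs with ⟨h1, α₁, α₂, rfl, h2, h3⟩ | ⟨α₁, x, α₂, g, rfl, h1, h2⟩
      · exact .inl ⟨h1, α₁, α₂, rfl, .skip he h2, h3⟩
      · exact .inr ⟨α₁, x, α₂, g, rfl, .skip he h1, h2⟩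
    | @cons y _ _ g' hg hK hs =>
      rcases ih hs with ⟨h1, α₁, α₂, rfl, h2, h3⟩ | ⟨α₁, x, α₂, g, rfl, h1, h2⟩
      · exact .inl ⟨h1, y :: α₁, α₂, rfl, .cons hg hK h2, h3⟩
      · exact .inr ⟨y :: α₁, x, α₂, g, rfl, .cons hg hK h1, h2⟩

theorem Sub.exists_of_mem (hs : Sub F K h α w) {e : Entry Bool} (he : e ∈ α) :
    ∃ g, Fixes F g ∧ (∀ v ∈ K, g v = h v) ∧ e.mapVal g ∈ w := by
  induction hs with
  | nil => simp at he
  | skip _ _ ih =>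
    obtain ⟨g, h1, h2, h3⟩ := ih he
    exact ⟨g, h1, h2, List.mem_cons_of_mem _ h3⟩
  | @cons _ _ _ g hg hK _ ih =>
    rcases List.mem_cons.1 he with rfl | he
    · exact ⟨g, hg, hK, by simp⟩
    · obtain ⟨g, h1, h2, h3⟩ := ih he
      exact ⟨g, h1, h2, List.mem_cons_of_mem _ h3⟩

/-- The permutation of an entry counts only on the values of that entry, so it may be exchanged for
another one. This is used when a step enlarges the set of known values. -/
theorem Sub.imp {K' : List Val} {h' : Equiv.Perm Val} (hs : Sub F K h α w)
    (H : ∀ e ∈ α, ∀ g, Fixes F g → (∀ v ∈ K, g v = h v) → e.mapVal g ∈ w →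
      ∃ g', Fixes F g' ∧ (∀ v ∈ K', g' v = h' v) ∧ ∀ v ∈ e.vals, g' v = g v) :
    Sub F K' h' α w := by
  induction hs with
  | nil => exact .nil
  | skip he _ ih =>
    exact .skip he (ih fun e he g h1 h2 h3 => H e he g h1 h2 (List.mem_cons_of_mem _ h3))
  | cons hg hK _ ih =>
    obtain ⟨g', h1, h2, h3⟩ := H _ List.mem_cons_self _ hg hK List.mem_cons_self
    rw [← Entry.mapVal_congr h3]
    exact .cons h1 h2 (ih fun e he g h1 h2 h3 =>
      H e (List.mem_cons_of_mem _ he) g h1 h2 (List.mem_cons_of_mem _ h3))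

theorem Sub.trans {K' : List Val} {h' : Equiv.Perm Val} {x : List (Entry Bool)}
    (hs : Sub F K h α w) (hs' : Sub F K' h' w x) (hK : ∀ v ∈ K, h v ∈ K') :
    Sub F K (h' * h) α x := by
  induction hs' generalizing α with
  | nil =>
    cases hs
    exact .nil
  | skip he _ ih => exact .skip he (ih hs)
  | cons hg' hK' _ ih =>
    cases hs with
    | skip he hs => exact .skip he (ih hs)
    | cons hg hK₀ hs =>
      rw [Entry.mapVal_mapVal, ← Equiv.Perm.coe_mul]
      refine .cons (hg'.mul hg) (fun v hv => ?_) (ih hs)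
      rw [Equiv.Perm.mul_apply, hK₀ v hv, hK' _ (hK v hv), Equiv.Perm.mul_apply]

theorem Sub.cnt_eq (hs : Sub F K h α w) : cnt α = cnt w := by
  induction hs with
  | nil => rfl
  | skip he _ ih => simpa [cnt, he] using ih
  | @cons e _ _ _ _ _ _ ih =>
    simp only [cnt, List.countP_cons, Entry.mapVal] at ih ⊢
    rw [ih]

/-- Skipped entries are untracked, and on the values of tracked entries all permutations agree with
`h`. So the tracked parts correspond exactly, with their order and mutual equalities. -/
theorem Sub.tracked_eq (hs : Sub F K h α w) (hK : ∀ e ∈ α, e.1 = true → ∀ v ∈ e.vals, v ∈ K) :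
    tracked w = (tracked α).map (Entry.mapVal h) := by
  induction hs with
  | nil => rfl
  | skip he _ ih => simpa [tracked, he] using ih hK
  | @cons e _ _ g hg hK' _ ih =>
    have ih := ih fun e he => hK e (by simp [he])
    by_cases he : e.1 = true
    · have h1 : (e.mapVal g).1 = true := he
      rw [tracked, List.filter_cons_of_pos (by simpa using h1), tracked,
        List.filter_cons_of_pos (by simpa using he), List.map_cons]
      rw [tracked, tracked] at ih
      rw [ih, Entry.mapVal_congr fun v hv => hK' v (hK e (by simp) he v hv)]
    · have h1 : ¬ (e.mapVal g).1 = true := he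
      rw [tracked, List.filter_cons_of_neg (by simpa using h1), tracked,
        List.filter_cons_of_neg (by simpa using he)]
      exact ih

end

theorem Fixes.map_eq {F : List Val} {h : Equiv.Perm Val} (hF : Fixes F h) : F.map h = F := by
  conv_rhs => rw [← List.map_id F]
  exact List.map_congr_left hF.fix

theorem stateVals_map {φ : Type} (g : Val → Val) (w : List (Entry φ)) :
    stateVals (w.map (Entry.mapVal g)) = (stateVals w).map g := by
  simp [stateVals, List.flatMap_map, List.map_flatMap, Entry.vals_mapVal]

theorem Sub.known_eq {F : List Val} {h : Equiv.Perm Val} {α w : List (Entry Bool)}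
    (hs : Sub F (known F α) h α w) (hF : Fixes F h) :
    known F w = (known F α).map h := by
  rw [known, hs.tracked_eq fun e he hb v hv => mem_known.2 (.inr ⟨e, he, hb, hv⟩), stateVals_map,
    known, List.map_append, hF.map_eq]

theorem Sim.trans {F : List Val} {α β γ : List (Entry Bool)} (h : Sim F α β) (h' : Sim F β γ) :
    Sim F α γ := by
  obtain ⟨g, hg, hs⟩ := h
  obtain ⟨g', hg', hs'⟩ := h'
  refine ⟨g' * g, hg'.mul hg, hs.trans hs' fun v hv => ?_⟩
  rw [hs.known_eq hg]
  exact List.mem_map_of_mem hv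

/-! ### Simulation of steps -/

theorem outItems_map {g : Equiv.Perm Val} (hg : ∀ v, kind (g v) = kind v)
    (o : Option (Val × Item)) (ν : List Val) :
    outItems (o.map fun p => (g p.1, p.2.mapVal g)) (ν.map g) =
      (outItems o ν).map fun p => (g p.1, p.2.mapVal g) := by
  simp only [outItems, List.map_append, List.filter_map, List.map_map]
  congr 1
  · cases o <;> simp
  · have : (fun v => decide (kind v ≠ none)) ∘ g = fun v => decide (kind v ≠ none) := by
      funext v
      simp [hg]
    rw [this]
    rfl

theorem mem_vals_outItems {𝒢 : Program} (h𝒢 : 𝒢.Pure) {A z ν o z'}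
    (h : LStep 𝒢 A z ν o z') {p : Val × Item} (hp : p ∈ outItems o ν) {v : Val}
    (hv : v = p.1 ∨ v ∈ p.2.vals) : v ∈ z.vals ∨ v ∈ ν := by
  rcases mem_outItems.1 hp with ho | ⟨-, h2, h3⟩
  · obtain ⟨-, h1, h2⟩ := (h.mem_vals h𝒢).2 _ ho
    rcases hv with rfl | hv
    · exact .inl h1
    · exact h2 v hv
  · rcases hv with rfl | hv
    · exact .inr h2
    · rw [h3] at hv
      simp [Item.vals, Proc.vals] at hv

/-- The values that are known after a step. -/
theorem known_exec {𝒢 : Program} (h𝒢 : 𝒢.Pure) {F : List Val} {A z ν o z'}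
    (h : LStep 𝒢 A z ν o z') {f f' : Bool} {L R outs : List (Entry Bool)}
    (houts : outs.map Prod.snd = outItems o ν) (hf : bchild f f')
    (hc : ∀ e ∈ outs, bchild f e.1) {v : Val}
    (hv : v ∈ known F (L ++ (f', A, z') :: R ++ outs)) :
    v ∈ known F (L ++ (f, A, z) :: R) ∨ f = true ∧ v ∈ ν := by
  rw [mem_known] at hv
  rw [mem_known]
  rcases hv with hv | ⟨e, he, hb, hv⟩
  · exact .inl (.inl hv)
  · simp only [List.mem_append, List.mem_cons] at he
    rcases he with (he | rfl | he) | he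
    · exact .inl (.inr ⟨e, by simp [he], hb, hv⟩)
    · have hft := hf hb
      subst hft
      simp only [Entry.vals, List.mem_cons] at hv
      have key : v = A ∨ v ∈ z.vals ∨ v ∈ ν := by
        rcases hv with hv | hv
        · exact .inl hv
        · exact (h.mem_vals h𝒢).1 v hv
      rcases key with hv | hv | hv
      · exact .inl (.inr ⟨(true, A, z), by simp, rfl, by simp [Entry.vals, hv]⟩)
      · exact .inl (.inr ⟨(true, A, z), by simp, rfl, by simp [Entry.vals, hv]⟩)
      · exact .inr ⟨rfl, hv⟩
    · exact .inl (.inr ⟨e, by simp [he], hb, hv⟩)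
    · have hft := hc e he hb
      subst hft
      have he' : e.2 ∈ outItems o ν := houts ▸ List.mem_map_of_mem he
      rcases mem_vals_outItems h𝒢 h he' (v := v) (by simpa [Entry.vals] using hv) with hv | hv
      · exact .inl (.inr ⟨(true, A, z), by simp, rfl, by simp [Entry.vals, hv]⟩)
      · exact .inr ⟨rfl, hv⟩

/-- The owners of the entries are known. -/
def Owned (F : List Val) (α : List (Entry Bool)) : Prop := ∀ e ∈ α, e.2.1 ∈ known F α

/-- The inverse permutation pulls a step of the renamed item back to the item, with prescribed new
values `ν₀`. -/
theorem LStep.unperm {𝒢 : Program} (h𝒢 : 𝒢.Pure) {g : Equiv.Perm Val}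
    (hg : ∀ v, kind (g v) = kind v) {A z ν ν₀ o z'}
    (h : LStep 𝒢 (g A) (z.mapVal g) ν o z') (hν : ν₀.map g = ν) :
    ∃ o₀ z₀', LStep 𝒢 A z ν₀ o₀ z₀' ∧ (o = o₀.map fun p => (g p.1, p.2.mapVal g)) ∧
      z' = z₀'.mapVal g := by
  have hg' : ∀ v, kind (g⁻¹ v) = kind v := fun v => by
    rw [← hg]
    simp
  have hcomp : ∀ y : Item, (y.mapVal g).mapVal ⇑g⁻¹ = y := fun y => by
    rw [Item.mapVal_mapVal]
    exact Item.mapVal_eq_self fun v _ => by simp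
  have hcomp' : ∀ y : Item, (y.mapVal ⇑g⁻¹).mapVal g = y := fun y => by
    rw [Item.mapVal_mapVal]
    exact Item.mapVal_eq_self fun v _ => by simp
  have := h.perm h𝒢 hg'
  rw [hcomp, ← hν, List.map_map] at this
  refine ⟨_, _, by simpa using this, ?_, (hcomp' z').symm⟩
  cases o with
  | none => rfl
  | some p => exact congrArg some (Prod.ext (by simp) (hcomp' p.2).symm)

/-- A step of an untracked entry without counterpart in `α` adds only entries that may be skipped.
If the acting entry has a counterpart, that one is first for its owner in `α` as well, and it makes
the same step with the new values that are supplied for `α`. -/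
theorem Sim.exec {𝒢 : Program} (h𝒢 : 𝒢.Pure) {α w w₁ : List (Entry Bool)} {b : Bool}
    (hα : Owned 𝒢.free α) (h : Sim 𝒢.free α w) (hw : Exec 𝒢 bchild b w w₁) :
    b = false ∧ Sim 𝒢.free α w₁ ∨ ∃ α₁, (b, α₁) ∈ steps 𝒢 α ∧ Sim 𝒢.free α₁ w₁ := by
  obtain ⟨h, hh, hs⟩ := h
  have hknown := hs.known_eq hh
  cases hw with
  | @mk L R outs _ f' A z ν o z' hL hstep hν hfresh houts hf hc =>
    have hνw : ∀ v ∈ ν, ∀ u ∈ known 𝒢.free α, h u ≠ v := by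
      intro v hv u hu huv
      have : v ∈ known 𝒢.free (L ++ (b, A, z) :: R) := by
        rw [hknown, ← huv]
        exact List.mem_map_of_mem hu
      rcases known_subset this with h' | h'
      · exact (hfresh v hv).1 h'
      · exact (hfresh v hv).2 h'
    rcases hs.split with ⟨hb, α₁, α₂, rfl, h1, h2⟩ | ⟨α₁, x, α₂, g₀, rfl, h1, h2, hg, hgK₀, hx⟩
    · simp only at hb
      subst hb
      refine .inl ⟨rfl, h, hh, ?_⟩
      have hout : ∀ e ∈ outs, e.1 = false := fun e he => by simpa [bchild] using hc e he
      have h3 := (h1.append (Sub.skip (e := (f', A, z')) (by simpa [bchild] using hf) h2)).append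
        (Sub.skips (h := h) (F := 𝒢.free) (K := known 𝒢.free (α₁ ++ α₂)) hout)
      simpa using h3
    · right
      obtain ⟨b', A₀, z₀⟩ := x
      simp only [Entry.mapVal, Prod.mk.injEq] at hx
      obtain ⟨rfl, rfl, rfl⟩ := hx
      set α := α₁ ++ (b, A₀, z₀) :: α₂ with hαdef
      have hA₀ : A₀ ∈ known 𝒢.free α := hα (b, A₀, z₀) (by simp [hαdef])
      -- The owner `A₀` is known, so all entries rename it alike. An earlier entry of `A₀` in `α`
      -- would be an earlier entry of the acting owner in `w`.
      have hL' : ∀ e ∈ α₁, e.2.1 ≠ A₀ := by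
        intro e he heA
        obtain ⟨g', -, k1, k2⟩ := h1.exists_of_mem he
        apply hL _ k2
        simp only [Entry.mapVal, heA]
        rw [k1 _ hA₀, hgK₀ _ hA₀]
      have hU : ∀ v, v ∈ known 𝒢.free α ∨ (∃ e ∈ α, v ∈ e.vals) → v ∈ usedVals 𝒢 α := by
        rintro v (hv | ⟨e, he, hv⟩)
        · rcases known_subset hv with hv | hv <;> simp [usedVals, hv]
        · rw [usedVals, List.mem_append]
          exact .inr (mem_stateVals'.2 ⟨e, he, hv⟩)
      have hUF : ∀ v ∈ 𝒢.free, v ∈ usedVals 𝒢 α := fun v hv => by simp [usedVals, hv]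
      obtain ⟨o₁, z₁, hs₁, -⟩ := hstep.unperm h𝒢 hg.kind_eq (ν₀ := ν.map ⇑g₀⁻¹)
        (by simp [List.map_map, Function.comp_def])
      obtain ⟨ν₀, hν₀, hk⟩ := hs₁.exists_supply ((usedVals 𝒢 α).filterMap Val.toName)
        ((usedVals 𝒢 α).flatMap Val.fv)
      have hfresh₀ := supply_used hν₀
      have hk' : ν₀.map kind = ν.map kind := by
        rw [← hk, List.map_map]
        exact List.map_congr_left fun v _ => hg.inv.kind_eq v
      -- permutations are extended to the new values
      have ext : ∀ (e : Entry Bool), e ∈ α → ∀ g : Equiv.Perm Val, Fixes 𝒢.free g →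
          (∀ v ∈ known 𝒢.free α, g v = h v) →
          e.mapVal g ∈ L ++ (b, g₀ A₀, z₀.mapVal g₀) :: R →
          ∃ g', Fixes 𝒢.free g' ∧ (∀ v, v ∈ known 𝒢.free α ∨ v ∈ e.vals → g' v = g v) ∧
            ν₀.map g' = ν := by
        intro e he g hg hgK hew
        have hold : ∀ u ∈ ν₀, u ∉ {v | v ∈ known 𝒢.free α ∨ v ∈ e.vals} := by
          rintro u hu (hu' | hu')
          · exact hfresh₀ u hu (hU u (.inl hu'))
          · exact hfresh₀ u hu (hU u (.inr ⟨e, he, hu'⟩))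
        refine hg.exists_list _ hν₀.spec.1 hν hold ?_ (fun u hu hF => hfresh₀ u hu (hUF u hF))
          (fun v hv => (hfresh v hv).1) hk'
        rintro v hv u (hu | hu) rfl
        · exact hνw _ hv u hu (hgK u hu).symm
        · refine (hfresh _ hv).2 (mem_stateVals'.2 ⟨_, hew, ?_⟩)
          rw [Entry.vals_mapVal]
          exact List.mem_map_of_mem hu
      obtain ⟨g₁, l1, l2, l3⟩ := ext (b, A₀, z₀) (by simp [hαdef]) g₀ hg hgK₀
        (by simp [Entry.mapVal])
      have hgA : g₁ A₀ = g₀ A₀ := l2 _ (.inl hA₀)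
      have hgz : z₀.mapVal g₁ = z₀.mapVal g₀ :=
        Item.mapVal_congr fun v hv => l2 v (.inr (by simp [Entry.vals, hv]))
      rw [← hgA, ← hgz] at hstep
      obtain ⟨o₀, z₀', hs₀, rfl, rfl⟩ := hstep.unperm h𝒢 l1.kind_eq l3
      rw [← l3, outItems_map l1.kind_eq] at houts
      have hcomp : ∀ e : Entry Bool, (e.mapVal ⇑g₁⁻¹).mapVal g₁ = e := fun e => by
        rw [Entry.mapVal_mapVal, ← Equiv.Perm.coe_mul, mul_inv_cancel]
        exact e.mapVal_id
      obtain ⟨outs₀, hout₀, rfl⟩ : ∃ outs₀ : List (Entry Bool),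
          outs₀.map Prod.snd = outItems o₀ ν₀ ∧ outs = outs₀.map (Entry.mapVal g₁) := by
        refine ⟨outs.map (Entry.mapVal ⇑g₁⁻¹), ?_, ?_⟩
        · have : ∀ e : Entry Bool, (e.mapVal ⇑g₁⁻¹).2 = (g₁⁻¹ e.2.1, e.2.2.mapVal ⇑g₁⁻¹) :=
            fun e => rfl
          rw [List.map_map]
          simp only [Function.comp_def, this]
          have h' : (outs.map fun x => (g₁⁻¹ x.2.1, x.2.2.mapVal ⇑g₁⁻¹)) =
              (outs.map Prod.snd).map fun p => (g₁⁻¹ p.1, p.2.mapVal ⇑g₁⁻¹) := by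
            rw [List.map_map]
            rfl
          rw [h', houts, List.map_map]
          conv_rhs => rw [← List.map_id (outItems o₀ ν₀)]
          refine List.map_congr_left fun p _ => ?_
          simp only [Function.comp_def, Item.mapVal_mapVal, id]
          exact Prod.ext (by simp) (Item.mapVal_eq_self fun v _ => by simp)
        · rw [List.map_map]
          conv_lhs => rw [← List.map_id outs]
          exact List.map_congr_left fun e _ => (hcomp e).symm
      have hc₀ : ∀ e ∈ outs₀, bchild b e.1 := fun e he =>
        hc (e.mapVal g₁) (List.mem_map_of_mem he)
      refine ⟨α₁ ++ (f', A₀, z₀') :: α₂ ++ outs₀, mem_steps.2 ⟨α₁, _, α₂, rfl, mem_stepsAt.2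
        ⟨hL', ν₀, o₀, z₀', f', outs₀, hs₀, hν₀, hout₀, hf, hc₀, rfl⟩⟩, g₁, l1, ?_⟩
      have hK' : ∀ v ∈ known 𝒢.free (α₁ ++ (f', A₀, z₀') :: α₂ ++ outs₀),
          v ∈ known 𝒢.free α ∨ v ∈ ν₀ := by
        intro v hv
        rcases known_exec h𝒢 hs₀ hout₀ hf hc₀ hv with h' | h'
        · exact .inl h'
        · exact .inr h'.2
      -- The new values may become known, so the permutations of the entries that do not move are
      -- extended to them in the same way.
      have hold : ∀ {β y}, Sub 𝒢.free (known 𝒢.free α) h β y → (∀ e ∈ β, e ∈ α) →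
          (∀ e ∈ y, e ∈ L ++ (b, g₀ A₀, z₀.mapVal g₀) :: R) →
          Sub 𝒢.free (known 𝒢.free (α₁ ++ (f', A₀, z₀') :: α₂ ++ outs₀)) g₁ β y := by
        intro β y hβ hβα hy
        refine hβ.imp fun e he g hg hgK hey => ?_
        obtain ⟨g', m1, m2, m3⟩ := ext e (hβα e he) g hg hgK (hy _ hey)
        refine ⟨g', m1, fun v hv => ?_, fun v hv => m2 v (.inr hv)⟩
        rcases hK' v hv with hv | hv
        · rw [m2 v (.inl hv), l2 v (.inl hv), hgK v hv, hgK₀ v hv]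
        · exact List.map_inj_left.1 (m3.trans l3.symm) v hv
      refine Sub.append (Sub.append (hold h1 ?_ ?_) ?_) (.map l1 (fun _ _ => rfl) _)
      · exact fun e he => by simp [hαdef, he]
      · exact fun e he => by simp [he]
      · have h3 := Sub.cons (e := (f', A₀, z₀')) l1
          (fun _ _ => rfl) (hold h2 (fun e he => by simp [hαdef, he]) fun e he => by simp [he])
        simpa only [Entry.mapVal, hgA] using h3

/-- A finished process that is not tracked can be removed if it does not occur in `α`. -/
theorem Sim.drop {F : List Val} {α w w' : List (Entry Bool)} (h : Sim F α w)
    (hα : ∀ e ∈ α, e.1 = false → e.2.2 ≠ .inr .nil) (hw : Drop (· = false) w w') :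
    Sim F α w' := by
  cases hw with
  | refl => exact h
  | drop hL hf =>
    obtain ⟨g, hg, hs⟩ := h
    rcases hs.split with ⟨-, α₁, α₂, rfl, h1, h2⟩ | ⟨α₁, x, α₂, g', rfl, -, -, -, -, hx⟩
    · exact ⟨g, hg, h1.append h2⟩
    · simp only [Entry.mapVal, Prod.mk.injEq] at hx
      exact absurd (Item.mapVal_nil.1 hx.2.2.symm) (hα x (by simp) (hx.1.symm.trans hf))

/-! ### Normal forms of lists of entries -/

instance : LawfulBEq Item where
  eq_of_beq {a b} h := by
    rcases a with a | a <;> rcases b with b | b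
    · exact congrArg Sum.inl (eq_of_beq (α := ℕ × List Val) h)
    · cases h
    · cases h
    · exact congrArg Sum.inr (eq_of_beq (α := Proc) h)
  rfl {a} := by
    rcases a with a | a
    · exact beq_self_eq_true (α := ℕ × List Val) a
    · exact beq_self_eq_true (α := Proc) a

/-- The variable, or the index of the actor name in its class. -/
def Val.idx : Val → ℕ
  | .var x => x
  | .act A => A.2

/-- The value of the same kind with index `i`. -/
def Val.retag (v : Val) (i : ℕ) : Val :=
  match v with
  | .var _ => .var i
  | .act A => .act (A.1, i)

theorem Val.idx_retag (v : Val) (i : ℕ) : (v.retag i).idx = i := by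
  cases v <;> rfl

theorem Val.kind_retag (v : Val) (i : ℕ) : kind (v.retag i) = kind v := by
  cases v <;> rfl

theorem Val.ext_idx {u v : Val} (h : kind u = kind v) (h' : u.idx = v.idx) : u = v := by
  cases u <;> cases v <;> simp_all [kind, Val.idx, Prod.ext_iff]

/-- A bound for the indices of values. -/
def bnd (F : List Val) : ℕ := (F.map fun v => v.idx + 1).sum

theorem idx_lt_bnd {F : List Val} {v : Val} (hv : v ∈ F) : v.idx < bnd F :=
  List.single_le_sum (l := F.map fun v => v.idx + 1) (by simp) _
    (List.mem_map_of_mem (f := fun v : Val => v.idx + 1) hv)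

/-- The canonical name of a value, with the values in `F` fixed and those in `tv` named first. -/
def normVal (F tv vs : List Val) (v : Val) : Val :=
  if v ∈ F then v else
    if v ∈ tv then v.retag (bnd F + tv.idxOf v) else v.retag (bnd F + tv.length + vs.idxOf v)

theorem kind_normVal (F tv vs : List Val) (v : Val) : kind (normVal F tv vs v) = kind v := by
  unfold normVal
  split_ifs <;> simp [Val.kind_retag]

theorem idx_normVal_lt {F tv vs : List Val} {v : Val} (hv : v ∈ F ∨ v ∈ tv ∨ v ∈ vs) :
    (normVal F tv vs v).idx < bnd F + tv.length + vs.length := by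
  unfold normVal
  split_ifs with h1 h2
  · have := idx_lt_bnd h1
    omega
  · rw [Val.idx_retag]
    have := List.idxOf_lt_length_iff.2 h2
    omega
  · rw [Val.idx_retag]
    have := List.idxOf_lt_length_iff.2 ((hv.resolve_left h1).resolve_left h2)
    omega

/-- Values in `F`, values in `tv` and all others receive indices from three disjoint ranges: below
`bnd F`, the next `tv.length` numbers, and the rest. -/
theorem normVal_inj {F tv vs : List Val} {u v : Val} (hu : u ∈ F ∨ u ∈ tv ∨ u ∈ vs)
    (h : normVal F tv vs u = normVal F tv vs v) : u = v := by
  have hidx := congrArg Val.idx h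
  unfold normVal at h hidx
  by_cases h1 : u ∈ F <;> by_cases h2 : v ∈ F
  · simpa [h1, h2] using h
  · have := idx_lt_bnd h1
    by_cases h3 : v ∈ tv <;> simp only [h1, h2, h3, if_true, if_false, Val.idx_retag] at hidx <;> omega
  · have := idx_lt_bnd h2
    by_cases h3 : u ∈ tv <;> simp only [h1, h2, h3, if_true, if_false, Val.idx_retag] at hidx <;> omega
  · by_cases h3 : u ∈ tv <;> by_cases h4 : v ∈ tv <;>
      simp only [h1, h2, h3, h4, if_true, if_false, Val.idx_retag] at hidx
    · exact (List.idxOf_inj h3).1 (by omega)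
    · have := List.idxOf_lt_length_iff.2 h3
      omega
    · have := List.idxOf_lt_length_iff.2 h4
      omega
    · exact (List.idxOf_inj ((hu.resolve_left h1).resolve_left h3)).1 (by omega)

theorem exists_perm_normVal (F tv vs : List Val) :
    ∃ g, Fixes F g ∧ ∀ v, v ∈ F ∨ v ∈ tv ∨ v ∈ vs → g v = normVal F tv vs v := by
  obtain ⟨g, h1, h2⟩ := exists_perm_of_zip (c := kind)
    ((F ++ tv ++ vs).map fun v => (v, normVal F tv vs v)) (by
      simp only [List.mem_map, forall_exists_index, and_imp]
      rintro _ u hu rfl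
      exact (kind_normVal F tv vs u).symm) (by
      simp only [List.mem_map, forall_exists_index, and_imp]
      rintro _ u hu rfl _ v hv rfl
      simp only [List.append_assoc, List.mem_append] at hu hv
      exact ⟨congrArg (normVal F tv vs), normVal_inj hu⟩)
  have h3 : ∀ v, v ∈ F ∨ v ∈ tv ∨ v ∈ vs → g v = normVal F tv vs v := fun v hv =>
    h2 (v, normVal F tv vs v) (List.mem_map_of_mem (f := fun v => (v, normVal F tv vs v))
      (by simpa using hv))
  refine ⟨g, ⟨h1, fun v hv => ?_⟩, h3⟩
  rw [h3 v (.inl hv), normVal, if_pos hv]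

/-- Remove repetitions of entries that are not tracked, between tracked entries. -/
def dedupe (α : List (Entry Bool)) : List (Entry Bool) :=
  α.foldr (fun e (r : List (Entry Bool)) => if e.1 = false ∧ e ∈ r.takeWhile (fun e : Entry Bool => !e.1) then r else e :: r) []

theorem dedupe_cons (e : Entry Bool) (α : List (Entry Bool)) :
    dedupe (e :: α) = if e.1 = false ∧ e ∈ (dedupe α).takeWhile (fun e : Entry Bool => !e.1) then dedupe α
      else e :: dedupe α := rfl

theorem mem_of_mem_dedupe {α : List (Entry Bool)} {e : Entry Bool} (he : e ∈ dedupe α) :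
    e ∈ α := by
  induction α with
  | nil => exact he
  | cons a α ih =>
    rw [dedupe_cons] at he
    split_ifs at he
    · exact List.mem_cons_of_mem _ (ih he)
    · rcases List.mem_cons.1 he with rfl | he
      · simp
      · exact List.mem_cons_of_mem _ (ih he)

theorem sub_dedupe (F K : List Val) (α : List (Entry Bool)) : Sub F K 1 (dedupe α) α := by
  induction α with
  | nil => exact .nil
  | cons e α ih =>
    rw [dedupe_cons]
    split_ifs with h
    · exact .skip h.1 ih
    · have := Sub.cons (e := e) (.one F) (fun _ _ => rfl) ih
      have he : e.mapVal ((1 : Equiv.Perm Val) : Val → Val) = e := e.mapVal_id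
      rwa [he] at this

/-- An entry is removed only in favour of a copy further right that comes before the next tracked
entry, so the surviving copy is preceded by no more tracked entries than the original. -/
theorem exists_dedupe {L R : List (Entry Bool)} {e : Entry Bool} :
    ∃ L' R', dedupe (L ++ e :: R) = L' ++ e :: R' ∧ cnt L' ≤ cnt L := by
  induction L with
  | nil =>
    rw [List.nil_append, dedupe_cons]
    split_ifs with h
    · obtain ⟨L', R', h'⟩ := List.append_of_mem h.2
      refine ⟨L', R' ++ (dedupe R).dropWhile (fun e : Entry Bool => !e.1), ?_, ?_⟩
      · conv_lhs => rw [← List.takeWhile_append_dropWhile (p := fun e : Entry Bool => !e.1) (l := dedupe R), h']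
        simp
      · have : ∀ e ∈ L', ¬ e.1 = true := by
          intro e he
          have h1 : e ∈ (dedupe R).takeWhile fun e : Entry Bool => !e.1 := by simp [h', he]
          simpa using List.mem_takeWhile_imp h1
        simp only [cnt, List.countP_eq_zero.2 this, zero_le]
    · exact ⟨[], _, rfl, by simp [cnt]⟩
  | cons a L ih =>
    obtain ⟨L', R', h1, h2⟩ := ih
    rw [List.cons_append, dedupe_cons, h1]
    split_ifs with h
    · exact ⟨L', R', rfl, h2.trans (by simp [cnt, List.countP_cons])⟩
    · refine ⟨a :: L', R', rfl, ?_⟩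
      simp only [cnt, List.countP_cons] at h2 ⊢
      omega

/-- Entries that matter for the tracked ones. -/
def keep (K : List Val) (e : Entry Bool) : Bool :=
  e.1 || (decide (e.2.1 ∈ K) && decide (e.2.2 ≠ .inr .nil))

/-- The entries that matter, with canonical values. -/
def rename (F tv : List Val) (α : List (Entry Bool)) : List (Entry Bool) :=
  (α.filter (keep (F ++ tv))).map fun e => e.mapVal (normVal F tv e.vals)

def norm (F : List Val) (α : List (Entry Bool)) : List (Entry Bool) :=
  dedupe (rename F (stateVals (tracked α)) α)

/-- On `F` and `tv` the canonical name does not depend on the list `vs` of the entry. Hence the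
permutations of the different entries agree with `p` on known values, as `Sub` demands. -/
theorem sub_rename {F tv : List Val} {p : Equiv.Perm Val}
    (hp' : ∀ v, v ∈ F ∨ v ∈ tv → p v = normVal F tv [] v) (α : List (Entry Bool)) :
    Sub F ((F ++ tv).map p) p⁻¹ (rename F tv α) α := by
  induction α with
  | nil => exact .nil
  | cons e α ih =>
    rw [rename]
    by_cases he : keep (F ++ tv) e = true
    · rw [List.filter_cons_of_pos he, List.map_cons]
      obtain ⟨g, h1, h2⟩ := exists_perm_normVal F tv e.vals
      have hg : ∀ v ∈ F ++ tv, g v = p v := by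
        intro v hv
        rw [List.mem_append] at hv
        rw [h2 v (by tauto), hp' v hv, normVal, normVal]
        rcases hv with hv | hv <;> simp [hv]
      have := Sub.cons (e := e.mapVal (normVal F tv e.vals)) (h := p⁻¹)
        (K := (F ++ tv).map p) h1.inv (by
          intro v hv
          obtain ⟨u, hu, rfl⟩ := List.mem_map.1 hv
          conv_lhs => rw [← hg u hu]
          simp) ih
      rw [← Entry.mapVal_congr fun v hv => h2 v (.inr (.inr hv)), Entry.mapVal_mapVal,
        ← Equiv.Perm.coe_mul, inv_mul_cancel] at this
      have he : e.mapVal ((1 : Equiv.Perm Val) : Val → Val) = e := e.mapVal_id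
      rw [he] at this
      rwa [← Entry.mapVal_congr fun v hv => h2 v (.inr (.inr hv))]
    · rw [List.filter_cons_of_neg he]
      exact .skip (by simp only [keep, Bool.or_eq_true, not_or] at he; simpa using he.1) ih

/-- Normalization is correct in both directions. The simulation `Sim` serves for the passage from
concrete to abstract runs. The last clause serves for the way back: an unfinished untracked entry of
a known owner leaves a copy in the normal form, no further back among the tracked entries, and
renamed on known values in the same way as the tracked part. -/
theorem norm_spec (F : List Val) (α : List (Entry Bool)) :
    Sim F (norm F α) α ∧ Owned F (norm F α) ∧ (∀ e ∈ norm F α, e.1 = false → e.2.2 ≠ .inr .nil) ∧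
    ∃ p, Fixes F p ∧ tracked (norm F α) = (tracked α).map (Entry.mapVal p) ∧
      ∀ L A z R, α = L ++ (false, A, z) :: R → A ∈ known F α → z ≠ .inr .nil →
        ∃ L' R' g, norm F α = L' ++ (false, g A, z.mapVal g) :: R' ∧ cnt L' ≤ cnt L ∧ Fixes F g ∧
          ∀ v ∈ known F α, g v = p v := by
  obtain ⟨p, hp, hp'⟩ := exists_perm_normVal F (stateVals (tracked α)) []
  have hs := sub_rename (p := p) (fun v hv => hp' v (by tauto)) α
  set tv := stateVals (tracked α) with htv
  have hsn : Sub F ((F ++ tv).map p) p⁻¹ (norm F α) α := by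
    have := (sub_dedupe F ((F ++ tv).map p) (rename F tv α)).trans hs (by simp)
    rwa [mul_one] at this
  have hreps : ∀ e ∈ norm F α, ∃ e₀ ∈ α, keep (F ++ tv) e₀ = true ∧
      e = e₀.mapVal (normVal F tv e₀.vals) := by
    intro e he
    obtain ⟨e₀, h1, rfl⟩ := List.mem_map.1 (mem_of_mem_dedupe he)
    exact ⟨e₀, (List.mem_filter.1 h1).1, (List.mem_filter.1 h1).2, rfl⟩
  have htv : ∀ e ∈ α, e.1 = true → ∀ v ∈ e.vals, v ∈ tv := fun e he hb v hv =>
    mem_stateVals'.2 ⟨e, by simp [tracked, he, hb], hv⟩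
  have hpn : ∀ vs, ∀ v, v ∈ F ∨ v ∈ tv → normVal F tv vs v = p v := by
    intro vs v hv
    rw [hp' v (by tauto), normVal, normVal]
    rcases hv with hv | hv <;> simp [hv]
  have htr : tracked (norm F α) = (tracked α).map (Entry.mapVal p) := by
    rw [hsn.tracked_eq, List.map_map]
    · conv_lhs => rw [← List.map_id (tracked (norm F α))]
      refine List.map_congr_left fun e _ => ?_
      rw [Function.comp_apply, Entry.mapVal_mapVal, ← Equiv.Perm.coe_mul, mul_inv_cancel]
      exact e.mapVal_id.symm
    · intro e he hb v hv
      obtain ⟨e₀, h1, -, rfl⟩ := hreps e he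
      rw [Entry.vals_mapVal, List.mem_map] at hv
      obtain ⟨u, hu, rfl⟩ := hv
      have hu' := htv e₀ h1 hb u hu
      rw [hpn _ u (.inr hu')]
      exact List.mem_map_of_mem (by simp [hu'])
  have hkn : known F (norm F α) = (F ++ tv).map p := by
    rw [known, htr, stateVals_map, List.map_append, hp.map_eq]
  refine ⟨⟨p⁻¹, hp.inv, hkn ▸ hsn⟩, ?_, ?_, p, hp, htr, ?_⟩
  · intro e he
    obtain ⟨e₀, h1, h2, rfl⟩ := hreps e he
    have : e₀.2.1 ∈ F ++ tv := by
      simp only [keep, Bool.or_eq_true, Bool.and_eq_true, decide_eq_true_eq] at h2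
      rcases h2 with h2 | h2
      · exact List.mem_append_right _ (htv e₀ h1 h2 _ (by simp [Entry.vals]))
      · exact h2.1
    rw [hkn]
    simp only [Entry.mapVal]
    rw [hpn _ _ (List.mem_append.1 this)]
    exact List.mem_map_of_mem this
  · intro e he hb
    obtain ⟨e₀, h1, h2, rfl⟩ := hreps e he
    simp only [Entry.mapVal] at hb
    simp only [keep, hb, Bool.false_or, Bool.and_eq_true, decide_eq_true_eq] at h2
    simpa [Entry.mapVal, Item.mapVal_nil] using h2.2
  · rintro L A z R rfl hA hz
    obtain ⟨g, h1, h2⟩ := exists_perm_normVal F tv (Entry.vals (false, A, z))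
    have hkeep : keep (F ++ tv) (false, A, z) = true := by
      simpa [keep, hz] using List.mem_append.1 hA
    have he : rename F tv (L ++ (false, A, z) :: R) =
        rename F tv L ++ (false, g A, z.mapVal g) :: rename F tv R := by
      simp only [rename, List.filter_append, List.filter_cons_of_pos hkeep, List.map_append,
        List.map_cons]
      rw [← Entry.mapVal_congr fun v hv => h2 v (.inr (.inr hv))]
      rfl
    obtain ⟨L', R', h3, h4⟩ := exists_dedupe (L := rename F tv L) (R := rename F tv R)
      (e := (false, g A, z.mapVal g))
    refine ⟨L', R', g, ?_, h4.trans ?_, h1, fun v hv => ?_⟩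
    · rw [norm, ← h3, ← he]
    · rw [rename, cnt, List.countP_map]
      exact (List.filter_sublist).countP_le
    · have hv' := List.mem_append.1 hv
      rw [h2 v (by tauto)]
      exact hpn _ v hv'

/-! ### Abstract runs -/

/-- The normal forms of the results of steps, with at most `N` tracked items. -/
def succs (𝒢 : Program) (N : ℕ) (α : List (Entry Bool)) : List (Bool × List (Entry Bool)) :=
  ((steps 𝒢 α).map fun r => (r.1, norm 𝒢.free r.2)).filter fun r => cnt r.2 ≤ N

theorem mem_succs {𝒢 : Program} {N : ℕ} {α α' : List (Entry Bool)} {b : Bool} :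
    (b, α') ∈ succs 𝒢 N α ↔ (∃ β, (b, β) ∈ steps 𝒢 α ∧ α' = norm 𝒢.free β) ∧ cnt α' ≤ N := by
  simp only [succs, List.mem_filter, List.mem_map, Prod.mk.injEq, Prod.exists, decide_eq_true_eq]
  constructor
  · rintro ⟨⟨_, β, h, rfl, rfl⟩, h'⟩
    exact ⟨⟨β, h, rfl⟩, h'⟩
  · rintro ⟨⟨β, h, rfl⟩, h'⟩
    exact ⟨⟨_, β, h, rfl, rfl⟩, h'⟩

/-- Abstract runs with `n` tracked steps. -/
inductive APath (𝒢 : Program) (N : ℕ) : ℕ → List (Entry Bool) → List (Entry Bool) → Prop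
  | refl (α) : APath 𝒢 N 0 α α
  | step {n α α' α'' b} (h : APath 𝒢 N n α α') (h' : (b, α'') ∈ succs 𝒢 N α') :
      APath 𝒢 N (n + b.toNat) α α''

/-- Properties of normal forms. -/
structure Normal (F : List Val) (α : List (Entry Bool)) : Prop where
  owned : Owned F α
  ne_nil : ∀ e ∈ α, e.1 = false → e.2.2 ≠ .inr .nil

theorem normal_norm (F : List Val) (α : List (Entry Bool)) : Normal F (norm F α) :=
  ⟨(norm_spec F α).2.1, (norm_spec F α).2.2.1⟩

theorem sim_norm (F : List Val) (α : List (Entry Bool)) : Sim F (norm F α) α := (norm_spec F α).1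

theorem Sim.cnt_eq {F : List Val} {α w : List (Entry Bool)} (h : Sim F α w) : cnt α = cnt w := by
  obtain ⟨_, _, h⟩ := h
  exact h.cnt_eq

theorem APath.normal {𝒢 : Program} {N n : ℕ} {α α' : List (Entry Bool)} (h : APath 𝒢 N n α α')
    (hα : Normal 𝒢.free α) : Normal 𝒢.free α' := by
  cases h with
  | refl => exact hα
  | step h h' =>
    obtain ⟨⟨β, -, rfl⟩, -⟩ := mem_succs.1 h'
    exact normal_norm _ _

/-- Abstract runs simulate marked runs. -/
theorem Run.apath {𝒢 : Program} (h𝒢 : 𝒢.Pure) {N n : ℕ} {w w' : List (Entry Bool)}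
    (h : Run 𝒢 N n w w') {α : List (Entry Bool)} (hα : Normal 𝒢.free α)
    (hs : Sim 𝒢.free α w) : ∃ α', APath 𝒢 N n α α' ∧ Sim 𝒢.free α' w' := by
  induction h with
  | refl w => exact ⟨α, .refl α, hs⟩
  | drop h h' ih =>
    obtain ⟨α', h1, h2⟩ := ih hs
    exact ⟨α', h1, h2.drop (h1.normal hα).ne_nil h'⟩
  | exec h h' hN ih =>
    obtain ⟨α', h1, h2⟩ := ih hs
    rcases h2.exec h𝒢 (h1.normal hα).owned h' with ⟨rfl, h3⟩ | ⟨β, h3, h4⟩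
    · exact ⟨α', h1, h3⟩
    · have h5 := (sim_norm 𝒢.free β).trans h4
      exact ⟨_, .step h1 (mem_succs.2 ⟨⟨β, h3, rfl⟩, by rwa [h5.cnt_eq]⟩), h5⟩

/-! ### Resolvable items -/

/-- An index above all those in `X` and among the values already chosen is fresh for every kind. -/
theorem exists_fresh (ν X : List Val) :
    ∃ ν' : List Val, ν'.Nodup ∧ ν.map kind = ν'.map kind ∧ ∀ v ∈ ν', v ∉ X := by
  induction ν with
  | nil => exact ⟨[], by simp, rfl, by simp⟩
  | cons v ν ih =>
    obtain ⟨ν', h1, h2, h3⟩ := ih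
    have h4 : v.retag (bnd (X ++ ν')) ∉ X ++ ν' := fun h => by
      have := idx_lt_bnd h
      rw [Val.idx_retag] at this
      omega
    rw [List.mem_append, not_or] at h4
    refine ⟨_ :: ν', List.nodup_cons.2 ⟨h4.2, h1⟩, by simp [h2, Val.kind_retag], ?_⟩
    intro u hu
    rcases List.mem_cons.1 hu with rfl | hu
    · exact h4.1
    · exact h3 u hu

/-- `Res 𝒢 K n Pr B i z`: the item `z` of `B` can be executed until it satisfies `Pr` or is
finished, and so can the messages to known actors that are sent. -/
inductive Res (𝒢 : Program) (K : List Val) (n : ℕ) (Pr : Val → ℕ → Item → Prop) :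
    Val → ℕ → Item → Prop
  | present {B i z} (h : Pr B i z) : Res 𝒢 K n Pr B i z
  | done {B i} : Res 𝒢 K n Pr B i (.inr .nil)
  | step {B i z ν o z'} (hν : ν.Nodup) (hf : ∀ v ∈ ν, v ∉ K ∧ v ∉ z.vals)
      (h : LStep 𝒢 B z ν o z') (hr : Res 𝒢 K n Pr B i z')
      (ho : ∀ p, o = some p → p.1 ∈ K → Res 𝒢 K n Pr p.1 n p.2) : Res 𝒢 K n Pr B i z

theorem Res.mono {𝒢 : Program} {K n Pr} (hPr : ∀ B i j z, i ≤ j → Pr B i z → Pr B j z) {B i z}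
    (h : Res 𝒢 K n Pr B i z) {j : ℕ} (hij : i ≤ j) : Res 𝒢 K n Pr B j z := by
  induction h generalizing j with
  | present h => exact .present (hPr _ _ _ _ hij h)
  | done => exact .done
  | step hν hf h hr ho ih _ => exact .step hν hf h (ih hij) ho

/-- Resolvability survives a change of the known values from `K` to `K₁`, where `X` contains the
newly known ones, and of the target items. The new values of a derivation are generic, so they can
be chosen outside of `K₁` and `X`. Then no value in `X` ever turns up, and a message whose receiver
lies in `K₁` is one whose receiver lay in `K`, for which a derivation is at hand. -/
theorem Res.transfer {𝒢 : Program} (h𝒢 : 𝒢.Pure) {K n Pr K₁ n₁ Pr₁} {X : List Val}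
    {f : ℕ → ℕ} (hK₁ : ∀ v ∈ K₁, v ∈ K ∨ v ∈ X) (hX : ∀ v ∈ X, v ∉ K) (hn : f n ≤ n₁)
    (hPr₁ : ∀ B i j z, i ≤ j → Pr₁ B i z → Pr₁ B j z)
    (hPr : ∀ B i z (k : Equiv.Perm Val), Pr B i z → B ∈ K → Fixes K k →
      (∀ v ∈ X, v ∉ (z.mapVal k).vals) → Res 𝒢 K₁ n₁ Pr₁ B (f i) (z.mapVal k))
    {B i z} (h : Res 𝒢 K n Pr B i z) (hB : B ∈ K) {k : Equiv.Perm Val} (hk : Fixes K k)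
    (hkX : ∀ v ∈ X, v ∉ (z.mapVal k).vals) : Res 𝒢 K₁ n₁ Pr₁ B (f i) (z.mapVal k) := by
  induction h generalizing k with
  | present h => exact hPr _ _ _ _ h hB hk hkX
  | done => exact .done
  | @step B i z ν o z' hν hf h hr ho ih ih' =>
    -- Avoiding `K` and the item allows `k` to be extended; avoiding `K₁` and `X` keeps the new
    -- values apart from everything that is known afterwards.
    obtain ⟨ν₁, h1, h2, h3⟩ := exists_fresh ν (K ++ K₁ ++ X ++ (z.mapVal k).vals)
    simp only [List.mem_append, not_or] at h3
    obtain ⟨k₁, hk₁, hk₁z, hk₁ν⟩ := hk.exists_list {v | v ∈ z.vals} hν h1 (fun v hv => (hf v hv).2)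
      (fun v hv x hx hxv => (h3 v hv).2 (by
        rw [Item.vals_mapVal, ← hxv]
        exact List.mem_map_of_mem hx)) (fun v hv => (hf v hv).1) (fun v hv => (h3 v hv).1.1.1) h2
    have hz : z.mapVal k₁ = z.mapVal k := Item.mapVal_congr hk₁z
    have hs := h.perm h𝒢 hk₁.kind_eq
    rw [hk₁.fix B hB, hz, hk₁ν] at hs
    obtain ⟨hv1, hv2⟩ := h.mem_vals h𝒢
    have key : ∀ v ∈ X, ∀ u, u = B ∨ u ∈ z.vals ∨ u ∈ ν → k₁ u ≠ v := by
      rintro v hv u (rfl | hu | hu) rfl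
      · rw [hk₁.fix _ hB] at hv
        exact hX _ hv hB
      · rw [hk₁z u hu] at hv
        refine hkX _ hv ?_
        rw [Item.vals_mapVal]
        exact List.mem_map_of_mem hu
      · have : k₁ u ∈ ν₁ := hk₁ν ▸ List.mem_map_of_mem hu
        exact (h3 _ this).1.2 hv
    refine .step h1 (fun v hv => ⟨(h3 v hv).1.1.2, (h3 v hv).2⟩) hs (ih hB hk₁ ?_) ?_
    · intro v hv hv'
      rw [Item.vals_mapVal, List.mem_map] at hv'
      obtain ⟨u, hu, rfl⟩ := hv'
      exact key _ hv u (hv1 u hu) rfl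
    · intro p hp hpK
      obtain ⟨q, rfl, rfl⟩ := Option.map_eq_some_iff.1 hp
      obtain ⟨-, hq1, hq2⟩ := hv2 q rfl
      simp only at hpK ⊢
      have hqK : q.1 ∈ K := by
        rcases hK₁ _ hpK with h' | h'
        · have := hk₁.fix _ h'
          rwa [k₁.injective this] at h'
        · exact absurd rfl (key _ h' q.1 (.inr (.inl hq1)))
      rw [hk₁.fix _ hqK]
      -- A sent message is to be resolved at the end of the list, and the old end `n` is mapped to a
      -- position `f n ≤ n₁`.
      refine (ih' q rfl hqK hqK hk₁ ?_).mono hPr₁ hn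
      intro v hv hv'
      rw [Item.vals_mapVal, List.mem_map] at hv'
      obtain ⟨u, hu, rfl⟩ := hv'
      exact key _ hv u (.inr (hq2 u hu)) rfl

theorem Item.mapVal_one (z : Item) : z.mapVal ((1 : Equiv.Perm Val) : Val → Val) = z := z.mapVal_id

theorem Res.perm {𝒢 : Program} (h𝒢 : 𝒢.Pure) {K n Pr}
    (hmono : ∀ B i j z, i ≤ j → Pr B i z → Pr B j z)
    (hPr : ∀ B i z (k : Equiv.Perm Val), Pr B i z → B ∈ K → Fixes K k →
      Pr B i (z.mapVal k))
    {B i z} (h : Res 𝒢 K n Pr B i z) (hB : B ∈ K) {k : Equiv.Perm Val} (hk : Fixes K k) :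
    Res 𝒢 K n Pr B i (z.mapVal k) :=
  h.transfer h𝒢 (X := []) (f := id) (fun v hv => .inl hv) (by simp) le_rfl hmono
    (fun B i z k h hB hk _ => .present (hPr B i z k h hB hk)) hB hk (by simp)

/-! ### Positions -/

/-- The entry `e` occurs in `w` after `j` tracked entries. -/
def At (w : List (Entry Bool)) (j : ℕ) (e : Entry Bool) : Prop :=
  ∃ L R, w = L ++ e :: R ∧ cnt L = j

theorem cnt_append (L R : List (Entry Bool)) : cnt (L ++ R) = cnt L + cnt R := List.countP_append

theorem cnt_cons (e : Entry Bool) (R : List (Entry Bool)) : cnt (e :: R) = e.1.toNat + cnt R := by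
  obtain ⟨b, e⟩ := e
  cases b <;> simp [cnt, add_comm]

theorem At.mem {w j e} (h : At w j e) : e ∈ w := by
  obtain ⟨L, R, rfl, -⟩ := h
  simp

theorem At.le {w j e} (h : At w j e) : j ≤ cnt w := by
  obtain ⟨L, R, rfl, rfl⟩ := h
  simp [cnt_append]

theorem exists_at {w : List (Entry Bool)} {e} (h : e ∈ w) : ∃ j, At w j e := by
  obtain ⟨L, R, rfl⟩ := List.append_of_mem h
  exact ⟨_, L, R, rfl, rfl⟩

theorem at_cons {a w j e} : At (a :: w) j e ↔ j = 0 ∧ e = a ∨ ∃ i, At w i e ∧ j = a.1.toNat + i := by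
  constructor
  · rintro ⟨L, R, h, rfl⟩
    cases L with
    | nil =>
      cases h
      exact .inl ⟨rfl, rfl⟩
    | cons b L =>
      cases h
      exact .inr ⟨_, ⟨L, R, rfl, rfl⟩, cnt_cons _ _⟩
  · rintro (⟨rfl, rfl⟩ | ⟨_, ⟨L, R, rfl, rfl⟩, rfl⟩)
    · exact ⟨[], w, rfl, rfl⟩
    · exact ⟨a :: L, R, rfl, cnt_cons _ _⟩

theorem at_append {w w' j e} : At (w ++ w') j e ↔ At w j e ∨ ∃ i, At w' i e ∧ j = cnt w + i := by
  induction w generalizing j with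
  | nil =>
    have : ¬ At [] j e := by
      rintro ⟨L, R, h, -⟩
      simp at h
    simp [this, cnt]
  | cons a w ih =>
    rw [List.cons_append, at_cons, at_cons, cnt_cons]
    constructor
    · rintro (h | ⟨i, h, rfl⟩)
      · exact .inl (.inl h)
      · rcases ih.1 h with h' | ⟨k, h', rfl⟩
        · exact .inl (.inr ⟨i, h', rfl⟩)
        · exact .inr ⟨k, h', by omega⟩
    · rintro ((h | ⟨i, h, rfl⟩) | ⟨i, h, rfl⟩)
      · exact .inl h
      · exact .inr ⟨i, ih.2 (.inl h), rfl⟩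
      · exact .inr ⟨_, ih.2 (.inr ⟨i, h, rfl⟩), by omega⟩

theorem at_map {g : Val → Val} {w j e} (h : At (w.map (Entry.mapVal g)) j e) :
    ∃ e', At w j e' ∧ e = e'.mapVal g := by
  obtain ⟨L, R, h1, rfl⟩ := h
  obtain ⟨L', R', rfl, rfl, h2⟩ := List.map_eq_append_iff.1 h1
  obtain ⟨e', R'', rfl, rfl, rfl⟩ := List.map_eq_cons_iff.1 h2
  refine ⟨e', ⟨L', R'', rfl, ?_⟩, rfl⟩
  rw [cnt, cnt, List.countP_map]
  rfl

theorem tracked_append (L R : List (Entry Bool)) : tracked (L ++ R) = tracked L ++ tracked R :=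
  List.filter_append ..

theorem tracked_true (p : Val × Item) (w : List (Entry Bool)) :
    tracked ((true, p) :: w) = (true, p) :: tracked w := rfl

theorem tracked_false (p : Val × Item) (w : List (Entry Bool)) :
    tracked ((false, p) :: w) = tracked w := rfl

theorem tracked_eq_nil {w : List (Entry Bool)} (h : ∀ e ∈ w, e.1 = false) : tracked w = [] := by
  rw [tracked, List.filter_eq_nil_iff]
  intro e he
  simp [h e he]

theorem cnt_eq_length (w : List (Entry Bool)) : cnt w = (tracked w).length :=
  List.countP_eq_length_filter

theorem known_congr {F : List Val} {w w' : List (Entry Bool)} (h : tracked w = tracked w') :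
    known F w = known F w' := by
  rw [known, h, known]

/-! ### Flushing -/

/-- Since `Pr` holds of nothing for `B` at `i`, the derivation has to end in `done`. It is then a
script by which a concrete configuration runs the item to `0` and removes it. Emitted items are
appended; those of known owners are again resolvable. -/
theorem Res.flush {𝒢 : Program} (h𝒢 : 𝒢.Pure) {K n Pr}
    (hmono : ∀ B i j z, i ≤ j → Pr B i z → Pr B j z)
    (hPr : ∀ B i z (k : Equiv.Perm Val), Pr B i z → B ∈ K → Fixes K k →
      Pr B i (z.mapVal k))
    {B i z} (h : Res 𝒢 K n Pr B i z) (hno : ∀ z, ¬ Pr B i z) (hB : B ∈ K) {T : Config}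
    {L R : List (Entry Bool)} {k : Equiv.Perm Val} (hk : Fixes K k)
    (hT : Rep T (L ++ (false, B, z.mapVal k) :: R)) (hL : ∀ e ∈ L, e.2.1 ≠ B)
    (hK : K = known 𝒢.free (L ++ R)) :
    ∃ T' outs, Reach 𝒢 T T' ∧ Rep T' (L ++ (R ++ outs)) ∧
      ∀ e ∈ outs, e.1 = false ∧ (e.2.1 ∈ K → Res 𝒢 K n Pr e.2.1 n e.2.2) := by
  induction h generalizing T R k with
  | present h => exact absurd h (hno _)
  | done => exact ⟨T, [], .refl, by simpa using hT.drop hL, by simp⟩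
  | @step B i z ν o z' hν hf h hr ho ih ih' =>
    obtain ⟨o₁, z₁, hs, -⟩ : ∃ o₁ z₁, LStep 𝒢 B (z.mapVal k) (ν.map k) o₁ z₁ ∧ True := by
      have := h.perm h𝒢 hk.kind_eq
      rw [hk.fix B hB] at this
      exact ⟨_, _, this, trivial⟩
    obtain ⟨ν₁, h1, h2, h3, h4⟩ := hT.step h𝒢 hL hs
    have hKw : ∀ v ∈ K, v ∈ 𝒢.free ∨ v ∈ stateVals (L ++ (false, B, z.mapVal k) :: R) := by
      intro v hv
      apply known_subset
      have ht : tracked (L ++ (false, B, z.mapVal k) :: R) = tracked (L ++ R) := by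
        simp [tracked]
      rwa [known_congr ht, ← hK]
    have hνK : ∀ v ∈ ν₁, v ∉ K := fun v hv hvK => by
      rcases hKw v hvK with h' | h'
      · exact (h3 v hv).1 h'
      · exact (h3 v hv).2 h'
    -- The generic new values of the derivation are renamed to the ones that the configuration
    -- imposes.
    obtain ⟨k₁, hk₁, hk₁z, hk₁ν⟩ := hk.exists_list {v | v ∈ z.vals} hν h2
      (fun v hv => (hf v hv).2) (by
        rintro v hv x hx rfl
        refine (h3 _ hv).2 (mem_stateVals'.2 ⟨_, List.mem_append_right _ List.mem_cons_self, ?_⟩)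
        simp only [Entry.vals, Item.vals_mapVal, List.mem_cons]
        exact .inr (List.mem_map_of_mem hx)) (fun v hv => (hf v hv).1) hνK (by
          rw [← h1, List.map_map]
          exact List.map_congr_left fun v _ => (hk.kind_eq v).symm)
    have hz : z.mapVal k₁ = z.mapVal k := Item.mapVal_congr hk₁z
    have hs₁ := h.perm h𝒢 hk₁.kind_eq
    rw [hk₁.fix B hB, hz, hk₁ν] at hs₁
    obtain ⟨T₁, h5, h6⟩ := h4 _ _ hs₁
    have h7 := h6 false ((outItems (o.map fun p => (k₁ p.1, p.2.mapVal k₁)) ν₁).map fun p =>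
      (false, p)) (by simp [Function.comp_def])
    set outs : List (Entry Bool) := (outItems (o.map fun p => (k₁ p.1, p.2.mapVal k₁)) ν₁).map
      fun p => (false, p) with houts
    have hout : ∀ e ∈ outs, e.1 = false ∧ (e.2.1 ∈ K → Res 𝒢 K n Pr e.2.1 n e.2.2) := by
      intro e he
      obtain ⟨p, hp, rfl⟩ := List.mem_map.1 he
      refine ⟨rfl, fun hpK => ?_⟩
      rcases mem_outItems.1 hp with hp | ⟨-, hp, -⟩
      · obtain ⟨q, rfl, rfl⟩ := Option.map_eq_some_iff.1 hp
        simp only at hpK ⊢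
        have hqK : q.1 ∈ K := by
          have := hk₁.fix _ hpK
          rwa [k₁.injective this] at hpK
        rw [hk₁.fix _ hqK]
        exact (ho q rfl hqK).perm h𝒢 hmono hPr hqK hk₁
      -- A new actor is not known, so nothing is required of its items.
      · exact absurd hpK (hνK _ hp)
    obtain ⟨T', outs', h8, h9, h10⟩ := ih hno hB hk₁ (R := R ++ outs) (by simpa using h7) hL (by
      rw [hK]
      apply known_congr
      rw [← List.append_assoc, tracked_append (L ++ R), tracked_eq_nil fun e he => (hout e he).1,
        List.append_nil])
    refine ⟨T', outs ++ outs', .head h5 h8, by simpa using h9, ?_⟩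
    intro e he
    rcases List.mem_append.1 he with he | he
    · exact hout e he
    · exact h10 e he

/-! ### Concretization of abstract runs -/

/-- All the items of known actors that are not tracked can be resolved. -/
def Junk (𝒢 : Program) (K : List Val) (n : ℕ) (Pr : Val → ℕ → Item → Prop)
    (w : List (Entry Bool)) : Prop :=
  ∀ j e, At w j e → e.1 = false → e.2.1 ∈ K → Res 𝒢 K n Pr e.2.1 j e.2.2

/-- The item `z` of `B` occurs in `α`, after at most `i` tracked entries, up to a permutation that
agrees with `h` on known values. -/
def Pres (F : List Val) (α : List (Entry Bool)) (h : Equiv.Perm Val) (B : Val) (i : ℕ) (z : Item) :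
    Prop :=
  ∃ j e g, At α j e ∧ e.1 = false ∧ j ≤ i ∧ Fixes F g ∧ (∀ v ∈ known F α, g v = h v) ∧
    B = g e.2.1 ∧ z = e.2.2.mapVal g

theorem Pres.mono {F α h} (B : Val) (i j : ℕ) (z : Item) (hij : i ≤ j) (hp : Pres F α h B i z) :
    Pres F α h B j z := by
  obtain ⟨k, e, g, h1, h2, h3, h4⟩ := hp
  exact ⟨k, e, g, h1, h2, h3.trans hij, h4⟩

/-- The list `w` differs from `α`, up to a permutation, in that the items that are not tracked
still have to be executed. -/
def Lag (𝒢 : Program) (α w : List (Entry Bool)) : Prop :=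
  ∃ h, Fixes 𝒢.free h ∧ tracked w = (tracked α).map (Entry.mapVal h) ∧
    Junk 𝒢 (known 𝒢.free w) (cnt α) (Pres 𝒢.free α h) w

theorem known_eq_map {F : List Val} {α w : List (Entry Bool)} {h : Equiv.Perm Val}
    (hF : Fixes F h) (ht : tracked w = (tracked α).map (Entry.mapVal h)) :
    known F w = (known F α).map h := by
  rw [known, ht, stateVals_map, known, List.map_append, hF.map_eq]

theorem Pres.perm {F α w h} (hF : Fixes F h) (ht : tracked w = (tracked α).map (Entry.mapVal h))
    (B : Val) (i : ℕ) (z : Item) (k : Equiv.Perm Val) (hp : Pres F α h B i z) (hB : B ∈ known F w)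
    (hk : Fixes (known F w) k) : Pres F α h B i (z.mapVal k) := by
  obtain ⟨j, e, g, h1, h2, h3, h4, h5, h6, rfl⟩ := hp
  refine ⟨j, e, k * g, h1, h2, h3, (hk.mono (by simp [known])).mul h4, fun v hv => ?_, ?_, ?_⟩
  · rw [Equiv.Perm.mul_apply, h5 v hv]
    refine hk.fix _ ?_
    rw [known_eq_map hF ht]
    exact List.mem_map_of_mem hv
  · rw [Equiv.Perm.mul_apply, ← h6, hk.fix _ hB]
  · rw [Item.mapVal_mapVal]
    rfl

/-- Clears the way for a tracked item. The untracked items of `A` before it are run to the end one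
by one, each on its own; what they emit lands behind all tracked entries, so nothing new gets in the
way. -/
theorem Junk.flush {𝒢 : Program} (h𝒢 : 𝒢.Pure) {K n Pr}
    (hmono : ∀ B i j z, i ≤ j → Pr B i z → Pr B j z)
    (hPr : ∀ B i z (k : Equiv.Perm Val), Pr B i z → B ∈ K → Fixes K k → Pr B i (z.mapVal k))
    {T : Config} {L R : List (Entry Bool)} {A z} (hT : Rep T (L ++ (true, A, z) :: R))
    (hL : ∀ e ∈ L, e.1 = true → e.2.1 ≠ A) (hK : K = known 𝒢.free (L ++ (true, A, z) :: R))
    (hJ : Junk 𝒢 K n Pr (L ++ (true, A, z) :: R)) (hn : n = cnt (L ++ (true, A, z) :: R))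
    (hno : ∀ z, ¬ Pr A (cnt L) z) :
    ∃ T' L' R', Reach 𝒢 T T' ∧ Rep T' (L' ++ (true, A, z) :: R') ∧ tracked L' = tracked L ∧
      tracked R' = tracked R ∧ (∀ e ∈ L', e.2.1 ≠ A) ∧ Junk 𝒢 K n Pr (L' ++ (true, A, z) :: R') := by
  induction hm : L.countP (fun e => decide (e.2.1 = A)) using Nat.strong_induction_on
    generalizing T L R with
  | _ m ih =>
    by_cases hA : ∃ e ∈ L, e.2.1 = A
    · obtain ⟨e, he, heA⟩ := hA
      have hc : cont A L ≠ [] := by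
        intro h
        have : e.2.2 ∈ cont A L := mem_cont.2 ⟨e.1, by rw [← heA]; exact he⟩
        simp [h] at this
      obtain ⟨y, l, hyl⟩ := List.exists_cons_of_ne_nil hc
      obtain ⟨L₁, f, L₂, rfl, h1, -⟩ := cont_split hyl
      have hf : f = false := by
        by_contra hf
        exact hL (f, A, y) (by simp) (by simpa using hf) rfl
      subst hf
      have hAK : A ∈ K := by
        rw [hK, mem_known]
        exact .inr ⟨(true, A, z), by simp, rfl, by simp [Entry.vals]⟩
      have hcL : cnt L₁ ≤ cnt (L₁ ++ (false, A, y) :: L₂) := by simp [cnt_append]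
      have hres := hJ (cnt L₁) (false, A, y) ⟨L₁, L₂ ++ (true, A, z) :: R, by simp, rfl⟩ rfl hAK
      have hw : tracked (L₁ ++ (false, A, y) :: L₂ ++ (true, A, z) :: R) =
          tracked (L₁ ++ (L₂ ++ (true, A, z) :: R)) := by
        simp [tracked]
      obtain ⟨T', outs, h2, h3, h4⟩ := hres.flush h𝒢 hmono hPr (fun y hy => hno y (hmono _ _ _ _ hcL hy))
        hAK (.one K) (T := T) (L := L₁) (R := L₂ ++ (true, A, z) :: R)
        (by rw [Item.mapVal_one]; simpa using hT) h1 (by rw [hK, known_congr hw])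
      have h3' : Rep T' (L₁ ++ L₂ ++ (true, A, z) :: (R ++ outs)) := by simpa using h3
      have hto : tracked outs = [] := tracked_eq_nil fun e he => (h4 e he).1
      have hcnt : cnt (L₁ ++ L₂) = cnt (L₁ ++ (false, A, y) :: L₂) := by
        simp [cnt_append, cnt_cons]
      have hco : cnt outs = 0 := by rw [cnt_eq_length, hto]; rfl
      have hw' : tracked (L₁ ++ L₂ ++ (true, A, z) :: (R ++ outs)) =
          tracked (L₁ ++ (false, A, y) :: L₂ ++ (true, A, z) :: R) := by
        simp [tracked_append, tracked_true, tracked_false, hto]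
      -- Removing an untracked entry shifts no position, and the emitted entries stand at the last
      -- position `n`, the one for which they are resolvable.
      have hJ' : Junk 𝒢 K n Pr (L₁ ++ L₂ ++ (true, A, z) :: (R ++ outs)) := by
        intro j e hj he heK
        have : At (L₁ ++ (false, A, y) :: L₂ ++ (true, A, z) :: R) j e ∨ e ∈ outs ∧ j = n := by
          simp only [at_append, at_cons] at hj ⊢
          rcases hj with (hj | ⟨i, hj, rfl⟩) | ⟨i, ⟨rfl, rfl⟩ | ⟨_, hj | ⟨i, hj, rfl⟩, rfl⟩, rfl⟩
          · exact .inl (.inl (.inl hj))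
          · exact .inl (.inl (.inr ⟨i, .inr ⟨i, hj, by simp⟩, rfl⟩))
          · simp at he
          · exact .inl (.inr ⟨_, .inr ⟨_, hj, rfl⟩, by rw [hcnt]⟩)
          · refine .inr ⟨hj.mem, ?_⟩
            have := hj.le
            simp only [hn, cnt_append, cnt_cons, Bool.toNat_false]
            omega
        rcases this with h' | ⟨h', rfl⟩
        · exact hJ j e h' he heK
        · exact (h4 e h').2 heK
      obtain ⟨T'', L', R', h5, h6, h7, h8, h9, h10⟩ := ih _ (by
          rw [← hm]
          simp [List.countP_append]) h3' (L := L₁ ++ L₂) (fun e he => hL e (by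
          simp only [List.mem_append, List.mem_cons] at he ⊢
          tauto)) (by rw [hK]; exact known_congr hw'.symm) hJ'
          (by rw [hn, cnt_eq_length, cnt_eq_length, hw']) (by rwa [hcnt]) rfl
      refine ⟨T'', L', R', h2.trans h5, h6, ?_, ?_, h9, h10⟩
      · rw [h7, tracked_append, tracked_append, tracked_false]
      · rw [h8, tracked_append, hto, List.append_nil]
    · push Not at hA
      exact ⟨T, L, R, .refl, hT, rfl, rfl, hA, hJ⟩

/-- An item that occurs in `α` has a copy in the normal form by the last clause of `norm_spec`,
except for finished processes, which are resolved by `done`. Entries of unknown owners were never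
targets for known ones. -/
theorem Lag.norm {𝒢 : Program} (h𝒢 : 𝒢.Pure) {α w : List (Entry Bool)} (h : Lag 𝒢 α w) :
    Lag 𝒢 (norm 𝒢.free α) w := by
  obtain ⟨h, hh, ht, hJ⟩ := h
  obtain ⟨-, -, -, p, hp, hpt, hpj⟩ := norm_spec 𝒢.free α
  have ht' : tracked w = (tracked (ActorSL.norm 𝒢.free α)).map (Entry.mapVal (h * p⁻¹)) := by
    rw [hpt, List.map_map, ht]
    refine List.map_congr_left fun e _ => ?_
    rw [Function.comp_apply, Entry.mapVal_mapVal, ← Equiv.Perm.coe_mul, inv_mul_cancel_right]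
  refine ⟨h * p⁻¹, hh.mul hp.inv, ht', fun j e hj he heK => ?_⟩
  have hcnt : cnt (ActorSL.norm 𝒢.free α) = cnt α := by
    rw [cnt_eq_length, hpt, List.length_map, cnt_eq_length]
  have hkα := known_eq_map hp hpt
  have key := (hJ j e hj he heK).transfer h𝒢 (X := []) (f := id)
    (Pr₁ := Pres 𝒢.free (ActorSL.norm 𝒢.free α) (h * p⁻¹)) (n₁ := cnt (ActorSL.norm 𝒢.free α))
    (fun v hv => .inl hv) (by simp) hcnt.ge Pres.mono ?_ heK (.one _) (by simp)
  · rwa [Item.mapVal_one] at key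
  · intro B i z k hz hB hk _
    obtain ⟨j, ⟨b, A, x⟩, g, ⟨L, R, h1, h1'⟩, rfl, h3, h4, h5, h6, h7⟩ := hz.perm hh ht _ _ _ _ hB hk
    rw [h7]
    by_cases hx : x = .inr .nil
    · rw [hx]
      exact .done
    have hA : A ∈ known 𝒢.free α := by
      rw [known_eq_map hh ht, h6, List.mem_map] at hB
      obtain ⟨u, hu, hu'⟩ := hB
      rw [← h5 u hu] at hu'
      have hu'' : u = A := g.injective hu'
      rwa [hu''] at hu
    obtain ⟨L', R', g', k1, k2, k3, k4⟩ := hpj L A x R h1 hA hx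
    refine .present ⟨_, _, g * g'⁻¹, ⟨L', R', k1, rfl⟩, rfl, by simp only [id]; omega,
      h4.mul k3.inv, fun v hv => ?_, by simpa using h6, ?_⟩
    · rw [hkα, List.mem_map] at hv
      obtain ⟨u, hu, rfl⟩ := hv
      conv_lhs => rw [← k4 u hu]
      simp [h5 u hu]
    · rw [Item.mapVal_mapVal, ← Equiv.Perm.coe_mul, inv_mul_cancel_right]

/-- The form of `Fixes.exists_list` in which the protected values `X` already include those that are
fixed. -/
theorem exists_extend {F X ν ν' : List Val} {g : Equiv.Perm Val} (hg : Fixes F g) (hν : ν.Nodup)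
    (hν' : ν'.Nodup) (hk : ν.map kind = ν'.map kind) (hX : ∀ v ∈ ν, v ∉ X)
    (hX' : ∀ v ∈ ν', v ∉ X.map g) (hF : F ⊆ X) :
    ∃ g', Fixes F g' ∧ (∀ v ∈ X, g' v = g v) ∧ ν.map g' = ν' := by
  refine hg.exists_list {v | v ∈ X} hν hν' hX (fun v hv x hx hxv => hX' v hv ?_)
    (fun v hv h => hX v hv (hF h)) (fun v hv h => hX' v hv ?_) hk
  · rw [← hxv]
    exact List.mem_map_of_mem hx
  · rw [← hg.fix v h]
    exact List.mem_map_of_mem (hF h)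

theorem free_subset_known (F : List Val) (w : List (Entry Bool)) : F ⊆ known F w := by
  simp [known]

/-- The concrete list does not move. The abstract step becomes part of the resolution: whatever was
a copy of the old item can now make the same step, become a copy of the new one and send a copy of
the message that `α₁` contains. -/
theorem Lag.junk_step {𝒢 : Program} (h𝒢 : 𝒢.Pure) {α α₁ w : List (Entry Bool)}
    (hα : Owned 𝒢.free α) (h : Lag 𝒢 α w) (hs : (false, α₁) ∈ steps 𝒢 α) : Lag 𝒢 α₁ w := by
  obtain ⟨h, hh, ht, hJ⟩ := h
  obtain ⟨L, ⟨b, A, x⟩, R, rfl, hs⟩ := mem_steps.1 hs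
  obtain ⟨hL, ν₀, o₀, x', f', outs, h1, h2, h3, h4, h5, h6⟩ := mem_stepsAt.1 hs
  simp only [Prod.mk.injEq] at h6 hL h1 h2 h4 h5
  obtain ⟨rfl, rfl⟩ := h6
  have hf' : f' = false := by simpa [bchild] using h4
  subst hf'
  have hout : ∀ e ∈ outs, e.1 = false := fun e he => by simpa [bchild] using h5 e he
  have hto : tracked outs = [] := tracked_eq_nil hout
  have htα : tracked (L ++ (false, A, x') :: R ++ outs) = tracked (L ++ (false, A, x) :: R) := by
    simp [tracked_append, tracked_false, hto]
  have hcnt : cnt (L ++ (false, A, x') :: R ++ outs) = cnt (L ++ (false, A, x) :: R) := by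
    rw [cnt_eq_length, htα, cnt_eq_length]
  have hkα : known 𝒢.free (L ++ (false, A, x') :: R ++ outs) =
      known 𝒢.free (L ++ (false, A, x) :: R) := known_congr htα
  set α := L ++ (false, A, x) :: R with hαdef
  set α₁ := L ++ (false, A, x') :: R ++ outs with hα₁def
  have hA : A ∈ known 𝒢.free α := hα (false, A, x) (by simp [hαdef])
  refine ⟨h, hh, by rw [ht, htα], fun j e hj he heK => ?_⟩
  have key := (hJ j e hj he heK).transfer h𝒢 (X := []) (f := id)
    (Pr₁ := Pres 𝒢.free α₁ h) (n₁ := cnt α₁)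
    (fun v hv => .inl hv) (by simp) hcnt.ge Pres.mono ?_ heK (.one _) (by simp)
  · rwa [Item.mapVal_one] at key
  intro B i z k hz hB hk _
  obtain ⟨j, e, g, m1, m2, m3, m4, m5, m6, m7⟩ := hz.perm hh ht _ _ _ _ hB hk
  have hcase : At α₁ j e ∨ j = cnt L ∧ e = (false, A, x) := by
    simp only [hαdef, hα₁def, at_append, at_cons] at m1 ⊢
    rcases m1 with m1 | ⟨i, ⟨rfl, rfl⟩ | ⟨i, m1, rfl⟩, rfl⟩
    · exact .inl (.inl (.inl m1))
    · exact .inr (by simp)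
    · exact .inl (.inl (.inr ⟨_, .inr ⟨i, m1, rfl⟩, rfl⟩))
  rcases hcase with hcase | ⟨rfl, rfl⟩
  · exact .present ⟨j, e, g, hcase, m2, m3, m4, by rwa [hkα], m6, m7⟩
  simp only at m6 m7
  rw [m7]
  have hfr := supply_used h2
  have hUx : ∀ v ∈ known 𝒢.free α ++ x.vals, v ∈ usedVals 𝒢 α := by
    intro v hv
    rw [usedVals, List.mem_append]
    rcases List.mem_append.1 hv with hv | hv
    · exact known_subset hv
    · exact .inr (mem_stateVals'.2 ⟨(false, A, x), by simp [hαdef], by simp [Entry.vals, hv]⟩)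
  -- Each copy makes the step with new values of its own. They stay unknown, because the acting
  -- entry is not tracked.
  obtain ⟨ν, n1, n2, n3⟩ := exists_fresh ν₀ ((known 𝒢.free α ++ x.vals).map g)
  obtain ⟨g', p1, p2, p3⟩ := exists_extend m4 (X := known 𝒢.free α ++ x.vals) h2.spec.1 n1 n2
    (fun v hv hv' => hfr v hv (hUx v hv')) n3
    (fun v hv => List.mem_append_left _ (free_subset_known _ _ hv))
  have hkg : known 𝒢.free w = (known 𝒢.free α).map g := by
    rw [known_eq_map hh ht]
    exact List.map_congr_left fun v hv => (m5 v hv).symm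
  have hstep := h1.perm h𝒢 p1.kind_eq
  rw [p3, p2 A (by simp [hA]), ← m6, Item.mapVal_congr fun v hv => p2 v (by simp [hv])] at hstep
  have hg'K : ∀ v ∈ known 𝒢.free α₁, g' v = h v := fun v hv => by
    rw [hkα] at hv
    rw [p2 v (by simp [hv]), m5 v hv]
  refine .step n1 (fun v hv => ?_) hstep (.present ⟨cnt L, (false, A, x'), g', ?_, rfl, m3, p1, hg'K,
    ?_, rfl⟩) ?_
  · have := n3 v hv
    rw [List.map_append, List.mem_append, not_or, ← hkg] at this
    rwa [Item.vals_mapVal]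
  · exact ⟨L, R ++ outs, by simp [hα₁def], rfl⟩
  · rw [m6, p2 A (by simp [hA])]
  · rintro p hp -
    obtain ⟨q, rfl, rfl⟩ := Option.map_eq_some_iff.1 hp
    have hq : q ∈ outs.map Prod.snd := by
      rw [h3]
      exact mem_outItems.2 (.inl rfl)
    obtain ⟨e, he, rfl⟩ := List.mem_map.1 hq
    obtain ⟨i, hi⟩ := exists_at (w := α₁) (e := e) (by simp [hα₁def, he])
    exact .present ⟨i, e, g', hi, hout e he, hcnt ▸ hi.le, p1, hg'K, rfl, rfl⟩

theorem outs_map {g : Equiv.Perm Val} (hg : ∀ v, kind (g v) = kind v) {o : Option (Val × Item)}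
    {ν : List Val} {outs : List (Entry Bool)} (h : outs.map Prod.snd = outItems o ν) :
    (outs.map (Entry.mapVal g)).map Prod.snd =
      outItems (o.map fun p => (g p.1, p.2.mapVal g)) (ν.map g) := by
  rw [outItems_map hg, ← h, List.map_map, List.map_map]
  rfl

theorem exists_split {w X Y : List (Entry Bool)} {e : Entry Bool} (h : tracked w = X ++ e :: Y) :
    ∃ L R, w = L ++ e :: R ∧ tracked L = X ∧ tracked R = Y := by
  obtain ⟨L, R₀, rfl, hX, hR⟩ := List.filter_eq_append_iff.1 h
  obtain ⟨L₂, R, rfl, hL₂, -, hY⟩ := List.filter_eq_cons_iff.1 hR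
  refine ⟨L ++ L₂, R, by simp, ?_, hY⟩
  rw [tracked_append, tracked_eq_nil (w := L₂) fun e he => by simpa using hL₂ e he, List.append_nil]
  exact hX

/-- The postponed items that block the acting entry are flushed, the entry makes its step in the
configuration, and the remaining obligations are restated for the enlarged set of known values and
the shifted positions. -/
theorem Lag.tracked_step {𝒢 : Program} (h𝒢 : 𝒢.Pure) {α α₁ w : List (Entry Bool)}
    (hα : Owned 𝒢.free α) (h : Lag 𝒢 α w) (hs : (true, α₁) ∈ steps 𝒢 α) {T : Config}
    (hT : Rep T w) :
    ∃ T₁ w₁, Relation.TransGen (Step 𝒢) T T₁ ∧ Rep T₁ w₁ ∧ Lag 𝒢 α₁ w₁ := by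
  obtain ⟨h, hh, ht, hJ⟩ := h
  obtain ⟨La, ⟨b, A, x⟩, Ra, rfl, hs⟩ := mem_steps.1 hs
  obtain ⟨hLa, ν₀, o₀, x', f', outs, h1, h2, h3, h4, h5, h6⟩ := mem_stepsAt.1 hs
  simp only [Prod.mk.injEq] at h6 hLa h1 h2 h4 h5
  obtain ⟨rfl, rfl⟩ := h6
  set α := La ++ (true, A, x) :: Ra with hαdef
  set α₁ := La ++ (f', A, x') :: Ra ++ outs with hα₁def
  have hA : A ∈ known 𝒢.free α := hα (true, A, x) (by simp [hαdef])
  have hinj : ∀ g : Equiv.Perm Val, (∀ v ∈ known 𝒢.free α, g v = h v) → ∀ v, g v = h A → v = A :=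
    fun g hg v hv => g.injective (hv.trans (hg A hA).symm)
  -- split `w` at the entry that makes the step
  have ht₀ : tracked w = (tracked La).map (Entry.mapVal h) ++
      (true, h A, x.mapVal h) :: (tracked Ra).map (Entry.mapVal h) := by
    rw [ht, hαdef, tracked_append, tracked_true, List.map_append, List.map_cons]
    rfl
  obtain ⟨L, R, rfl, htL, htR⟩ := exists_split ht₀
  have hcL : cnt L = cnt La := by rw [cnt_eq_length, htL, List.length_map, cnt_eq_length]
  have hkw := known_eq_map hh ht
  have hL : ∀ e ∈ L, e.1 = true → e.2.1 ≠ h A := by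
    intro e he hb heA
    have : e ∈ tracked L := by simp [tracked, he, hb]
    rw [htL, List.mem_map] at this
    obtain ⟨e', he', rfl⟩ := this
    exact hLa e' (List.mem_of_mem_filter he') (h.injective heA)
  -- In `α` the acting entry is the first of `A`. Any other entry of `A` comes after it and so has
  -- more than `cnt L` tracked entries before it.
  have hno : ∀ z, ¬ Pres 𝒢.free α h (h A) (cnt L) z := by
    rintro z ⟨j, e, g, k1, k2, k3, k4, k5, k6, k7⟩
    have heA := hinj g k5 _ k6.symm
    simp only [hαdef, at_append, at_cons] at k1
    rcases k1 with k1 | ⟨i, ⟨rfl, rfl⟩ | ⟨i, k1, rfl⟩, rfl⟩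
    · exact hLa e k1.mem heA
    · simp at k2
    · simp only [Bool.toNat_true] at k3
      omega
  obtain ⟨T', L', R', r1, r2, r3, r4, r5, r6⟩ := hJ.flush h𝒢 Pres.mono (Pres.perm hh ht) hT
    hL rfl (by rw [cnt_eq_length, cnt_eq_length, ht, List.length_map]) hno
  have hcL' : cnt L' = cnt La := by rw [cnt_eq_length, r3, ← cnt_eq_length, hcL]
  have htw : tracked (L' ++ (true, h A, x.mapVal h) :: R') =
      tracked (L ++ (true, h A, x.mapVal h) :: R) := by
    simp [tracked_append, tracked_true, r3, r4]
  have hs' := h1.perm h𝒢 hh.kind_eq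
  obtain ⟨ν, l1, l2, l3, l4⟩ := r2.step h𝒢 r5 hs'
  have hfr := supply_used h2
  have hUα : ∀ v, v ∈ known 𝒢.free α ∨ v ∈ stateVals α → v ∈ usedVals 𝒢 α := by
    intro v hv
    rw [usedVals, List.mem_append]
    rcases hv with hv | hv
    · exact known_subset hv
    · exact .inr hv
  have hνk : ∀ v ∈ ν, v ∉ (known 𝒢.free α).map h := by
    intro v hv hv'
    rw [← hkw, known_congr htw.symm] at hv'
    rcases known_subset hv' with h' | h'
    · exact (l3 v hv).1 h'
    · exact (l3 v hv).2 h'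
  have hkind : ν₀.map kind = ν.map kind := by
    rw [← l1, List.map_map]
    exact List.map_congr_left fun v _ => (hh.kind_eq v).symm
  obtain ⟨h', m1, m2, m3⟩ := exists_extend hh h2.spec.1 l2 hkind
    (fun v hv hv' => hfr v hv (hUα v (.inl hv'))) hνk (free_subset_known _ _)
  have hxk : ∀ v ∈ x.vals, v ∈ known 𝒢.free α := fun v hv =>
    mem_known.2 (.inr ⟨(true, A, x), by simp [hαdef], rfl, by simp [Entry.vals, hv]⟩)
  have hs'' := h1.perm h𝒢 m1.kind_eq
  rw [m2 A hA, Item.mapVal_congr fun v hv => m2 v (hxk v hv), m3] at hs''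
  obtain ⟨T₁, n1, n2⟩ := l4 _ _ hs''
  have n3 := n2 f' (outs.map (Entry.mapVal h')) (by rw [outs_map m1.kind_eq h3, m3])
  have hmapk : ∀ w : List (Entry Bool), (∀ e ∈ w, e ∈ α) →
      (tracked w).map (Entry.mapVal h) = (tracked w).map (Entry.mapVal h') := by
    intro w hw
    refine List.map_congr_left fun e he => Entry.mapVal_congr fun v hv => (m2 v ?_).symm
    have := List.mem_filter.1 he
    exact mem_known.2 (.inr ⟨e, hw e this.1, this.2, hv⟩)
  set w₁ := L' ++ (f', h A, x'.mapVal h') :: R' ++ outs.map (Entry.mapVal h') with hw₁def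
  have hto : tracked (outs.map (Entry.mapVal h')) = (tracked outs).map (Entry.mapVal h') := by
    rw [tracked, List.filter_map]
    rfl
  have ht₁ : tracked w₁ = (tracked α₁).map (Entry.mapVal h') := by
    have e1 := hmapk La fun e he => by simp [hαdef, he]
    have e2 := hmapk Ra fun e he => by simp [hαdef, he]
    have e3 : (true, h A, x'.mapVal h') = Entry.mapVal h' (true, A, x') := by
      simp [Entry.mapVal, m2 A hA]
    rw [hw₁def, hα₁def]
    cases f' <;> simp [tracked_append, tracked_true, tracked_false, hto, r3, r4, htL, htR,
      e1, e2, ← e3]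
  refine ⟨T₁, w₁, .tail' r1 n1, n3, h', m1, ht₁, ?_⟩
  have hK₁α : ∀ v ∈ known 𝒢.free α₁, v ∈ known 𝒢.free α ∨ v ∈ ν₀ := by
    intro v hv
    rcases known_exec h𝒢 h1 h3 h4 h5 hv with h' | h'
    · exact .inl h'
    · exact .inr h'.2
  set K := known 𝒢.free (L ++ (true, h A, x.mapVal h) :: R) with hKdef
  have hK₁ : ∀ v ∈ known 𝒢.free w₁, v ∈ K ∨ v ∈ ν := by
    intro v hv
    rw [known_eq_map m1 ht₁, List.mem_map] at hv
    obtain ⟨u, hu, rfl⟩ := hv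
    rcases hK₁α u hu with hu | hu
    · rw [m2 u hu, hkw]
      exact .inl (List.mem_map_of_mem hu)
    · exact .inr (m3 ▸ List.mem_map_of_mem hu)
  have hνK : ∀ v ∈ ν, v ∉ K := fun v hv hv' => hνk v hv (hkw ▸ hv')
  -- Positions count preceding tracked entries. Those beyond `cnt La` counted the acting entry as
  -- one, and it now counts as `f'.toNat`.
  let f : ℕ → ℕ := fun i => if i ≤ cnt La then i else i - 1 + f'.toNat
  have hfn : f (cnt α) ≤ cnt α₁ := by
    simp only [f, hαdef, hα₁def, cnt_append, cnt_cons, Bool.toNat_true]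
    split_ifs <;> omega
  have hfmono : ∀ i j, i ≤ j → f i ≤ f j := by
    intro i j hij
    simp only [f]
    split_ifs <;> omega
  have htrans : ∀ {B i z}, Res 𝒢 K (cnt α) (Pres 𝒢.free α h) B i z → B ∈ K →
      (∀ v ∈ ν, v ∉ z.vals) →
      Res 𝒢 (known 𝒢.free w₁) (cnt α₁) (Pres 𝒢.free α₁ h') B (f i) z := by
    intro B i z hres hB hz
    have := hres.transfer h𝒢 (Pr₁ := Pres 𝒢.free α₁ h') hK₁ hνK hfn Pres.mono ?_ hB (.one K)
      (by rwa [Item.mapVal_one])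
    · rwa [Item.mapVal_one] at this
    intro B i z k hp hB hk hkν
    obtain ⟨j, e, g, q1, q2, q3, q4, q5, q6, q7⟩ := hp.perm hh ht _ _ _ _ hB hk
    rw [q7] at hkν ⊢
    have hat : At α₁ (f j) e := by
      simp only [hαdef, hα₁def, at_append, at_cons] at q1 ⊢
      rcases q1 with q1 | ⟨i, ⟨rfl, rfl⟩ | ⟨i, q1, rfl⟩, rfl⟩
      · have := q1.le
        simp only [f, this, if_true]
        exact .inl (.inl q1)
      · simp at q2
      · refine .inl (.inr ⟨_, .inr ⟨i, q1, rfl⟩, ?_⟩)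
        simp only [f, Bool.toNat_true]
        split_ifs <;> omega
    have heU : ∀ v ∈ known 𝒢.free α ++ e.2.2.vals, v ∈ usedVals 𝒢 α := by
      intro v hv
      refine hUα v ?_
      rcases List.mem_append.1 hv with hv | hv
      · exact .inl hv
      · exact .inr (mem_stateVals.2 ⟨e, q1.mem, .inr hv⟩)
    -- The renaming of this copy must send the new abstract values to the new concrete ones, since
    -- they may be known from now on. This is possible because the copy does not contain the latter,
    -- by `hkν`.
    obtain ⟨g', s1, s2, s3⟩ := exists_extend q4 (X := known 𝒢.free α ++ e.2.2.vals) h2.spec.1 l2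
      hkind (fun v hv hv' => hfr v hv (heU v hv')) (fun v hv => by
        rw [List.map_append, List.mem_append, not_or, ← Item.vals_mapVal]
        refine ⟨?_, hkν v hv⟩
        rw [List.map_congr_left q5]
        exact hνk v hv)
      (fun v hv => List.mem_append_left _ (free_subset_known _ _ hv))
    have heB : e.2.1 ∈ known 𝒢.free α := by
      rw [hkw, q6, List.mem_map] at hB
      obtain ⟨u, hu, hu'⟩ := hB
      rw [← q5 u hu] at hu'
      have hu'' := g.injective hu'
      rwa [hu''] at hu
    refine .present ⟨f j, e, g', hat, q2, hfmono _ _ q3, s1, fun v hv => ?_, ?_, ?_⟩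
    · rcases hK₁α v hv with hv | hv
      · rw [s2 v (by simp [hv]), q5 v hv, m2 v hv]
      · exact List.map_inj_left.1 (s3.trans m3.symm) v hv
    · rw [q6, s2 _ (by simp [heB])]
    · exact Item.mapVal_congr fun v hv => (s2 v (by simp [hv])).symm
  intro j e hj he heK
  -- An entry that does not move does not contain the new values. If its owner is known now, it was
  -- known before, and the old obligation is transferred.
  have hold : ∀ i, At (L' ++ (true, h A, x.mapVal h) :: R') i e → f i = j →
      Res 𝒢 (known 𝒢.free w₁) (cnt α₁) (Pres 𝒢.free α₁ h') e.2.1 j e.2.2 := by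
    rintro i hi rfl
    have heν : ∀ v ∈ ν, v ∉ e.vals := fun v hv hv' =>
      (l3 v hv).2 (mem_stateVals'.2 ⟨e, hi.mem, hv'⟩)
    have heK' : e.2.1 ∈ K := by
      rcases hK₁ _ heK with h' | h'
      · exact h'
      · exact absurd (by simp [Entry.vals]) (heν _ h')
    exact htrans (r6 i e hi he heK') heK' fun v hv hv' => heν v hv (by simp [Entry.vals, hv'])
  simp only [hw₁def, at_append, at_cons] at hj
  rcases hj with (hj | ⟨i, ⟨rfl, rfl⟩ | ⟨i, hj, rfl⟩, rfl⟩) | ⟨i, hj, rfl⟩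
  · refine hold j (at_append.2 (.inl hj)) ?_
    have := hj.le
    rw [hcL'] at this
    simp [f, this]
  -- If the acting entry loses its mark, its continuation is an untracked item that occurs in `α₁`
  -- at the same position.
  · simp only at he
    subst he
    refine .present ⟨cnt La, (false, A, x'), h', ⟨La, Ra ++ outs, by simp [hα₁def], rfl⟩, rfl,
      by omega, m1, fun _ _ => rfl, (m2 A hA).symm, rfl⟩
  · refine hold (cnt L' + (1 + i)) (at_append.2 (.inr ⟨_, at_cons.2 (.inr ⟨i, hj, rfl⟩), rfl⟩)) ?_
    simp only [f]
    split_ifs <;> omega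
  · obtain ⟨e', he', rfl⟩ := at_map hj
    refine .present ⟨cnt (La ++ (f', A, x') :: Ra) + i, e', h', at_append.2 (.inr ⟨i, he', rfl⟩), he,
      ?_, m1, fun _ _ => rfl, rfl, rfl⟩
    simp only [cnt_append, cnt_cons]
    have hcR : cnt R' = cnt Ra := by
      rw [cnt_eq_length, r4, htR, List.length_map, cnt_eq_length]
    omega

/-- Abstract runs can be concretized. -/
theorem APath.concretize {𝒢 : Program} (h𝒢 : 𝒢.Pure) {N n : ℕ} {α α' : List (Entry Bool)}
    (h : APath 𝒢 N n α α') (hα : Normal 𝒢.free α) {T : Config} {w : List (Entry Bool)}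
    (hT : Rep T w) (hl : Lag 𝒢 α w) :
    ∃ T' w', Reach 𝒢 T T' ∧ (0 < n → Relation.TransGen (Step 𝒢) T T') ∧ Rep T' w' ∧
      Lag 𝒢 α' w' := by
  induction h with
  | refl => exact ⟨T, w, .refl, by simp, hT, hl⟩
  | @step n α α' α'' b h h' ih =>
    obtain ⟨T₁, w₁, h1, h2, h3, h4⟩ := ih hα hl
    obtain ⟨⟨β, h5, rfl⟩, -⟩ := mem_succs.1 h'
    have hn := (h.normal hα).owned
    cases b with
    -- Untracked abstract steps cost no transition, so progress is claimed only if some step is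
    -- tracked.
    | false => exact ⟨T₁, w₁, h1, by simpa using h2, h3, (h4.junk_step h𝒢 hn h5).norm h𝒢⟩
    | true =>
      obtain ⟨T₂, w₂, h6, h7, h8⟩ := h4.tracked_step h𝒢 hn h5 h3
      have h9 : Relation.TransGen (Step 𝒢) T T₂ := Relation.TransGen.trans_right h1 h6
      exact ⟨T₂, w₂, h9.to_reflTransGen, fun _ => h9, h7, h8.norm h𝒢⟩

theorem lag_refl (𝒢 : Program) (w : List (Entry Bool)) : Lag 𝒢 w w := by
  refine ⟨1, .one _, ?_, fun j e hj he _ => .present ⟨j, e, 1, hj, he, le_rfl, .one _,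
    fun _ _ => rfl, rfl, (Item.mapVal_one _).symm⟩⟩
  conv_lhs => rw [← List.map_id (tracked w)]
  exact List.map_congr_left fun e _ => e.mapVal_id.symm

/-! ### Sizes -/

def Atom.size : Atom → ℕ
  | .bvar k => k + 1
  | .val _ => 1

def Expr.size : Expr → ℕ
  | .atom t => t.size
  | .new C => C + 1

/-- The size of a process, with numbers in unary and values of size 1. -/
def Proc.size : Proc → ℕ
  | .nil => 0
  | .letin E P => E.size + P.size + 1
  | .send t m Es P => t.size + m + (Es.map Expr.size).sum + P.size + 1
  | .ite E E' P Q => E.size + E'.size + P.size + Q.size + 1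
  | .plus P Q => P.size + Q.size + 1

def Item.size : Item → ℕ
  | .inl μ => μ.1 + μ.2.length
  | .inr P => P.size

theorem Atom.size_mapVal (f : Val → Val) (t : Atom) : (t.mapVal f).size = t.size := by
  cases t <;> rfl

theorem Expr.size_mapVal (f : Val → Val) (E : Expr) : (E.mapVal f).size = E.size := by
  cases E <;> simp [Expr.mapVal, Expr.size, Atom.size_mapVal]

theorem Proc.size_mapVal (f : Val → Val) (P : Proc) : (P.mapVal f).size = P.size := by
  induction P <;> simp_all [Proc.mapVal, Proc.size, Atom.size_mapVal, Expr.size_mapVal,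
    Function.comp_def]

theorem Item.size_mapVal (f : Val → Val) (z : Item) : (z.mapVal f).size = z.size := by
  cases z <;> simp [Item.mapVal, Item.size, Proc.size_mapVal]

theorem Atom.size_inst_le (U : Val) (k : ℕ) (t : Atom) : (t.inst U k).size ≤ t.size := by
  cases t with
  | bvar j => by_cases h : j = k <;> simp [Atom.inst, Atom.size, h]
  | val V => rfl

theorem Expr.size_inst_le (U : Val) (k : ℕ) (E : Expr) : (E.inst U k).size ≤ E.size := by
  cases E with
  | atom t => exact t.size_inst_le U k
  | new C => rfl

theorem Proc.size_inst_le (U : Val) (k : ℕ) (P : Proc) : (P.inst U k).size ≤ P.size := by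
  induction P generalizing k with
  | nil => rfl
  | letin E P ih =>
    have := E.size_inst_le U k
    have := ih (k + 1)
    simp only [Proc.inst, Proc.size]
    omega
  | send t m Es P ih =>
    have h1 := t.size_inst_le U k
    have h2 := ih k
    have h3 : ((Es.map (Expr.inst U k)).map Expr.size).sum ≤ (Es.map Expr.size).sum := by
      rw [List.map_map]
      exact List.sum_le_sum fun E _ => E.size_inst_le U k
    simp only [Proc.inst, Proc.size]
    omega
  | ite E E' P Q ih ih' =>
    have := E.size_inst_le U k
    have := E'.size_inst_le U k
    have := ih k
    have := ih' k
    simp only [Proc.inst, Proc.size]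
    omega
  | plus P Q ih ih' =>
    have := ih k
    have := ih' k
    simp only [Proc.inst, Proc.size]
    omega

theorem Atom.length_vals_le (t : Atom) : t.vals.length ≤ t.size := by
  cases t <;> simp [Atom.vals, Atom.size]

theorem Expr.length_vals_le (E : Expr) : E.vals.length ≤ E.size := by
  cases E with
  | atom t => exact t.length_vals_le
  | new C => simp [Expr.vals]

/-- Arguments have positive size, so the size of a send bounds the arity of its message. -/
theorem Expr.one_le_size (E : Expr) : 1 ≤ E.size := by
  rcases E with (k | v) | C <;> simp [Expr.size, Atom.size]

theorem Proc.length_vals_le (P : Proc) : P.vals.length ≤ P.size := by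
  induction P with
  | nil => simp [Proc.vals]
  | letin E P ih =>
    have := E.length_vals_le
    simp only [Proc.vals, Proc.size, List.length_append]
    omega
  | send t m Es P ih =>
    have h1 := t.length_vals_le
    have h2 : (Es.flatMap Expr.vals).length ≤ (Es.map Expr.size).sum := by
      rw [List.length_flatMap]
      exact List.sum_le_sum fun E _ => E.length_vals_le
    simp only [Proc.vals, Proc.size, List.length_append]
    omega
  | ite E E' P Q ih ih' =>
    have := E.length_vals_le
    have := E'.length_vals_le
    simp only [Proc.vals, Proc.size, List.length_append]
    omega
  | plus P Q ih ih' =>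
    simp only [Proc.vals, Proc.size, List.length_append]
    omega

theorem Item.length_vals_le (z : Item) : z.vals.length ≤ z.size := by
  cases z with
  | inl μ => simp [Item.vals, Item.size]
  | inr P => exact P.length_vals_le

theorem length_le_sum_size (Es : List Expr) : Es.length ≤ (Es.map Expr.size).sum := by
  induction Es with
  | nil => simp
  | cons E Es ih =>
    have := E.one_le_size
    simp only [List.length_cons, List.map_cons, List.sum_cons]
    omega

theorem EvalF.length_eq {Es Us ν} (h : EvalF Es Us ν) : Us.length = Es.length := by
  induction h <;> simp_all

theorem EvalF.kind_le {Es Us ν} (h : EvalF Es Us ν) :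
    ∀ v ∈ ν, ∃ C ≤ (Es.map Expr.size).sum, kind v = some (some C) := by
  induction h with
  | nil => simp
  | val U h ih =>
    intro v hv
    obtain ⟨C, h1, h2⟩ := ih v hv
    exact ⟨C, by simp only [List.map_cons, List.sum_cons]; omega, h2⟩
  | @new Es Us ν C v hv h ih =>
    intro w hw
    simp only [List.map_cons, List.sum_cons, Expr.size]
    rcases List.mem_cons.1 hw with rfl | hw
    · exact ⟨C, by omega, hv⟩
    · obtain ⟨C', h1, h2⟩ := ih w hw
      exact ⟨C', by omega, h2⟩

/-- A bound for the sizes of the method bodies. -/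
def Program.maxSize (𝒢 : Program) : ℕ := (𝒢.defs.map fun d => d.body.size).sum

/-- Continuations are no larger than the process, a message is no larger than the send that emits
it, and an instance has the size of its body because values have size 1. Class numbers are measured
in unary, which also bounds the classes of new actors. -/
theorem LStep.size_le {𝒢 : Program} {A z ν o z'} (h : LStep 𝒢 A z ν o z') {W : ℕ}
    (hW : 𝒢.maxSize ≤ W) (hz : z.size ≤ W) :
    z'.size ≤ W ∧ (∀ p, o = some p → p.2.size ≤ W) ∧
      ∀ v ∈ ν, kind v = none ∨ ∃ C ≤ W, kind v = some (some C) := by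
  cases h with
  | @letin E P U ν h =>
    have h1 := P.size_inst_le U 0
    simp only [Item.size, Proc.size] at hz ⊢
    refine ⟨by omega, by simp, fun v hv => .inr ?_⟩
    obtain ⟨C, h2, h3⟩ := h.kind_le v hv
    simp only [List.map_cons, List.map_nil, List.sum_cons, List.sum_nil] at h2
    exact ⟨C, by omega, h3⟩
  | @send B m Es P Us ν h hB =>
    have h1 := h.length_eq
    have h2 := length_le_sum_size Es
    simp only [Item.size, Proc.size] at hz ⊢
    refine ⟨by omega, ?_, fun v hv => .inr ?_⟩
    · rintro p hp
      cases hp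
      simp only
      omega
    · obtain ⟨C, h2, h3⟩ := h.kind_le v hv
      exact ⟨C, by omega, h3⟩
  | @ite E E' P Q U V ν h =>
    simp only [Item.size, Proc.size] at hz ⊢
    refine ⟨by split_ifs <;> omega, by simp, fun v hv => .inr ?_⟩
    obtain ⟨C, h2, h3⟩ := h.kind_le v hv
    simp only [List.map_cons, List.map_nil, List.sum_cons, List.sum_nil] at h2
    exact ⟨C, by omega, h3⟩
  | plusL =>
    simp only [Item.size, Proc.size] at hz ⊢
    exact ⟨by omega, by simp, by simp⟩
  | plusR =>
    simp only [Item.size, Proc.size] at hz ⊢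
    exact ⟨by omega, by simp, by simp⟩
  | @start d Us ν hd hA hlen hν hk =>
    refine ⟨?_, by simp, fun v hv => .inl (hk v hv)⟩
    have : d.body.size ≤ 𝒢.maxSize :=
      List.single_le_sum (by simp) _ (List.mem_map_of_mem (f := fun d : MethodDef => d.body.size) hd)
    simp only [Item.size, MethodDef.instWith, Proc.subst, Proc.size_mapVal]
    omega

/-! ### Finiteness -/

theorem finite_lists {α : Type} {s : Set α} (hs : s.Finite) (n : ℕ) :
    {l : List α | l.length ≤ n ∧ ∀ x ∈ l, x ∈ s}.Finite := by
  induction n with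
  | zero =>
    refine (Set.finite_singleton []).subset ?_
    rintro l ⟨h, -⟩
    simpa using h
  | succ n ih =>
    refine ((Set.finite_singleton []).union (Set.Finite.image2 List.cons hs ih)).subset ?_
    rintro l ⟨h1, h2⟩
    cases l with
    | nil => simp
    | cons x l =>
      refine .inr ⟨x, h2 x (by simp), l, ⟨by simpa using h1, fun y hy => h2 y (by simp [hy])⟩, rfl⟩

theorem finite_atoms {V : Set Val} (hV : V.Finite) (s : ℕ) :
    {t : Atom | t.size ≤ s ∧ ∀ v ∈ t.vals, v ∈ V}.Finite := by
  refine (((Set.finite_Iio s).image Atom.bvar).union (hV.image Atom.val)).subset ?_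
  rintro (k | v) ⟨h1, h2⟩
  · exact .inl ⟨k, h1, rfl⟩
  · exact .inr ⟨v, h2 v (by simp [Atom.vals]), rfl⟩

theorem finite_exprs {V : Set Val} (hV : V.Finite) (s : ℕ) :
    {E : Expr | E.size ≤ s ∧ ∀ v ∈ E.vals, v ∈ V}.Finite := by
  refine (((finite_atoms hV s).image Expr.atom).union ((Set.finite_Iio s).image Expr.new)).subset ?_
  rintro (t | C) ⟨h1, h2⟩
  · exact .inl ⟨t, ⟨h1, h2⟩, rfl⟩
  · exact .inr ⟨C, h1, rfl⟩

theorem finite_procs {V : Set Val} (hV : V.Finite) (s : ℕ) :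
    {P : Proc | P.size ≤ s ∧ ∀ v ∈ P.vals, v ∈ V}.Finite := by
  induction s with
  | zero =>
    refine (Set.finite_singleton .nil).subset ?_
    rintro P ⟨h, -⟩
    cases P <;> simp [Proc.size] at h ⊢
  | succ s ih =>
    have hE := finite_exprs hV s
    have ht := finite_atoms hV s
    have hl := finite_lists hE s
    refine ((((Set.finite_singleton .nil).union (Set.Finite.image2 Proc.letin hE ih)).union
      ((((ht.prod (Set.finite_Iic s)).prod hl).prod ih).image
        fun x => Proc.send x.1.1.1 x.1.1.2 x.1.2 x.2)).union
      ((((hE.prod hE).prod ih).prod ih).image fun x => Proc.ite x.1.1.1 x.1.1.2 x.1.2 x.2)).union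
      (Set.Finite.image2 Proc.plus ih ih) |>.subset ?_
    rintro P ⟨h1, h2⟩
    cases P with
    | nil => simp
    | letin E P =>
      simp only [Proc.size, Proc.vals, List.mem_append] at h1 h2
      exact .inl (.inl (.inl (.inr ⟨E, ⟨by omega, fun v hv => h2 v (.inl hv)⟩, P,
        ⟨by omega, fun v hv => h2 v (.inr hv)⟩, rfl⟩)))
    | send t m Es P =>
      simp only [Proc.size, Proc.vals, List.mem_append, List.mem_flatMap] at h1 h2
      have h3 := length_le_sum_size Es
      refine .inl (.inl (.inr ⟨(((t, m), Es), P), ⟨⟨⟨⟨?_, ?_⟩, ?_⟩, ?_, ?_⟩, ?_, ?_⟩, rfl⟩))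
      · show t.size ≤ s
        omega
      · exact fun v hv => h2 v (.inl (.inl hv))
      · show m ≤ s
        omega
      · show Es.length ≤ s
        omega
      · intro E hE
        have h4 : E.size ≤ (Es.map Expr.size).sum :=
          List.single_le_sum (by simp) _ (List.mem_map_of_mem hE)
        exact ⟨by omega, fun v hv => h2 v (.inl (.inr ⟨E, hE, hv⟩))⟩
      · show P.size ≤ s
        omega
      · exact fun v hv => h2 v (.inr hv)
    | ite E E' P Q =>
      simp only [Proc.size, Proc.vals, List.mem_append] at h1 h2
      refine .inl (.inr ⟨(((E, E'), P), Q), ⟨⟨⟨⟨?_, ?_⟩, ?_, ?_⟩, ?_, ?_⟩, ?_, ?_⟩, rfl⟩)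
      · show E.size ≤ s
        omega
      · exact fun v hv => h2 v (.inl (.inl (.inl hv)))
      · show E'.size ≤ s
        omega
      · exact fun v hv => h2 v (.inl (.inl (.inr hv)))
      · show P.size ≤ s
        omega
      · exact fun v hv => h2 v (.inl (.inr hv))
      · show Q.size ≤ s
        omega
      · exact fun v hv => h2 v (.inr hv)
    | plus P Q =>
      simp only [Proc.size, Proc.vals, List.mem_append] at h1 h2
      exact .inr ⟨P, ⟨by omega, fun v hv => h2 v (.inl hv)⟩, Q,
        ⟨by omega, fun v hv => h2 v (.inr hv)⟩, rfl⟩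

theorem finite_items {V : Set Val} (hV : V.Finite) (s : ℕ) :
    {z : Item | z.size ≤ s ∧ ∀ v ∈ z.vals, v ∈ V}.Finite := by
  refine ((((Set.finite_Iic s).prod (finite_lists hV s)).image Sum.inl).union
    ((finite_procs hV s).image Sum.inr)).subset ?_
  rintro (⟨m, Us⟩ | P) ⟨h1, h2⟩
  · simp only [Item.size] at h1
    exact .inl ⟨(m, Us), ⟨by simp only [Set.mem_Iic]; omega, by show Us.length ≤ s; omega, h2⟩, rfl⟩
  · exact .inr ⟨P, ⟨h1, h2⟩, rfl⟩

/-- The entries with an item of bounded size and values in `V`. -/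
def entries (V : Set Val) (W : ℕ) : Set (Entry Bool) :=
  {e | e.2.2.size ≤ W ∧ ∀ v ∈ e.vals, v ∈ V}

theorem finite_entries {V : Set Val} (hV : V.Finite) (W : ℕ) : (entries V W).Finite := by
  refine ((Set.finite_univ (α := Bool)).prod (hV.prod (finite_items hV W))).subset ?_
  rintro ⟨b, A, z⟩ ⟨h1, h2⟩
  simp only [Entry.vals, List.mem_cons, forall_eq_or_imp] at h2
  exact ⟨trivial, h2.1, h1, h2.2⟩

/-- A value is determined by its kind and its index. -/
theorem finite_vals {K : Set (Option (Option ℕ))} (hK : K.Finite) (I : ℕ) :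
    {v : Val | kind v ∈ K ∧ v.idx < I}.Finite := by
  have : Set.InjOn (fun v : Val => (kind v, v.idx)) {v : Val | kind v ∈ K ∧ v.idx < I} := by
    intro u _ v _ h
    simp only [Prod.mk.injEq] at h
    exact Val.ext_idx h.1 h.2
  refine Set.Finite.of_finite_image ((hK.prod (Set.finite_Iio I)).subset ?_) this
  rintro _ ⟨v, hv, rfl⟩
  exact hv

/-- The entries have items of size at most `W` and values with kinds in `K`. -/
def Bounded (K : Set (Option (Option ℕ))) (W : ℕ) (α : List (Entry Bool)) : Prop :=
  ∀ e ∈ α, e ∈ entries {v | kind v ∈ K} W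

theorem bounded_steps {𝒢 : Program} (h𝒢 : 𝒢.Pure) {K : Set (Option (Option ℕ))} {W : ℕ}
    (hW : 𝒢.maxSize ≤ W) (hK : none ∈ K) (hK' : ∀ C ≤ W, some (some C) ∈ K)
    {α β : List (Entry Bool)} {b : Bool} (hα : Bounded K W α) (h : (b, β) ∈ steps 𝒢 α) :
    Bounded K W β := by
  obtain ⟨L, ⟨f, A, z⟩, R, rfl, hs⟩ := mem_steps.1 h
  obtain ⟨-, ν, o, z', f', outs, h1, -, h3, -, -, h6⟩ := mem_stepsAt.1 hs
  simp only [Prod.mk.injEq] at h6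
  obtain ⟨rfl, rfl⟩ := h6
  obtain ⟨hz, hv⟩ := hα (b, A, z) (by simp)
  simp only [Entry.vals, List.mem_cons, forall_eq_or_imp, Set.mem_ofPred_eq] at hv hz h1
  obtain ⟨k1, k2, k3⟩ := h1.size_le hW hz
  have hν : ∀ v ∈ ν, kind v ∈ K := by
    intro v hv
    rcases k3 v hv with h | ⟨C, hC, h⟩ <;> rw [h]
    · exact hK
    · exact hK' C hC
  intro e he
  simp only [List.mem_append, List.mem_cons] at he
  rcases he with (he | rfl | he) | he
  · exact hα e (by simp [he])
  · refine ⟨k1, ?_⟩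
    simp only [Entry.vals, List.mem_cons, forall_eq_or_imp, Set.mem_ofPred_eq]
    refine ⟨hv.1, fun v hv' => ?_⟩
    rcases (h1.mem_vals h𝒢).1 v hv' with rfl | h | h
    · exact hv.1
    · exact hv.2 v h
    · exact hν v h
  · exact hα e (by simp [he])
  · have hp : e.2 ∈ outItems o ν := h3 ▸ List.mem_map_of_mem he
    constructor
    · rcases mem_outItems.1 hp with h | ⟨-, -, h⟩
      · exact k2 _ h
      · rw [h]
        simp [Item.size, Proc.size]
    · intro v hv'
      rcases mem_vals_outItems h𝒢 h1 hp (v := v) (by simpa [Entry.vals] using hv') with h | h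
      · exact hv.2 v h
      · exact hν v h

theorem length_stateVals_le {W : ℕ} {w : List (Entry Bool)} (h : ∀ e ∈ w, e.2.2.size ≤ W) :
    (stateVals w).length ≤ w.length * (W + 1) := by
  induction w with
  | nil => simp [stateVals]
  | cons e w ih =>
    have h1 := ih fun e he => h e (by simp [he])
    have h2 := h e (by simp)
    have h3 := e.2.2.length_vals_le
    simp only [stateVals, List.flatMap_cons, List.length_append, Entry.vals, List.length_cons]
      at h1 ⊢
    rw [Nat.add_mul]
    omega

theorem nodup_takeWhile_dedupe (α : List (Entry Bool)) :
    ((dedupe α).takeWhile fun e : Entry Bool => !e.1).Nodup := by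
  induction α with
  | nil => simp [dedupe]
  | cons e α ih =>
    rw [dedupe_cons]
    split_ifs with h
    · exact ih
    · rw [List.takeWhile_cons]
      split_ifs with h'
      · exact List.nodup_cons.2 ⟨fun h'' => h ⟨by simpa using h', h''⟩, ih⟩
      · exact List.nodup_nil

/-- The untracked entries between two consecutive tracked ones are distinct, so there are at most
`s.card` of them. The initial stretch is counted separately to make the induction go through. -/
theorem length_dedupe_le (α : List (Entry Bool)) {s : Finset (Entry Bool)}
    (h : ∀ e ∈ dedupe α, e ∈ s) :
    (dedupe α).length ≤ cnt (dedupe α) * (s.card + 1) +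
      ((dedupe α).takeWhile fun e : Entry Bool => !e.1).length := by
  induction α with
  | nil => simp [dedupe]
  | cons e α ih =>
    rw [dedupe_cons] at h ⊢
    split_ifs at h ⊢ with h1
    · exact ih h
    · have h2 := ih fun e he => h e (by simp [he])
      rw [cnt_cons, List.takeWhile_cons, List.length_cons]
      obtain ⟨b, e⟩ := e
      cases b with
      | false =>
        simp only [Bool.toNat_false, Bool.not_false, if_true, List.length_cons]
        rw [zero_add]
        omega
      | true =>
        simp only [Bool.toNat_true, Bool.not_true, Bool.false_eq_true, if_false, List.length_nil]
        have h3 : ((dedupe α).takeWhile fun e : Entry Bool => !e.1).length ≤ s.card := by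
          rw [← List.toFinset_card_of_nodup (nodup_takeWhile_dedupe α)]
          refine Finset.card_le_card fun e he => ?_
          rw [List.mem_toFinset] at he
          exact h e (List.mem_cons_of_mem _ ((List.takeWhile_sublist _).subset he))
        rw [Nat.add_mul]
        omega

theorem finite_norms (F : List Val) {K : Set (Option (Option ℕ))} (hK : K.Finite) (W N : ℕ) :
    {α | cnt α ≤ N ∧ ∃ β, Bounded K W β ∧ α = norm F β}.Finite := by
  -- The summands make room for the values in `F`, for those of at most `N` tracked entries (the
  -- owner and at most `W` values each), and for the values of the entry itself.
  set I := bnd F + N * (W + 1) + (W + 1) with hI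
  have hE := finite_entries (finite_vals hK I) W
  refine (finite_lists hE (N * (hE.toFinset.card + 1) + hE.toFinset.card)).subset ?_
  rintro _ ⟨hN, β, hβ, rfl⟩
  have hmem : ∀ e ∈ norm F β, e ∈ entries {v | kind v ∈ K ∧ v.idx < I} W := by
    intro e he
    obtain ⟨e₀, h1, rfl⟩ := List.mem_map.1 (mem_of_mem_dedupe he)
    obtain ⟨h2, h3⟩ := hβ e₀ (List.mem_filter.1 h1).1
    refine ⟨by simpa [Entry.mapVal, Item.size_mapVal] using h2, fun v hv => ?_⟩
    rw [Entry.vals_mapVal, List.mem_map] at hv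
    obtain ⟨u, hu, rfl⟩ := hv
    refine ⟨by rw [kind_normVal]; exact h3 u hu, ?_⟩
    have h4 := idx_normVal_lt (F := F) (tv := stateVals (tracked β)) (vs := e₀.vals) (v := u)
      (.inr (.inr hu))
    have h5 := length_stateVals_le (W := W) (w := tracked β) fun e he =>
      (hβ e (List.mem_of_mem_filter he)).1
    have h6 : (tracked β).length ≤ N := by
      rwa [← cnt_eq_length, ← (sim_norm F β).cnt_eq]
    have h7 : (tracked β).length * (W + 1) ≤ N * (W + 1) := Nat.mul_le_mul_right _ h6
    have h8 := e₀.2.2.length_vals_le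
    simp only [Entry.vals, List.length_cons] at h4 ⊢
    omega
  refine ⟨?_, hmem⟩
  have h1 := length_dedupe_le (rename F (stateVals (tracked β)) β) (s := hE.toFinset)
    fun e he => hE.mem_toFinset.2 (hmem e he)
  have h2 : ((norm F β).takeWhile fun e : Entry Bool => !e.1).length ≤ hE.toFinset.card := by
    rw [norm, ← List.toFinset_card_of_nodup (nodup_takeWhile_dedupe _)]
    refine Finset.card_le_card fun e he => ?_
    rw [List.mem_toFinset] at he
    exact hE.mem_toFinset.2 (hmem e ((List.takeWhile_sublist _).subset he))
  have h3 : cnt (norm F β) * (hE.toFinset.card + 1) ≤ N * (hE.toFinset.card + 1) :=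
    Nat.mul_le_mul_right _ hN
  exact h1.trans (Nat.add_le_add h3 h2)

theorem bounded_norm {F : List Val} {K : Set (Option (Option ℕ))} {W : ℕ} {β : List (Entry Bool)}
    (hβ : Bounded K W β) : Bounded K W (norm F β) := by
  intro e he
  obtain ⟨e₀, h1, rfl⟩ := List.mem_map.1 (mem_of_mem_dedupe he)
  obtain ⟨h2, h3⟩ := hβ e₀ (List.mem_filter.1 h1).1
  refine ⟨by simpa [Entry.mapVal, Item.size_mapVal] using h2, fun v hv => ?_⟩
  rw [Entry.vals_mapVal, List.mem_map] at hv
  obtain ⟨u, hu, rfl⟩ := hv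
  simpa only [Set.mem_ofPred_eq, kind_normVal] using h3 u hu

theorem APath.bounded {𝒢 : Program} (h𝒢 : 𝒢.Pure) {K : Set (Option (Option ℕ))} {W : ℕ}
    (hW : 𝒢.maxSize ≤ W) (hK : none ∈ K) (hK' : ∀ C ≤ W, some (some C) ∈ K) {N n : ℕ}
    {α α' : List (Entry Bool)} (h : APath 𝒢 N n α α') (hα : Bounded K W α) :
    Bounded K W α' ∧ (α' = α ∨ cnt α' ≤ N ∧ ∃ β, Bounded K W β ∧ α' = norm 𝒢.free β) := by
  induction h with
  | refl => exact ⟨hα, .inl rfl⟩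
  | step _ h ih =>
    obtain ⟨⟨β, h1, rfl⟩, h2⟩ := mem_succs.1 h
    have h3 := bounded_steps h𝒢 hW hK hK' (ih hα).1 h1
    exact ⟨bounded_norm h3, .inr ⟨h2, β, h3, rfl⟩⟩

/-- Finitely many abstract states are reachable. -/
theorem finite_apath {𝒢 : Program} (h𝒢 : 𝒢.Pure) (N : ℕ) (α : List (Entry Bool)) :
    {α' | ∃ n, APath 𝒢 N n α α'}.Finite := by
  -- Every item is a descendant of an item of `α` or of a method body, and every kind occurs in `α`,
  -- is that of variables, or is a class of number at most `W`.
  set W := 𝒢.maxSize + (α.map fun e => e.2.2.size).sum with hW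
  set K : Set (Option (Option ℕ)) := {none} ∪ (fun C => some (some C)) '' Set.Iic W ∪
    {k | k ∈ (stateVals α).map kind} with hKdef
  have hK : K.Finite := ((Set.finite_singleton _).union ((Set.finite_Iic W).image _)).union
    (List.finite_toSet _)
  have hα : Bounded K W α := by
    intro e he
    have : e.2.2.size ≤ (α.map fun e => e.2.2.size).sum :=
      List.single_le_sum (by simp) _ (List.mem_map_of_mem (f := fun e : Entry Bool => e.2.2.size) he)
    exact ⟨by omega, fun v hv => .inr (List.mem_map_of_mem (mem_stateVals'.2 ⟨e, he, hv⟩))⟩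
  refine ((Set.finite_singleton α).union (finite_norms 𝒢.free hK W N)).subset ?_
  rintro α' ⟨n, h⟩
  exact (h.bounded h𝒢 (by omega) (.inl (.inl rfl)) (fun C hC => .inl (.inr ⟨C, hC, rfl⟩)) hα).2

/-! ### Abstract runs from the markings of a configuration -/

/-- The abstract states for the markings of a configuration. -/
def starts (𝒢 : Program) (N : ℕ) (S : Config) : List (List (Entry Bool)) :=
  ((tuples [true, false] S.items.length).map fun fl =>
    norm 𝒢.free (fl.zip S.items)).filter fun α => cnt α ≤ N

theorem mem_starts {𝒢 : Program} {N : ℕ} {S : Config} {α : List (Entry Bool)} :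
    α ∈ starts 𝒢 N S ↔ (∃ w : List (Entry Bool), w.map Prod.snd = S.items ∧
      α = norm 𝒢.free w) ∧ cnt α ≤ N := by
  simp only [starts, List.mem_filter, List.mem_map, decide_eq_true_eq]
  refine and_congr_left fun _ => ⟨?_, ?_⟩
  · rintro ⟨fl, hfl, rfl⟩
    exact ⟨_, List.map_snd_zip (by rw [(mem_tuples.1 hfl).1]), rfl⟩
  · rintro ⟨w, hw, rfl⟩
    refine ⟨w.map Prod.fst, mem_tuples.2 ⟨by simp [← hw], fun b _ => by cases b <;> simp⟩, ?_⟩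
    have hz : (w.map Prod.fst).zip (w.map Prod.snd) = w := (List.zip_of_prod rfl rfl).symm
    rw [← hw, hz]

theorem normal_of_mem_starts {𝒢 : Program} {N : ℕ} {S : Config} {α : List (Entry Bool)}
    (h : α ∈ starts 𝒢 N S) : Normal 𝒢.free α := by
  obtain ⟨⟨w, -, rfl⟩, -⟩ := mem_starts.1 h
  exact normal_norm _ _

/-- Abstract runs exist for all markings of reachable configurations. -/
theorem Reach.exists_apath {𝒢 : Program} (h𝒢 : 𝒢.Pure) {S T : Config}
    (hS : Reach 𝒢 𝒢.init S) (hT : Reach 𝒢 S T) :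
    ∃ w : List (Entry ℕ), Rep T w ∧ Exact T w ∧ ∀ (N : ℕ) (W : List (Entry Bool)),
      W.map Prod.snd = w.map Prod.snd → cnt W ≤ N →
      ∃ α ∈ starts 𝒢 N S, ∃ n α', APath 𝒢 N n α α' ∧ Sim 𝒢.free α' W := by
  obtain ⟨h1, h2⟩ := hS.rep_items h𝒢 (w := S.items.map fun p => ((0 : ℕ), p))
    (by simp [Function.comp_def])
  obtain ⟨w, h3, h4, h5⟩ := hT.exists_lift h𝒢 h1 h2
  refine ⟨w, h3, h4, fun N W hW hN => ?_⟩
  -- The depths of `w` and the marks of `W` are joined into one flagging of the same items, to which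
  -- `Lift` applies.
  have hb : boolOf (w.zipWith (fun e e' => ((e.1, e'.1), e.2)) W) = W ∧
      depthOf (w.zipWith (fun e e' => ((e.1, e'.1), e.2)) W) = w := by
    clear h3 h4 h5 hN
    induction w generalizing W with
    | nil => cases W <;> simp_all [boolOf, depthOf]
    | cons e w ih =>
      cases W with
      | nil => simp at hW
      | cons e' W =>
        simp only [List.map_cons, List.cons.injEq] at hW
        obtain ⟨h1, h2⟩ := ih W hW.2
        simp only [boolOf, depthOf, List.zipWith_cons_cons, List.map_cons, List.cons.injEq] at h1 h2 ⊢
        exact ⟨⟨Prod.ext rfl hW.1.symm, h1⟩, trivial, h2⟩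
  obtain ⟨W₀, n, k1, k2, k3, -, -⟩ := h5 N _ hb.2 (by rwa [hb.1])
  rw [hb.1] at k3
  have hW₀ : (boolOf W₀).map Prod.snd = S.items := by
    have := congrArg (List.map Prod.snd) k1
    simpa [depthOf, boolOf, Function.comp_def] using this
  obtain ⟨α', l1, l2⟩ := k3.apath h𝒢 (normal_norm 𝒢.free _) (sim_norm 𝒢.free _)
  exact ⟨_, mem_starts.2 ⟨⟨_, hW₀, rfl⟩, by rwa [(sim_norm 𝒢.free _).cnt_eq]⟩, n, α', l1, l2⟩

/-- Abstract runs from markings of reachable configurations can be concretized. -/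
theorem APath.exists_reach {𝒢 : Program} (h𝒢 : 𝒢.Pure) {S : Config}
    (hS : Reach 𝒢 𝒢.init S) {N n : ℕ} {α α' : List (Entry Bool)} (hα : α ∈ starts 𝒢 N S)
    (h : APath 𝒢 N n α α') : ∃ T w, Reach 𝒢 S T ∧ Rep T w ∧ Lag 𝒢 α' w := by
  have hn := normal_of_mem_starts hα
  obtain ⟨⟨w, hw, rfl⟩, -⟩ := mem_starts.1 hα
  obtain ⟨T, w', h1, -, h2, h3⟩ := h.concretize h𝒢 hn (hS.rep_items h𝒢 hw).1
    ((lag_refl 𝒢 w).norm h𝒢)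
  exact ⟨T, w', h1, h2, h3⟩

/-! ### Termination -/

/-- The state `f i` is the last one reached with exactly `i` tracked steps. Indexing by tracked
steps ensures that a repetition `f i = f j` with `i < j` closes a cycle that contains a tracked
step. -/
theorem APath.exists_seq {𝒢 : Program} {N n : ℕ} {α α' : List (Entry Bool)}
    (h : APath 𝒢 N n α α') :
    ∃ f : ℕ → List (Entry Bool), f n = α' ∧ (∀ i ≤ n, APath 𝒢 N i α (f i)) ∧
      ∀ i j, i ≤ j → j ≤ n → APath 𝒢 N (j - i) (f i) (f j) := by
  induction h with
  | refl α =>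
    refine ⟨fun _ => α, rfl, fun i hi => ?_, fun i j _ hj => ?_⟩
    · rw [Nat.le_zero.1 hi]
      exact .refl α
    · rw [Nat.le_zero.1 hj, Nat.zero_sub]
      exact .refl α
  | @step n α α' α'' b h h' ih =>
    obtain ⟨f, h1, h2, h3⟩ := ih
    have hlast : ∀ i ≤ n, APath 𝒢 N (n + b.toNat - i) (f i) α'' := by
      intro i hi
      have := APath.step (h3 i n hi le_rfl) (by rwa [h1])
      rwa [← Nat.sub_add_comm hi] at this
    refine ⟨Function.update f (n + b.toNat) α'', by simp, fun i hi => ?_, fun i j hij hj => ?_⟩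
    · by_cases hi' : i = n + b.toNat
      · subst hi'
        rw [Function.update_self]
        exact .step h h'
      · rw [Function.update_of_ne hi']
        exact h2 i (by cases b <;> simp at hi hi' <;> omega)
    · by_cases hj' : j = n + b.toNat
      · subst hj'
        rw [Function.update_self]
        by_cases hi' : i = n + b.toNat
        · subst hi'
          rw [Function.update_self, Nat.sub_self]
          exact .refl _
        · rw [Function.update_of_ne hi']
          exact hlast i (by cases b <;> simp at hij hi' <;> omega)
      · have hjn : j ≤ n := by cases b <;> simp at hj hj' <;> omega
        rw [Function.update_of_ne hj', Function.update_of_ne (by cases b <;> simp at hj' ⊢ <;> omega)]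
        exact h3 i j hij hjn

/-- Among the states from which `Q` can be reached, each has a successor of the same sort: the way
to `Q` followed by the way to the next `Q` has at least one step. -/
theorem exists_infinite {β : Type} {r : β → β → Prop} {Q : β → Prop} {a : β}
    (ha : ∃ y, Relation.ReflTransGen r a y ∧ Q y)
    (hQ : ∀ x, Q x → ∃ y, Relation.TransGen r x y ∧ Q y) :
    ∃ s : ℕ → β, s 0 = a ∧ ∀ n, r (s n) (s (n + 1)) := by
  let X := {x // ∃ y, Relation.ReflTransGen r x y ∧ Q y}
  have hX : ∀ x : X, ∃ y : X, r x.1 y.1 := by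
    rintro ⟨x, y, hxy, hy⟩
    obtain ⟨z, hz, hz'⟩ := hQ y hy
    obtain ⟨u, hu, hu'⟩ := Relation.TransGen.head'_iff.1 (Relation.TransGen.trans_right hxy hz)
    exact ⟨⟨u, z, hu', hz'⟩, hu⟩
  choose f hf using hX
  refine ⟨fun n => (f^[n] ⟨a, ha⟩).1, rfl, fun n => ?_⟩
  simp only [Function.iterate_succ_apply']
  exact hf _

/-- One tracked item is enough, because an infinite computation has arbitrarily long causal chains.
Conversely, each passage through a cycle with a tracked step costs at least one transition and
restores the invariant `Lag`. -/
theorem terminates_iff {𝒢 : Program} (h𝒢 : 𝒢.Pure) :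
    𝒢.Terminates ↔ ¬ ∃ α ∈ starts 𝒢 1 𝒢.init, ∃ n β m, APath 𝒢 1 n α β ∧ 0 < m ∧
      APath 𝒢 1 m β β := by
  refine not_congr ⟨?_, ?_⟩
  · rintro ⟨s, h0, hs⟩
    obtain ⟨h1, h2⟩ := rep_init (φ := ℕ) h𝒢 (w := 𝒢.init.items.map fun p => (0, p))
      (by simp [Function.comp_def])
    have key : ∀ D, ∃ α ∈ starts 𝒢 1 𝒢.init, ∃ n ≥ D, ∃ α', APath 𝒢 1 n α α' := by
      intro D
      obtain ⟨W, W', n, k1, k2, k3, k4⟩ := exists_run_of_infinite h𝒢 hs (by rwa [h0]) (by rwa [h0])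
        (by intro e he; obtain ⟨p, -, rfl⟩ := List.mem_map.1 he; rfl) D
      obtain ⟨α', l1, -⟩ := k4.apath h𝒢 (normal_norm 𝒢.free _) (sim_norm 𝒢.free _)
      refine ⟨_, mem_starts.2 ⟨⟨W, ?_, rfl⟩, by rwa [(sim_norm 𝒢.free _).cnt_eq]⟩, n, k3, α', l1⟩
      rw [k1]
      simp [Function.comp_def]
    have hfin : (⋃ α ∈ {α | α ∈ starts 𝒢 1 𝒢.init}, {α' | ∃ n, APath 𝒢 1 n α α'}).Finite :=
      (List.finite_toSet _).biUnion fun α _ => finite_apath h𝒢 1 α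
    -- There are more tracked steps than abstract states, so some state recurs after a positive
    -- number of them.
    obtain ⟨α, hα, n, hn, α', hp⟩ := key (hfin.toFinset.card + 1)
    obtain ⟨f, -, hf1, hf2⟩ := hp.exists_seq
    obtain ⟨i, hi, j, hj, hij, hfij⟩ := Finset.exists_ne_map_eq_of_card_lt_of_maps_to
      (s := Finset.range (n + 1)) (t := hfin.toFinset) (f := f) (by simp; omega) (by
        intro i hi
        simp only [Finset.coe_range, Set.mem_Iio] at hi
        simp only [Set.Finite.coe_toFinset, Set.mem_iUnion]
        exact ⟨α, hα, i, hf1 i (by omega)⟩)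
    rw [Finset.mem_range] at hi hj
    rcases lt_or_gt_of_ne hij with h | h
    · have := hf2 i j h.le (by omega)
      rw [← hfij] at this
      exact ⟨α, hα, i, f i, j - i, hf1 i (by omega), by omega, this⟩
    · have := hf2 j i h.le (by omega)
      rw [hfij] at this
      exact ⟨α, hα, j, f j, i - j, hf1 j (by omega), by omega, this⟩
  · rintro ⟨α, hα, n, β, m, h1, hm, h2⟩
    obtain ⟨T, w, h3, h4, h5⟩ := h1.exists_reach h𝒢 .refl hα
    have hβ := h1.normal (normal_of_mem_starts hα)
    exact exists_infinite (r := Step 𝒢) (Q := fun T => ∃ w, Rep T w ∧ Lag 𝒢 β w)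
      ⟨T, h3, w, h4, h5⟩ (by
        rintro T ⟨w, k1, k2⟩
        obtain ⟨T', w', -, k3, k4, k5⟩ := h2.concretize h𝒢 hβ k1 k2
        exact ⟨T', k3 hm, w', k4, k5⟩)

/-! ### Similarity -/

/-- The values that correspond to each other in two items, and the values that are fixed. -/
def simPairs (F : List Val) (z z' : Item) : List (Val × Val) :=
  z.vals.zip z'.vals ++ F.map fun v => (v, v)

/-- The decision procedure for similarity with respect to permutations that preserve `c`. -/
def simb {γ : Type} [DecidableEq γ] (c : Val → γ) (F : List Val) (z z' : Item) : Bool :=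
  decide (z.mapVal (fun v => ((simPairs F z z').lookup v).getD v) = z' ∧
    ∀ p ∈ simPairs F z z', c p.1 = c p.2 ∧ ∀ q ∈ simPairs F z z', p.1 = q.1 ↔ p.2 = q.2)

/-- Reading `z` and `z'` in parallel gives the only possible partial map of values. It extends to a
permutation exactly if it respects equalities and colours, also together with the identity on `F`.
-/
theorem simb_iff {γ : Type} [DecidableEq γ] {c : Val → γ} {F : List Val} {z z' : Item} :
    simb c F z z' = true ↔
      ∃ g : Equiv.Perm Val, (∀ v, c (g v) = c v) ∧ (∀ v ∈ F, g v = v) ∧ z' = z.mapVal g := by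
  rw [simb, decide_eq_true_eq]
  constructor
  · rintro ⟨h1, h2⟩
    obtain ⟨g, k1, k2⟩ := exists_perm_of_zip _ (fun p hp => (h2 p hp).1) fun p hp => (h2 p hp).2
    refine ⟨g, k1, fun v hv => k2 (v, v) ?_, ?_⟩
    · rw [simPairs, List.mem_append]
      exact .inr (List.mem_map_of_mem (f := fun v => (v, v)) hv)
    -- Equal lengths ensure that `zip` cuts off no value of `z`, so that each has a partner.
    · have hlen : z.vals.length = z'.vals.length := by
        conv_rhs => rw [← h1, Item.vals_mapVal, List.length_map]
      conv_lhs => rw [← h1]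
      refine Item.mapVal_congr fun v hv => ?_
      obtain ⟨u, hu⟩ := lookup_isSome_of_mem (l := simPairs F z z') (x := v) (by
        rw [simPairs, List.map_append, List.map_fst_zip hlen.le]
        exact List.mem_append_left _ hv)
      rw [hu]
      exact (k2 _ (mem_of_lookup_eq hu)).symm
  · rintro ⟨g, h1, h2, rfl⟩
    have key : ∀ p ∈ simPairs F z (z.mapVal g), p.2 = g p.1 := by
      intro p hp
      rw [simPairs, List.mem_append, Item.vals_mapVal, List.zip_map_right, List.mem_map,
        List.mem_map] at hp
      rcases hp with ⟨q, hq, rfl⟩ | ⟨v, hv, rfl⟩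
      · have hz : z.vals.zip z.vals = z.vals.map fun v => (v, v) :=
          (List.zip_of_prod (by simp [Function.comp_def]) (by simp [Function.comp_def])).symm
        rw [hz] at hq
        obtain ⟨v, hv, rfl⟩ := List.mem_map.1 hq
        rfl
      · exact (h2 v hv).symm
    refine ⟨Item.mapVal_congr fun v hv => ?_, fun p hp => ⟨?_, fun q hq => ?_⟩⟩
    · obtain ⟨u, hu⟩ := lookup_isSome_of_mem (l := simPairs F z (z.mapVal g)) (x := v) (by
        rw [simPairs, List.map_append, List.map_fst_zip (by simp [Item.vals_mapVal])]
        exact List.mem_append_left _ hv)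
      rw [hu]
      exact key _ (mem_of_lookup_eq hu)
    · rw [key p hp, h1]
    · rw [key p hp, key q hq, g.apply_eq_iff_eq]

/-- Equivalence of renamings says that `ρ x ↦ ρ' x` is well defined, injective and preserves kinds;
on finitely many arguments it extends to a permutation. -/
theorem RenEq.exists_fixes {F : List ℕ} {ρ ρ' : ℕ → Val} (h : RenEq F ρ ρ') (xs : List ℕ) :
    ∃ g, Fixes (F.map .var) g ∧ ∀ x ∈ xs, g (ρ x) = ρ' x := by
  obtain ⟨g, h1, h2⟩ := exists_perm_of_zip (c := kind) ((xs ++ F).map fun x => (ρ x, ρ' x)) (by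
      intro p hp
      obtain ⟨x, -, rfl⟩ := List.mem_map.1 hp
      have := h.cls x
      cases h1 : ρ x with
      | var y =>
        cases h2 : ρ' x with
        | var y' => rfl
        | act A => exact absurd ((this A.1).2 ⟨A.2, h2⟩) (by simp [h1])
      | act A =>
        have := (this A.1).1 ⟨A.2, h1⟩
        obtain ⟨i, hi⟩ := this
        simp [hi, kind]) (by
      intro p hp q hq
      obtain ⟨x, -, rfl⟩ := List.mem_map.1 hp
      obtain ⟨y, -, rfl⟩ := List.mem_map.1 hq
      exact h.partition x y)
  refine ⟨g, ⟨h1, fun v hv => ?_⟩, fun x hx => ?_⟩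
  · obtain ⟨x, hx, rfl⟩ := List.mem_map.1 hv
    have := h2 (ρ x, ρ' x) (List.mem_map.2 ⟨x, by simp [hx], rfl⟩)
    rwa [h.fix_left x hx, h.fix_right x hx] at this
  · exact h2 (ρ x, ρ' x) (List.mem_map.2 ⟨x, by simp [hx], rfl⟩)

/-- A single `ρ` that names all values suffices: variables in `F` name themselves, and any other
value is named by a variable beyond `F` that encodes it. Such names allow any item to be written
without actor names. -/
theorem Fixes.exists_renEq {F : List ℕ} {g : Equiv.Perm Val} (hg : Fixes (F.map .var) g) :
    ∃ (enc : Val → ℕ) (ρ : ℕ → Val), RenEq F ρ (fun x => g (ρ x)) ∧ ∀ v, ρ (enc v) = v := by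
  have hF : ∀ x ∈ F, g (.var x) = .var x := fun x hx => hg.fix _ (List.mem_map_of_mem hx)
  let B := F.sum + 1
  have hB : ∀ n, B + n ∉ F := fun n hn => by
    have := List.single_le_sum (l := F) (by simp) _ hn
    omega
  refine ⟨fun v => if v ∈ F.map .var then v.idx else B + Encodable.encode v,
    fun y => if y ∈ F then .var y else Denumerable.ofNat Val (y - B), ⟨?_, ?_, ?_, ?_, ?_⟩, ?_⟩
  · intro x hx
    simp [hx]
  · intro x hx
    simp [hx, hF]
  · intro x y
    simp
  · intro x c
    have : ∀ v, (∃ i, v = .act (c, i)) ↔ kind v = some c := by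
      rintro (y | ⟨c', i⟩)
      · simp [kind]
      · simp [kind, eq_comm]
    rw [this, this, hg.kind_eq]
  · intro x z hz
    have : ∀ v, v = .var z ∨ g v = .var z → v = g v := by
      rintro v (rfl | h)
      · rw [hF z hz]
      · rw [← hF z hz, g.apply_eq_iff_eq] at h
        rw [h, hF z hz]
    exact this _
  · intro v
    by_cases hv : v ∈ F.map .var
    · obtain ⟨x, hx, rfl⟩ := List.mem_map.1 hv
      simp [Val.idx, hx]
    · simp only [if_neg hv, if_neg (hB _), Nat.add_sub_cancel_left, Denumerable.ofNat_encode]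

theorem Expr.all_of_vals {p : Atom → Prop} (hp : ∀ j, p (.bvar j)) {E : Expr}
    (h : ∀ v ∈ E.vals, p (.val v)) : E.All p := by
  cases E with
  | atom t => cases t <;> simp_all [Expr.All, Expr.vals, Atom.vals]
  | new C => trivial

theorem Proc.all_of_vals {p : Atom → Prop} (hp : ∀ j, p (.bvar j)) {P : Proc} {k : ℕ}
    (h : ∀ v ∈ P.vals, p (.val v)) : P.All (fun _ => p) k := by
  induction P generalizing k with
  | nil => trivial
  | letin E P ih =>
    simp only [Proc.vals, List.mem_append] at h
    exact ⟨Expr.all_of_vals hp fun v hv => h v (.inl hv), ih fun v hv => h v (.inr hv)⟩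
  | send t m Es P ih =>
    simp only [Proc.vals, List.mem_append, List.mem_flatMap] at h
    exact ⟨Expr.all_of_vals (E := .atom t) hp fun v hv => h v (.inl (.inl hv)),
      fun E hE => Expr.all_of_vals hp fun v hv => h v (.inl (.inr ⟨E, hE, hv⟩)),
      ih fun v hv => h v (.inr hv)⟩
  | ite E E' P Q ih ih' =>
    simp only [Proc.vals, List.mem_append] at h
    exact ⟨Expr.all_of_vals hp fun v hv => h v (.inl (.inl (.inl hv))),
      Expr.all_of_vals hp fun v hv => h v (.inl (.inl (.inr hv))),
      ih fun v hv => h v (.inl (.inr hv)), ih' fun v hv => h v (.inr hv)⟩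
  | plus P Q ih ih' =>
    simp only [Proc.vals, List.mem_append] at h
    exact ⟨ih fun v hv => h v (.inl hv), ih' fun v hv => h v (.inr hv)⟩

/-- Similarity is lying in the same orbit under the permutations that preserve kinds and fix `F`. In
this form it composes with the permutations of the simulation. -/
theorem procSim_iff {F : List ℕ} {P P' : Proc} :
    ProcSim F P P' ↔ ∃ g, Fixes (F.map .var) g ∧ P' = P.mapVal g := by
  constructor
  · rintro ⟨P₀, ρ, ρ', h0, h, rfl, rfl⟩
    obtain ⟨g, h1, h2⟩ := h.exists_fixes P₀.fv
    refine ⟨g, h1, ?_⟩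
    rw [Proc.subst, Proc.subst, Proc.mapVal_mapVal]
    refine Proc.mapVal_congr fun v hv => ?_
    obtain ⟨x, rfl⟩ := h0.vals hv
    exact (h2 x (Proc.mem_fv.2 hv)).symm
  · rintro ⟨g, hg, rfl⟩
    obtain ⟨enc, ρ, h1, h2⟩ := hg.exists_renEq
    refine ⟨P.mapVal fun v => .var (enc v), ρ, _, ?_, h1, ?_, ?_⟩
    · apply Proc.all_of_vals
      · simp
      · intro v hv
        rw [Proc.vals_mapVal, List.mem_map] at hv
        obtain ⟨u, -, rfl⟩ := hv
        simp
    · rw [Proc.subst, Proc.mapVal_mapVal]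
      conv_lhs => rw [← P.mapVal_id]
      exact Proc.mapVal_congr fun v _ => (h2 v).symm
    · rw [Proc.subst, Proc.mapVal_mapVal]
      exact Proc.mapVal_congr fun v _ => by simp [Val.bind, h2]

theorem msgSim_iff {F : List ℕ} {μ μ' : Msg} :
    MsgSim F μ μ' ↔ μ.meth = μ'.meth ∧ ∃ g, Fixes (F.map .var) g ∧ μ'.args = μ.args.map g := by
  refine and_congr_right fun _ => ⟨?_, ?_⟩
  · rintro ⟨xs, ρ, ρ', h, h1, h2⟩
    obtain ⟨g, h3, h4⟩ := h.exists_fixes xs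
    refine ⟨g, h3, ?_⟩
    rw [h1, h2, List.map_map]
    exact List.map_congr_left fun x hx => (h4 x hx).symm
  · rintro ⟨g, hg, h⟩
    obtain ⟨enc, ρ, h1, h2⟩ := hg.exists_renEq
    refine ⟨μ.args.map enc, ρ, _, h1, ?_, ?_⟩
    · simp [Function.comp_def, h2]
    · simp [Function.comp_def, h2, h]

/-- Similarity of items. -/
def ItemSim (F : List Val) (z z' : Item) : Prop := ∃ g, Fixes F g ∧ z' = z.mapVal g

theorem itemSim_inr {𝒢 : Program} {P P' : Proc} :
    ItemSim 𝒢.free (.inr P) (.inr P') ↔ ProcSim 𝒢.main.fv P P' := by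
  rw [procSim_iff]
  simp [ItemSim, Item.mapVal, Program.free]

theorem itemSim_msg {𝒢 : Program} {μ μ' : Msg} :
    ItemSim 𝒢.free (.inl (μ.meth, μ.args)) (.inl (μ'.meth, μ'.args)) ↔ MsgSim 𝒢.main.fv μ μ' := by
  rw [msgSim_iff]
  simp only [ItemSim, Item.mapVal, Sum.inl.injEq, Prod.mk.injEq, Program.free]
  constructor
  · rintro ⟨g, h1, h2, h3⟩
    exact ⟨h2.symm, g, h1, h3⟩
  · rintro ⟨h2, g, h1, h3⟩
    exact ⟨g, h1, h2.symm, h3⟩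

theorem itemSim_iff {F : List Val} {z z' : Item} : ItemSim F z z' ↔ simb kind F z z' = true := by
  rw [simb_iff]
  exact ⟨fun ⟨g, h1, h2⟩ => ⟨g, h1.1, h1.2, h2⟩, fun ⟨g, h1, h2, h3⟩ => ⟨g, ⟨h1, h2⟩, h3⟩⟩

theorem ItemSim.mapVal {F : List Val} {z z' : Item} (h : ItemSim F z z') {g : Equiv.Perm Val}
    (hg : Fixes F g) : ItemSim F z (z'.mapVal g) := by
  obtain ⟨k, hk, rfl⟩ := h
  exact ⟨g * k, hg.mul hk, by rw [Item.mapVal_mapVal]; rfl⟩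

/-- Whether the value is an actor name. -/
def Val.isAct (v : Val) : Bool := (kind v).isSome

/-- Process reachability allows classes to be permuted, so the colour is only whether a value is an
actor name. A permutation of the values that respects it splits into one of the variables and one of
the names. -/
theorem exists_rename_iff {P P' : Proc} :
    (∃ (π : Equiv.Perm ℕ) (τ : Equiv.Perm ActorName), P' = P.mapVal (Val.rename π τ)) ↔
      simb Val.isAct [] (.inr P) (.inr P') = true := by
  rw [simb_iff]
  constructor
  · rintro ⟨π, τ, rfl⟩
    exact ⟨⟨Val.rename π τ, Val.rename π.symm τ.symm, fun v => by cases v <;> simp [Val.rename],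
      fun v => by cases v <;> simp [Val.rename]⟩, fun v => by cases v <;> rfl, by simp, rfl⟩
  · rintro ⟨g, hg, -, h⟩
    have key : ∀ g : Equiv.Perm Val, (∀ v, (g v).isAct = v.isAct) →
        (∀ x, ∃ y, g (.var x) = .var y) ∧ ∀ A, ∃ B, g (.act A) = .act B := by
      refine fun g hg => ⟨fun x => ?_, fun A => ?_⟩
      · have := hg (.var x)
        cases h : g (.var x) with
        | var y => exact ⟨y, rfl⟩
        | act B => simp [h, Val.isAct, kind] at this
      · have := hg (.act A)
        cases h : g (.act A) with
        | var y => simp [h, Val.isAct, kind] at this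
        | act B => exact ⟨B, rfl⟩
    obtain ⟨h1, h2⟩ := key g hg
    obtain ⟨h3, h4⟩ := key g.symm fun v => by rw [← hg, Equiv.apply_symm_apply]
    choose π hπ using h1
    choose τ hτ using h2
    choose π' hπ' using h3
    choose τ' hτ' using h4
    refine ⟨⟨π, π', fun x => ?_, fun x => ?_⟩, ⟨τ, τ', fun x => ?_, fun x => ?_⟩, ?_⟩
    · have := hπ' (π x)
      rw [← hπ, Equiv.symm_apply_apply] at this
      exact (Val.var.inj this).symm
    · have := hπ (π' x)
      rw [← hπ', Equiv.apply_symm_apply] at this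
      exact (Val.var.inj this).symm
    · have := hτ' (τ x)
      rw [← hτ, Equiv.symm_apply_apply] at this
      exact (Val.act.inj this).symm
    · have := hτ (τ' x)
      rw [← hτ', Equiv.apply_symm_apply] at this
      exact (Val.act.inj this).symm
    · rw [Sum.inr.inj h]
      refine Proc.mapVal_congr fun v _ => ?_
      cases v with
      | var x => exact hπ x
      | act A => exact hτ A

/-! ### Markings -/

/-- The items to be tracked can be prescribed separately for each owner, as a sublist of its items.
-/
theorem exists_marking {w : List (Entry ℕ)} {l : Val → List Item}
    (h : ∀ v, (l v).Sublist (cont v w)) :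
    ∃ W : List (Entry Bool), W.map Prod.snd = w.map Prod.snd ∧ ∀ v, cont v (tracked W) = l v := by
  induction w generalizing l with
  | nil => exact ⟨[], rfl, fun v => (List.sublist_nil.1 (h v)).symm⟩
  | cons e w ih =>
    have he := h e.2.1
    rw [cont_cons, if_pos rfl] at he
    have hne : ∀ v, v ≠ e.2.1 → (l v).Sublist (cont v w) := fun v hv => by
      have := h v
      rwa [cont_cons, if_neg hv.symm] at this
    rcases List.sublist_cons_iff.1 he with he | ⟨l', hl', he⟩
    · obtain ⟨W, h1, h2⟩ := ih (l := l) fun v => by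
        by_cases hv : v = e.2.1
        · rwa [hv]
        · exact hne v hv
      exact ⟨(false, e.2) :: W, by simp [h1], h2⟩
    · obtain ⟨W, h1, h2⟩ := ih (l := Function.update l e.2.1 l') fun v => by
        by_cases hv : v = e.2.1
        · rwa [hv, Function.update_self]
        · rw [Function.update_of_ne hv]
          exact hne v hv
      refine ⟨(true, e.2) :: W, by simp [h1], fun v => ?_⟩
      have : tracked ((true, e.2) :: W) = (true, e.2) :: tracked W := rfl
      rw [this, cont_cons, h2]
      by_cases hv : e.2.1 = v
      · rw [if_pos hv, ← hv, Function.update_self, hl']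
      · rw [if_neg hv, Function.update_of_ne (Ne.symm hv)]

theorem length_le_sum_cont {w : List (Entry Bool)} {n : ℕ} {os : Fin n → Val}
    (h : ∀ e ∈ w, ∃ i, os i = e.2.1) : w.length ≤ ∑ i, (cont (os i) w).length := by
  induction w with
  | nil => simp
  | cons e w ih =>
    obtain ⟨i, hi⟩ := h e (by simp)
    have h1 : ∀ j, (cont (os j) w).length + (if j = i then 1 else 0) ≤
        (cont (os j) (e :: w)).length := by
      intro j
      rw [cont_cons]
      by_cases hj : j = i
      · simp [hj, hi]
      · rw [if_neg hj]
        split_ifs <;> simp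
    have h2 := Finset.sum_le_sum fun j (_ : j ∈ Finset.univ) => h1 j
    rw [Finset.sum_add_distrib, Finset.sum_ite_eq' Finset.univ i, if_pos (Finset.mem_univ i)] at h2
    have h3 := ih fun e he => h e (by simp [he])
    simp only [List.length_cons]
    omega

theorem cont_map {g : Equiv.Perm Val} (v : Val) (w : List (Entry Bool)) :
    cont (g v) (w.map (Entry.mapVal g)) = (cont v w).map (Item.mapVal g) := by
  induction w with
  | nil => rfl
  | cons e w ih =>
    rw [List.map_cons, cont_cons, cont_cons, ih]
    by_cases he : e.2.1 = v
    · simp [Entry.mapVal, he]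
    · have : ¬ (e.mapVal g).2.1 = g v := fun h => he (g.injective h)
      rw [if_neg this, if_neg he]

theorem Sim.exists_fixes {F : List Val} {α w : List (Entry Bool)} (h : Sim F α w) :
    ∃ g, Fixes F g ∧ tracked α = (tracked w).map (Entry.mapVal g) := by
  obtain ⟨h, h1, h2⟩ := h
  refine ⟨h⁻¹, h1.inv, ?_⟩
  rw [h2.tracked_eq fun e he hb v hv => mem_known.2 (.inr ⟨e, he, hb, hv⟩), List.map_map]
  conv_lhs => rw [← List.map_id (tracked α)]
  refine List.map_congr_left fun e _ => ?_
  rw [Function.comp_apply, Entry.mapVal_mapVal, ← Equiv.Perm.coe_mul, inv_mul_cancel]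
  exact e.mapVal_id.symm

/-! ### Process reachability -/

/-- It suffices to track the process in question, which explains the bound 1. In both directions the
tracked items of the concrete and the abstract state differ by a permutation that preserves kinds,
which is absorbed in the renaming. -/
theorem processReachable_iff {𝒢 : Program} (h𝒢 : 𝒢.Pure) {P : Proc} :
    𝒢.ProcessReachable P ↔ ∃ α ∈ starts 𝒢 1 𝒢.init, ∃ n α', APath 𝒢 1 n α α' ∧
      ∃ e ∈ tracked α', simb Val.isAct [] (.inr P) e.2.2 = true := by
  constructor
  · rintro ⟨S, hS, a, ha, h⟩
    rw [exists_rename_iff, simb_iff] at h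
    obtain ⟨k, hk1, -, hk2⟩ := h
    obtain ⟨w, h1, h2, h3⟩ := Reach.exists_apath h𝒢 .refl hS
    obtain ⟨W, h4, h5⟩ := exists_marking (w := w)
        (l := fun v => if v = .act a.name then [.inr a.proc] else []) (by
      intro v
      split_ifs with hv
      · rw [hv, List.singleton_sublist]
        exact h2 a ha
      · exact List.nil_sublist _)
    have hcnt : cnt W ≤ 1 := by
      rw [cnt_eq_length]
      refine (length_le_sum_cont (n := 1) (os := fun _ => .act a.name) fun e he => ⟨0, ?_⟩).trans ?_
      · by_contra hne
        have := h5 e.2.1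
        rw [if_neg (Ne.symm hne)] at this
        have h6 : e.2.2 ∈ cont e.2.1 (tracked W) := mem_cont.2 ⟨e.1, he⟩
        simp [this] at h6
      · simp [h5]
    obtain ⟨α, hα, n, α', hp, hs⟩ := h3 1 W h4 hcnt
    refine ⟨α, hα, n, α', hp, ?_⟩
    obtain ⟨g, hg, ht⟩ := hs.exists_fixes
    have h6 : Sum.inr a.proc ∈ cont (.act a.name) (tracked W) := by simp [h5]
    obtain ⟨f, hf⟩ := mem_cont.1 h6
    rw [ht]
    refine ⟨_, List.mem_map_of_mem hf, simb_iff.2 ⟨g * k, fun v => ?_, by simp, ?_⟩⟩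
    · rw [Equiv.Perm.mul_apply, Val.isAct, hg.kind_eq]
      exact hk1 v
    · simp only [Entry.mapVal, hk2, Item.mapVal_mapVal]
      rfl
  · rintro ⟨α, hα, n, α', hp, e, he, h⟩
    obtain ⟨T, w, h1, h2, g, hg, ht, -⟩ := hp.exists_reach h𝒢 .refl hα
    obtain ⟨k, hk1, -, hk2⟩ := simb_iff.1 h
    have hw : e.mapVal g ∈ w := by
      have : e.mapVal g ∈ tracked w := ht ▸ List.mem_map_of_mem he
      exact List.mem_of_mem_filter this
    obtain ⟨A, hA, hA'⟩ := h2.owner _ hw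
    obtain ⟨a, ha, rfl⟩ := mem_names.1 hA
    have hm : (Sum.inr ((P.mapVal k).mapVal g) : Item) ∈ cont (.act a.name) w := by
      rw [mem_cont]
      refine ⟨e.1, ?_⟩
      rw [← hA']
      have : e.2.2.mapVal g = Sum.inr ((P.mapVal k).mapVal g) := by rw [hk2]; rfl
      rw [← this]
      exact hw
    -- The item is a process and not a message, so it can only be the running process of its owner.
    have hP : a.proc = (P.mapVal k).mapVal g := by
      rcases h2.content a ha with hc | ⟨-, hc⟩ <;> rw [hc] at hm
      · simpa [msgItems, eq_comm] using hm
      · simp [msgItems] at hm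
    refine ⟨T, h1, a, ha, exists_rename_iff.2 (simb_iff.2 ⟨g * k, fun v => ?_, by simp, ?_⟩)⟩
    · rw [Equiv.Perm.mul_apply, Val.isAct, hg.kind_eq]
      exact hk1 v
    · rw [hP, Proc.mapVal_mapVal]
      rfl

/-! ### Control-state reachability -/

/-- The tracked items contain a copy of the configuration `T`. -/
def Covers (𝒢 : Program) (T : Config) (α : List (Entry Bool)) : Prop :=
  ∃ os : Fin T.length → Val, Function.Injective os ∧ ∀ i, kind (os i) = some (T.get i).name.1 ∧
    List.Forall₂ (ItemSim 𝒢.free) (.inr (T.get i).proc :: msgItems (T.get i).queue)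
      (cont (os i) (tracked α))

theorem Covers.perm {𝒢 : Program} {T : Config} {α w : List (Entry Bool)} (h : Covers 𝒢 T α)
    {g : Equiv.Perm Val} (hg : Fixes 𝒢.free g)
    (ht : tracked w = (tracked α).map (Entry.mapVal g)) : Covers 𝒢 T w := by
  obtain ⟨os, h1, h2⟩ := h
  refine ⟨fun i => g (os i), g.injective.comp h1, fun i => ⟨?_, ?_⟩⟩
  · rw [hg.kind_eq, (h2 i).1]
  · rw [ht, cont_map, List.forall₂_map_right_iff]
    exact (h2 i).2.imp fun z z' hz => hz.mapVal hg

/-- The number of items of a configuration. -/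
def Config.size (T : Config) : ℕ := (T.map fun a => 1 + a.queue.length).sum

/-- Tracked are the items of `T'` that match items of `T`, so their number is the number of items of
`T`. Untracked items may stand between them, which the ordering permits because queues only have to
embed. -/
theorem controlStateReachable_iff {𝒢 : Program} (h𝒢 : 𝒢.Pure) {S T : Config}
    (hS : Reach 𝒢 𝒢.init S) :
    𝒢.ControlStateReachable S T ↔ ∃ α ∈ starts 𝒢 T.size S, ∃ n α', APath 𝒢 T.size n α α' ∧
      Covers 𝒢 T α' := by
  constructor
  · rintro ⟨T', ⟨f, hf, hle⟩, hT'⟩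
    obtain ⟨w, h1, h2, h3⟩ := hS.exists_apath h𝒢 hT'
    have hq : ∀ i, ∃ l, List.Forall₂ (MsgSim 𝒢.main.fv) (T.get i).queue l ∧
        l.Sublist (T'.get (f i)).queue := fun i => List.sublistForall₂_iff.1 (hle i).2.2
    choose q hq1 hq2 using hq
    have hinj : Function.Injective fun i => (T'.get (f i)).name := by
      intro i j hij
      refine hf ?_
      have := h1.nodup
      rw [names, List.nodup_iff_injective_getElem] at this
      have h4 := @this ⟨(f i).1, by simp⟩ ⟨(f j).1, by simp⟩ (by simpa using hij)
      exact Fin.ext (by simpa using h4)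
    classical
    -- For each matched actor, its process and the matched part of its queue are marked; for all
    -- others nothing is marked.
    let l : Val → List Item := fun v =>
      if h : ∃ i, .act (T'.get (f i)).name = v then
        .inr (T'.get (f h.choose)).proc :: msgItems (q h.choose) else []
    have hl : ∀ i, l (.act (T'.get (f i)).name) = .inr (T'.get (f i)).proc :: msgItems (q i) := by
      intro i
      have h : ∃ j, Val.act (T'.get (f j)).name = .act (T'.get (f i)).name := ⟨i, rfl⟩
      have h4 : h.choose = i := hinj (Val.act.inj h.choose_spec)
      simp only [l]
      rw [dif_pos h, h4]
    obtain ⟨W, h4, h5⟩ := exists_marking (w := w) (l := l) (by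
      intro v
      by_cases h : ∃ i, .act (T'.get (f i)).name = v
      · obtain ⟨i, rfl⟩ := h
        rw [hl, h1.exact_content h2 (List.get_mem _ _)]
        exact ((hq2 i).map _).cons_cons _
      · simp only [l]
        rw [dif_neg h]
        exact List.nil_sublist _)
    have hcnt : cnt W ≤ T.size := by
      rw [cnt_eq_length]
      refine (length_le_sum_cont (os := fun i => .act (T'.get (f i)).name) fun e he => ?_).trans ?_
      · by_contra hne
        have h6 : e.2.2 ∈ cont e.2.1 (tracked W) := mem_cont.2 ⟨e.1, he⟩
        rw [h5] at h6
        simp only [l] at h6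
        rw [dif_neg hne] at h6
        simp at h6
      · rw [Config.size, ← Fin.sum_univ_fun_getElem]
        refine Finset.sum_le_sum fun i _ => ?_
        rw [h5, hl]
        have := (hq1 i).length_eq
        simp only [List.get_eq_getElem] at this
        simp [msgItems, this, Nat.add_comm]
    obtain ⟨α, hα, n, α', hp, hs⟩ := h3 _ W h4 hcnt
    obtain ⟨g, hg, ht⟩ := hs.exists_fixes
    refine ⟨α, hα, n, α', hp, Covers.perm (α := W) ⟨fun i => .act (T'.get (f i)).name,
      fun i j hij => hinj (Val.act.inj hij), fun i => ⟨?_, ?_⟩⟩ hg ht⟩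
    · simp only [kind]
      rw [(hle i).1]
    · rw [h5, hl]
      refine .cons (itemSim_inr.2 (hle i).2.1) ?_
      rw [msgItems, msgItems, List.forall₂_map_left_iff, List.forall₂_map_right_iff]
      exact (hq1 i).imp fun μ μ' h => itemSim_msg.2 h
  · rintro ⟨α, hα, n, α', hp, hc⟩
    obtain ⟨T', w, h1, h2, g, hg, ht, -⟩ := hp.exists_reach h𝒢 hS hα
    obtain ⟨os, h3, h4⟩ := hc.perm hg ht
    have hf : ∀ i, ∃ j : Fin T'.length, os i = .act (T'.get j).name ∧
        (T.get i).name.1 = (T'.get j).name.1 ∧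
        ProcSim 𝒢.main.fv (T.get i).proc (T'.get j).proc ∧
        List.SublistForall₂ (MsgSim 𝒢.main.fv) (T.get i).queue (T'.get j).queue := by
      intro i
      obtain ⟨h5, h6⟩ := h4 i
      generalize hl : cont (os i) (tracked w) = l at h6
      cases h6 with
      | @cons _ z _ rest hz hrest =>
        have hsub : (z :: rest).Sublist (cont (os i) w) := by
          rw [← hl]
          exact List.filter_sublist.filterMap _
        obtain ⟨f, hfw⟩ := mem_cont.1 (hsub.subset List.mem_cons_self)
        obtain ⟨A, hA, hA'⟩ := h2.owner _ hfw
        obtain ⟨a, ha, rfl⟩ := mem_names.1 hA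
        obtain ⟨j, rfl⟩ := List.mem_iff_get.1 ha
        dsimp only at hA'
        refine ⟨j, hA', ?_⟩
        rw [hA'] at h5 hsub
        obtain ⟨k, hk, rfl⟩ := hz
        simp only [Item.mapVal] at hsub
        rcases h2.content _ ha with hc | ⟨-, hc⟩
        · rw [hc] at hsub
          -- The first matched item is a process, so it is not found among the messages. It is the
          -- running process of the actor, and the other matched items form a subsequence of the
          -- queue.
          rcases List.cons_sublist_cons'.1 hsub with hsub | ⟨hproc, hsub⟩
          · have := hsub.subset List.mem_cons_self
            simp [msgItems] at this
          · refine ⟨by simpa [kind, eq_comm] using h5,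
              itemSim_inr.1 ⟨k, hk, hproc.symm⟩, ?_⟩
            have hs : List.SublistForall₂ (ItemSim 𝒢.free) (msgItems (T.get i).queue)
                (msgItems (T'.get j).queue) := List.sublistForall₂_iff.2 ⟨rest, hrest, hsub⟩
            rw [msgItems, msgItems, List.sublistForall₂_map_left_iff,
              List.sublistForall₂_map_right_iff, List.sublistForall₂_iff] at hs
            obtain ⟨l', hs1, hs2⟩ := hs
            exact List.sublistForall₂_iff.2 ⟨l', hs1.imp fun μ μ' h => itemSim_msg.1 h, hs2⟩
        · rw [hc] at hsub
          have := hsub.subset List.mem_cons_self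
          simp [msgItems] at this
    choose f hf1 hf2 using hf
    refine ⟨T', ⟨f, fun i j hij => h3 ?_, fun i => ?_⟩, h1⟩
    · rw [hf1, hf1, hij]
    · exact hf2 i

/-! ### Composition rules for primitive recursive functions -/

-- Each rule below lets all arguments, and the bodies of local functions, depend on a common
-- parameter. The primitive recursiveness of a definition can then be read off its syntax.
attribute [fun_prop] Primrec

section Rules

variable {α β γ δ σ : Type} [Primcodable α] [Primcodable β] [Primcodable γ] [Primcodable δ]
  [Primcodable σ]

@[fun_prop]
theorem primrec_id : Primrec fun a : α => a := Primrec.id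

@[fun_prop]
theorem primrec_const (x : σ) : Primrec fun _ : α => x := Primrec.const x

@[fun_prop]
theorem primrec_comp {f : β → σ} {g : α → β} (hf : Primrec f) (hg : Primrec g) :
    Primrec fun a => f (g a) := hf.comp hg

@[fun_prop]
theorem primrec_pair {f : α → β} {g : α → γ} (hf : Primrec f) (hg : Primrec g) :
    Primrec fun a => (f a, g a) := hf.pair hg

@[fun_prop]
theorem primrec_fst {f : α → β × γ} (hf : Primrec f) : Primrec fun a => (f a).1 :=
  Primrec.fst.comp hf

@[fun_prop]
theorem primrec_snd {f : α → β × γ} (hf : Primrec f) : Primrec fun a => (f a).2 :=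
  Primrec.snd.comp hf

@[fun_prop]
theorem primrec_inl {f : α → β} (hf : Primrec f) : Primrec fun a => (Sum.inl (f a) : β ⊕ γ) :=
  Primrec.sumInl.comp hf

@[fun_prop]
theorem primrec_inr {f : α → γ} (hf : Primrec f) : Primrec fun a => (Sum.inr (f a) : β ⊕ γ) :=
  Primrec.sumInr.comp hf

@[fun_prop]
theorem primrec_sumElim {f : α → β ⊕ γ} {g : α → β → σ} {h : α → γ → σ} (hf : Primrec f)
    (hg : Primrec fun p : α × β => g p.1 p.2) (hh : Primrec fun p : α × γ => h p.1 p.2) :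
    Primrec fun a => Sum.elim (g a) (h a) (f a) :=
  (Primrec.sumCasesOn hf hg hh).of_eq fun a => by cases f a <;> rfl

@[fun_prop]
theorem primrec_append {f g : α → List β} (hf : Primrec f) (hg : Primrec g) :
    Primrec fun a => f a ++ g a := Primrec.list_append.comp hf hg

@[fun_prop]
theorem primrec_cons {f : α → β} {g : α → List β} (hf : Primrec f) (hg : Primrec g) :
    Primrec fun a => f a :: g a := Primrec.list_cons.comp hf hg

@[fun_prop]
theorem primrec_map {f : α → List β} {g : α → β → γ} (hf : Primrec f)
    (hg : Primrec fun p : α × β => g p.1 p.2) : Primrec fun a => (f a).map (g a) :=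
  Primrec.list_map hf hg

@[fun_prop]
theorem primrec_flatMap {f : α → List β} {g : α → β → List γ} (hf : Primrec f)
    (hg : Primrec fun p : α × β => g p.1 p.2) : Primrec fun a => (f a).flatMap (g a) :=
  Primrec.list_flatMap hf hg

@[fun_prop]
theorem primrec_filterMap {f : α → List β} {g : α → β → Option γ} (hf : Primrec f)
    (hg : Primrec fun p : α × β => g p.1 p.2) : Primrec fun a => (f a).filterMap (g a) :=
  Primrec.listFilterMap hf hg

@[fun_prop]
theorem primrec_foldr {f : α → List β} {g : α → β → σ → σ} {x : α → σ} (hf : Primrec f)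
    (hg : Primrec fun p : α × β × σ => g p.1 p.2.1 p.2.2) (hx : Primrec x) :
    Primrec fun a => (f a).foldr (g a) (x a) :=
  Primrec.list_foldr (h := fun a p => g a p.1 p.2) hf hx hg

@[fun_prop]
theorem primrec_foldl {f : α → List β} {g : α → σ → β → σ} {x : α → σ} (hf : Primrec f)
    (hg : Primrec fun p : α × σ × β => g p.1 p.2.1 p.2.2) (hx : Primrec x) :
    Primrec fun a => (f a).foldl (g a) (x a) :=
  Primrec.list_foldl (h := fun a p => g a p.1 p.2) hf hx hg

@[fun_prop]
theorem primrec_length {f : α → List β} (hf : Primrec f) : Primrec fun a => (f a).length :=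
  Primrec.list_length.comp hf

@[fun_prop]
theorem primrec_tail {f : α → List β} (hf : Primrec f) : Primrec fun a => (f a).tail :=
  Primrec.list_tail.comp hf

@[fun_prop]
theorem primrec_head? {f : α → List β} (hf : Primrec f) : Primrec fun a => (f a).head? :=
  Primrec.list_head?.comp hf

@[fun_prop]
theorem primrec_take {f : α → List β} {n : α → ℕ} (hn : Primrec n) (hf : Primrec f) :
    Primrec fun a => (f a).take (n a) := Primrec.list_take.comp hn hf

@[fun_prop]
theorem primrec_drop {f : α → List β} {n : α → ℕ} (hn : Primrec n) (hf : Primrec f) :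
    Primrec fun a => (f a).drop (n a) := Primrec.list_drop.comp hn hf

@[fun_prop]
theorem primrec_range {n : α → ℕ} (hn : Primrec n) : Primrec fun a => List.range (n a) :=
  Primrec.list_range.comp hn

@[fun_prop]
theorem primrec_getElem? {f : α → List β} {n : α → ℕ} (hf : Primrec f) (hn : Primrec n) :
    Primrec fun a => (f a)[n a]? := Primrec.list_getElem?.comp hf hn

@[fun_prop]
theorem primrec_lookup [DecidableEq β] {f : α → List (β × γ)} {x : α → β} (hx : Primrec x)
    (hf : Primrec f) : Primrec fun a => (f a).lookup (x a) := Primrec.listLookup.comp hx hf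

@[fun_prop]
theorem primrec_idxOf [DecidableEq β] {f : α → List β} {x : α → β} (hx : Primrec x)
    (hf : Primrec f) : Primrec fun a => (f a).idxOf (x a) := Primrec.list_idxOf.comp hx hf

@[fun_prop]
theorem primrec_some {f : α → β} (hf : Primrec f) : Primrec fun a => some (f a) :=
  Primrec.option_some.comp hf

@[fun_prop]
theorem primrec_getD {f : α → Option β} {g : α → β} (hf : Primrec f) (hg : Primrec g) :
    Primrec fun a => (f a).getD (g a) := Primrec.option_getD.comp hf hg

@[fun_prop]
theorem primrec_toList {f : α → Option β} (hf : Primrec f) : Primrec fun a => (f a).toList :=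
  Primrec.optionToList.comp hf

@[fun_prop]
theorem primrec_isSome {f : α → Option β} (hf : Primrec f) : Primrec fun a => (f a).isSome :=
  Primrec.option_isSome.comp hf

@[fun_prop]
theorem primrec_optionMap {f : α → Option β} {g : α → β → γ} (hf : Primrec f)
    (hg : Primrec fun p : α × β => g p.1 p.2) : Primrec fun a => (f a).map (g a) :=
  Primrec.option_map hf hg

@[fun_prop]
theorem primrec_bind {f : α → Option β} {g : α → β → Option γ} (hf : Primrec f)
    (hg : Primrec fun p : α × β => g p.1 p.2) : Primrec fun a => (f a).bind (g a) :=
  Primrec.option_bind hf hg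

@[fun_prop]
theorem primrec_optionElim {f : α → Option β} {x : α → γ} {g : α → β → γ} (hf : Primrec f)
    (hx : Primrec x) (hg : Primrec fun p : α × β => g p.1 p.2) :
    Primrec fun a => (f a).elim (x a) (g a) :=
  (Primrec.option_casesOn hf hx hg).of_eq fun a => by cases f a <;> rfl

@[fun_prop]
theorem primrec_natRec {n : α → ℕ} {x : α → σ} {g : α → ℕ → σ → σ} (hn : Primrec n)
    (hx : Primrec x) (hg : Primrec fun p : α × ℕ × σ => g p.1 p.2.1 p.2.2) :
    Primrec fun a => Nat.rec (motive := fun _ => σ) (x a) (g a) (n a) :=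
  Primrec.nat_rec' (h := fun a p => g a p.1 p.2) hn hx hg

@[fun_prop]
theorem primrec_add {f g : α → ℕ} (hf : Primrec f) (hg : Primrec g) :
    Primrec fun a => f a + g a := Primrec.nat_add.comp hf hg

@[fun_prop]
theorem primrec_mul {f g : α → ℕ} (hf : Primrec f) (hg : Primrec g) :
    Primrec fun a => f a * g a := Primrec.nat_mul.comp hf hg

@[fun_prop]
theorem primrec_sub {f g : α → ℕ} (hf : Primrec f) (hg : Primrec g) :
    Primrec fun a => f a - g a := Primrec.nat_sub.comp hf hg

@[fun_prop]
theorem primrec_div {f g : α → ℕ} (hf : Primrec f) (hg : Primrec g) :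
    Primrec fun a => f a / g a := Primrec.nat_div.comp hf hg

@[fun_prop]
theorem primrec_mod {f g : α → ℕ} (hf : Primrec f) (hg : Primrec g) :
    Primrec fun a => f a % g a := Primrec.nat_mod.comp hf hg

@[fun_prop]
theorem primrec_natPair {f g : α → ℕ} (hf : Primrec f) (hg : Primrec g) :
    Primrec fun a => Nat.pair (f a) (g a) := Primrec₂.natPair.comp hf hg

@[fun_prop]
theorem primrec_unpair {f : α → ℕ} (hf : Primrec f) : Primrec fun a => (f a).unpair :=
  Primrec.unpair.comp hf

@[fun_prop]
theorem primrec_encode {f : α → β} (hf : Primrec f) : Primrec fun a => Encodable.encode (f a) :=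
  Primrec.encode.comp hf

@[fun_prop]
theorem primrec_not {f : α → Bool} (hf : Primrec f) : Primrec fun a => !f a := Primrec.not.comp hf

@[fun_prop]
theorem primrec_and {f g : α → Bool} (hf : Primrec f) (hg : Primrec g) :
    Primrec fun a => f a && g a := Primrec.and.comp hf hg

@[fun_prop]
theorem primrec_or {f g : α → Bool} (hf : Primrec f) (hg : Primrec g) :
    Primrec fun a => f a || g a := Primrec.or.comp hf hg

@[fun_prop]
theorem primrec_ite {p : α → Prop} [h : ∀ a, Decidable (p a)] {f g : α → σ}
    (hp : Primrec fun a => decide (p a)) (hf : Primrec f) (hg : Primrec g) :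
    Primrec fun a => if p a then f a else g a :=
  (Primrec.cond hp hf hg).of_eq fun a => by by_cases h : p a <;> simp [h]

@[fun_prop]
theorem primrec_decide_eq {f g : α → β} [h : ∀ a, Decidable (f a = g a)] (hf : Primrec f)
    (hg : Primrec g) : Primrec fun a => decide (f a = g a) := by
  classical
  exact ((Primrec.eq (α := β)).comp hf hg).decide.of_eq fun a => by simp

@[fun_prop]
theorem primrec_decide_not {p : α → Prop} [h : ∀ a, Decidable (p a)] [h' : ∀ a, Decidable (¬ p a)]
    (hp : Primrec fun a => decide (p a)) : Primrec fun a => decide (¬ p a) :=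
  (Primrec.not.comp hp).of_eq fun a => by simp

@[fun_prop]
theorem primrec_decide_and {p q : α → Prop} [h : ∀ a, Decidable (p a)] [h' : ∀ a, Decidable (q a)]
    [h'' : ∀ a, Decidable (p a ∧ q a)]
    (hp : Primrec fun a => decide (p a)) (hq : Primrec fun a => decide (q a)) :
    Primrec fun a => decide (p a ∧ q a) :=
  (Primrec.and.comp hp hq).of_eq fun a => by simp

@[fun_prop]
theorem primrec_decide_iff {p q : α → Prop} [h : ∀ a, Decidable (p a)] [h' : ∀ a, Decidable (q a)]
    [h'' : ∀ a, Decidable (p a ↔ q a)]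
    (hp : Primrec fun a => decide (p a)) (hq : Primrec fun a => decide (q a)) :
    Primrec fun a => decide (p a ↔ q a) := by
  refine (primrec_decide_eq hp hq).of_eq fun a => ?_
  simp

@[fun_prop]
theorem primrec_decide_le {f g : α → ℕ} (hf : Primrec f) (hg : Primrec g) :
    Primrec fun a => decide (f a ≤ g a) := (Primrec.nat_le.comp hf hg).decide

@[fun_prop]
theorem primrec_all {f : α → List β} {g : α → β → Bool} (hf : Primrec f)
    (hg : Primrec fun p : α × β => g p.1 p.2) : Primrec fun a => (f a).all (g a) := by
  have : Primrec fun a => (f a).foldr (fun b r => g a b && r) true := by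
    have : Primrec fun p : α × β × Bool => g p.1 p.2.1 := hg.comp (f := fun p : α × β => g p.1 p.2)
      (g := fun p : α × β × Bool => (p.1, p.2.1)) (by fun_prop)
    fun_prop
  exact this.of_eq fun a => by
    induction f a with
    | nil => rfl
    | cons b l ih => rw [List.foldr_cons, ih, List.all_cons]

@[fun_prop]
theorem primrec_any {f : α → List β} {g : α → β → Bool} (hf : Primrec f)
    (hg : Primrec fun p : α × β => g p.1 p.2) : Primrec fun a => (f a).any (g a) := by
  refine (Primrec.not.comp (primrec_all (g := fun a b => !g a b) hf (Primrec.not.comp hg))).of_eq fun a => ?_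
  simp [List.any_eq_not_all_not]

@[fun_prop]
theorem primrec_decide_forall_mem {f : α → List β} {p : α → β → Prop}
    [h : ∀ a b, Decidable (p a b)] [h' : ∀ a, Decidable (∀ b ∈ f a, p a b)]
    (hf : Primrec f) (hp : Primrec fun q : α × β => decide (p q.1 q.2)) :
    Primrec fun a => decide (∀ b ∈ f a, p a b) :=
  (primrec_all (g := fun a b => decide (p a b)) hf hp).of_eq fun a => by rw [Bool.eq_iff_iff]; simp

@[fun_prop]
theorem primrec_decide_exists_mem {f : α → List β} {p : α → β → Prop}
    [h : ∀ a b, Decidable (p a b)] [h' : ∀ a, Decidable (∃ b ∈ f a, p a b)]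
    (hf : Primrec f) (hp : Primrec fun q : α × β => decide (p q.1 q.2)) :
    Primrec fun a => decide (∃ b ∈ f a, p a b) :=
  (primrec_any (g := fun a b => decide (p a b)) hf hp).of_eq fun a => by rw [Bool.eq_iff_iff]; simp

@[fun_prop]
theorem primrec_decide_mem {f : α → List β} {x : α → β} [h : ∀ a, Decidable (x a ∈ f a)]
    (hx : Primrec x) (hf : Primrec f) : Primrec fun a => decide (x a ∈ f a) := by
  classical
  have : Primrec fun a => (f a).any fun b => decide (b = x a) := by fun_prop
  exact this.of_eq fun a => by rw [Bool.eq_iff_iff]; simp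

@[fun_prop]
theorem primrec_decide_bool {f : α → Bool} [h : ∀ a, Decidable (f a = true)] (hf : Primrec f) :
    Primrec fun a => decide (f a = true) := hf.of_eq fun a => by simp

@[fun_prop]
theorem primrec_filter {f : α → List β} {g : α → β → Bool} (hf : Primrec f)
    (hg : Primrec fun p : α × β => g p.1 p.2) : Primrec fun a => (f a).filter (g a) := by
  have : Primrec fun a => (f a).flatMap fun b => if g a b = true then [b] else [] := by fun_prop
  exact this.of_eq fun a => by
    induction f a with
    | nil => rfl
    | cons b l ih => by_cases hb : g a b = true <;> simp [hb, ih]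

@[fun_prop]
theorem primrec_takeWhile {f : α → List β} {g : α → β → Bool} (hf : Primrec f)
    (hg : Primrec fun p : α × β => g p.1 p.2) : Primrec fun a => (f a).takeWhile (g a) := by
  have : Primrec fun a => (f a).foldr (fun b r => if g a b = true then b :: r else []) [] := by
    have : Primrec fun p : α × β × List β => g p.1 p.2.1 :=
      hg.comp (f := fun p : α × β => g p.1 p.2)
        (g := fun p : α × β × List β => (p.1, p.2.1)) (by fun_prop)
    fun_prop
  exact this.of_eq fun a => by
    induction f a with
    | nil => rfl
    | cons b l ih => rw [List.foldr_cons, ih, List.takeWhile_cons]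

@[fun_prop]
theorem primrec_headD {f : α → List β} {x : α → β} (hf : Primrec f) (hx : Primrec x) :
    Primrec fun a => (f a).headD (x a) := by
  have : Primrec fun a => (f a).head?.getD (x a) := by fun_prop
  exact this.of_eq fun a => by cases f a <;> rfl

@[fun_prop]
theorem primrec_zip {f : α → List β} {g : α → List γ} (hf : Primrec f) (hg : Primrec g) :
    Primrec fun a => (f a).zip (g a) := by
  have : Primrec fun a => (List.range (f a).length).filterMap fun i =>
      (f a)[i]?.bind fun x => (g a)[i]?.map fun y => (x, y) := by fun_prop
  refine this.of_eq fun a => ?_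
  generalize f a = l
  generalize g a = l'
  induction l generalizing l' with
  | nil => rfl
  | cons x l ih =>
    cases l' with
    | nil => simp
    | cons y l' =>
      rw [List.length_cons, List.range_succ_eq_map, List.filterMap_cons, List.filterMap_map]
      simpa using ih l'

@[fun_prop]
theorem primrec_dedup [DecidableEq β] {f : α → List β} (hf : Primrec f) :
    Primrec fun a => (f a).dedup := by
  have : Primrec fun a => (f a).foldr (fun x r => if x ∈ r then r else x :: r) [] := by fun_prop
  refine this.of_eq fun a => ?_
  induction f a with
  | nil => rfl
  | cons x l ih =>
    rw [List.foldr_cons, ih]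
    split_ifs with h
    · rw [List.dedup_cons_of_mem (by simpa using h)]
    · rw [List.dedup_cons_of_notMem (by simpa using h)]

@[fun_prop]
theorem primrec_sum {f : α → List ℕ} (hf : Primrec f) : Primrec fun a => (f a).sum := by
  have : Primrec fun a => (f a).foldr (fun x r => x + r) 0 := by fun_prop
  exact this.of_eq fun a => by rw [List.sum_eq_foldr]

@[fun_prop]
theorem primrec_countP {f : α → List β} {g : α → β → Bool} (hf : Primrec f)
    (hg : Primrec fun p : α × β => g p.1 p.2) : Primrec fun a => (f a).countP (g a) := by
  have : Primrec fun a => ((f a).filter (g a)).length := by fun_prop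
  exact this.of_eq fun a => List.countP_eq_length_filter.symm

end Rules

/-! ### Reachability in finite graphs -/

section Search

variable {ι β : Type}

/-- The vertices that are reachable in at most `n` steps. -/
def layers (start : ι → List β) (next : ι → β → List β) (i : ι) (n : ℕ) : List β :=
  n.rec (start i) fun _ l => l ++ l.flatMap (next i)

theorem mem_layers {start : ι → List β} {next : ι → β → List β} {i : ι} {n : ℕ} {b : β}
    (h : b ∈ layers start next i n) :
    ∃ a ∈ start i, Relation.ReflTransGen (fun x y => y ∈ next i x) a b := by
  induction n generalizing b with
  | zero => exact ⟨b, h, .refl⟩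
  | succ n ih =>
    rcases List.mem_append.1 h with h | h
    · exact ih h
    · obtain ⟨c, hc, hb⟩ := List.mem_flatMap.1 h
      obtain ⟨a, ha, hac⟩ := ih hc
      exact ⟨a, ha, hac.tail hb⟩

theorem mem_layers_of_closed {start : ι → List β} {next : ι → β → List β} {i : ι} {n : ℕ} {a b : β}
    (h : ∀ x ∈ layers start next i n, ∀ y ∈ next i x, y ∈ layers start next i n)
    (ha : a ∈ start i) (hab : Relation.ReflTransGen (fun x y => y ∈ next i x) a b) :
    b ∈ layers start next i n := by
  induction hab with
  | refl =>
    clear h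
    induction n with
    | zero => exact ha
    | succ n ih => exact List.mem_append_left _ ih
  | tail _ hbc ih => exact h _ ih _ hbc

/-- As long as a layer is not closed, the next one contains a new vertex. This can happen only
finitely often within a finite set. -/
theorem exists_closed {start : ι → List β} {next : ι → β → List β} {i : ι}
    (h : {b | ∃ a ∈ start i, Relation.ReflTransGen (fun x y => y ∈ next i x) a b}.Finite) :
    ∃ n, ∀ x ∈ layers start next i n, ∀ y ∈ next i x, y ∈ layers start next i n := by
  classical
  by_contra hno
  push Not at hno
  have key : ∀ n, n ≤ (layers start next i n).toFinset.card := by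
    intro n
    induction n with
    | zero => exact Nat.zero_le _
    | succ n ih =>
      obtain ⟨x, hx, y, hy, hxy⟩ := hno n
      refine ih.trans_lt (Finset.card_lt_card ⟨fun z hz => ?_, fun hsub => hxy ?_⟩)
      · rw [List.mem_toFinset] at hz ⊢
        exact List.mem_append_left _ hz
      · rw [← List.mem_toFinset]
        refine hsub (List.mem_toFinset.2 (List.mem_append_right _ ?_))
        exact List.mem_flatMap.2 ⟨x, hx, hy⟩
  have h1 := key (h.toFinset.card + 1)
  have h2 : (layers start next i (h.toFinset.card + 1)).toFinset ⊆ h.toFinset := by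
    intro b hb
    rw [Set.Finite.mem_toFinset]
    exact mem_layers (List.mem_toFinset.1 hb)
  have := Finset.card_le_card h2
  omega

/-- Reachability of a vertex is decidable in finite graphs that are given uniformly. -/
theorem exists_computable_reach [Primcodable ι] [Primcodable β]
    {start : ι → List β} {next : ι → β → List β} {good : ι → β → Bool}
    {dom : ι → Bool} (hs : Primrec start) (hn : Primrec fun p : ι × β => next p.1 p.2)
    (hg : Primrec fun p : ι × β => good p.1 p.2) (hd : Primrec dom)
    (hfin : ∀ i, dom i = true →
      {b | ∃ a ∈ start i, Relation.ReflTransGen (fun x y => y ∈ next i x) a b}.Finite) :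
    ∃ f : ι → Bool, Computable f ∧ ∀ i, dom i = true → (f i = true ↔ ∃ a ∈ start i, ∃ b,
      Relation.ReflTransGen (fun x y => y ∈ next i x) a b ∧ good i b = true) := by
  classical
  -- Outside of `dom` the graph may be infinite. There the search stops at once, so that the
  -- algorithm halts on every input.
  let closed : ι → ℕ → Bool := fun i n => !dom i || ((layers start next i n).flatMap (next i)).all
    fun y => decide (y ∈ layers start next i n)
  have hclosed : ∀ i, ∃ n, closed i n = true := by
    intro i
    cases hdi : dom i with
    | false => exact ⟨0, by simp [closed, hdi]⟩
    | true =>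
      obtain ⟨n, hn⟩ := exists_closed (hfin i hdi)
      refine ⟨n, ?_⟩
      simpa [closed, hdi] using hn
  have hlayers : Primrec₂ (layers start next) := by
    have : Primrec fun p : ι × ℕ => Nat.rec (motive := fun _ => List β) (start p.1)
        (fun _ l => l ++ l.flatMap (next p.1)) p.2 := by fun_prop
    exact this
  have hclosed' : Primrec₂ closed := by
    have h1 : Primrec fun p : ι × ℕ => layers start next p.1 p.2 := hlayers
    have : Primrec fun p : ι × ℕ => !dom p.1 ||
      ((layers start next p.1 p.2).flatMap (next p.1)).all
        fun y => decide (y ∈ layers start next p.1 p.2) := by fun_prop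
    exact this
  -- This minimization is the only step that is not primitive recursive: finiteness is known, but no
  -- bound on the number of layers is computed.
  let n : ι → ℕ := fun i => Nat.find (hclosed i)
  have hn' : Computable n := by
    refine Partrec.of_eq_tot (Partrec.rfind (p := fun i n => Part.some (closed i n))
      hclosed'.to_comp.partrec) fun i => ?_
    refine Nat.mem_rfind.2 ⟨by simpa using (Nat.find_spec (hclosed i)).symm, fun {m} hm => by
      simpa using Nat.find_min (hclosed i) hm⟩
  refine ⟨fun i => (layers start next i (n i)).any (good i), ?_, fun i hdi => ?_⟩
  · have : Primrec fun p : ι × ℕ => (layers start next p.1 p.2).any (good p.1) := by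
      have h1 : Primrec fun p : ι × ℕ => layers start next p.1 p.2 := hlayers
      fun_prop
    exact this.to_comp.comp (Computable.id.pair hn')
  · have hcl : closed i (n i) = true := Nat.find_spec (hclosed i)
    simp only [closed, hdi, Bool.not_true, Bool.false_or, List.all_eq_true, List.mem_flatMap,
      decide_eq_true_eq, forall_exists_index, and_imp] at hcl
    rw [List.any_eq_true]
    constructor
    · rintro ⟨b, hb, hgb⟩
      obtain ⟨a, ha, hab⟩ := mem_layers hb
      exact ⟨a, ha, b, hab, hgb⟩
    · rintro ⟨a, ha, b, hab, hgb⟩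
      exact ⟨b, mem_layers_of_closed (fun x hx y hy => hcl y x hx hy) ha hab, hgb⟩

end Search

/-! ### The syntax is primitive recursive -/

/-- The encodings are transported along these equivalences, which are therefore the identity on
codes. -/
theorem primrec_valEquiv : Primrec Val.equiv :=
  Primrec.encode_iff.1 (Primrec.encode.of_eq fun _ => rfl)

theorem primrec_valEquiv_symm : Primrec Val.equiv.symm :=
  Primrec.encode_iff.1 (Primrec.encode.of_eq fun x => by cases x <;> rfl)

theorem primrec_atomEquiv : Primrec Atom.equiv :=
  Primrec.encode_iff.1 (Primrec.encode.of_eq fun _ => rfl)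

theorem primrec_atomEquiv_symm : Primrec Atom.equiv.symm :=
  Primrec.encode_iff.1 (Primrec.encode.of_eq fun x => by cases x <;> rfl)

theorem primrec_exprEquiv : Primrec Expr.equiv :=
  Primrec.encode_iff.1 (Primrec.encode.of_eq fun _ => rfl)

theorem primrec_exprEquiv_symm : Primrec Expr.equiv.symm :=
  Primrec.encode_iff.1 (Primrec.encode.of_eq fun x => by cases x <;> rfl)

theorem primrec_methodDefEquiv : Primrec MethodDef.equiv :=
  Primrec.encode_iff.1 (Primrec.encode.of_eq fun _ => rfl)

theorem primrec_programEquiv : Primrec Program.equiv :=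
  Primrec.encode_iff.1 (Primrec.encode.of_eq fun _ => rfl)

theorem primrec_msgEquiv : Primrec Msg.equiv :=
  Primrec.encode_iff.1 (Primrec.encode.of_eq fun _ => rfl)

theorem primrec_actorEquiv : Primrec Actor.equiv :=
  Primrec.encode_iff.1 (Primrec.encode.of_eq fun _ => rfl)

section Rules

variable {α β σ : Type} [Primcodable α] [Primcodable β] [Primcodable σ]

@[fun_prop]
theorem primrec_cls {f : α → MethodDef} (hf : Primrec f) : Primrec fun a => (f a).cls :=
  Primrec.fst.comp (primrec_methodDefEquiv.comp hf)

@[fun_prop]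
theorem primrec_methodDef_meth {f : α → MethodDef} (hf : Primrec f) :
    Primrec fun a => (f a).meth :=
  (Primrec.fst.comp Primrec.snd).comp (primrec_methodDefEquiv.comp hf)

@[fun_prop]
theorem primrec_params {f : α → MethodDef} (hf : Primrec f) : Primrec fun a => (f a).params :=
  (Primrec.fst.comp (Primrec.snd.comp Primrec.snd)).comp (primrec_methodDefEquiv.comp hf)

@[fun_prop]
theorem primrec_body {f : α → MethodDef} (hf : Primrec f) : Primrec fun a => (f a).body :=
  (Primrec.snd.comp (Primrec.snd.comp Primrec.snd)).comp (primrec_methodDefEquiv.comp hf)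

@[fun_prop]
theorem primrec_main {f : α → Program} (hf : Primrec f) : Primrec fun a => (f a).main :=
  Primrec.fst.comp (primrec_programEquiv.comp hf)

@[fun_prop]
theorem primrec_defs {f : α → Program} (hf : Primrec f) : Primrec fun a => (f a).defs :=
  Primrec.snd.comp (primrec_programEquiv.comp hf)

@[fun_prop]
theorem primrec_msg_meth {f : α → Msg} (hf : Primrec f) : Primrec fun a => (f a).meth :=
  Primrec.fst.comp (primrec_msgEquiv.comp hf)

@[fun_prop]
theorem primrec_args {f : α → Msg} (hf : Primrec f) : Primrec fun a => (f a).args :=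
  Primrec.snd.comp (primrec_msgEquiv.comp hf)

@[fun_prop]
theorem primrec_name {f : α → Actor} (hf : Primrec f) : Primrec fun a => (f a).name :=
  Primrec.fst.comp (primrec_actorEquiv.comp hf)

@[fun_prop]
theorem primrec_proc {f : α → Actor} (hf : Primrec f) : Primrec fun a => (f a).proc :=
  (Primrec.fst.comp Primrec.snd).comp (primrec_actorEquiv.comp hf)

@[fun_prop]
theorem primrec_queue {f : α → Actor} (hf : Primrec f) : Primrec fun a => (f a).queue :=
  (Primrec.snd.comp Primrec.snd).comp (primrec_actorEquiv.comp hf)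

@[fun_prop]
theorem primrec_ofNat {τ : Type} [Denumerable τ] {f : α → ℕ} (hf : Primrec f) :
    Primrec fun a => Denumerable.ofNat τ (f a) := (Primrec.ofNat τ).comp hf

@[fun_prop]
theorem primrec_valElim {f : α → Val} {g : α → ℕ → σ} {h : α → ActorName → σ} (hf : Primrec f)
    (hg : Primrec fun p : α × ℕ => g p.1 p.2) (hh : Primrec fun p : α × ActorName => h p.1 p.2) :
    Primrec fun a => Sum.elim (g a) (h a) (Val.equiv (f a)) :=
  primrec_sumElim (primrec_valEquiv.comp hf) hg hh

@[fun_prop]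
theorem primrec_atomElim {f : α → Atom} {g : α → ℕ → σ} {h : α → Val → σ} (hf : Primrec f)
    (hg : Primrec fun p : α × ℕ => g p.1 p.2) (hh : Primrec fun p : α × Val => h p.1 p.2) :
    Primrec fun a => Sum.elim (g a) (h a) (Atom.equiv (f a)) :=
  primrec_sumElim (primrec_atomEquiv.comp hf) hg hh

@[fun_prop]
theorem primrec_exprElim {f : α → Expr} {g : α → Atom → σ} {h : α → ℕ → σ} (hf : Primrec f)
    (hg : Primrec fun p : α × Atom => g p.1 p.2) (hh : Primrec fun p : α × ℕ => h p.1 p.2) :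
    Primrec fun a => Sum.elim (g a) (h a) (Expr.equiv (f a)) :=
  primrec_sumElim (primrec_exprEquiv.comp hf) hg hh

@[fun_prop]
theorem primrec_var {f : α → ℕ} (hf : Primrec f) : Primrec fun a => Val.var (f a) :=
  primrec_valEquiv_symm.comp (Primrec.sumInl.comp hf)

@[fun_prop]
theorem primrec_act {f : α → ActorName} (hf : Primrec f) : Primrec fun a => Val.act (f a) :=
  primrec_valEquiv_symm.comp (Primrec.sumInr.comp hf)

@[fun_prop]
theorem primrec_bvar {f : α → ℕ} (hf : Primrec f) : Primrec fun a => Atom.bvar (f a) :=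
  primrec_atomEquiv_symm.comp (Primrec.sumInl.comp hf)

@[fun_prop]
theorem primrec_val {f : α → Val} (hf : Primrec f) : Primrec fun a => Atom.val (f a) :=
  primrec_atomEquiv_symm.comp (Primrec.sumInr.comp hf)

@[fun_prop]
theorem primrec_atom {f : α → Atom} (hf : Primrec f) : Primrec fun a => Expr.atom (f a) :=
  primrec_exprEquiv_symm.comp (Primrec.sumInl.comp hf)

@[fun_prop]
theorem primrec_new {f : α → ℕ} (hf : Primrec f) : Primrec fun a => Expr.new (f a) :=
  primrec_exprEquiv_symm.comp (Primrec.sumInr.comp hf)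

@[fun_prop]
theorem primrec_letin {f : α → Expr} {g : α → Proc} (hf : Primrec f) (hg : Primrec g) :
    Primrec fun a => Proc.letin (f a) (g a) := by
  have : Primrec fun a => 4 * Nat.pair (Encodable.encode (f a)) (Encodable.encode (g a)) + 1 := by
    fun_prop
  exact Primrec.encode_iff.1 this

@[fun_prop]
theorem primrec_send {t : α → Atom} {m : α → ℕ} {Es : α → List Expr} {g : α → Proc}
    (ht : Primrec t) (hm : Primrec m) (hEs : Primrec Es) (hg : Primrec g) :
    Primrec fun a => Proc.send (t a) (m a) (Es a) (g a) := by
  have : Primrec fun a =>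
      4 * Nat.pair (Encodable.encode (t a, m a, Es a)) (Encodable.encode (g a)) + 2 := by
    fun_prop
  exact Primrec.encode_iff.1 this

@[fun_prop]
theorem primrec_iteProc {f f' : α → Expr} {g g' : α → Proc} (hf : Primrec f) (hf' : Primrec f')
    (hg : Primrec g) (hg' : Primrec g') :
    Primrec fun a => Proc.ite (f a) (f' a) (g a) (g' a) := by
  have : Primrec fun a => 4 * Nat.pair (Encodable.encode (f a, f' a))
      (Nat.pair (Encodable.encode (g a)) (Encodable.encode (g' a))) + 3 := by
    fun_prop
  exact Primrec.encode_iff.1 this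

@[fun_prop]
theorem primrec_plus {g g' : α → Proc} (hg : Primrec g) (hg' : Primrec g') :
    Primrec fun a => Proc.plus (g a) (g' a) := by
  have : Primrec fun a => 4 * Nat.pair (Encodable.encode (g a)) (Encodable.encode (g' a)) + 4 := by
    fun_prop
  exact Primrec.encode_iff.1 this

end Rules

/-- What a process consists of. -/
abbrev Proc.Parts : Type :=
  Option ((Expr × Proc) ⊕ (Atom × ℕ × List Expr × Proc) ⊕ (Expr × Expr × Proc × Proc) ⊕
    (Proc × Proc))

/-- The outermost constructor of a process. -/
def Proc.parts : Proc → Proc.Parts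
  | .nil => none
  | .letin E P => some (.inl (E, P))
  | .send t m Es P => some (.inr (.inl (t, m, Es, P)))
  | .ite E E' P Q => some (.inr (.inr (.inl (E, E', P, Q))))
  | .plus P Q => some (.inr (.inr (.inr (P, Q))))

/-- The outermost constructor of the process with code `4 * k + r + 1`. -/
def partsOfCode (k r : ℕ) : Proc.Parts :=
  if r = 0 then some (Sum.inl (Denumerable.ofNat Expr k.unpair.1, Denumerable.ofNat Proc k.unpair.2))
  else if r = 1 then some (Sum.inr (Sum.inl
    ((Denumerable.ofNat (Atom × ℕ × List Expr) k.unpair.1).1,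
      (Denumerable.ofNat (Atom × ℕ × List Expr) k.unpair.1).2.1,
      (Denumerable.ofNat (Atom × ℕ × List Expr) k.unpair.1).2.2,
      Denumerable.ofNat Proc k.unpair.2)))
  else if r = 2 then some (Sum.inr (Sum.inr (Sum.inl
    ((Denumerable.ofNat (Expr × Expr) k.unpair.1).1, (Denumerable.ofNat (Expr × Expr) k.unpair.1).2,
      Denumerable.ofNat Proc k.unpair.2.unpair.1, Denumerable.ofNat Proc k.unpair.2.unpair.2))))
  else some (Sum.inr (Sum.inr (Sum.inr
    (Denumerable.ofNat Proc k.unpair.1, Denumerable.ofNat Proc k.unpair.2))))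

theorem Proc.ofNat_code (P : Proc) : Denumerable.ofNat Proc P.code = P :=
  Denumerable.ofNat_encode P

/-- The residue modulo 4 of the predecessor of a nonzero code tells the constructor, and the
quotient holds the components. -/
theorem Proc.parts_eq (P : Proc) : P.parts = if Encodable.encode P = 0 then none else
    partsOfCode ((Encodable.encode P - 1) / 4) ((Encodable.encode P - 1) % 4) := by
  have h : Encodable.encode P = P.code := rfl
  rw [h]
  cases P with
  | nil => rfl
  | letin E P =>
    have h1 : ∀ a, 4 * a / 4 = a := fun a => by omega
    have h2 : ∀ a, 4 * a % 4 = 0 := fun a => by omega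
    simp [Proc.code, Proc.parts, partsOfCode, h1, h2, Proc.ofNat_code, -Denumerable.ofEquiv_ofNat]
  | send t m Es P =>
    have h1 : ∀ a, (4 * a + 1) / 4 = a := fun a => by omega
    have h2 : ∀ a, (4 * a + 1) % 4 = 1 := fun a => by omega
    simp [Proc.code, Proc.parts, partsOfCode, h1, h2, Proc.ofNat_code, -Encodable.encode_prod_val,
      -Denumerable.ofEquiv_ofNat]
  | ite E E' P Q =>
    have h1 : ∀ a, (4 * a + 2) / 4 = a := fun a => by omega
    have h2 : ∀ a, (4 * a + 2) % 4 = 2 := fun a => by omega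
    simp [Proc.code, Proc.parts, partsOfCode, h1, h2, Proc.ofNat_code, -Encodable.encode_prod_val,
      -Denumerable.ofEquiv_ofNat]
  | plus P Q =>
    have h1 : ∀ a, (4 * a + 3) / 4 = a := fun a => by omega
    have h2 : ∀ a, (4 * a + 3) % 4 = 3 := fun a => by omega
    simp [Proc.code, Proc.parts, partsOfCode, h1, h2, Proc.ofNat_code, -Denumerable.ofEquiv_ofNat]

section Rules

variable {α β σ : Type} [Primcodable α] [Primcodable β] [Primcodable σ]

@[fun_prop]
theorem primrec_parts {f : α → Proc} (hf : Primrec f) : Primrec fun a => (f a).parts := by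
  have : Primrec fun p : ℕ × ℕ => partsOfCode p.1 p.2 := by
    unfold partsOfCode
    fun_prop
  simp only [Proc.parts_eq]
  fun_prop

theorem Proc.code_lt_of_mem_parts (P : Proc) :
    match P.parts with
    | none => True
    | some (.inl p) => p.2.code < P.code
    | some (.inr (.inl p)) => p.2.2.2.code < P.code
    | some (.inr (.inr (.inl p))) => p.2.2.1.code < P.code ∧ p.2.2.2.code < P.code
    | some (.inr (.inr (.inr p))) => p.1.code < P.code ∧ p.2.code < P.code := by
  cases P with
  | nil => trivial
  | letin E P =>
    have := Nat.right_le_pair (Encodable.encode E) P.code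
    simp only [Proc.parts, Proc.code]
    omega
  | send t m Es P =>
    have := Nat.right_le_pair (Encodable.encode (t, m, Es)) P.code
    simp only [Proc.parts, Proc.code]
    omega
  | ite E E' P Q =>
    have h1 := Nat.right_le_pair (Encodable.encode (E, E')) (Nat.pair P.code Q.code)
    have h2 := Nat.right_le_pair P.code Q.code
    have h3 := Nat.left_le_pair P.code Q.code
    simp only [Proc.parts, Proc.code]
    omega
  | plus P Q =>
    have h2 := Nat.right_le_pair P.code Q.code
    have h3 := Nat.left_le_pair P.code Q.code
    simp only [Proc.parts, Proc.code]
    omega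

/-- Recursion on processes, with the number of binders as an additional argument. -/
theorem primrec_procRec {F : α → ℕ → Proc → σ} {hn : α × ℕ → σ} {hl : α × ℕ × Expr × σ → σ}
    {hs : α × ℕ × Atom × ℕ × List Expr × σ → σ} {hi : α × ℕ × Expr × Expr × σ × σ → σ}
    {hp : α × ℕ × σ × σ → σ} (pn : Primrec hn) (pl : Primrec hl) (ps : Primrec hs)
    (pi : Primrec hi) (pp : Primrec hp) (en : ∀ a k, F a k .nil = hn (a, k))
    (el : ∀ a k E P, F a k (.letin E P) = hl (a, k, E, F a (k + 1) P))
    (es : ∀ a k t m Es P, F a k (.send t m Es P) = hs (a, k, t, m, Es, F a k P))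
    (ei : ∀ a k E E' P Q, F a k (.ite E E' P Q) = hi (a, k, E, E', F a k P, F a k Q))
    (ep : ∀ a k P Q, F a k (.plus P Q) = hp (a, k, F a k P, F a k Q)) :
    Primrec fun p : α × ℕ × Proc => F p.1 p.2.1 p.2.2 := by
  -- Course-of-values recursion along the code: `l` lists the immediate subprocesses, with one more
  -- binder under a `let`, and `g` combines their results. The subprocesses have smaller codes by
  -- `Proc.code_lt_of_mem_parts`.
  let l : ℕ × Proc → List (ℕ × Proc) := fun b => b.2.parts.elim [] <|
    Sum.elim (fun p => [(b.1 + 1, p.2)]) <| Sum.elim (fun p => [(b.1, p.2.2.2)]) <|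
      Sum.elim (fun p => [(b.1, p.2.2.1), (b.1, p.2.2.2)]) fun p => [(b.1, p.1), (b.1, p.2)]
  let g : α → (ℕ × Proc) × List σ → Option σ := fun a b => b.1.2.parts.elim (some (hn (a, b.1.1))) <|
    Sum.elim (fun p => b.2[0]?.map fun r => hl (a, b.1.1, p.1, r)) <|
    Sum.elim (fun p => b.2[0]?.map fun r => hs (a, b.1.1, p.1, p.2.1, p.2.2.1, r)) <|
    Sum.elim (fun p => b.2[0]?.bind fun r => b.2[1]?.map fun r' =>
      hi (a, b.1.1, p.1, p.2.1, r, r')) fun _ => b.2[0]?.bind fun r => b.2[1]?.map fun r' =>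
        hp (a, b.1.1, r, r')
  have hl' : Primrec l := by fun_prop
  have h1 : Primrec fun q : (α × (ℕ × Proc) × List σ) × (Expr × Proc) =>
    q.1.2.2[0]?.map fun r => hl (q.1.1, q.1.2.1.1, q.2.1, r) := by fun_prop
  have h2 : Primrec fun q : (α × (ℕ × Proc) × List σ) × (Atom × ℕ × List Expr × Proc) =>
    q.1.2.2[0]?.map fun r => hs (q.1.1, q.1.2.1.1, q.2.1, q.2.2.1, q.2.2.2.1, r) := by fun_prop
  have h3 : Primrec fun q : (α × (ℕ × Proc) × List σ) × (Expr × Expr × Proc × Proc) =>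
    q.1.2.2[0]?.bind fun r => q.1.2.2[1]?.map fun r' =>
      hi (q.1.1, q.1.2.1.1, q.2.1, q.2.2.1, r, r') := by fun_prop
  have h4 : Primrec fun q : (α × (ℕ × Proc) × List σ) × (Proc × Proc) =>
    q.1.2.2[0]?.bind fun r => q.1.2.2[1]?.map fun r' => hp (q.1.1, q.1.2.1.1, r, r') := by fun_prop
  have hg : Primrec fun q : α × (ℕ × Proc) × List σ => g q.1 q.2 := by
    refine primrec_optionElim (f := fun q : α × (ℕ × Proc) × List σ => q.2.1.2.parts)
      (x := fun q => some (hn (q.1, q.2.1.1))) (by fun_prop) (by fun_prop) ?_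
    refine primrec_sumElim (f := fun q : (α × (ℕ × Proc) × List σ) × _ => q.2) (by fun_prop)
      (h1.comp (g := fun q : ((α × (ℕ × Proc) × List σ) × _) × (Expr × Proc) => (q.1.1, q.2))
        (by fun_prop)) ?_
    refine primrec_sumElim (f := fun q : ((α × (ℕ × Proc) × List σ) × _) × _ => q.2) (by fun_prop)
      (h2.comp (g := fun q : (((α × (ℕ × Proc) × List σ) × _) × _) × _ => (q.1.1.1, q.2))
        (by fun_prop)) ?_
    exact primrec_sumElim (f := fun q : (((α × (ℕ × Proc) × List σ) × _) × _) × _ => q.2)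
      (by fun_prop)
      (h3.comp (g := fun q : ((((α × (ℕ × Proc) × List σ) × _) × _) × _) × _ => (q.1.1.1.1, q.2))
        (by fun_prop))
      (h4.comp (g := fun q : ((((α × (ℕ × Proc) × List σ) × _) × _) × _) × _ => (q.1.1.1.1, q.2))
        (by fun_prop))
  have hm : Primrec fun q : α × ℕ × Proc => Encodable.encode q.2.2 := by fun_prop
  have hl'' : Primrec₂ fun (_ : α) (b : ℕ × Proc) => l b := hl'.comp Primrec.snd
  have hm' : Primrec₂ fun (_ : α) (b : ℕ × Proc) => Encodable.encode b.2 := hm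
  have hg' : Primrec₂ g := hg
  refine Primrec.nat_omega_rec (fun a (b : ℕ × Proc) => F a b.1 b.2) hm' hl'' hg' ?_ ?_
  · rintro - ⟨k, P⟩ b hb
    have h := P.code_lt_of_mem_parts
    cases P <;> simp [l, Proc.parts] at hb h
    · subst hb; exact h
    · subst hb; exact h
    · rcases hb with rfl | rfl
      · exact h.1
      · exact h.2
    · rcases hb with rfl | rfl
      · exact h.1
      · exact h.2
  · rintro a ⟨k, P⟩
    cases P with
    | nil => exact congrArg some (en a k).symm
    | letin E P => exact congrArg some (el a k E P).symm
    | send t m Es P => exact congrArg some (es a k t m Es P).symm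
    | ite E E' P Q => exact congrArg some (ei a k E E' P Q).symm
    | plus P Q => exact congrArg some (ep a k P Q).symm

end Rules

/-! ### Operations on the syntax are primitive recursive -/

section Rules

variable {α β σ : Type} [Primcodable α] [Primcodable β] [Primcodable σ]

@[fun_prop]
theorem primrec_kind {f : α → Val} (hf : Primrec f) : Primrec fun a => kind (f a) := by
  have : Primrec fun a => Sum.elim (fun _ => none) (fun A : ActorName => some A.1)
    (Val.equiv (f a)) := by fun_prop
  exact this.of_eq fun a => by cases f a <;> rfl

@[fun_prop]
theorem primrec_isAct {f : α → Val} (hf : Primrec f) : Primrec fun a => (f a).isAct := by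
  unfold Val.isAct
  fun_prop

@[fun_prop]
theorem primrec_idx {f : α → Val} (hf : Primrec f) : Primrec fun a => (f a).idx := by
  have : Primrec fun a => Sum.elim (fun x => x) (fun A : ActorName => A.2)
    (Val.equiv (f a)) := by fun_prop
  exact this.of_eq fun a => by cases f a <;> rfl

@[fun_prop]
theorem primrec_retag {f : α → Val} {n : α → ℕ} (hf : Primrec f) (hn : Primrec n) :
    Primrec fun a => (f a).retag (n a) := by
  have : Primrec fun a => Sum.elim (fun _ => Val.var (n a))
    (fun A : ActorName => Val.act (A.1, n a)) (Val.equiv (f a)) := by fun_prop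
  exact this.of_eq fun a => by cases f a <;> rfl

@[fun_prop]
theorem primrec_toName {f : α → Val} (hf : Primrec f) : Primrec fun a => (f a).toName := by
  have : Primrec fun a => Sum.elim (fun _ => none) (fun A : ActorName => some A)
    (Val.equiv (f a)) := by fun_prop
  exact this.of_eq fun a => by cases f a <;> rfl

@[fun_prop]
theorem primrec_valFv {f : α → Val} (hf : Primrec f) : Primrec fun a => (f a).fv := by
  have : Primrec fun a => Sum.elim (fun x => [x]) (fun _ => []) (Val.equiv (f a)) := by fun_prop
  exact this.of_eq fun a => by cases f a <;> rfl

@[fun_prop]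
theorem primrec_valBind {f : α → Val} {ρ : α → ℕ → Val} (hρ : Primrec fun p : α × ℕ => ρ p.1 p.2)
    (hf : Primrec f) : Primrec fun a => (f a).bind (ρ a) := by
  have : Primrec fun a => Sum.elim (ρ a) (fun A => Val.act A) (Val.equiv (f a)) := by fun_prop
  exact this.of_eq fun a => by cases f a <;> rfl

@[fun_prop]
theorem primrec_atomVals {f : α → Atom} (hf : Primrec f) : Primrec fun a => (f a).vals := by
  have : Primrec fun a => Sum.elim (fun _ => []) (fun v => [v]) (Atom.equiv (f a)) := by fun_prop
  exact this.of_eq fun a => by cases f a <;> rfl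

@[fun_prop]
theorem primrec_exprVals {f : α → Expr} (hf : Primrec f) : Primrec fun a => (f a).vals := by
  have : Primrec fun a => Sum.elim (fun t => t.vals) (fun _ => []) (Expr.equiv (f a)) := by
    fun_prop
  exact this.of_eq fun a => by cases f a <;> rfl

@[fun_prop]
theorem primrec_procVals {f : α → Proc} (hf : Primrec f) : Primrec fun a => (f a).vals := by
  have := primrec_procRec (α := Unit) (F := fun _ _ P => P.vals) (hn := fun _ => [])
    (hl := fun q => q.2.2.1.vals ++ q.2.2.2)
    (hs := fun q => q.2.2.1.vals ++ q.2.2.2.2.1.flatMap Expr.vals ++ q.2.2.2.2.2)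
    (hi := fun q => q.2.2.1.vals ++ q.2.2.2.1.vals ++ q.2.2.2.2.1 ++ q.2.2.2.2.2)
    (hp := fun q => q.2.2.1 ++ q.2.2.2) (by fun_prop) (by fun_prop) (by fun_prop) (by fun_prop)
    (by fun_prop) (fun _ _ => rfl) (fun _ _ _ _ => rfl) (fun _ _ _ _ _ _ => rfl)
    (fun _ _ _ _ _ _ => rfl) (fun _ _ _ _ => rfl)
  exact this.comp (f := fun p : Unit × ℕ × Proc => p.2.2.vals)
    (g := fun a => ((), 0, f a)) (by fun_prop)

@[fun_prop]
theorem primrec_fv {f : α → Proc} (hf : Primrec f) : Primrec fun a => (f a).fv := by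
  simp only [Proc.fv_eq]
  fun_prop

@[fun_prop]
theorem primrec_atomMapVal {f : α → Atom} {g : α → Val → Val}
    (hg : Primrec fun p : α × Val => g p.1 p.2) (hf : Primrec f) :
    Primrec fun a => (f a).mapVal (g a) := by
  have : Primrec fun a => Sum.elim (fun k => Atom.bvar k) (fun v => Atom.val (g a v)) (Atom.equiv (f a)) := by
    fun_prop
  exact this.of_eq fun a => by cases f a <;> rfl

@[fun_prop]
theorem primrec_exprMapVal {f : α → Expr} {g : α → Val → Val}
    (hg : Primrec fun p : α × Val => g p.1 p.2) (hf : Primrec f) :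
    Primrec fun a => (f a).mapVal (g a) := by
  obtain ⟨G, rfl⟩ : ∃ G : α × Val → Val, g = fun a v => G (a, v) := ⟨fun p => g p.1 p.2, rfl⟩
  have hG : Primrec G := hg
  have : Primrec fun a => Sum.elim (fun t => Expr.atom (t.mapVal fun v => G (a, v))) (fun C => Expr.new C)
    (Expr.equiv (f a)) := by fun_prop
  exact this.of_eq fun a => by cases f a <;> rfl

@[fun_prop]
theorem primrec_procMapVal {f : α → Proc} {g : α → Val → Val}
    (hg : Primrec fun p : α × Val => g p.1 p.2) (hf : Primrec f) :
    Primrec fun a => (f a).mapVal (g a) := by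
  obtain ⟨G, rfl⟩ : ∃ G : α × Val → Val, g = fun a v => G (a, v) := ⟨fun p => g p.1 p.2, rfl⟩
  have hG : Primrec G := hg
  have := primrec_procRec (F := fun a _ P => P.mapVal fun v => G (a, v)) (hn := fun _ => .nil)
    (hl := fun q => .letin (q.2.2.1.mapVal fun v => G (q.1, v)) q.2.2.2)
    (hs := fun q => .send (q.2.2.1.mapVal fun v => G (q.1, v)) q.2.2.2.1
      (q.2.2.2.2.1.map fun E => E.mapVal fun v => G (q.1, v)) q.2.2.2.2.2)
    (hi := fun q => .ite (q.2.2.1.mapVal fun v => G (q.1, v))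
      (q.2.2.2.1.mapVal fun v => G (q.1, v)) q.2.2.2.2.1 q.2.2.2.2.2)
    (hp := fun q => .plus q.2.2.1 q.2.2.2) (by fun_prop) (by fun_prop) (by fun_prop) (by fun_prop)
    (by fun_prop) (fun _ _ => rfl) (fun _ _ _ _ => rfl) (fun _ _ _ _ _ _ => rfl)
    (fun _ _ _ _ _ _ => rfl) (fun _ _ _ _ => rfl)
  exact this.comp (f := fun p : α × ℕ × Proc => p.2.2.mapVal fun v => G (p.1, v))
    (g := fun a => (a, 0, f a)) (by fun_prop)

@[fun_prop]
theorem primrec_atomInst {f : α → Atom} {U : α → Val} {k : α → ℕ} (hU : Primrec U) (hk : Primrec k)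
    (hf : Primrec f) : Primrec fun a => (f a).inst (U a) (k a) := by
  have : Primrec fun a => Sum.elim (fun j => if j = k a then Atom.val (U a) else Atom.bvar j)
    (fun v => Atom.val v) (Atom.equiv (f a)) := by fun_prop
  exact this.of_eq fun a => by cases f a <;> rfl

@[fun_prop]
theorem primrec_exprInst {f : α → Expr} {U : α → Val} {k : α → ℕ} (hU : Primrec U) (hk : Primrec k)
    (hf : Primrec f) : Primrec fun a => (f a).inst (U a) (k a) := by
  have : Primrec fun a => Sum.elim (fun t => Expr.atom (t.inst (U a) (k a))) (fun C => Expr.new C)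
    (Expr.equiv (f a)) := by fun_prop
  exact this.of_eq fun a => by cases f a <;> rfl

@[fun_prop]
theorem primrec_procInst {f : α → Proc} {U : α → Val} {k : α → ℕ} (hU : Primrec U) (hk : Primrec k)
    (hf : Primrec f) : Primrec fun a => (f a).inst (U a) (k a) := by
  have := primrec_procRec (F := fun U k P => P.inst U k) (hn := fun _ => .nil)
    (hl := fun q => .letin (q.2.2.1.inst q.1 q.2.1) q.2.2.2)
    (hs := fun q => .send (q.2.2.1.inst q.1 q.2.1) q.2.2.2.1
      (q.2.2.2.2.1.map fun E => E.inst q.1 q.2.1) q.2.2.2.2.2)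
    (hi := fun q => .ite (q.2.2.1.inst q.1 q.2.1)
      (q.2.2.2.1.inst q.1 q.2.1) q.2.2.2.2.1 q.2.2.2.2.2)
    (hp := fun q => .plus q.2.2.1 q.2.2.2) (by fun_prop) (by fun_prop) (by fun_prop) (by fun_prop)
    (by fun_prop) (fun _ _ => rfl) (fun _ _ _ _ => rfl) (fun _ _ _ _ _ _ => rfl)
    (fun _ _ _ _ _ _ => rfl) (fun _ _ _ _ => rfl)
  exact this.comp (f := fun p : Val × ℕ × Proc => p.2.2.inst p.1 p.2.1)
    (g := fun a => (U a, k a, f a)) (by fun_prop)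

@[fun_prop]
theorem primrec_itemVals {f : α → Item} (hf : Primrec f) : Primrec fun a => (f a).vals := by
  have : Primrec fun a => Sum.elim (fun μ => μ.2) (fun P => P.vals) (f a) := by fun_prop
  exact this.of_eq fun a => by cases f a <;> rfl

@[fun_prop]
theorem primrec_itemMapVal {f : α → Item} {g : α → Val → Val}
    (hg : Primrec fun p : α × Val => g p.1 p.2) (hf : Primrec f) :
    Primrec fun a => (f a).mapVal (g a) := by
  obtain ⟨G, rfl⟩ : ∃ G : α × Val → Val, g = fun a v => G (a, v) := ⟨fun p => g p.1 p.2, rfl⟩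
  have hG : Primrec G := hg
  have : Primrec fun a => Sum.elim (fun μ : ℕ × List Val => Sum.inl (μ.1, μ.2.map fun v => G (a, v)))
    (fun P => Sum.inr (P.mapVal fun v => G (a, v))) (f a) := by fun_prop
  exact this.of_eq fun a => by cases f a <;> rfl

@[fun_prop]
theorem primrec_entryVals {f : α → Entry Bool} (hf : Primrec f) : Primrec fun a => (f a).vals := by
  unfold Entry.vals
  fun_prop

@[fun_prop]
theorem primrec_entryMapVal {f : α → Entry Bool} {g : α → Val → Val}
    (hg : Primrec fun p : α × Val => g p.1 p.2) (hf : Primrec f) :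
    Primrec fun a => (f a).mapVal (g a) := by
  obtain ⟨G, rfl⟩ : ∃ G : α × Val → Val, g = fun a v => G (a, v) := ⟨fun p => g p.1 p.2, rfl⟩
  have hG : Primrec G := hg
  unfold Entry.mapVal
  fun_prop

/-! ### Evaluation is primitive recursive -/

@[fun_prop]
theorem primrec_freshName {N : α → List ActorName} {C : α → ℕ} (hN : Primrec N) (hC : Primrec C) :
    Primrec fun a => freshName (N a) (C a) := by
  unfold freshName
  fun_prop

@[fun_prop]
theorem primrec_freshVars {X : α → List ℕ} {n : α → ℕ} (hX : Primrec X) (hn : Primrec n) :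
    Primrec fun a => freshVars (X a) (n a) := by
  unfold freshVars
  fun_prop

@[fun_prop]
theorem primrec_evals {N : α → List ActorName} {Es : α → List Expr} (hN : Primrec N)
    (hEs : Primrec Es) : Primrec fun a => evals (N a) (Es a) := by
  have h : Primrec fun q : List ActorName × Option (List Val × List ActorName) × Expr =>
      evalStep q.1 q.2.1 q.2.2 := by
    have : Primrec fun q : List ActorName × Option (List Val × List ActorName) × Expr =>
        q.2.1.bind fun r => Sum.elim (fun t => t.vals.head?.map fun U => (r.1 ++ [U], r.2))
          (fun C => some (r.1 ++ [.act (freshName (q.1 ++ r.2) C)],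
            r.2 ++ [freshName (q.1 ++ r.2) C])) (Expr.equiv q.2.2) := by fun_prop
    refine this.of_eq fun q => ?_
    rw [evalStep]
    congr 1
    funext r
    cases q.2.2 <;> rfl
  unfold evals
  exact primrec_foldl hEs (h.comp (g := fun p : α × Option (List Val × List ActorName) × Expr =>
    (N p.1, p.2)) (by fun_prop)) (by fun_prop)

@[fun_prop]
theorem primrec_locals {d : α → MethodDef} (hd : Primrec d) : Primrec fun a => (d a).locals := by
  unfold MethodDef.locals
  fun_prop

@[fun_prop]
theorem primrec_instWith {d : α → MethodDef} {A : α → Val} {Us ν : α → List Val} (hd : Primrec d)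
    (hA : Primrec A) (hUs : Primrec Us) (hν : Primrec ν) :
    Primrec fun a => (d a).instWith (A a) (Us a) (ν a) := by
  unfold MethodDef.instWith Proc.subst
  fun_prop

end Rules

/-! ### The abstract transition system is primitive recursive -/

section Rules

variable {α β : Type} [Primcodable α] [Primcodable β]

@[fun_prop]
theorem primrec_free {𝒢 : α → Program} (h𝒢 : Primrec 𝒢) : Primrec fun a => (𝒢 a).free := by
  unfold Program.free
  fun_prop

/-- The local steps of a process. -/
def psteps (N : List ActorName) (p : Proc.Parts) : List (List Val × Option (Val × Item) × Item) :=
  p.elim [] <| Sum.elim (fun p => (evals N [p.1]).toList.map fun r =>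
      (r.2.map Val.act, none, Sum.inr (p.2.inst (r.1.headD (.var 0)) 0))) <|
    Sum.elim (fun p => (p.1.vals.filter fun B => kind B ≠ none).flatMap fun B =>
      (evals N p.2.2.1).toList.map fun r =>
        (r.2.map Val.act, some (B, Sum.inl (p.2.1, r.1)), Sum.inr p.2.2.2)) <|
    Sum.elim (fun p => (evals N [p.1, p.2.1]).toList.map fun r =>
      (r.2.map Val.act, none, Sum.inr (if r.1.head? = r.1.tail.head? then p.2.2.1 else p.2.2.2)))
    fun p => [([], none, Sum.inr p.1), ([], none, Sum.inr p.2)]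

theorem primrec_psteps : Primrec fun q : List ActorName × Proc.Parts => psteps q.1 q.2 := by
  have h1 : Primrec fun q : List ActorName × (Expr × Proc) =>
      (evals q.1 [q.2.1]).toList.map fun r => (r.2.map Val.act, (none : Option (Val × Item)),
        (Sum.inr (q.2.2.inst (r.1.headD (.var 0)) 0) : Item)) := by fun_prop
  have h2 : Primrec fun q : List ActorName × (Atom × ℕ × List Expr × Proc) =>
      (q.2.1.vals.filter fun B => kind B ≠ none).flatMap fun B =>
        (evals q.1 q.2.2.2.1).toList.map fun r =>
          (r.2.map Val.act, some (B, (Sum.inl (q.2.2.1, r.1) : Item)),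
            (Sum.inr q.2.2.2.2 : Item)) := by fun_prop
  have h3 : Primrec fun q : List ActorName × (Expr × Expr × Proc × Proc) =>
      (evals q.1 [q.2.1, q.2.2.1]).toList.map fun r =>
        (r.2.map Val.act, (none : Option (Val × Item)),
          (Sum.inr (if r.1.head? = r.1.tail.head? then q.2.2.2.1 else q.2.2.2.2) : Item)) := by
    fun_prop
  have h4 : Primrec fun q : Proc × Proc =>
      [(([] : List Val), (none : Option (Val × Item)), (Sum.inr q.1 : Item)),
        ([], none, Sum.inr q.2)] := by fun_prop
  unfold psteps
  refine primrec_optionElim (by fun_prop) (by fun_prop) ?_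
  refine primrec_sumElim (f := fun q : (List ActorName × Proc.Parts) × _ => q.2) (by fun_prop)
    (h1.comp (g := fun q : ((List ActorName × Proc.Parts) × _) × _ => (q.1.1.1, q.2))
      (by fun_prop)) ?_
  refine primrec_sumElim (f := fun q : ((List ActorName × Proc.Parts) × _) × _ => q.2)
    (by fun_prop)
    (h2.comp (g := fun q : (((List ActorName × Proc.Parts) × _) × _) × _ => (q.1.1.1.1, q.2))
      (by fun_prop)) ?_
  exact primrec_sumElim (f := fun q : (((List ActorName × Proc.Parts) × _) × _) × _ => q.2)
    (by fun_prop)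
    (h3.comp (g := fun q : ((((List ActorName × Proc.Parts) × _) × _) × _) × _ =>
      (q.1.1.1.1.1, q.2)) (by fun_prop))
    (h4.comp (g := fun q : ((((List ActorName × Proc.Parts) × _) × _) × _) × _ => q.2)
      (by fun_prop))

@[fun_prop]
theorem primrec_lsteps {𝒢 : α → Program} {N : α → List ActorName} {X : α → List ℕ} {A : α → Val}
    {z : α → Item} (h𝒢 : Primrec 𝒢) (hN : Primrec N) (hX : Primrec X) (hA : Primrec A)
    (hz : Primrec z) : Primrec fun a => lsteps (𝒢 a) (N a) (X a) (A a) (z a) := by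
  have h1 : Primrec fun q : (Program × List ℕ × Val) × (ℕ × List Val) =>
      (q.1.1.defs.filter fun d => kind q.1.2.2 = some (some d.cls) ∧ d.meth = q.2.1 ∧
        q.2.2.length = d.params.length).map fun d =>
        ((freshVars q.1.2.1 d.locals.length).map Val.var, (none : Option (Val × Item)),
          (Sum.inr (d.instWith q.1.2.2 q.2.2 ((freshVars q.1.2.1 d.locals.length).map Val.var)) :
            Item)) := by
    have k1 : Primrec fun q : Val × (ℕ × List Val) × MethodDef =>
        decide (kind q.1 = some (some q.2.2.cls) ∧ q.2.2.meth = q.2.1.1 ∧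
          q.2.1.2.length = q.2.2.params.length) := by fun_prop
    have k2 : Primrec fun q : (List ℕ × Val) × List Val × MethodDef =>
        ((freshVars q.1.1 q.2.2.locals.length).map Val.var, (none : Option (Val × Item)),
          (Sum.inr (q.2.2.instWith q.1.2 q.2.1
            ((freshVars q.1.1 q.2.2.locals.length).map Val.var)) : Item)) := by fun_prop
    refine primrec_map (primrec_filter (by fun_prop) ?_) ?_
    · exact k1.comp (g := fun p : ((Program × List ℕ × Val) × (ℕ × List Val)) × MethodDef =>
        (p.1.1.2.2, p.1.2, p.2)) (by fun_prop)
    · exact k2.comp (g := fun p : ((Program × List ℕ × Val) × (ℕ × List Val)) × MethodDef =>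
        (p.1.1.2, p.1.2.2, p.2)) (by fun_prop)
  have h2 := primrec_sumElim (g := fun a μ => lsteps (𝒢 a) (N a) (X a) (A a) (.inl μ))
    (h := fun a P => psteps (N a) (Proc.parts P)) hz
    (h1.comp (g := fun p : α × (ℕ × List Val) => ((𝒢 p.1, X p.1, A p.1), p.2)) (by fun_prop))
    (primrec_psteps.comp (g := fun p : α × Proc => (N p.1, p.2.parts)) (by fun_prop))
  refine h2.of_eq fun a => ?_
  rcases z a with μ | P
  · rfl
  · cases P <;> rfl

@[fun_prop]
theorem primrec_tuples {l : α → List β} {n : α → ℕ} (hl : Primrec l) (hn : Primrec n) :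
    Primrec fun a => tuples (l a) (n a) := by
  have : Primrec fun a => Nat.rec (motive := fun _ => List (List β)) [[]]
    (fun _ r => (l a).flatMap fun x => r.map fun xs => x :: xs) (n a) := by fun_prop
  refine this.of_eq fun a => ?_
  induction n a with
  | zero => rfl
  | succ n ih => simp only [tuples, ← ih]

@[fun_prop]
theorem primrec_outItems {o : α → Option (Val × Item)} {ν : α → List Val} (ho : Primrec o)
    (hν : Primrec ν) : Primrec fun a => outItems (o a) (ν a) := by
  unfold outItems
  fun_prop

@[fun_prop]
theorem primrec_childFlags {b : α → Bool} (hb : Primrec b) :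
    Primrec fun a => childFlags (b a) := by
  unfold childFlags
  fun_prop

theorem primrec_stepsAt : Primrec fun q : (Program × List Val) × List (Entry Bool) × Entry Bool ×
    List (Entry Bool) => stepsAt q.1.1 q.1.2 q.2.1 q.2.2.1 q.2.2.2 := by
  have h : Primrec fun q : (List (Entry Bool) × Entry Bool × List (Entry Bool)) ×
      List Val × Option (Val × Item) × Item =>
      (tuples (childFlags q.1.2.1.1) (1 + (outItems q.2.2.1 q.2.1).length)).map fun fl =>
        (q.1.2.1.1, q.1.1 ++ (fl.headD false, q.1.2.1.2.1, q.2.2.2) :: q.1.2.2 ++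
          fl.tail.zip (outItems q.2.2.1 q.2.1)) := by
    fun_prop
  have h0 : Primrec fun q : List (Entry Bool) × Entry Bool =>
      decide (∃ e' ∈ q.1, e'.2.1 = q.2.2.1) := by fun_prop
  have h1 : Primrec fun q : (Program × List Val) × Entry Bool =>
      lsteps q.1.1 (q.1.2.filterMap Val.toName) (q.1.2.flatMap Val.fv) q.2.2.1 q.2.2.2 := by
    fun_prop
  unfold stepsAt
  refine primrec_ite (h0.comp (g := fun q : (Program × List Val) × List (Entry Bool) ×
    Entry Bool × List (Entry Bool) => (q.2.1, q.2.2.1)) (by fun_prop)) (by fun_prop)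
    (primrec_flatMap (h1.comp (g := fun q : (Program × List Val) × List (Entry Bool) ×
      Entry Bool × List (Entry Bool) => (q.1, q.2.2.1)) (by fun_prop)) ?_)
  exact h.comp (g := fun p : ((Program × List Val) × List (Entry Bool) × Entry Bool ×
    List (Entry Bool)) × List Val × Option (Val × Item) × Item => (p.1.2, p.2)) (by fun_prop)

@[fun_prop]
theorem primrec_stateVals {w : α → List (Entry Bool)} (hw : Primrec w) :
    Primrec fun a => stateVals (w a) := by
  unfold stateVals
  fun_prop

theorem primrec_steps' : Primrec fun q : Program × List (Entry Bool) => steps q.1 q.2 := by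
  unfold steps
  refine primrec_flatMap (by fun_prop) (primrec_flatMap (by fun_prop) ?_)
  exact primrec_stepsAt.comp (g := fun p : ((Program × List (Entry Bool)) × ℕ) × Entry Bool =>
    ((p.1.1.1, p.1.1.1.free ++ stateVals p.1.1.2), p.1.1.2.take p.1.2, p.2,
      p.1.1.2.drop (p.1.2 + 1))) (by fun_prop)

@[fun_prop]
theorem primrec_steps {𝒢 : α → Program} {w : α → List (Entry Bool)} (h𝒢 : Primrec 𝒢)
    (hw : Primrec w) : Primrec fun a => steps (𝒢 a) (w a) :=
  primrec_steps'.comp (h𝒢.pair hw)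

@[fun_prop]
theorem primrec_tracked {w : α → List (Entry Bool)} (hw : Primrec w) :
    Primrec fun a => tracked (w a) := by
  unfold tracked
  fun_prop

@[fun_prop]
theorem primrec_cnt {w : α → List (Entry Bool)} (hw : Primrec w) :
    Primrec fun a => cnt (w a) := by
  unfold cnt
  fun_prop

@[fun_prop]
theorem primrec_normVal {F tv vs : α → List Val} {v : α → Val} (hF : Primrec F) (htv : Primrec tv)
    (hvs : Primrec vs) (hv : Primrec v) :
    Primrec fun a => normVal (F a) (tv a) (vs a) (v a) := by
  unfold normVal bnd
  fun_prop

@[fun_prop]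
theorem primrec_dedupe {w : α → List (Entry Bool)} (hw : Primrec w) :
    Primrec fun a => dedupe (w a) := by
  unfold dedupe
  fun_prop

@[fun_prop]
theorem primrec_norm {F : α → List Val} {w : α → List (Entry Bool)} (hF : Primrec F)
    (hw : Primrec w) : Primrec fun a => norm (F a) (w a) := by
  unfold norm rename keep
  fun_prop

theorem primrec_succs' : Primrec fun q : Program × ℕ × List (Entry Bool) =>
    succs q.1 q.2.1 q.2.2 := by
  unfold succs
  fun_prop

@[fun_prop]
theorem primrec_succs {𝒢 : α → Program} {N : α → ℕ} {w : α → List (Entry Bool)} (h𝒢 : Primrec 𝒢)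
    (hN : Primrec N) (hw : Primrec w) : Primrec fun a => succs (𝒢 a) (N a) (w a) :=
  primrec_succs'.comp (h𝒢.pair (hN.pair hw))

@[fun_prop]
theorem primrec_msgItems {q : α → List Msg} (hq : Primrec q) :
    Primrec fun a => msgItems (q a) := by
  unfold msgItems
  fun_prop

@[fun_prop]
theorem primrec_items {S : α → Config} (hS : Primrec S) :
    Primrec fun a => (S a).items := by
  unfold Config.items
  fun_prop

@[fun_prop]
theorem primrec_starts {𝒢 : α → Program} {N : α → ℕ} {S : α → Config} (h𝒢 : Primrec 𝒢)
    (hN : Primrec N) (hS : Primrec S) : Primrec fun a => starts (𝒢 a) (N a) (S a) := by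
  unfold starts
  fun_prop

@[fun_prop]
theorem primrec_simb {γ : Type} [Primcodable γ] [DecidableEq γ] {c : Val → γ} {F : α → List Val}
    {z z' : α → Item} (hc : Primrec c) (hF : Primrec F) (hz : Primrec z) (hz' : Primrec z') :
    Primrec fun a => simb c (F a) (z a) (z' a) := by
  have h : Primrec fun q : List (Val × Val) × Item × Item =>
      decide (q.2.1.mapVal (fun v => (q.1.lookup v).getD v) = q.2.2 ∧
        ∀ p ∈ q.1, c p.1 = c p.2 ∧ ∀ p' ∈ q.1, p.1 = p'.1 ↔ p.2 = p'.2) := by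
    fun_prop
  unfold simb
  refine h.comp (g := fun a => (simPairs (F a) (z a) (z' a), z a, z' a)) ?_
  unfold simPairs
  fun_prop

end Rules

/-! ### Deciding the three problems -/

theorem Proc.noActors_iff {P : Proc} : P.NoActors ↔ ∀ v ∈ P.vals, kind v = none := by
  constructor
  · intro h v hv
    obtain ⟨x, rfl⟩ := h.vals hv
    rfl
  · intro h
    refine Proc.all_of_vals (by simp) fun v hv A hA => ?_
    obtain rfl := Atom.val.inj hA
    simpa [kind] using h _ hv

/-- The decision procedure for the absence of actor names in a program. -/
def Program.pureb (𝒢 : Program) : Bool :=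
  decide (∀ v ∈ 𝒢.main.vals, kind v = none) &&
    decide (∀ d ∈ 𝒢.defs, ∀ v ∈ d.body.vals, kind v = none)

/-- Purity guarantees that the abstract graphs are finite, and it can be tested, so it serves as the
domain of the search. -/
theorem Program.pureb_iff {𝒢 : Program} : 𝒢.pureb = true ↔ 𝒢.Pure := by
  simp only [Program.pureb, Bool.and_eq_true, decide_eq_true_eq, ← Proc.noActors_iff]
  exact ⟨fun h => ⟨h.1, h.2⟩, fun h => ⟨h.1, h.2⟩⟩

theorem Program.WellFormed.pure {𝒢 : Program} (h : 𝒢.WellFormed) : 𝒢.Pure :=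
  ⟨h.main_source.2, fun d hd => (h.body_source d hd).2⟩

theorem primrec_pureb : Primrec Program.pureb := by
  unfold Program.pureb
  fun_prop

theorem primrec_init : Primrec Program.init := by
  have h : Primrec Actor.equiv.symm :=
    Primrec.encode_iff.1 (Primrec.encode.of_eq fun x => rfl)
  have : Primrec fun 𝒢 : Program => [Actor.equiv.symm (root, 𝒢.main, [])] := by fun_prop
  exact this

theorem exists_apath_iff {𝒢 : Program} {N : ℕ} {α β : List (Entry Bool)} :
    (∃ n, APath 𝒢 N n α β) ↔
      Relation.ReflTransGen (fun x y => y ∈ (succs 𝒢 N x).map Prod.snd) α β := by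
  constructor
  · rintro ⟨n, h⟩
    induction h with
    | refl => exact .refl
    | step _ h' ih => exact ih.tail (List.mem_map_of_mem h')
  · intro h
    induction h with
    | refl => exact ⟨0, .refl _⟩
    | tail _ h' ih =>
      obtain ⟨n, hn⟩ := ih
      obtain ⟨⟨b, γ⟩, hb, rfl⟩ := List.mem_map.1 h'
      exact ⟨_, hn.step hb⟩

theorem finite_reach {𝒢 : Program} (h𝒢 : 𝒢.Pure) (N : ℕ) (l : List (List (Entry Bool))) :
    {b | ∃ a ∈ l, Relation.ReflTransGen
      (fun x y => y ∈ (succs 𝒢 N x).map Prod.snd) a b}.Finite := by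
  have : {b | ∃ a ∈ l, Relation.ReflTransGen
      (fun x y => y ∈ (succs 𝒢 N x).map Prod.snd) a b} =
      ⋃ a ∈ {a | a ∈ l}, {b | ∃ n, APath 𝒢 N n a b} := by
    ext b
    simp [exists_apath_iff]
  rw [this]
  exact (List.finite_toSet l).biUnion fun a _ => finite_apath h𝒢 N a

theorem decidableOn_processReachable :
    DecidableOn (fun x : Program × Proc => x.1.WellFormed) fun x => x.1.ProcessReachable x.2 := by
  have hinit := primrec_init
  have hpure := primrec_pureb
  obtain ⟨f, hf, h⟩ := exists_computable_reach (ι := Program × Proc)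
    (start := fun i => starts i.1 1 i.1.init)
    (next := fun i w => (succs i.1 1 w).map Prod.snd)
    (good := fun i w => (tracked w).any fun e => simb Val.isAct [] (.inr i.2) e.2.2)
    (dom := fun i => i.1.pureb) (by fun_prop) (by fun_prop) (by
      have h : Primrec fun q : Proc × Item => simb Val.isAct [] (.inr q.1) q.2 := by fun_prop
      exact primrec_any (by fun_prop)
        (h.comp (g := fun p : ((Program × Proc) × List (Entry Bool)) × Entry Bool =>
          (p.1.1.2, p.2.2.2)) (by fun_prop))) (by fun_prop)
    fun i hi => finite_reach (Program.pureb_iff.1 hi) 1 _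
  refine ⟨f, hf, fun x hx => ?_⟩
  change x.1.WellFormed at hx
  change f x = true ↔ x.1.ProcessReachable x.2
  rw [h x (Program.pureb_iff.2 hx.pure), processReachable_iff hx.pure]
  simp only [← exists_apath_iff, List.any_eq_true]
  refine exists_congr fun α => and_congr_right fun _ => ?_
  exact ⟨fun ⟨b, ⟨n, h1⟩, h2⟩ => ⟨n, b, h1, h2⟩, fun ⟨n, b, h1, h2⟩ => ⟨b, ⟨n, h1⟩, h2⟩⟩

/-- The decision procedure for the similarity of two lists of items. -/
def matchb (F : List Val) (l l' : List Item) : Bool :=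
  decide (l.length = l'.length) && (l.zip l').all fun p => simb kind F p.1 p.2

theorem matchb_iff {F : List Val} {l l' : List Item} :
    matchb F l l' = true ↔ List.Forall₂ (ItemSim F) l l' := by
  simp [matchb, List.forall₂_iff_zip, itemSim_iff]

/-- The decision procedure for the covering of a configuration. -/
def coversb (𝒢 : Program) (T : Config) (α : List (Entry Bool)) : Bool :=
  (tuples ((tracked α).map fun e => e.2.1) T.length).any fun os =>
    decide (os.dedup = os) && (T.zip os).all fun p => decide (kind p.2 = some p.1.name.1) &&
      matchb 𝒢.free (.inr p.1.proc :: msgItems p.1.queue) (cont p.2 (tracked α))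

/-- Every actor of `T` has at least its process as an item, so its counterpart owns a tracked entry.
Hence it suffices to try the owners of tracked entries. -/
theorem coversb_iff {𝒢 : Program} {T : Config} {α : List (Entry Bool)} :
    coversb 𝒢 T α = true ↔ Covers 𝒢 T α := by
  simp only [coversb, List.any_eq_true, mem_tuples, Bool.and_eq_true, decide_eq_true_eq,
    List.dedup_eq_self, List.all_eq_true, matchb_iff]
  constructor
  · rintro ⟨os, ⟨h1, -⟩, h2, h3⟩
    refine ⟨fun i => os[i], fun i j hij => ?_, fun i => h3 (T.get i, os[i]) ?_⟩
    · exact Fin.ext ((List.Nodup.getElem_inj_iff h2).1 hij)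
    · rw [List.mem_iff_getElem]
      exact ⟨i, by simp [h1], by simp⟩
  · rintro ⟨os, h1, h2⟩
    refine ⟨List.ofFn os, ⟨by simp, fun v hv => ?_⟩, List.nodup_ofFn.2 h1, fun p hp => ?_⟩
    · obtain ⟨i, rfl⟩ := List.mem_ofFn.1 hv
      have h3 := (h2 i).2
      cases hc : cont (os i) (tracked α) with
      | nil => rw [hc] at h3; cases h3
      | cons z l =>
        obtain ⟨f, hf⟩ := mem_cont.1 (hc ▸ List.mem_cons_self : z ∈ cont (os i) (tracked α))
        exact List.mem_map.2 ⟨_, hf, rfl⟩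
    · obtain ⟨i, hi, rfl⟩ := List.mem_iff_getElem.1 hp
      simp only [List.length_zip, List.length_ofFn, min_self] at hi
      simpa using h2 ⟨i, hi⟩

theorem primrec_matchb : Primrec fun q : List Val × List Item × List Item =>
    matchb q.1 q.2.1 q.2.2 := by
  unfold matchb
  fun_prop

theorem primrec_cont : Primrec fun q : Val × List (Entry Bool) => cont q.1 q.2 := by
  unfold cont
  fun_prop

theorem primrec_coversb : Primrec fun q : Program × Config × List (Entry Bool) =>
    coversb q.1 q.2.1 q.2.2 := by
  have h1 : Primrec fun p : (Program × List (Entry Bool)) × Actor × Val =>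
      (p.1.1.free, ((.inr p.2.1.proc : Item) :: msgItems p.2.1.queue, cont p.2.2 p.1.2)) := by
    have := primrec_cont.comp (g := fun p : (Program × List (Entry Bool)) × Actor × Val =>
      (p.2.2, p.1.2)) (by fun_prop)
    fun_prop
  have h2 : Primrec fun p : (Program × List (Entry Bool)) × Actor × Val =>
      decide (kind p.2.2 = some p.2.1.name.1) &&
      matchb p.1.1.free (.inr p.2.1.proc :: msgItems p.2.1.queue) (cont p.2.2 p.1.2) :=
    primrec_and (by fun_prop) (primrec_matchb.comp h1)
  unfold coversb
  refine primrec_any (by fun_prop) (primrec_and (by fun_prop) (primrec_all (by fun_prop) ?_))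
  exact h2.comp (g := fun q : ((Program × Config × List (Entry Bool)) × List Val) × Actor × Val =>
    ((q.1.1.1, tracked q.1.1.2.2), q.2)) (by fun_prop)

theorem decidableOn_controlStateReachable :
    DecidableOn (fun x : Program × Config × Config => x.1.WellFormed ∧ Reach x.1 x.1.init x.2.1)
      fun x => x.1.ControlStateReachable x.2.1 x.2.2 := by
  have hpure := primrec_pureb
  have hsize : Primrec Config.size := by
    unfold Config.size
    fun_prop
  obtain ⟨f, hf, h⟩ := exists_computable_reach (ι := Program × Config × Config)
    (start := fun i => starts i.1 (Config.size i.2.2) i.2.1)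
    (next := fun i w => (succs i.1 (Config.size i.2.2) w).map Prod.snd)
    (good := fun i w => coversb i.1 i.2.2 w)
    (dom := fun i => i.1.pureb) (by fun_prop) (by fun_prop)
    (primrec_coversb.comp (g := fun p : (Program × Config × Config) × List (Entry Bool) =>
      (p.1.1, p.1.2.2, p.2)) (by fun_prop)) (by fun_prop)
    fun i hi => finite_reach (Program.pureb_iff.1 hi) _ _
  refine ⟨f, hf, fun x hx => ?_⟩
  change x.1.WellFormed ∧ Reach x.1 x.1.init x.2.1 at hx
  change f x = true ↔ x.1.ControlStateReachable x.2.1 x.2.2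
  rw [h x (Program.pureb_iff.2 hx.1.pure), controlStateReachable_iff hx.1.pure hx.2]
  simp only [← exists_apath_iff, coversb_iff]
  refine exists_congr fun α => and_congr_right fun _ => ?_
  exact ⟨fun ⟨b, ⟨n, h1⟩, h2⟩ => ⟨n, b, h1, h2⟩, fun ⟨n, b, h1, h2⟩ => ⟨b, ⟨n, h1⟩, h2⟩⟩

/-! ### Cycles -/

/-- An abstract state with a guess of the start of a cycle, and whether a tracked item made a step
since then. -/
abbrev Lasso : Type := List (Entry Bool) × Option (List (Entry Bool)) × Bool

/-- The start of the cycle is guessed once, without moving. Only tracked steps after the guess are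
recorded. Being on a cycle with a tracked step thus becomes a reachability question. -/
def Lasso.next (𝒢 : Program) (s : Lasso) : List Lasso :=
  (if s.2.1 = none then [(s.1, some s.1, false)] else []) ++
    (succs 𝒢 1 s.1).map fun r => (r.2, s.2.1, s.2.1.isSome && (s.2.2 || r.1))

theorem Lasso.sound {𝒢 : Program} {α : List (Entry Bool)} {s : Lasso}
    (h : Relation.ReflTransGen (fun x y => y ∈ Lasso.next 𝒢 x) (α, none, false) s) :
    (∃ n, APath 𝒢 1 n α s.1) ∧ ∀ a, s.2.1 = some a →
      ∃ n m, APath 𝒢 1 n α a ∧ APath 𝒢 1 m a s.1 ∧ (s.2.2 = true → 0 < m) := by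
  induction h with
  | refl => exact ⟨⟨0, .refl _⟩, by simp⟩
  | @tail s t _ h ih =>
    obtain ⟨⟨n, hn⟩, ih⟩ := ih
    rw [Lasso.next, List.mem_append] at h
    rcases h with h | h
    · split_ifs at h
      · rw [List.mem_singleton] at h
        subst h
        refine ⟨⟨n, hn⟩, fun a ha => ?_⟩
        obtain rfl := Option.some.inj ha
        exact ⟨n, 0, hn, .refl _, by simp⟩
      · simp at h
    · obtain ⟨⟨b, γ⟩, hb, rfl⟩ := List.mem_map.1 h
      refine ⟨⟨_, hn.step hb⟩, fun a ha => ?_⟩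
      obtain ⟨k, m, h1, h2, h3⟩ := ih a ha
      refine ⟨k, _, h1, h2.step hb, fun hf => ?_⟩
      cases b with
      | true => simp
      | false =>
        simp only [Bool.or_false, Bool.and_eq_true] at hf
        have := h3 hf.2
        omega

theorem Lasso.complete {𝒢 : Program} {n m : ℕ} {α β γ : List (Entry Bool)}
    (h1 : APath 𝒢 1 n α β) (h2 : APath 𝒢 1 m β γ) :
    Relation.ReflTransGen (fun x y => y ∈ Lasso.next 𝒢 x) (α, none, false)
      (γ, some β, decide (0 < m)) := by
  have k1 : Relation.ReflTransGen (fun x y => y ∈ Lasso.next 𝒢 x) (α, none, false)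
      (β, none, false) := by
    clear h2
    induction h1 with
    | refl => exact .refl
    | step _ h ih =>
      refine ih.tail (List.mem_append_right _ (List.mem_map.2 ⟨_, h, ?_⟩))
      simp
  refine (k1.tail (b := (β, none, false)) (c := (β, some β, false)) ?_).trans ?_
  · exact List.mem_append_left _ (by simp)
  · clear k1 h1
    induction h2 with
    | refl => exact .refl
    | @step m _ _ _ b _ h ih =>
      refine ih.tail (List.mem_append_right _ (List.mem_map.2 ⟨_, h, ?_⟩))
      cases b <;> simp

theorem decidableOn_terminates :
    DecidableOn (fun 𝒢 : Program => 𝒢.WellFormed) fun 𝒢 => 𝒢.Terminates := by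
  classical
  have hinit := primrec_init
  have hpure := primrec_pureb
  obtain ⟨f, hf, h⟩ := exists_computable_reach (ι := Program) (β := Lasso)
    (start := fun 𝒢 => (starts 𝒢 1 𝒢.init).map fun α => (α, none, false))
    (next := Lasso.next) (good := fun _ s => decide (s.2.1 = some s.1) && s.2.2)
    (dom := Program.pureb) (by fun_prop) (by unfold Lasso.next; fun_prop) (by fun_prop) hpure (by
      -- The current state and the guessed one are both reachable abstract states, so the product
      -- graph is finite as well.
      intro 𝒢 h𝒢
      have hfin := finite_reach (Program.pureb_iff.1 h𝒢) 1 (starts 𝒢 1 𝒢.init)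
      refine (hfin.prod ((hfin.image some).insert none |>.prod (Set.finite_univ (α := Bool)))).subset ?_
      rintro ⟨β, o, b⟩ ⟨s, hs, hr⟩
      obtain ⟨α, hα, rfl⟩ := List.mem_map.1 hs
      obtain ⟨h1, h2⟩ := Lasso.sound hr
      refine ⟨⟨α, hα, exists_apath_iff.1 h1⟩, ?_, Set.mem_univ _⟩
      cases o with
      | none => exact .inl rfl
      | some a =>
        obtain ⟨n, m, h3, -⟩ := h2 a rfl
        exact .inr ⟨a, ⟨α, hα, exists_apath_iff.1 ⟨n, h3⟩⟩, rfl⟩)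
  refine ⟨fun 𝒢 => !f 𝒢, Primrec.not.to_comp.comp hf, fun 𝒢 h𝒢 => ?_⟩
  change (!f 𝒢) = true ↔ 𝒢.Terminates
  replace h𝒢 : 𝒢.WellFormed := h𝒢
  rw [terminates_iff h𝒢.pure, Bool.not_eq_true', Bool.eq_false_iff, ne_eq, not_iff_not,
    h 𝒢 (Program.pureb_iff.2 h𝒢.pure)]
  constructor
  · rintro ⟨s, hs, t, hr, ht⟩
    obtain ⟨α, hα, rfl⟩ := List.mem_map.1 hs
    simp only [Bool.and_eq_true, decide_eq_true_eq] at ht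
    obtain ⟨n, m, h1, h2, h3⟩ := (Lasso.sound hr).2 _ ht.1
    exact ⟨α, hα, n, _, m, h1, h3 ht.2, h2⟩
  · rintro ⟨α, hα, n, β, m, h1, h2, h3⟩
    exact ⟨_, List.mem_map_of_mem hα, _, Lasso.complete h1 h3, by simp [h2]⟩

end ActorSL

theorem mainTheorem9 :
    ActorSL.DecidableOn
      (fun 𝒢 : ActorSL.Program => 𝒢.WellFormed)
      (fun 𝒢 => 𝒢.Terminates) ∧
    ActorSL.DecidableOn
      (fun x : ActorSL.Program × ActorSL.Config × ActorSL.Config =>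
        x.1.WellFormed ∧ ActorSL.Reach x.1 x.1.init x.2.1)
      (fun x => x.1.ControlStateReachable x.2.1 x.2.2) ∧
    ActorSL.DecidableOn
      (fun x : ActorSL.Program × ActorSL.Proc => x.1.WellFormed)
      (fun x => x.1.ProcessReachable x.2) :=
  ⟨ActorSL.decidableOn_terminates, ActorSL.decidableOn_controlStateReachable,
    ActorSL.decidableOn_processReachable⟩
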